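/- Let $p\ge 2$, $q=e^{i\pi/p}$, $[n]=\frac{q^n-q^{-n}}{q-q^{-1}}$, and let $\binom{m}{n}_q$ be the $q$-binomial coefficient (a Laurent polynomial in $q$, evaluated at this root of unity). **Quantum plane and one-forms.** The divided-power quantum plane $C$ is the associative algebra with basis $x^{(m)}y^{(n)}$, $m,n\ge 0$, and product $x^{(a)}y^{(b)}\cdot x^{(c)}y^{(d)}=q^{bc}\binom{a+c}{a}_q\binom{b+d}{b}_q x^{(a+c)}y^{(b+d)}$. Let $\Omega^1=C\xi\oplus C\eta$ (free left module), with $d\colon C\to\Omega^1$, $d(x^{(m)}y^{(n)})=q^{m+n-1}x^{(m-1)}y^{(n)}\xi+q^{n-1}x^{(m)}y^{(n-1)}\eta$ (divided powers with negative index are $0$). Put $X=x^{(p)}$, $Y=y^{(p)}$. Let $C_i$ be spanned by the $x^{(m)}y^{(n)}$ with $m+n=i$, $C_{(i)}=\bigoplus_{j\le i}C_j$, $\Omega^1_i=C_i\xi\oplus C_i\eta$, $\Omega^1_{(i)}=C_{(i)}\xi\oplus C_{(i)}\eta$ (so $C_{(-1)}=0$, $\Omega^1_{(-1)}=0$). **Quantum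 groups.** $\overline{U}$ is the algebra generated by $E,F,K^{\pm1}$ with $KEK^{-1}=q^2E$, $KFK^{-1}=q^{-2}F$, $[E,F]=\frac{K-K^{-1}}{q-q^{-1}}$, $E^p=F^p=0$, $K^{2p}=1$. It acts on $C$ and on $\Omega^1$ by $E(x^{(m)}y^{(n)})=[m+1]x^{(m+1)}y^{(n-1)}$, $K(x^{(m)}y^{(n)})=q^{m-n}x^{(m)}y^{(n)}$, $F(x^{(m)}y^{(n)})=[n+1]x^{(m-1)}y^{(n+1)}$, and, for $f\in C$, $E(f\xi)=qE(f)\xi$, $E(f\eta)=q^{-1}E(f)\eta+f\xi$, $K(f\xi)=qK(f)\xi$, $K(f\eta)=q^{-1}K(f)\eta$, $F(f\xi)=F(f)\xi+K^{-1}(f)\eta$, $F(f\eta)=F(f)\eta$. Let $U$ be Lusztig's quantum group: the specialization at $v=q$ of the $\mathbb{C}[v,v^{-1}]$-subalgebra of generic $U_v(sl_2)$ generated by $K^{\pm1}$ and all $E^n/[n]_v!$, $F^n/[n]_v!$ (in which $K^{2p}=1$ holds). There is a canonical homomorphism $\overline{U}\to U$; let $\mathcal{E}=E^p/[p]!$ and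 $\mathcal{F}=F^p/[p]!$ in $U$. **Modules.** For $\epsilon=\pm$ and $1\le r\le p$, $X^{\epsilon}_r$ is the irreducible $r$-dimensional $\overline{U}$-module with basis $w_0,\dots,w_{r-1}$, $Kw_l=\epsilon q^{r-1-2l}w_l$, $Ew_l=\epsilon[l][r-l]w_{l-1}$, $Fw_l=w_{l+1}$ ($w_{-1}=w_r=0$). For $1\le r\le p-1$, $n\ge 1$, $W^\epsilon_r(n)$ is the $\overline{U}$-module with basis $w_0,\dots,w_{N-1}$, $N=(n-1)p+r$, where $Kw_l=\epsilon q^{r-1-2l}w_l$; $Fw_l=0$ if $p\mid l+1$ or $l=N-1$, and $Fw_l=w_{l+1}$ otherwise; $Ew_0=0$, $Ew_l=w_{l-1}$ if $p\mid l>0$, and $Ew_l=\epsilon[l][r-l]w_{l-1}$ if $p\nmid l$. (It is the snake $X^\epsilon_r\to X^{-\epsilon}_{p-r}\leftarrow X^\epsilon_r\to\cdots\leftarrow X^\epsilon_r$ with $n$ upper pieces $X^\epsilon_r$ and $n-1$ lower pieces $X^{-\epsilon}_{p-r}$; $W^\epsilon_r(1)=X^\epsilon_r$.) $P^\epsilon_{p-1}$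 is the projective cover of $X^\epsilon_{p-1}$. **Theorem.** The actions of $\overline{U}$ on $C$ and on $\Omega^1$ extend to actions of $U$ (that is, the extended actions restrict to the given ones along $\overline{U}\to U$) such that, for $M,N\ge0$, $0\le m,n\le p-1$ and $u=X^MY^Nx^{(m)}y^{(n)}$, $$\mathcal{E}u=N(-1)^{(N-1)p+n+m}X^{M+1}Y^{N-1}x^{(m)}y^{(n)},\qquad \mathcal{F}u=M(-1)^{(M-1)p}X^{M-1}Y^{N+1}x^{(m)}y^{(n)},$$ $$[\mathcal{E},\mathcal{F}]u=(-1)^{(M+N-1)p+m+n}(M-N)u,$$ $$\mathcal{E}(u\xi)=-N(-1)^{(N-1)p+n+m}X^{M+1}Y^{N-1}x^{(m)}y^{(n)}\xi,$$ $$\mathcal{E}(u\eta)=-N(-1)^{(N-1)p+n+m}X^{M+1}Y^{N-1}x^{(m)}y^{(n)}\eta+\delta_{m,0}\begin{cases}N(-1)^nX^MY^{N-1}x^{(p-1)}y^{(n+1)}\xi,&n\le p-2,\\X^MY^Nx^{(p-1)}\xi,&n=p-1,\end{cases}$$ $$\mathcal{F}(u\xi)=M(-1)^{(M-1)p}X^{M-1}Y^{N+1}x^{(m)}y^{(n)}\xi+\delta_{n,0}\begin{cases}M(-1)^{(M-1)p+m}q^{-m-1}X^{M-1}Y^Nx^{(m+1)}y^{(p-1)}\eta,&m\le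 p-2,\\(-1)^{(M+N)p}X^MY^Ny^{(p-1)}\eta,&m=p-1,\end{cases}$$ $$\mathcal{F}(u\eta)=M(-1)^{(M-1)p}X^{M-1}Y^{N+1}x^{(m)}y^{(n)}\eta$$ (terms with coefficient $N=0$, respectively $M=0$, are zero). Moreover, for every $n\ge1$, with upper signs for odd $n$ and lower signs for even $n$: 1. $C_{((n-1)p-1)}$ and $C_{(np-1)}$ are $U$-submodules and, as $U$-modules, $$C_{(np-1)}=C_{((n-1)p-1)}\oplus\bigoplus_{r=1}^{p-1}V_r\oplus Z,$$ where $V_r=C_{(n-1)p+r-1}$ is isomorphic to $W^{\pm}_r(n)$ over $\overline{U}$ and is an indecomposable $U$-module (irreducible for $n=1$), and $Z=C_{np-1}$ is isomorphic to $n$ copies of $X^{\pm}_p$ over $\overline{U}$ and is an irreducible $U$-module. 2. $\Omega^1_{((n-1)p-1)}$ and $\Omega^1_{(np-1)}$ are $U$-submodules and, as $U$-modules, $$\Omega^1_{(np-1)}=\Omega^1_{((n-1)p-1)}\oplus\bigoplus_{r=2}^{p-1}dV_r\oplus dZ\oplus T\oplus\bigoplus_{r=1}^{p-2}V'_r\oplus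 Q,$$ where $dV_r=d(C_{(n-1)p+r-1})$ is isomorphic to $W^{\pm}_r(n)$ over $\overline{U}$ and is an indecomposable $U$-module (irreducible for $n=1$); $dZ=d(C_{np-1})$ is isomorphic to $n$ copies of $X^{\pm}_p$ over $\overline{U}$ and is an irreducible $U$-module; $T\subseteq\Omega^1_{(n-1)p}$ is isomorphic to $n-1$ copies of $X^{\mp}_p$ over $\overline{U}$ and, for $n\ge2$, is an irreducible $U$-module; $V'_r\subseteq\Omega^1_{(n-1)p+r}$ is isomorphic to $W^{\pm}_r(n)$ over $\overline{U}$ and is an indecomposable $U$-module (irreducible for $n=1$); and $Q=\Omega^1_{np-1}$ is isomorphic to $n$ copies of $P^{\pm}_{p-1}$ over $\overline{U}$ and is a projective object of the category of finite-dimensional $U$-modules. -/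

import Mathlib

noncomputable section

namespace QSl2

/-! ### q-numbers -/

/-- The even root of unity `q = exp(iπ/p)`. -/
def q (p : ℕ) : ℂ := Complex.exp (Real.pi * Complex.I / p)

/-- The q-integer `[n] = (v^n - v^{-n}) / (v - v⁻¹)`. -/
def qInt {k : Type*} [Field k] (v : k) (n : ℤ) : k := (v ^ n - v ^ (-n)) / (v - v⁻¹)

/-- The q-factorial `[n]! = [1][2]⋯[n]`. -/
def qFact {k : Type*} [Field k] (v : k) (n : ℕ) : k := ∏ i ∈ Finset.range n, qInt v (i + 1)

/-- The (balanced) q-binomial coefficient: the Laurent polynomial `[n]! / ([m]! [n-m]!)` evaluated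
at `v`, given by its Pascal recursion, so that it also makes sense at a root of unity. -/
def qBinom {k : Type*} [Field k] (v : k) : ℕ → ℕ → k
  | _, 0 => 1
  | 0, _ + 1 => 0
  | n + 1, m + 1 => v ^ (m + 1) * qBinom v n (m + 1) + v ^ ((m : ℤ) - n) * qBinom v n m

section qBinomLemmas

variable {k : Type*} [Field k] (v : k)

theorem qBinom_zero_right (n : ℕ) : qBinom v n 0 = 1 := by
  cases n <;> rfl

theorem qBinom_of_lt (n m : ℕ) (h : n < m) : qBinom v n m = 0 := by
  induction n generalizing m with
  | zero => cases m with
    | zero => omega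
    | succ m => rfl
  | succ n ih => cases m with
    | zero => omega
    | succ m =>
      simp only [qBinom]
      rw [ih (m + 1) (by omega), ih m (by omega)]; simp

theorem qBinom_self (n : ℕ) : qBinom v n n = 1 := by
  induction n with
  | zero => rfl
  | succ n ih =>
    simp only [qBinom]
    rw [qBinom_of_lt v n (n + 1) (by omega), ih]; simp

theorem qBinom_trinomial (hv : v ≠ 0) (a b c : ℕ) :
    qBinom v (a + b + c) (a + b) * qBinom v (a + b) a =
      qBinom v (a + (b + c)) a * qBinom v (b + c) b := by
  induction hs : a + b + c using Nat.strong_induction_on generalizing a b c with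
  | _ s ih =>
  subst hs
  rcases a with _ | a
  · simp [qBinom_zero_right]
  rcases b with _ | b
  · simp [qBinom_zero_right, qBinom_self]
  rcases c with _ | c
  · simp [qBinom_self]
  obtain ⟨m, hm⟩ : ∃ m, m = a + b + 1 := ⟨_, rfl⟩
  obtain ⟨t, ht⟩ : ∃ t, t = b + c + 1 := ⟨_, rfl⟩
  obtain ⟨s, hs⟩ : ∃ s, s = a + b + c + 2 := ⟨_, rfl⟩
  have h1 : qBinom v s m * qBinom v m a = qBinom v s a * qBinom v (t + 1) (b + 1) := by
    convert ih (a + (b + 1) + (c + 1)) (by omega) a (b + 1) (c + 1) rfl using 3 <;> omega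
  have h2 : qBinom v s m * qBinom v m (a + 1) = qBinom v s (a + 1) * qBinom v t b := by
    convert ih (a + 1 + b + (c + 1)) (by omega) (a + 1) b (c + 1) rfl using 3 <;> omega
  have h3 : qBinom v s (m + 1) * qBinom v (m + 1) (a + 1) =
      qBinom v s (a + 1) * qBinom v t (b + 1) := by
    convert ih (a + 1 + (b + 1) + c) (by omega) (a + 1) (b + 1) c rfl using 3 <;> omega
  have goal' : qBinom v (s + 1) (m + 1) * qBinom v (m + 1) (a + 1) =
      qBinom v (s + 1) (a + 1) * qBinom v (t + 1) (b + 1) := by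
    have e1 : qBinom v (s + 1) (m + 1) =
      v ^ (m + 1) * qBinom v s (m + 1) + v ^ ((m : ℤ) - s) * qBinom v s m := rfl
    have e2 : qBinom v (m + 1) (a + 1) =
      v ^ (a + 1) * qBinom v m (a + 1) + v ^ ((a : ℤ) - m) * qBinom v m a := rfl
    have e3 : qBinom v (s + 1) (a + 1) =
      v ^ (a + 1) * qBinom v s (a + 1) + v ^ ((a : ℤ) - s) * qBinom v s a := rfl
    have e4 : qBinom v (t + 1) (b + 1) =
      v ^ (b + 1) * qBinom v t (b + 1) + v ^ ((b : ℤ) - t) * qBinom v t b := rfl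
    have p1 : v ^ (m + 1) = v ^ (a + 1) * v ^ (b + 1) := by
      rw [← pow_add]; congr 1; omega
    have p2 : v ^ ((m : ℤ) - s) * v ^ (a + 1) = v ^ (a + 1) * v ^ ((b : ℤ) - t) := by
      rw [mul_comm]; congr 2; omega
    have p3 : v ^ ((m : ℤ) - s) * v ^ ((a : ℤ) - m) = v ^ ((a : ℤ) - s) := by
      rw [← zpow_add₀ hv]; congr 1; ring
    calc _ = v ^ (m + 1) * (qBinom v s (m + 1) * qBinom v (m + 1) (a + 1))
          + v ^ ((m : ℤ) - s) * qBinom v s m * qBinom v (m + 1) (a + 1) := by rw [e1]; ring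
      _ = v ^ (m + 1) * (qBinom v s (m + 1) * qBinom v (m + 1) (a + 1))
          + (v ^ ((m : ℤ) - s) * v ^ (a + 1)) * (qBinom v s m * qBinom v m (a + 1))
          + (v ^ ((m : ℤ) - s) * v ^ ((a : ℤ) - m)) * (qBinom v s m * qBinom v m a) := by
            rw [e2]; ring
      _ = v ^ (a + 1) * qBinom v s (a + 1) *
            (v ^ (b + 1) * qBinom v t (b + 1) + v ^ ((b : ℤ) - t) * qBinom v t b)
          + v ^ ((a : ℤ) - s) * (qBinom v s a * qBinom v (t + 1) (b + 1)) := by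
            rw [h1, h2, h3, p1, p2, p3]; ring
      _ = _ := by rw [← e4, e3]; ring
  convert goal' using 3 <;> omega

end qBinomLemmas

theorem q_ne_zero (p : ℕ) : q p ≠ 0 := Complex.exp_ne_zero _

theorem q_pow_p (p : ℕ) (hp : p ≠ 0) : q p ^ p = -1 := by
  rw [q, ← Complex.exp_nat_mul, mul_div_cancel₀ _ (by exact_mod_cast hp), Complex.exp_pi_mul_I]

theorem q_sq_ne_one (p : ℕ) (hp : 2 ≤ p) (j : ℕ) (h0 : 0 < j) (hj : j < p) :
    q p ^ (2 * j) ≠ 1 := by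
  intro h
  have h2 : IsPrimitiveRoot (q p) (2 * p) := by
    have := Complex.isPrimitiveRoot_exp (2 * p) (by omega)
    convert this using 1
    rw [q]; congr 1
    have : (p : ℂ) ≠ 0 := by exact_mod_cast (by omega : p ≠ 0)
    push_cast; field_simp
  have := Nat.le_of_dvd (by omega) (h2.dvd_of_pow_eq_one _ h)
  omega

theorem q_sub_inv_ne_zero (p : ℕ) (hp : 2 ≤ p) : q p - (q p)⁻¹ ≠ 0 := by
  intro h
  apply q_sq_ne_one p hp 1 one_pos (by omega)
  have := q_ne_zero p
  field_simp at h
  linear_combination h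

theorem q_pow_two_p (p : ℕ) (hp : p ≠ 0) : q p ^ (2 * p) = 1 := by
  rw [mul_comm, pow_mul, q_pow_p p hp]; norm_num

theorem qInt_mul_p (p : ℕ) (hp : p ≠ 0) (j : ℤ) : qInt (q p) (p * j) = 0 := by
  rw [qInt, ← mul_neg, zpow_mul, zpow_mul, zpow_natCast, q_pow_p p hp, zpow_neg, ← inv_zpow]
  norm_num

theorem qInt_zero {k : Type*} [Field k] (v : k) : qInt v 0 = 0 := by simp [qInt]

theorem qInt_add_one {k : Type*} [Field k] (v : k) (hv : v ≠ 0) (h : v - v⁻¹ ≠ 0) (n : ℤ) :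
    qInt v (n + 1) = v * qInt v n + v ^ (-n) := by
  rw [qInt, qInt, div_eq_iff h, add_mul, mul_assoc, div_mul_cancel₀ _ h, zpow_add₀ hv, neg_add,
    zpow_add₀ hv]
  simp only [zpow_one, zpow_neg]
  ring

theorem qInt_mul_sub {k : Type*} [Field k] (v : k) (hv : v ≠ 0) (h : v - v⁻¹ ≠ 0) (a b : ℤ) :
    qInt v a * qInt v (b + 1) - qInt v (a + 1) * qInt v b = qInt v (a - b) := by
  simp only [qInt]
  rw [div_mul_div_comm, div_mul_div_comm, ← sub_div, div_eq_div_iff (mul_ne_zero h h) h]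
  simp only [neg_add, neg_sub, zpow_add₀ hv, zpow_sub₀ hv, zpow_one, zpow_neg]
  have ha := zpow_ne_zero a hv
  have hb := zpow_ne_zero b hv
  field_simp
  ring

/-! ### The divided-power quantum plane -/

/-- The divided-power quantum plane: the `ℂ`-vector space with basis `x^(m) y^(n)`, `m, n ≥ 0`. -/
def QPlane (_p : ℕ) : Type := ℕ × ℕ →₀ ℂ

namespace QPlane

variable (p : ℕ)

instance : AddCommGroup (QPlane p) := inferInstanceAs (AddCommGroup (ℕ × ℕ →₀ ℂ))
instance : Module ℂ (QPlane p) := inferInstanceAs (Module ℂ (ℕ × ℕ →₀ ℂ))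

/-- The basis monomials `x^(m) y^(n)`. -/
def basis : Module.Basis (ℕ × ℕ) ℂ (QPlane p) := ⟨LinearEquiv.refl ℂ (ℕ × ℕ →₀ ℂ)⟩

/-- The basis monomial `x^(m) y^(n)`. -/
def xy (m n : ℕ) : QPlane p := basis p (m, n)

/-- The product, `x^(a) y^(b) · x^(c) y^(d) = q^{bc} [a+c; a] [b+d; b] x^(a+c) y^(b+d)`. -/
def mulMap : QPlane p →ₗ[ℂ] QPlane p →ₗ[ℂ] QPlane p :=
  (basis p).constr ℂ fun s => (basis p).constr ℂ fun t =>
    (q p ^ (s.2 * t.1) * qBinom (q p) (s.1 + t.1) s.1 * qBinom (q p) (s.2 + t.2) s.2) •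
      xy p (s.1 + t.1) (s.2 + t.2)

theorem mulMap_xy (a b c d : ℕ) : mulMap p (xy p a b) (xy p c d) =
    (q p ^ (b * c) * qBinom (q p) (a + c) a * qBinom (q p) (b + d) b) •
      xy p (a + c) (b + d) := by
  simp [mulMap, xy, Module.Basis.constr_basis]

variable {p} in
theorem induction {P : QPlane p → Prop} (f : QPlane p) (hxy : ∀ m n, P (xy p m n))
    (hadd : ∀ f g, P f → P g → P (f + g)) (hsmul : ∀ (c : ℂ) f, P f → P (c • f)) : P f := by
  have hf : f ∈ Submodule.span ℂ (Set.range (basis p)) := by simp [(basis p).span_eq]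
  induction hf using Submodule.span_induction with
  | mem x h => obtain ⟨⟨m, n⟩, rfl⟩ := h; exact hxy m n
  | zero => simpa using hsmul 0 _ (hxy 0 0)
  | add f g _ _ h1 h2 => exact hadd f g h1 h2
  | smul c f _ h => exact hsmul c f h

theorem mulMap_assoc (f g h : QPlane p) :
    mulMap p (mulMap p f g) h = mulMap p f (mulMap p g h) := by
  induction f using induction with
  | hadd f f' h1 h2 => simp only [map_add, LinearMap.add_apply, h1, h2]
  | hsmul c f h1 => simp only [map_smul, LinearMap.smul_apply, h1]
  | hxy a b =>
  induction g using induction with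
  | hadd f f' h1 h2 => simp only [map_add, LinearMap.add_apply, h1, h2]
  | hsmul c f h1 => simp only [map_smul, LinearMap.smul_apply, h1]
  | hxy c d =>
  induction h using induction with
  | hadd f f' h1 h2 => simp only [map_add, h1, h2]
  | hsmul c f h1 => simp only [map_smul, h1]
  | hxy e f =>
  simp only [mulMap_xy, map_smul, LinearMap.smul_apply, smul_smul, add_assoc]
  congr 1
  have h1 := qBinom_trinomial (q p) (q_ne_zero p) a c e
  have h2 := qBinom_trinomial (q p) (q_ne_zero p) b d f
  simp only [add_assoc] at h1 h2
  calc _ = q p ^ (b * c + (b + d) * e) *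
        (qBinom (q p) (a + (c + e)) (a + c) * qBinom (q p) (a + c) a) *
        (qBinom (q p) (b + (d + f)) (b + d) * qBinom (q p) (b + d) b) := by ring
    _ = _ := by rw [h1, h2]; ring

instance : Mul (QPlane p) := ⟨fun f g => mulMap p f g⟩
instance : One (QPlane p) := ⟨xy p 0 0⟩

theorem mul_def (f g : QPlane p) : f * g = mulMap p f g := rfl
theorem one_def : (1 : QPlane p) = xy p 0 0 := rfl

instance : Ring (QPlane p) :=
  { (inferInstance : AddCommGroup (QPlane p)) with
    mul := (· * ·)
    one := 1
    left_distrib := fun f g h => by simp only [mul_def, map_add]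
    right_distrib := fun f g h => by simp only [mul_def, map_add, LinearMap.add_apply]
    zero_mul := fun f => by simp only [mul_def, map_zero, LinearMap.zero_apply]
    mul_zero := fun f => by simp only [mul_def, map_zero]
    mul_assoc := mulMap_assoc p
    one_mul := fun f => by
      rw [mul_def, one_def]
      induction f using induction with
      | hadd f g h1 h2 => rw [map_add, h1, h2]
      | hsmul c f h => rw [map_smul, h]
      | hxy m n => simp [mulMap_xy, qBinom_zero_right]
    mul_one := fun f => by
      rw [mul_def, one_def]
      induction f using induction with
      | hadd f g h1 h2 => rw [map_add, LinearMap.add_apply, h1, h2]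
      | hsmul c f h => rw [map_smul, LinearMap.smul_apply, h]
      | hxy m n => simp [mulMap_xy, qBinom_self] }

instance : Algebra ℂ (QPlane p) :=
  Algebra.ofModule (fun c f g => by simp only [mul_def, map_smul, LinearMap.smul_apply])
    (fun c f g => by simp only [mul_def, map_smul])

/-- The divided power `x^(m)`. -/
def xd (m : ℕ) : QPlane p := xy p m 0

/-- The divided power `y^(n)`. -/
def yd (n : ℕ) : QPlane p := xy p 0 n

/-- `X = x^(p)`. -/
def X : QPlane p := xd p p

/-- `Y = y^(p)`. -/
def Y : QPlane p := yd p p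

/-- The element `X^M Y^N x^(m) y^(n)`. -/
def frob (M N m n : ℕ) : QPlane p := X p ^ M * Y p ^ N * xd p m * yd p n

end QPlane

/-! ### One-forms -/

/-- The one-forms on the divided-power quantum plane: the free left module over the quantum plane
with basis `ξ = dx`, `η = dy`; the pair `(f, g)` stands for `f ξ + g η`. -/
def OneForm (p : ℕ) : Type := QPlane p × QPlane p

namespace OneForm

variable (p : ℕ)

instance : AddCommGroup (OneForm p) := inferInstanceAs (AddCommGroup (QPlane p × QPlane p))
instance : Module ℂ (OneForm p) := inferInstanceAs (Module ℂ (QPlane p × QPlane p))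
instance : Module (QPlane p) (OneForm p) :=
  inferInstanceAs (Module (QPlane p) (QPlane p × QPlane p))

/-- The one-form `ξ = dx`. -/
def ξ : OneForm p := ((1, 0) : QPlane p × QPlane p)

/-- The one-form `η = dy`. -/
def η : OneForm p := ((0, 1) : QPlane p × QPlane p)

end OneForm

open QPlane OneForm

/-- The differential
`d (x^(m) y^(n)) = q^{m+n-1} x^(m-1) y^(n) ξ + q^{n-1} x^(m) y^(n-1) η`. -/
def d (p : ℕ) : QPlane p →ₗ[ℂ] OneForm p :=
  (basis p).constr ℂ fun s =>
    (match s with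
      | (0, _) => (0 : OneForm p)
      | (m + 1, n) => q p ^ (m + n) • xy p m n • ξ p) +
    (match s with
      | (_, 0) => (0 : OneForm p)
      | (m, n + 1) => q p ^ n • xy p m n • η p)

/-! ### The quantum groups -/

/-- The generators `E`, `F`, `K`, `K⁻¹`. -/
inductive Gen
  | E | F | K | Ki

/-- The defining relations of quantum `sl(2)` with parameter `v`. -/
inductive QRel {k : Type} [Field k] (v : k) : FreeAlgebra k Gen → FreeAlgebra k Gen → Prop
  | K_Ki : QRel v (FreeAlgebra.ι k Gen.K * FreeAlgebra.ι k Gen.Ki) 1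
  | Ki_K : QRel v (FreeAlgebra.ι k Gen.Ki * FreeAlgebra.ι k Gen.K) 1
  | K_E : QRel v
      (FreeAlgebra.ι k Gen.K * FreeAlgebra.ι k Gen.E * FreeAlgebra.ι k Gen.Ki)
      (v ^ 2 • FreeAlgebra.ι k Gen.E)
  | K_F : QRel v
      (FreeAlgebra.ι k Gen.K * FreeAlgebra.ι k Gen.F * FreeAlgebra.ι k Gen.Ki)
      ((v ^ 2)⁻¹ • FreeAlgebra.ι k Gen.F)
  | E_F : QRel v
      (FreeAlgebra.ι k Gen.E * FreeAlgebra.ι k Gen.F -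
        FreeAlgebra.ι k Gen.F * FreeAlgebra.ι k Gen.E)
      ((v - v⁻¹)⁻¹ • (FreeAlgebra.ι k Gen.K - FreeAlgebra.ι k Gen.Ki))

/-- The relations of the `2p³`-dimensional quantum group. -/
inductive SmallRel (p : ℕ) : FreeAlgebra ℂ Gen → FreeAlgebra ℂ Gen → Prop
  | base {a b : FreeAlgebra ℂ Gen} : QRel (q p) a b → SmallRel p a b
  | E_pow : SmallRel p (FreeAlgebra.ι ℂ Gen.E ^ p) 0
  | F_pow : SmallRel p (FreeAlgebra.ι ℂ Gen.F ^ p) 0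
  | K_pow : SmallRel p (FreeAlgebra.ι ℂ Gen.K ^ (2 * p)) 1

/-- The `2p³`-dimensional (restricted) quantum group `Ū_q sl(2)` at `q = exp(iπ/p)`. -/
def SmallQG (p : ℕ) : Type := RingQuot (SmallRel p)

namespace SmallQG

variable (p : ℕ)

instance : Ring (SmallQG p) := inferInstanceAs (Ring (RingQuot (SmallRel p)))
instance : Algebra ℂ (SmallQG p) := inferInstanceAs (Algebra ℂ (RingQuot (SmallRel p)))

/-- The image of a generator. -/
def gen (g : Gen) : SmallQG p :=
  (RingQuot.mkAlgHom ℂ (SmallRel p) (FreeAlgebra.ι ℂ g) : RingQuot (SmallRel p))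

variable {p} in
/-- The algebra homomorphism out of `Ū_q sl(2)` given by elements that satisfy the relations. -/
def lift {A : Type*} [Ring A] [Algebra ℂ A] (g : Gen → A)
    (h1 : g .K * g .Ki = 1) (h2 : g .Ki * g .K = 1)
    (h3 : g .K * g .E * g .Ki = q p ^ 2 • g .E)
    (h4 : g .K * g .F * g .Ki = (q p ^ 2)⁻¹ • g .F)
    (h5 : g .E * g .F - g .F * g .E = (q p - (q p)⁻¹)⁻¹ • (g .K - g .Ki))
    (h6 : g .E ^ p = 0) (h7 : g .F ^ p = 0) (h8 : g .K ^ (2 * p) = 1) :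
    SmallQG p →ₐ[ℂ] A :=
  RingQuot.liftAlgHom ℂ ⟨FreeAlgebra.lift ℂ g, by
    intro x y h
    cases h with
    | base h => cases h <;> simp [h1, h2, h3, h4, h5]
    | E_pow => simp [h6]
    | F_pow => simp [h7]
    | K_pow => simp [h8]⟩

end SmallQG

/-- Quantum `sl(2)` over `ℂ(v)`, at the generic parameter `v`. -/
def GenericQG : Type := RingQuot (QRel (RatFunc.X : RatFunc ℂ))

namespace GenericQG

instance : Ring GenericQG := inferInstanceAs (Ring (RingQuot (QRel (RatFunc.X : RatFunc ℂ))))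
instance : Algebra (RatFunc ℂ) GenericQG :=
  inferInstanceAs (Algebra (RatFunc ℂ) (RingQuot (QRel (RatFunc.X : RatFunc ℂ))))
instance : Algebra ℂ GenericQG := Algebra.compHom GenericQG (algebraMap ℂ (RatFunc ℂ))
instance : IsScalarTower ℂ (RatFunc ℂ) GenericQG := IsScalarTower.of_algebraMap_eq (fun _ => rfl)

/-- The quotient map. -/
def mk : FreeAlgebra (RatFunc ℂ) Gen →ₐ[RatFunc ℂ] GenericQG :=
  (RingQuot.mkAlgHom (RatFunc ℂ) (QRel (RatFunc.X : RatFunc ℂ)) :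
    FreeAlgebra (RatFunc ℂ) Gen →ₐ[RatFunc ℂ] RingQuot (QRel (RatFunc.X : RatFunc ℂ)))

theorem mk_rel {a b : FreeAlgebra (RatFunc ℂ) Gen} (h : QRel RatFunc.X a b) : mk a = mk b :=
  RingQuot.mkAlgHom_rel (RatFunc ℂ) h

/-- The image of a generator. -/
def gen (g : Gen) : GenericQG := mk (FreeAlgebra.ι (RatFunc ℂ) g)

/-- The divided power `a^n / [n]!`. -/
def divPow (a : GenericQG) (n : ℕ) : GenericQG := (qFact (RatFunc.X : RatFunc ℂ) n)⁻¹ • a ^ n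

/-- Lusztig's form of generic quantum `sl(2)`: the `ℂ[v, v⁻¹]`-subalgebra generated by `K`, `K⁻¹`
and by all the divided powers `E^n / [n]!` and `F^n / [n]!`. -/
def lusztigForm : Subalgebra ℂ GenericQG :=
  Algebra.adjoin ℂ
    ({algebraMap (RatFunc ℂ) GenericQG RatFunc.X, algebraMap (RatFunc ℂ) GenericQG RatFunc.X⁻¹,
        gen .K, gen .Ki} ∪
      Set.range (divPow (gen .E)) ∪ Set.range (divPow (gen .F)))

/-- The parameter `v` as an element of Lusztig's form. -/
def v : lusztigForm := ⟨algebraMap (RatFunc ℂ) GenericQG RatFunc.X,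
  Algebra.subset_adjoin (by simp)⟩

/-- The element `v⁻¹` of Lusztig's form. -/
def vInv : lusztigForm := ⟨algebraMap (RatFunc ℂ) GenericQG RatFunc.X⁻¹,
  Algebra.subset_adjoin (by simp)⟩

/-- The element `K` of Lusztig's form. -/
def K : lusztigForm := ⟨gen .K, Algebra.subset_adjoin (by simp)⟩

/-- The element `K⁻¹` of Lusztig's form. -/
def Ki : lusztigForm := ⟨gen .Ki, Algebra.subset_adjoin (by simp)⟩

/-- The divided power `E^n / [n]!` in Lusztig's form. -/
def Ediv (n : ℕ) : lusztigForm := ⟨divPow (gen .E) n, Algebra.subset_adjoin (by simp)⟩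

/-- The divided power `F^n / [n]!` in Lusztig's form. -/
def Fdiv (n : ℕ) : lusztigForm := ⟨divPow (gen .F) n, Algebra.subset_adjoin (by simp)⟩

theorem coe_v : (v : GenericQG) = algebraMap (RatFunc ℂ) GenericQG RatFunc.X := rfl
theorem coe_vInv : (vInv : GenericQG) = algebraMap (RatFunc ℂ) GenericQG RatFunc.X⁻¹ := rfl

theorem gen_K_Ki : gen .K * gen .Ki = 1 := by
  have := mk_rel QRel.K_Ki
  simpa only [map_mul, map_one, gen] using this

theorem gen_Ki_K : gen .Ki * gen .K = 1 := by
  have := mk_rel QRel.Ki_K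
  simpa only [map_mul, map_one, gen] using this

theorem gen_K_E : gen .K * gen .E * gen .Ki = (RatFunc.X : RatFunc ℂ) ^ 2 • gen .E := by
  have := mk_rel QRel.K_E
  simpa only [map_mul, map_smul, gen] using this

theorem gen_K_F : gen .K * gen .F * gen .Ki = ((RatFunc.X : RatFunc ℂ) ^ 2)⁻¹ • gen .F := by
  have := mk_rel QRel.K_F
  simpa only [map_mul, map_smul, gen] using this

theorem gen_E_F : gen .E * gen .F - gen .F * gen .E =
    ((RatFunc.X : RatFunc ℂ) - RatFunc.X⁻¹)⁻¹ • (gen .K - gen .Ki) := by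
  have := mk_rel QRel.E_F
  simpa only [map_mul, map_sub, map_smul, gen] using this

theorem X_pow_ne_one (n : ℕ) (hn : n ≠ 0) : (RatFunc.X : RatFunc ℂ) ^ n ≠ 1 := by
  intro h
  have h2 : (Polynomial.X : Polynomial ℂ) ^ n = 1 := by
    apply RatFunc.algebraMap_injective ℂ
    simpa using h
  have := congrArg Polynomial.natDegree h2
  simp [hn] at this

theorem X_pow_sub_ne_zero (n : ℕ) (hn : n ≠ 0) :
    (RatFunc.X : RatFunc ℂ) ^ (n : ℤ) - RatFunc.X ^ (-(n : ℤ)) ≠ 0 := by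
  intro h
  apply X_pow_ne_one (n + n) (by omega)
  have h1 := sub_eq_zero.1 h
  rw [pow_add, ← zpow_natCast]
  nth_rewrite 1 [h1]
  rw [zpow_neg, inv_mul_cancel₀ (zpow_ne_zero _ RatFunc.X_ne_zero)]

theorem X_sub_inv_ne_zero : (RatFunc.X : RatFunc ℂ) - RatFunc.X⁻¹ ≠ 0 := by
  simpa using X_pow_sub_ne_zero 1 one_ne_zero

theorem qFact_ne_zero (n : ℕ) : qFact (RatFunc.X : RatFunc ℂ) n ≠ 0 := by
  refine Finset.prod_ne_zero_iff.2 fun i _ => div_ne_zero ?_ X_sub_inv_ne_zero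
  exact_mod_cast X_pow_sub_ne_zero (i + 1) (by omega)

theorem divPow_one (a : GenericQG) : divPow a 1 = a := by
  have : qFact (RatFunc.X : RatFunc ℂ) 1 = 1 := by
    simp [qFact, qInt, div_self X_sub_inv_ne_zero]
  rw [divPow, this]; simp

/-- The Laurent polynomial `[n]` as an element of Lusztig's form. -/
def qIntElt (n : ℕ) : lusztigForm := ∑ i ∈ Finset.range n, v ^ (n - 1 - i) * vInv ^ i

theorem sum_eq_qInt {k : Type*} [Field k] (w : k) (h : w - w⁻¹ ≠ 0) (n : ℕ) :
    ∑ i ∈ Finset.range n, w ^ (n - 1 - i) * w⁻¹ ^ i = qInt w n := by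
  rw [qInt, eq_div_iff h]
  have := (Commute.all w⁻¹ w).geom_sum₂_mul n
  rw [zpow_natCast, zpow_neg, zpow_natCast, ← inv_pow]
  have h2 : ∑ i ∈ Finset.range n, w ^ (n - 1 - i) * w⁻¹ ^ i =
      ∑ i ∈ Finset.range n, w⁻¹ ^ i * w ^ (n - 1 - i) :=
    Finset.sum_congr rfl fun i _ => mul_comm _ _
  rw [h2]
  linear_combination -this

theorem coe_qIntElt (n : ℕ) : (qIntElt n : GenericQG) =
    algebraMap (RatFunc ℂ) GenericQG (qInt RatFunc.X n) := by
  rw [← sum_eq_qInt _ X_sub_inv_ne_zero, qIntElt]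
  simp only [AddSubmonoidClass.coe_finsetSum, map_sum, MulMemClass.coe_mul,
    SubmonoidClass.coe_pow, coe_v, coe_vInv, map_mul, map_pow]

theorem divPow_pow (a : GenericQG) (n : ℕ) :
    a ^ n = algebraMap (RatFunc ℂ) GenericQG (qFact RatFunc.X n) * divPow a n := by
  rw [divPow, ← Algebra.smul_def, smul_smul, mul_inv_cancel₀ (qFact_ne_zero n), one_smul]

theorem coe_prod_qIntElt (n : ℕ) :
    (((List.range n).map fun i => qIntElt (i + 1)).prod : GenericQG) =
      algebraMap (RatFunc ℂ) GenericQG (qFact RatFunc.X n) := by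
  induction n with
  | zero => simp [qFact]
  | succ n ih =>
    rw [qFact, Finset.prod_range_succ, map_mul, ← qFact, ← ih, List.range_succ]
    simp [coe_qIntElt]

theorem Ediv_one_pow (n : ℕ) : Ediv 1 ^ n =
    ((List.range n).map fun i => qIntElt (i + 1)).prod * Ediv n := by
  apply Subtype.ext
  rw [MulMemClass.coe_mul, coe_prod_qIntElt, SubmonoidClass.coe_pow]
  change divPow _ 1 ^ n = _ * divPow _ n
  rw [divPow_one, divPow_pow]

theorem Fdiv_one_pow (n : ℕ) : Fdiv 1 ^ n =
    ((List.range n).map fun i => qIntElt (i + 1)).prod * Fdiv n := by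
  apply Subtype.ext
  rw [MulMemClass.coe_mul, coe_prod_qIntElt, SubmonoidClass.coe_pow]
  change divPow _ 1 ^ n = _ * divPow _ n
  rw [divPow_one, divPow_pow]

theorem K_mul_Ki : K * Ki = 1 := Subtype.ext gen_K_Ki

theorem Ki_mul_K : Ki * K = 1 := Subtype.ext gen_Ki_K

theorem K_E_Ki : K * Ediv 1 * Ki = v ^ 2 * Ediv 1 := by
  apply Subtype.ext
  change gen .K * divPow _ 1 * gen .Ki = algebraMap (RatFunc ℂ) GenericQG RatFunc.X ^ 2 * divPow _ 1
  rw [divPow_one, gen_K_E, Algebra.smul_def, map_pow]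

theorem K_F_Ki : K * Fdiv 1 * Ki = vInv ^ 2 * Fdiv 1 := by
  apply Subtype.ext
  change gen .K * divPow _ 1 * gen .Ki =
    algebraMap (RatFunc ℂ) GenericQG RatFunc.X⁻¹ ^ 2 * divPow _ 1
  rw [divPow_one, gen_K_F, Algebra.smul_def, ← inv_pow, map_pow]

theorem E_F_comm : (v - vInv) * (Ediv 1 * Fdiv 1 - Fdiv 1 * Ediv 1) = K - Ki := by
  apply Subtype.ext
  change (algebraMap (RatFunc ℂ) GenericQG RatFunc.X - algebraMap (RatFunc ℂ) GenericQG _) *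
    (divPow _ 1 * divPow _ 1 - divPow _ 1 * divPow _ 1) = gen .K - gen .Ki
  rw [divPow_one, divPow_one, gen_E_F, ← map_sub, ← Algebra.smul_def, smul_smul,
    mul_inv_cancel₀ X_sub_inv_ne_zero, one_smul]

end GenericQG

open GenericQG (lusztigForm)

/-- The specialization `v = q`. The relation `K^{2p} = 1`, part of the definition of
`Ū_q sl(2)`, is imposed too. (It holds in the specialization anyway, because
`∏_{s=1}^{p} (K v^{1-s} - K⁻¹ v^{s-1})` is a multiple of `∏_{s=1}^{p} (v^s - v^{-s})` in Lusztig's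
form.) -/
inductive LusztigRel (p : ℕ) : lusztigForm → lusztigForm → Prop
  | v : LusztigRel p GenericQG.v (algebraMap ℂ lusztigForm (q p))
  | K_pow : LusztigRel p (GenericQG.K ^ (2 * p)) 1

/-- Lusztig's divided-power quantum group `U_q sl(2)` at `q = exp(iπ/p)`. -/
def Lusztig (p : ℕ) : Type := RingQuot (LusztigRel p)

namespace Lusztig

variable (p : ℕ)

instance : Ring (Lusztig p) := inferInstanceAs (Ring (RingQuot (LusztigRel p)))
instance : Algebra ℂ (Lusztig p) := inferInstanceAs (Algebra ℂ (RingQuot (LusztigRel p)))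

/-- The specialization map. -/
def mk : lusztigForm →ₐ[ℂ] Lusztig p :=
  (RingQuot.mkAlgHom ℂ (LusztigRel p) : lusztigForm →ₐ[ℂ] RingQuot (LusztigRel p))

section relations

open GenericQG

theorem mk_vInv : mk p vInv = algebraMap ℂ _ (q p)⁻¹ := by
  have h : mk p GenericQG.v = algebraMap ℂ _ (q p) := by
    have := RingQuot.mkAlgHom_rel ℂ (LusztigRel.v (p := p))
    rw [AlgHom.commutes] at this
    exact this
  have h2 : GenericQG.v * vInv = 1 := by
    apply Subtype.ext
    change algebraMap (RatFunc ℂ) GenericQG RatFunc.X * algebraMap (RatFunc ℂ) GenericQG _ = 1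
    rw [← map_mul, mul_inv_cancel₀ RatFunc.X_ne_zero, map_one]
  have h3 : algebraMap ℂ (Lusztig p) (q p)⁻¹ * algebraMap ℂ (Lusztig p) (q p) = 1 := by
    rw [← map_mul, inv_mul_cancel₀ (q_ne_zero p), map_one]
  calc mk p vInv = algebraMap ℂ (Lusztig p) (q p)⁻¹ *
        (algebraMap ℂ (Lusztig p) (q p) * mk p vInv) := by rw [← mul_assoc, h3, one_mul]
    _ = _ := by rw [← h, ← map_mul, h2, map_one, mul_one]

theorem mk_v : mk p GenericQG.v = algebraMap ℂ _ (q p) := by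
  have := RingQuot.mkAlgHom_rel ℂ (LusztigRel.v (p := p))
  rw [AlgHom.commutes] at this
  exact this

theorem mk_prod_qIntElt (hp : 2 ≤ p) :
    mk p ((List.range p).map fun i => qIntElt (i + 1)).prod = 0 := by
  have h0 : mk p (qIntElt p) = 0 := by
    have : qInt (q p) (p : ℤ) = 0 := by
      rw [qInt, zpow_neg, zpow_natCast, q_pow_p p (by omega)]; norm_num
    rw [← sum_eq_qInt _ (q_sub_inv_ne_zero p hp)] at this
    have h2 := congrArg (algebraMap ℂ (Lusztig p)) this
    rw [map_zero] at h2
    rw [← h2, qIntElt]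
    simp only [map_sum, map_mul, map_pow, mk_v, mk_vInv]
  obtain ⟨m, rfl⟩ : ∃ m, p = m + 1 := ⟨p - 1, by omega⟩
  rw [List.range_succ, List.map_append, List.prod_append, map_mul]
  simp [h0]

end relations

open GenericQG in
/-- The canonical homomorphism `Ū_q sl(2) → U_q sl(2)`, given by `E ↦ E`, `F ↦ F`, `K ↦ K`. -/
def ofSmall [hp : Fact (2 ≤ p)] : SmallQG p →ₐ[ℂ] Lusztig p :=
  SmallQG.lift
    (fun
      | .E => mk p (Ediv 1)
      | .F => mk p (Fdiv 1)
      | .K => mk p K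
      | .Ki => mk p Ki)
    (by simp only [← map_mul, K_mul_Ki, map_one])
    (by simp only [← map_mul, Ki_mul_K, map_one])
    (by simp only [← map_mul, K_E_Ki]
        rw [map_mul, map_pow, mk_v, Algebra.smul_def, map_pow])
    (by simp only [← map_mul, K_F_Ki]
        rw [map_mul, map_pow, mk_vInv, Algebra.smul_def, ← map_pow, inv_pow])
    (by
      have h := congrArg (mk p) E_F_comm
      simp only [map_mul, map_sub, mk_v, mk_vInv] at h
      rw [← map_sub, ← Algebra.smul_def] at h
      simp only
      rw [← h, smul_smul, inv_mul_cancel₀ (q_sub_inv_ne_zero p hp.out), one_smul])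
    (by simp only [← map_pow]; rw [Ediv_one_pow, map_mul, mk_prod_qIntElt p hp.out, zero_mul])
    (by simp only [← map_pow]; rw [Fdiv_one_pow, map_mul, mk_prod_qIntElt p hp.out, zero_mul])
    (by
      simp only [← map_pow]
      have := RingQuot.mkAlgHom_rel ℂ (LusztigRel.K_pow (p := p))
      rw [map_one] at this
      exact this)

/-- `U_q sl(2)` as a left `Ū_q sl(2)`-module, through the canonical homomorphism. In a scalar tower
`Ū_q sl(2)`, `U_q sl(2)`, `M`, the action on `M` of `U_q sl(2)` thus extends the one of
`Ū_q sl(2)`. -/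
instance [Fact (2 ≤ p)] : Module (SmallQG p) (Lusztig p) :=
  Module.compHom (Lusztig p) (ofSmall p).toRingHom

/-- The element `𝓔 = E^p / [p]!`. -/
def 𝓔 : Lusztig p := mk p (GenericQG.Ediv p)

/-- The element `𝓕 = F^p / [p]!`. -/
def 𝓕 : Lusztig p := mk p (GenericQG.Fdiv p)

end Lusztig

/-! ### The action of `Ū_q sl(2)` on the quantum plane and on one-forms -/

namespace QPlane

variable (p : ℕ)

/-- `E (x^(m) y^(n)) = [m+1] x^(m+1) y^(n-1)`. -/
def opE : Module.End ℂ (QPlane p) :=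
  (basis p).constr ℂ fun
    | (_, 0) => 0
    | (m, n + 1) => qInt (q p) (m + 1) • xy p (m + 1) n

/-- `F (x^(m) y^(n)) = [n+1] x^(m-1) y^(n+1)`. -/
def opF : Module.End ℂ (QPlane p) :=
  (basis p).constr ℂ fun
    | (0, _) => 0
    | (m + 1, n) => qInt (q p) (n + 1) • xy p m (n + 1)

/-- `K (x^(m) y^(n)) = q^{m-n} x^(m) y^(n)`. -/
def opK : Module.End ℂ (QPlane p) :=
  (basis p).constr ℂ fun s => q p ^ ((s.1 : ℤ) - s.2) • xy p s.1 s.2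

/-- `K⁻¹ (x^(m) y^(n)) = q^{n-m} x^(m) y^(n)`. -/
def opKi : Module.End ℂ (QPlane p) :=
  (basis p).constr ℂ fun s => q p ^ ((s.2 : ℤ) - s.1) • xy p s.1 s.2

theorem opE_zero (m : ℕ) : opE p (xy p m 0) = 0 := by
  rw [xy, opE, Module.Basis.constr_basis]
theorem opE_succ (m n : ℕ) :
    opE p (xy p m (n + 1)) = qInt (q p) (m + 1) • xy p (m + 1) n := by
  rw [xy, opE, Module.Basis.constr_basis]
theorem opF_zero (n : ℕ) : opF p (xy p 0 n) = 0 := by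
  rw [xy, opF, Module.Basis.constr_basis]
theorem opF_succ (m n : ℕ) :
    opF p (xy p (m + 1) n) = qInt (q p) (n + 1) • xy p m (n + 1) := by
  rw [xy, opF, Module.Basis.constr_basis]
theorem opK_xy (m n : ℕ) : opK p (xy p m n) = q p ^ ((m : ℤ) - n) • xy p m n := by
  rw [xy, opK, Module.Basis.constr_basis]; rfl
theorem opKi_xy (m n : ℕ) : opKi p (xy p m n) = q p ^ ((n : ℤ) - m) • xy p m n := by
  rw [xy, opKi, Module.Basis.constr_basis]; rfl

variable {p} in
theorem end_ext {f g : Module.End ℂ (QPlane p)} (h : ∀ m n, f (xy p m n) = g (xy p m n)) :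
    f = g :=
  (basis p).ext fun s => h s.1 s.2

theorem opK_mul_opKi : opK p * opKi p = 1 := end_ext fun m n => by
  rw [Module.End.mul_apply, opKi_xy, map_smul, opK_xy, smul_smul, ← zpow_add₀ (q_ne_zero p)]
  simp

theorem opKi_mul_opK : opKi p * opK p = 1 := end_ext fun m n => by
  rw [Module.End.mul_apply, opK_xy, map_smul, opKi_xy, smul_smul, ← zpow_add₀ (q_ne_zero p)]
  simp

theorem opK_mul_opE : opK p * opE p * opKi p = q p ^ 2 • opE p := end_ext fun m n => by
  rw [Module.End.mul_apply, Module.End.mul_apply, opKi_xy, map_smul, map_smul,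
    LinearMap.smul_apply]
  cases n with
  | zero => simp [opE_zero]
  | succ n =>
    rw [opE_succ, map_smul, opK_xy, smul_smul, smul_smul, smul_smul]
    congr 1
    rw [mul_right_comm, ← zpow_add₀ (q_ne_zero p), ← zpow_natCast (q p) 2]
    congr 2
    push_cast; ring

theorem opK_mul_opF : opK p * opF p * opKi p = (q p ^ 2)⁻¹ • opF p := end_ext fun m n => by
  rw [Module.End.mul_apply, Module.End.mul_apply, opKi_xy, map_smul, map_smul,
    LinearMap.smul_apply]
  cases m with
  | zero => simp [opF_zero]
  | succ m =>
    rw [opF_succ, map_smul, opK_xy, smul_smul, smul_smul, smul_smul]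
    congr 1
    rw [mul_right_comm, ← zpow_add₀ (q_ne_zero p), ← zpow_natCast (q p) 2,
      ← zpow_neg]
    congr 2
    push_cast; ring

theorem opE_mul_opF (hp : 2 ≤ p) : opE p * opF p - opF p * opE p =
    (q p - (q p)⁻¹)⁻¹ • (opK p - opKi p) := end_ext fun m n => by
  have h := qInt_mul_sub (q p) (q_ne_zero p) (q_sub_inv_ne_zero p hp) m n
  have hR : ((q p - (q p)⁻¹)⁻¹ • (opK p - opKi p)) (xy p m n) =
      qInt (q p) ((m : ℤ) - n) • xy p m n := by
    rw [LinearMap.smul_apply, LinearMap.sub_apply, opK_xy, opKi_xy, ← sub_smul, smul_smul, qInt,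
      neg_sub, div_eq_inv_mul]
  rw [hR, LinearMap.sub_apply, Module.End.mul_apply, Module.End.mul_apply, ← h, sub_smul]
  congr 1
  · cases m with
    | zero => simp [opF_zero, qInt_zero]
    | succ m => rw [opF_succ, map_smul, opE_succ, smul_smul, mul_comm]; push_cast; rfl
  · cases n with
    | zero => simp [opE_zero, qInt_zero]
    | succ n => rw [opE_succ, map_smul, opF_succ, smul_smul]; push_cast; rfl

theorem exists_qInt_eq_zero (hp : p ≠ 0) (m : ℕ) : ∃ i ∈ Finset.range p,
    qInt (q p) ((m : ℤ) + i + 1) = 0 := by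
  have hlt : m % p < p := Nat.mod_lt _ (Nat.pos_of_ne_zero hp)
  refine ⟨p - 1 - m % p, Finset.mem_range.2 (by omega), ?_⟩
  have h := qInt_mul_p p hp (m / p + 1 : ℕ)
  rw [← h]
  congr 1
  have h1 := Nat.div_add_mod m p
  have : m + (p - 1 - m % p) + 1 = p * (m / p + 1) := by
    rw [mul_add, mul_one]; omega
  exact_mod_cast this

theorem opE_pow (k m n : ℕ) : (opE p ^ k) (xy p m n) = 0 ∨ (opE p ^ k) (xy p m n) =
    (∏ i ∈ Finset.range k, qInt (q p) ((m : ℤ) + i + 1)) • xy p (m + k) (n - k) := by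
  induction k with
  | zero => right; simp
  | succ k ih =>
    rw [pow_succ', Module.End.mul_apply]
    rcases ih with ih | ih
    · left; rw [ih, map_zero]
    · rw [ih, map_smul]
      rcases Nat.eq_zero_or_pos (n - k) with h | h
      · left; rw [h, opE_zero, smul_zero]
      · right
        obtain ⟨l, hl⟩ : ∃ l, n - k = l + 1 := ⟨n - k - 1, by omega⟩
        rw [hl, opE_succ, smul_smul, Finset.prod_range_succ, show n - (k + 1) = l by omega,
          add_assoc]
        push_cast; rfl

theorem opF_pow (k m n : ℕ) : (opF p ^ k) (xy p m n) = 0 ∨ (opF p ^ k) (xy p m n) =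
    (∏ i ∈ Finset.range k, qInt (q p) ((n : ℤ) + i + 1)) • xy p (m - k) (n + k) := by
  induction k with
  | zero => right; simp
  | succ k ih =>
    rw [pow_succ', Module.End.mul_apply]
    rcases ih with ih | ih
    · left; rw [ih, map_zero]
    · rw [ih, map_smul]
      rcases Nat.eq_zero_or_pos (m - k) with h | h
      · left; rw [h, opF_zero, smul_zero]
      · right
        obtain ⟨l, hl⟩ : ∃ l, m - k = l + 1 := ⟨m - k - 1, by omega⟩
        rw [hl, opF_succ, smul_smul, Finset.prod_range_succ, show m - (k + 1) = l by omega,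
          add_assoc]
        push_cast; rfl

theorem opE_pow_p (hp : p ≠ 0) : opE p ^ p = 0 := end_ext fun m n => by
  obtain ⟨i, hi, h0⟩ := exists_qInt_eq_zero p hp m
  rcases opE_pow p p m n with h | h
  · rw [h, LinearMap.zero_apply]
  · rw [h, Finset.prod_eq_zero hi h0, zero_smul, LinearMap.zero_apply]

theorem opF_pow_p (hp : p ≠ 0) : opF p ^ p = 0 := end_ext fun m n => by
  obtain ⟨i, hi, h0⟩ := exists_qInt_eq_zero p hp n
  rcases opF_pow p p m n with h | h
  · rw [h, LinearMap.zero_apply]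
  · rw [h, Finset.prod_eq_zero hi h0, zero_smul, LinearMap.zero_apply]

theorem opK_pow (k m n : ℕ) :
    (opK p ^ k) (xy p m n) = (q p ^ ((m : ℤ) - n)) ^ k • xy p m n := by
  induction k with
  | zero => simp
  | succ k ih => rw [pow_succ', Module.End.mul_apply, ih, map_smul, opK_xy, smul_smul, pow_succ]

theorem opK_pow_two_p (hp : p ≠ 0) : opK p ^ (2 * p) = 1 := end_ext fun m n => by
  rw [opK_pow, ← zpow_natCast, ← zpow_mul, mul_comm, zpow_mul, zpow_natCast, q_pow_two_p p hp,
    one_zpow, one_smul, Module.End.one_apply]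

/-- The action of `Ū_q sl(2)` on the quantum plane. -/
def action [hp : Fact (2 ≤ p)] : SmallQG p →ₐ[ℂ] Module.End ℂ (QPlane p) :=
  have hp0 : p ≠ 0 := by have := hp.out; omega
  SmallQG.lift
    (fun
      | .E => opE p
      | .F => opF p
      | .K => opK p
      | .Ki => opKi p)
    (opK_mul_opKi p) (opKi_mul_opK p) (opK_mul_opE p) (opK_mul_opF p) (opE_mul_opF p hp.out)
    (opE_pow_p p hp0) (opF_pow_p p hp0) (opK_pow_two_p p hp0)

instance [Fact (2 ≤ p)] : Module (SmallQG p) (QPlane p) :=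
  Module.compHom (QPlane p) (action p).toRingHom

end QPlane

namespace OneForm

variable (p : ℕ)

/-- `E (f ξ + g η) = (q E(f) + g) ξ + q⁻¹ E(g) η`. -/
def opE : Module.End ℂ (OneForm p) :=
  (LinearMap.prod
    ((q p • QPlane.opE p) ∘ₗ LinearMap.fst ℂ (QPlane p) (QPlane p)
      + LinearMap.snd ℂ (QPlane p) (QPlane p))
    (((q p)⁻¹ • QPlane.opE p) ∘ₗ LinearMap.snd ℂ (QPlane p) (QPlane p)) :
    Module.End ℂ (QPlane p × QPlane p))

/-- `F (f ξ + g η) = F(f) ξ + (F(g) + K⁻¹(f)) η`. -/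
def opF : Module.End ℂ (OneForm p) :=
  (LinearMap.prod
    (QPlane.opF p ∘ₗ LinearMap.fst ℂ (QPlane p) (QPlane p))
    (QPlane.opF p ∘ₗ LinearMap.snd ℂ (QPlane p) (QPlane p)
      + QPlane.opKi p ∘ₗ LinearMap.fst ℂ (QPlane p) (QPlane p)) :
    Module.End ℂ (QPlane p × QPlane p))

/-- `K (f ξ + g η) = q K(f) ξ + q⁻¹ K(g) η`. -/
def opK : Module.End ℂ (OneForm p) :=
  (LinearMap.prodMap (q p • QPlane.opK p) ((q p)⁻¹ • QPlane.opK p) :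
    Module.End ℂ (QPlane p × QPlane p))

/-- `K⁻¹ (f ξ + g η) = q⁻¹ K⁻¹(f) ξ + q K⁻¹(g) η`. -/
def opKi : Module.End ℂ (OneForm p) :=
  (LinearMap.prodMap ((q p)⁻¹ • QPlane.opKi p) (q p • QPlane.opKi p) :
    Module.End ℂ (QPlane p × QPlane p))

/-- The one-form `f ξ + g η`. -/
def mk (f g : QPlane p) : OneForm p := ((f, g) : QPlane p × QPlane p)

variable {p} in
theorem end_ext {a b : Module.End ℂ (OneForm p)} (h : ∀ f g, a (mk p f g) = b (mk p f g)) :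
    a = b :=
  LinearMap.ext fun s => h s.1 s.2

theorem add_mk (f g f' g' : QPlane p) : mk p f g + mk p f' g' = mk p (f + f') (g + g') := rfl
theorem sub_mk (f g f' g' : QPlane p) : mk p f g - mk p f' g' = mk p (f - f') (g - g') := rfl
theorem smul_mk (c : ℂ) (f g : QPlane p) : c • mk p f g = mk p (c • f) (c • g) := rfl
theorem opE_mk (f g : QPlane p) : opE p (mk p f g) =
    mk p (q p • QPlane.opE p f + g) ((q p)⁻¹ • QPlane.opE p g) := rfl
theorem opF_mk (f g : QPlane p) : opF p (mk p f g) =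
    mk p (QPlane.opF p f) (QPlane.opF p g + QPlane.opKi p f) := rfl
theorem opK_mk (f g : QPlane p) : opK p (mk p f g) =
    mk p (q p • QPlane.opK p f) ((q p)⁻¹ • QPlane.opK p g) := rfl
theorem opKi_mk (f g : QPlane p) : opKi p (mk p f g) =
    mk p ((q p)⁻¹ • QPlane.opKi p f) (q p • QPlane.opKi p g) := rfl

theorem K_Ki (f : QPlane p) : QPlane.opK p (QPlane.opKi p f) = f :=
  LinearMap.congr_fun (QPlane.opK_mul_opKi p) f
theorem Ki_K (f : QPlane p) : QPlane.opKi p (QPlane.opK p f) = f :=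
  LinearMap.congr_fun (QPlane.opKi_mul_opK p) f
theorem K_E_Ki (f : QPlane p) : QPlane.opK p (QPlane.opE p (QPlane.opKi p f)) =
    q p ^ 2 • QPlane.opE p f :=
  LinearMap.congr_fun (QPlane.opK_mul_opE p) f
theorem K_F_Ki (f : QPlane p) : QPlane.opK p (QPlane.opF p (QPlane.opKi p f)) =
    (q p ^ 2)⁻¹ • QPlane.opF p f :=
  LinearMap.congr_fun (QPlane.opK_mul_opF p) f
theorem E_Ki (f : QPlane p) : QPlane.opE p (QPlane.opKi p f) =
    q p ^ 2 • QPlane.opKi p (QPlane.opE p f) := by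
  rw [← map_smul, ← K_E_Ki, Ki_K]
theorem Ki_F (f : QPlane p) : QPlane.opKi p (QPlane.opF p f) =
    q p ^ 2 • QPlane.opF p (QPlane.opKi p f) := by
  rw [← Ki_K p (QPlane.opF p (QPlane.opKi p f)), K_F_Ki, map_smul, smul_smul,
    mul_inv_cancel₀ (pow_ne_zero _ (q_ne_zero p)), one_smul]
theorem E_F (hp : 2 ≤ p) (f : QPlane p) :
    QPlane.opE p (QPlane.opF p f) = QPlane.opF p (QPlane.opE p f) +
      (q p - (q p)⁻¹)⁻¹ • (QPlane.opK p f - QPlane.opKi p f) := by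
  have := LinearMap.congr_fun (QPlane.opE_mul_opF p hp) f
  rw [LinearMap.sub_apply, sub_eq_iff_eq_add'] at this
  exact this

theorem opK_mul_opKi : opK p * opKi p = 1 := end_ext fun f g => by
  rw [Module.End.mul_apply, opKi_mk, opK_mk]
  simp [K_Ki, smul_smul, q_ne_zero]

theorem opKi_mul_opK : opKi p * opK p = 1 := end_ext fun f g => by
  rw [Module.End.mul_apply, opK_mk, opKi_mk]
  simp [Ki_K, smul_smul, q_ne_zero]

theorem opK_mul_opE : opK p * opE p * opKi p = q p ^ 2 • opE p := end_ext fun f g => by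
  have hq := q_ne_zero p
  rw [Module.End.mul_apply, Module.End.mul_apply, opKi_mk, opE_mk, opK_mk, LinearMap.smul_apply,
    opE_mk, smul_mk]
  simp only [map_smul, map_add, K_E_Ki, K_Ki, smul_add, smul_smul]
  congr 1 <;> match_scalars <;> field_simp

theorem opK_mul_opF : opK p * opF p * opKi p = (q p ^ 2)⁻¹ • opF p := end_ext fun f g => by
  have hq := q_ne_zero p
  rw [Module.End.mul_apply, Module.End.mul_apply, opKi_mk, opF_mk, opK_mk, LinearMap.smul_apply,
    opF_mk, smul_mk]
  simp only [map_smul, map_add, K_F_Ki, K_Ki, smul_add, smul_smul]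
  congr 1 <;> match_scalars <;> field_simp

theorem opE_mul_opF (hp : 2 ≤ p) : opE p * opF p - opF p * opE p =
    (q p - (q p)⁻¹)⁻¹ • (opK p - opKi p) := end_ext fun f g => by
  have hq := q_ne_zero p
  have hs := q_sub_inv_ne_zero p hp
  have hs' : q p ^ 2 - 1 ≠ 0 := sub_ne_zero.2 (by simpa using q_sq_ne_one p hp 1 one_pos (by omega))
  have hi : (q p - (q p)⁻¹)⁻¹ = q p / (q p ^ 2 - 1) := by
    rw [inv_eq_iff_eq_inv, inv_div, eq_div_iff hq, sub_mul, inv_mul_cancel₀ hq, pow_two]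
  rw [hi, LinearMap.sub_apply, Module.End.mul_apply, Module.End.mul_apply, opF_mk, opE_mk, opE_mk,
    opF_mk, LinearMap.smul_apply, LinearMap.sub_apply, opK_mk, opKi_mk, sub_mk, sub_mk, smul_mk]
  simp only [map_smul, map_add, E_F p hp, E_Ki]
  congr 1
  · match_scalars <;> field_simp <;> ring
  · match_scalars <;> field_simp <;> ring

theorem opE_pow (hp : 2 ≤ p) (k : ℕ) (f g : QPlane p) : (opE p ^ (k + 1)) (mk p f g) =
    mk p (q p ^ (k + 1) • (QPlane.opE p ^ (k + 1)) f
        + qInt (q p) (k + 1 : ℕ) • (QPlane.opE p ^ k) g)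
      ((q p)⁻¹ ^ (k + 1) • (QPlane.opE p ^ (k + 1)) g) := by
  have hq := q_ne_zero p
  have hs := q_sub_inv_ne_zero p hp
  induction k with
  | zero => simp [opE_mk, qInt, div_self hs]
  | succ k ih =>
    rw [pow_succ', Module.End.mul_apply, ih, opE_mk]
    simp only [map_smul, map_add, ← Module.End.mul_apply, ← pow_succ']
    push_cast
    rw [qInt_add_one (q p) hq hs (k + 1 : ℤ)]
    have h : q p ^ (-((k : ℤ) + 1)) = (q p)⁻¹ ^ (k + 1) := by
      rw [zpow_neg, inv_pow]; exact_mod_cast rfl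
    rw [h]
    congr 1
    · module
    · module

theorem opF_pow (k : ℕ) (f g : QPlane p) : (opF p ^ (k + 1)) (mk p f g) =
    mk p ((QPlane.opF p ^ (k + 1)) f)
      ((QPlane.opF p ^ (k + 1)) g
        + (∑ i ∈ Finset.range (k + 1), (q p ^ 2) ^ i) •
          (QPlane.opF p ^ k) (QPlane.opKi p f)) := by
  have hKi : ∀ k, QPlane.opKi p ((QPlane.opF p ^ k) f) =
      (q p ^ 2) ^ k • (QPlane.opF p ^ k) (QPlane.opKi p f) := fun k => by
    induction k with
    | zero => simp
    | succ k ih =>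
      rw [pow_succ', Module.End.mul_apply, Ki_F, ih, map_smul, smul_smul, ← pow_succ',
        ← Module.End.mul_apply, ← pow_succ']
  induction k with
  | zero => simp [opF_mk]
  | succ k ih =>
    rw [pow_succ', Module.End.mul_apply, ih, opF_mk, hKi, Finset.sum_range_succ _ (k + 1)]
    have h : ∀ k g, QPlane.opF p ((QPlane.opF p ^ k) g) = (QPlane.opF p ^ (k + 1)) g :=
      fun k g => by rw [pow_succ', Module.End.mul_apply]
    simp only [map_smul, map_add, h]
    congr 1
    module

theorem opE_pow_p (hp : 2 ≤ p) : opE p ^ p = 0 := end_ext fun f g => by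
  have hp0 : p ≠ 0 := by omega
  have h := opE_pow p hp (p - 1) f g
  have h0 := qInt_mul_p p hp0 1
  rw [mul_one] at h0
  rw [Nat.sub_add_cancel (by omega), QPlane.opE_pow_p p hp0, h0] at h
  rw [h]
  simp only [LinearMap.zero_apply, smul_zero, zero_smul, add_zero]
  rfl

theorem opF_pow_p (hp : 2 ≤ p) : opF p ^ p = 0 := end_ext fun f g => by
  have hp0 : p ≠ 0 := by omega
  have h := opF_pow p (p - 1) f g
  have h1 : q p ^ 2 - 1 ≠ 0 := sub_ne_zero.2 (by simpa using q_sq_ne_one p hp 1 one_pos (by omega))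
  have h0 : ∑ i ∈ Finset.range p, (q p ^ 2) ^ i = 0 := by
    rw [geom_sum_eq (sub_ne_zero.1 h1), ← pow_mul, q_pow_two_p p hp0, sub_self, zero_div]
  rw [Nat.sub_add_cancel (by omega), QPlane.opF_pow_p p hp0, h0] at h
  rw [h]
  simp only [LinearMap.zero_apply, zero_smul, add_zero]
  rfl

theorem opK_pow (k : ℕ) (f g : QPlane p) : (opK p ^ k) (mk p f g) =
    mk p (q p ^ k • (QPlane.opK p ^ k) f) ((q p)⁻¹ ^ k • (QPlane.opK p ^ k) g) := by
  induction k with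
  | zero => simp
  | succ k ih =>
    rw [pow_succ', Module.End.mul_apply, ih, opK_mk]
    simp only [map_smul, ← Module.End.mul_apply, ← pow_succ', smul_smul]

theorem opK_pow_two_p (hp : p ≠ 0) : opK p ^ (2 * p) = 1 := end_ext fun f g => by
  rw [opK_pow, QPlane.opK_pow_two_p p hp, inv_pow, q_pow_two_p p hp]
  simp

/-- The action of `Ū_q sl(2)` on one-forms. -/
def action [hp : Fact (2 ≤ p)] : SmallQG p →ₐ[ℂ] Module.End ℂ (OneForm p) :=
  have hp0 : p ≠ 0 := by have := hp.out; omega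
  SmallQG.lift
    (fun
      | .E => opE p
      | .F => opF p
      | .K => opK p
      | .Ki => opKi p)
    (opK_mul_opKi p) (opKi_mul_opK p) (opK_mul_opE p) (opK_mul_opF p) (opE_mul_opF p hp.out)
    (opE_pow_p p hp.out) (opF_pow_p p hp.out) (opK_pow_two_p p hp0)

instance [Fact (2 ≤ p)] : Module (SmallQG p) (OneForm p) :=
  Module.compHom (OneForm p) (action p).toRingHom

end OneForm

/-! ### The modules `W^±_r(n)` and `X^±_r` -/

/-- The underlying space of the module `W^ε_r(n)`, of dimension `(n-1)p + r`. Its basis vectors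
`w_l`, `0 ≤ l < (n-1)p + r`, run through the "snake"
`X^ε_r ⟶ X^{-ε}_{p-r} ⟵ X^ε_r ⟶ ⋯ ⟵ X^ε_r` from left to right: the `w_{jp+k}`, `0 ≤ k < r`, span
the `j`-th subquotient `X^ε_r`, and the `w_{jp+r+k}`, `0 ≤ k < p - r`, span the submodule
`X^{-ε}_{p-r}` between the `j`-th and the `(j+1)`-th `X^ε_r`. -/
def WMod (p r n : ℕ) (_ε : ℤˣ) : Type := Fin ((n - 1) * p + r) →₀ ℂ

namespace WMod

variable (p r n : ℕ) (ε : ℤˣ)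

instance : AddCommGroup (WMod p r n ε) :=
  inferInstanceAs (AddCommGroup (Fin ((n - 1) * p + r) →₀ ℂ))
instance : Module ℂ (WMod p r n ε) := inferInstanceAs (Module ℂ (Fin ((n - 1) * p + r) →₀ ℂ))

/-- The basis vectors. -/
def basis : Module.Basis (Fin ((n - 1) * p + r)) ℂ (WMod p r n ε) :=
  ⟨LinearEquiv.refl ℂ (Fin ((n - 1) * p + r) →₀ ℂ)⟩

/-- The vector `w_l`, which is zero for `l ≥ (n-1)p + r`. -/
def w (l : ℕ) : WMod p r n ε := if h : l < (n - 1) * p + r then basis p r n ε ⟨l, h⟩ else 0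

/-- The coefficient of `E w_l = c_l w_{l-1}`. On each subquotient it is the usual one:
`[l] [r-l] = [k] [r-k]` for `l = jp + k`, and `[l] [r-l] = - [k] [p-r-k]` for `l = jp + r + k`.
The arrows from an `X^ε_r` to the submodule on its left have coefficient `1`. (For `r = p` there
are no such arrows.) -/
def coeffE (l : ℕ) : ℂ :=
  if p ∣ l ∧ ¬ p ∣ r then 1 else (ε : ℤ) * (qInt (q p) l * qInt (q p) ((r : ℤ) - l))

/-- The coefficient of `F w_l = c_l w_{l+1}`. -/
def coeffF (l : ℕ) : ℂ := if p ∣ l + 1 then 0 else 1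

/-- `E w_0 = 0` and `E w_l = c_l w_{l-1}` for `l ≥ 1`. -/
def opE : Module.End ℂ (WMod p r n ε) :=
  (basis p r n ε).constr ℂ fun l =>
    if (l : ℕ) = 0 then 0 else coeffE p r ε l • w p r n ε (l - 1)

/-- `F w_l = w_{l+1}`, except that it is zero if `w_{l+1}` starts another `X^ε_r` or if `w_l` is
the last basis vector. -/
def opF : Module.End ℂ (WMod p r n ε) :=
  (basis p r n ε).constr ℂ fun l => coeffF p l • w p r n ε (l + 1)

/-- `K w_l = ε q^{r-1-2l} w_l`. -/
def opK : Module.End ℂ (WMod p r n ε) :=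
  (basis p r n ε).constr ℂ fun l =>
    ((ε : ℤ) * q p ^ ((r : ℤ) - 1 - 2 * l) : ℂ) • w p r n ε l

/-- `K⁻¹ w_l = ε q^{-(r-1-2l)} w_l`. -/
def opKi : Module.End ℂ (WMod p r n ε) :=
  (basis p r n ε).constr ℂ fun l =>
    ((ε : ℤ) * q p ^ (-((r : ℤ) - 1 - 2 * l)) : ℂ) • w p r n ε l

theorem w_fin (l : Fin ((n - 1) * p + r)) : w p r n ε l = basis p r n ε l := by simp [w]

theorem w_eq_zero (l : ℕ) (h : ¬ l < (n - 1) * p + r) : w p r n ε l = 0 := by simp [w, h]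

variable {p r n ε} in
theorem end_ext {a b : Module.End ℂ (WMod p r n ε)}
    (h : ∀ l < (n - 1) * p + r, a (w p r n ε l) = b (w p r n ε l)) : a = b :=
  (basis p r n ε).ext fun l => by
    have := h l l.2
    rwa [w_fin] at this

theorem opE_zero : opE p r n ε (w p r n ε 0) = 0 := by
  by_cases h : 0 < (n - 1) * p + r
  · have := w_fin p r n ε ⟨0, h⟩
    simp only at this
    rw [this, opE, Module.Basis.constr_basis]; simp
  · rw [w_eq_zero _ _ _ _ _ h, map_zero]

theorem opE_succ (l : ℕ) (h : l + 1 < (n - 1) * p + r) : opE p r n ε (w p r n ε (l + 1)) =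
    coeffE p r ε (l + 1) • w p r n ε l := by
  have := w_fin p r n ε ⟨l + 1, h⟩
  simp only at this
  rw [this, opE, Module.Basis.constr_basis]; simp

theorem opF_w (l : ℕ) : opF p r n ε (w p r n ε l) = coeffF p l • w p r n ε (l + 1) := by
  by_cases h : l < (n - 1) * p + r
  · have := w_fin p r n ε ⟨l, h⟩
    simp only at this
    rw [this, opF, Module.Basis.constr_basis]
  · rw [w_eq_zero _ _ _ _ _ h, w_eq_zero _ _ _ _ _ (by omega), map_zero, smul_zero]

theorem opK_w (l : ℕ) : opK p r n ε (w p r n ε l) =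
    ((ε : ℤ) * q p ^ ((r : ℤ) - 1 - 2 * l) : ℂ) • w p r n ε l := by
  by_cases h : l < (n - 1) * p + r
  · have := w_fin p r n ε ⟨l, h⟩
    simp only at this
    rw [this, opK, Module.Basis.constr_basis]; simp [this]
  · rw [w_eq_zero _ _ _ _ _ h, map_zero, smul_zero]

theorem opKi_w (l : ℕ) : opKi p r n ε (w p r n ε l) =
    ((ε : ℤ) * q p ^ (-((r : ℤ) - 1 - 2 * l)) : ℂ) • w p r n ε l := by
  by_cases h : l < (n - 1) * p + r
  · have := w_fin p r n ε ⟨l, h⟩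
    simp only at this
    rw [this, opKi, Module.Basis.constr_basis]; simp [this]
  · rw [w_eq_zero _ _ _ _ _ h, map_zero, smul_zero]

theorem sign_mul_sign : ((ε : ℤ) : ℂ) * ((ε : ℤ) : ℂ) = 1 := by
  rcases Int.units_eq_one_or ε with rfl | rfl <;> simp

theorem opK_mul_opKi : opK p r n ε * opKi p r n ε = 1 := end_ext fun l _ => by
  rw [Module.End.mul_apply, opKi_w, map_smul, opK_w, smul_smul, mul_mul_mul_comm, sign_mul_sign,
    ← zpow_add₀ (q_ne_zero p)]
  simp

theorem opKi_mul_opK : opKi p r n ε * opK p r n ε = 1 := end_ext fun l _ => by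
  rw [Module.End.mul_apply, opK_w, map_smul, opKi_w, smul_smul, mul_mul_mul_comm, sign_mul_sign,
    ← zpow_add₀ (q_ne_zero p)]
  simp

theorem opK_mul_opE : opK p r n ε * opE p r n ε * opKi p r n ε = q p ^ 2 • opE p r n ε :=
  end_ext fun l hl => by
  rw [Module.End.mul_apply, Module.End.mul_apply, opKi_w, map_smul, map_smul,
    LinearMap.smul_apply]
  cases l with
  | zero => simp [opE_zero]
  | succ l =>
    rw [opE_succ _ _ _ _ _ hl, map_smul, opK_w, smul_smul, smul_smul, smul_smul]
    congr 1
    rw [mul_right_comm, mul_mul_mul_comm, sign_mul_sign, one_mul, ← zpow_add₀ (q_ne_zero p),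
      ← zpow_natCast (q p) 2]
    congr 2
    push_cast; ring

theorem opK_mul_opF : opK p r n ε * opF p r n ε * opKi p r n ε = (q p ^ 2)⁻¹ • opF p r n ε :=
  end_ext fun l hl => by
  rw [Module.End.mul_apply, Module.End.mul_apply, opKi_w, map_smul, map_smul,
    LinearMap.smul_apply, opF_w, map_smul, opK_w, smul_smul, smul_smul, smul_smul]
  congr 1
  rw [mul_right_comm, mul_mul_mul_comm, sign_mul_sign, one_mul, ← zpow_add₀ (q_ne_zero p),
    ← zpow_natCast (q p) 2, ← zpow_neg]
  congr 2
  push_cast; ring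

theorem coeff_mul (hp : 2 ≤ p) (l : ℕ) : coeffE p r ε (l + 1) * coeffF p l =
    (ε : ℤ) * (qInt (q p) (l + 1 : ℕ) * qInt (q p) ((r : ℤ) - (l + 1 : ℕ))) := by
  rw [coeffE, coeffF]
  by_cases h : p ∣ l + 1
  · have h0 : qInt (q p) ((l + 1 : ℕ) : ℤ) = 0 := by
      obtain ⟨j, hj⟩ := h
      rw [hj]
      exact_mod_cast qInt_mul_p p (by omega) j
    rw [if_pos h, h0]; simp
  · simp [h]

theorem opE_mul_opF (hp : 2 ≤ p) :
    opE p r n ε * opF p r n ε - opF p r n ε * opE p r n ε =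
      (q p - (q p)⁻¹)⁻¹ • (opK p r n ε - opKi p r n ε) := end_ext fun l hl => by
  have hR : ((q p - (q p)⁻¹)⁻¹ • (opK p r n ε - opKi p r n ε)) (w p r n ε l) =
      ((ε : ℤ) * qInt (q p) ((r : ℤ) - 1 - 2 * l)) • w p r n ε l := by
    rw [LinearMap.smul_apply, LinearMap.sub_apply, opK_w, opKi_w, ← sub_smul, smul_smul, qInt]
    congr 1; ring
  have h := qInt_mul_sub (q p) (q_ne_zero p) (q_sub_inv_ne_zero p hp) ((r : ℤ) - l - 1) l
  have hEF : opE p r n ε (opF p r n ε (w p r n ε l)) =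
      ((ε : ℤ) * (qInt (q p) (l + 1 : ℕ) * qInt (q p) ((r : ℤ) - (l + 1 : ℕ)))) •
        w p r n ε l := by
    rw [opF_w, map_smul]
    by_cases hl' : l + 1 < (n - 1) * p + r
    · rw [opE_succ _ _ _ _ _ hl', smul_smul, mul_comm, coeff_mul p r ε hp]
    · rw [w_eq_zero _ _ _ _ _ hl', map_zero, smul_zero]
      have : qInt (q p) ((r : ℤ) - (l + 1 : ℕ)) = 0 := by
        rw [← qInt_mul_p p (by omega) (-((n - 1 : ℕ) : ℤ))]
        congr 1
        have : l + 1 = (n - 1) * p + r := by omega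
        rw [this]; push_cast; ring
      rw [this, mul_zero, mul_zero, zero_smul]
  have hFE : opF p r n ε (opE p r n ε (w p r n ε l)) =
      ((ε : ℤ) * (qInt (q p) l * qInt (q p) ((r : ℤ) - l))) • w p r n ε l := by
    cases l with
    | zero => simp [opE_zero, qInt_zero]
    | succ l =>
      rw [opE_succ _ _ _ _ _ hl, map_smul, opF_w, smul_smul, coeff_mul p r ε hp]
  rw [hR, LinearMap.sub_apply, Module.End.mul_apply, Module.End.mul_apply, hEF, hFE, ← sub_smul]
  congr 1
  rw [← mul_sub]
  congr 1
  rw [show (r : ℤ) - 1 - 2 * l = (r : ℤ) - l - 1 - l by ring, ← h]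
  push_cast
  rw [show (r : ℤ) - l - 1 + 1 = r - l by ring, show (r : ℤ) - (l + 1) = r - l - 1 by ring]
  ring

theorem opF_pow (k l : ℕ) : (opF p r n ε ^ k) (w p r n ε l) =
    (∏ i ∈ Finset.range k, coeffF p (l + i)) • w p r n ε (l + k) := by
  induction k with
  | zero => simp
  | succ k ih =>
    rw [pow_succ', Module.End.mul_apply, ih, map_smul, opF_w, smul_smul, Finset.prod_range_succ]
    rfl

theorem opE_pow (k l : ℕ) (hl : l + k < (n - 1) * p + r) :
    (opE p r n ε ^ k) (w p r n ε (l + k)) =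
    (∏ i ∈ Finset.range k, coeffE p r ε (l + i + 1)) • w p r n ε l := by
  induction k with
  | zero => simp
  | succ k ih =>
    rw [pow_succ, Module.End.mul_apply, ← add_assoc,
      opE_succ _ _ _ _ _ (by omega : l + k + 1 < _), map_smul, ih (by omega), smul_smul, Finset.prod_range_succ, mul_comm]

theorem opE_pow_of_lt (k l : ℕ) (hl : l < (n - 1) * p + r) (h : l < k) :
    (opE p r n ε ^ k) (w p r n ε l) = 0 := by
  obtain ⟨j, rfl⟩ : ∃ j, k = j + 1 + l := ⟨k - l - 1, by omega⟩
  have := opE_pow p r n ε l 0 (by omega)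
  rw [zero_add] at this
  rw [pow_add, Module.End.mul_apply, this, map_smul, pow_succ, Module.End.mul_apply, opE_zero,
    map_zero, smul_zero]

theorem exists_dvd (hp : p ≠ 0) (m : ℕ) : ∃ i ∈ Finset.range p, p ∣ m + i := by
  refine ⟨(p - m % p) % p, Finset.mem_range.2 (Nat.mod_lt _ (by omega)), ?_⟩
  have hlt : m % p < p := Nat.mod_lt _ (Nat.pos_of_ne_zero hp)
  rw [Nat.dvd_iff_mod_eq_zero, Nat.add_mod, Nat.mod_mod, ← Nat.add_mod,
    ← Nat.mod_add_mod, Nat.add_sub_cancel' hlt.le, Nat.mod_self]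

theorem opF_pow_p (hp : p ≠ 0) : opF p r n ε ^ p = 0 := end_ext fun l _ => by
  obtain ⟨i, hi, h⟩ := exists_dvd p hp (l + 1)
  rw [opF_pow, Finset.prod_eq_zero hi, zero_smul, LinearMap.zero_apply]
  rw [coeffF, if_pos]
  rwa [add_right_comm]

theorem coeffE_eq_zero (hp : p ≠ 0) (l : ℕ) (h : (p : ℤ) ∣ (r : ℤ) - l) :
    coeffE p r ε l = 0 := by
  have h0 : qInt (q p) ((r : ℤ) - l) = 0 := by
    obtain ⟨j, hj⟩ := h
    rw [hj, qInt_mul_p p hp]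
  rw [coeffE, if_neg, h0, mul_zero, mul_zero]
  rintro ⟨h1, h2⟩
  apply h2
  have := dvd_add h (Int.natCast_dvd_natCast.2 h1)
  rw [sub_add_cancel] at this
  exact_mod_cast this

theorem opE_pow_p (hp : p ≠ 0) : opE p r n ε ^ p = 0 := end_ext fun l hl => by
  rw [LinearMap.zero_apply]
  by_cases h : l < p
  · exact opE_pow_of_lt p r n ε p l hl h
  obtain ⟨m, rfl⟩ : ∃ m, l = m + p := ⟨l - p, by omega⟩
  obtain ⟨i, hi, h⟩ := exists_dvd p hp (m + 1 + r * (p - 1))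
  rw [opE_pow _ _ _ _ _ _ hl, Finset.prod_eq_zero hi, zero_smul]
  apply coeffE_eq_zero p r ε hp
  have h2 : (p : ℤ) ∣ ((m + 1 + r * (p - 1) + i : ℕ) : ℤ) := Int.natCast_dvd_natCast.2 h
  have h3 : (r : ℤ) - ((m + i + 1 : ℕ) : ℤ) = p * r - ((m + 1 + r * (p - 1) + i : ℕ) : ℤ) := by
    have : ((p - 1 : ℕ) : ℤ) = p - 1 := by
      rw [Nat.cast_sub (by omega)]; simp
    push_cast
    rw [this]; ring
  rw [h3]
  exact dvd_sub (dvd_mul_right _ _) h2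

theorem opK_pow_two_p (hp : p ≠ 0) : opK p r n ε ^ (2 * p) = 1 := end_ext fun l _ => by
  have : ∀ k, (opK p r n ε ^ k) (w p r n ε l) =
      ((ε : ℤ) * q p ^ ((r : ℤ) - 1 - 2 * l) : ℂ) ^ k • w p r n ε l := fun k => by
    induction k with
    | zero => simp
    | succ k ih =>
      rw [pow_succ', Module.End.mul_apply, ih, map_smul, opK_w, smul_smul, pow_succ]
  rw [this, mul_pow, pow_mul, pow_two, sign_mul_sign, one_pow, one_mul, ← zpow_natCast, ← zpow_mul,
    mul_comm, zpow_mul, zpow_natCast, q_pow_two_p p hp, one_zpow, one_smul, Module.End.one_apply]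

/-- The action of `Ū_q sl(2)` on `W^ε_r(n)`. -/
def action [hp : Fact (2 ≤ p)] : SmallQG p →ₐ[ℂ] Module.End ℂ (WMod p r n ε) :=
  have hp0 : p ≠ 0 := by have := hp.out; omega
  SmallQG.lift
    (fun
      | .E => opE p r n ε
      | .F => opF p r n ε
      | .K => opK p r n ε
      | .Ki => opKi p r n ε)
    (opK_mul_opKi p r n ε) (opKi_mul_opK p r n ε) (opK_mul_opE p r n ε) (opK_mul_opF p r n ε)
    (opE_mul_opF p r n ε hp.out) (opE_pow_p p r n ε hp0) (opF_pow_p p r n ε hp0)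
    (opK_pow_two_p p r n ε hp0)

instance [Fact (2 ≤ p)] : Module (SmallQG p) (WMod p r n ε) :=
  Module.compHom (WMod p r n ε) (action p r n ε).toRingHom

end WMod

/-- The irreducible module `X^ε_r`, `1 ≤ r ≤ p`, with basis `w_0, …, w_{r-1}` and
`K w_l = ε q^{r-1-2l} w_l`, `E w_l = ε [l] [r-l] w_{l-1}`, `F w_l = w_{l+1}`. It is the snake with
a single piece. -/
abbrev XMod (p r : ℕ) (ε : ℤˣ) : Type := WMod p r 1 ε

/-! ### Notions for the decompositions -/

/-- A module is indecomposable if it is nonzero and not a direct sum of two nonzero submodules. -/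
def IsIndecomposable (A M : Type*) [Ring A] [AddCommGroup M] [Module A M] : Prop :=
  Nontrivial M ∧ ∀ S T : Submodule A M, IsCompl S T → S = ⊥ ∨ T = ⊥

/-- `P` is a projective cover of `M`: there is a surjection `P → M` with `P` projective whose kernel
is superfluous. -/
def IsProjectiveCover (A P M : Type*) [Ring A] [AddCommGroup P] [Module A P] [AddCommGroup M]
    [Module A M] : Prop :=
  Module.Projective A P ∧ ∃ π : P →ₗ[A] M, Function.Surjective π ∧
    ∀ S : Submodule A P, S ⊔ LinearMap.ker π = ⊤ → S = ⊤

/-- `P` is a projective object of the category of finite-dimensional modules over the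
`ℂ`-algebra `A`. -/
def IsProjectiveFD (A P : Type) [Ring A] [Algebra ℂ A] [AddCommGroup P] [Module ℂ P] [Module A P]
    [IsScalarTower ℂ A P] : Prop :=
  FiniteDimensional ℂ P ∧
  ∀ (M N : Type) [AddCommGroup M] [AddCommGroup N] [Module ℂ M] [Module ℂ N] [Module A M]
    [Module A N] [IsScalarTower ℂ A M] [IsScalarTower ℂ A N] [FiniteDimensional ℂ M]
    [FiniteDimensional ℂ N] (g : M →ₗ[A] N) (f : P →ₗ[A] N), Function.Surjective g →
    ∃ h : P →ₗ[A] M, g ∘ₗ h = f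

/-- `N` is the internal direct sum of the family `S` of submodules. -/
def IsDirectSum {A M ι : Type*} [Ring A] [AddCommGroup M] [Module A M] (N : Submodule A M)
    (S : ι → Submodule A M) : Prop :=
  iSupIndep S ∧ ⨆ i, S i = N

/-- The sign `+` for odd `n` and `-` for even `n`. -/
def sgn (n : ℕ) : ℤˣ := (-1) ^ (n + 1)

/-- The graded component of the quantum plane spanned by the `x^(m) y^(n)` with `m + n = i`. -/
def grade₀ (p i : ℕ) : Submodule ℂ (QPlane p) :=
  Submodule.span ℂ {f | ∃ m n, m + n = i ∧ f = xy p m n}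

/-- The span of the `x^(m) y^(n)` with `m + n < i`. -/
def fil₀ (p i : ℕ) : Submodule ℂ (QPlane p) :=
  Submodule.span ℂ {f | ∃ m n, m + n < i ∧ f = xy p m n}

/-- The graded component of the one-forms spanned by the `x^(m) y^(n) ξ` and `x^(m) y^(n) η` with
`m + n = i`. -/
def grade₁ (p i : ℕ) : Submodule ℂ (OneForm p) :=
  Submodule.span ℂ {f | ∃ m n, m + n = i ∧ (f = xy p m n • ξ p ∨ f = xy p m n • η p)}

/-- The span of the `x^(m) y^(n) ξ` and `x^(m) y^(n) η` with `m + n < i`. -/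
def fil₁ (p i : ℕ) : Submodule ℂ (OneForm p) :=
  Submodule.span ℂ {f | ∃ m n, m + n < i ∧ (f = xy p m n • ξ p ∨ f = xy p m n • η p)}

end QSl2

end

open QSl2 QSl2.QPlane QSl2.OneForm QSl2.Lusztig

noncomputable section

namespace QSl2

/-! ### Identities for q-binomial coefficients -/

section generic

variable {k : Type*} [Field k] {v : k}

theorem qInt_one (h : v - v⁻¹ ≠ 0) : qInt v 1 = 1 := by
  simp [qInt, div_self h]

theorem qInt_neg (n : ℤ) : qInt v (-n) = -qInt v n := by
  simp only [qInt, neg_neg]; ring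

theorem qInt_add (hv : v ≠ 0) (m n : ℤ) :
    qInt v (m + n) = v ^ n * qInt v m + v ^ (-m) * qInt v n := by
  simp only [qInt, neg_add, zpow_add₀ hv]; ring

theorem qBinom_one_right (hv : v ≠ 0) (h : v - v⁻¹ ≠ 0) (n : ℕ) : qBinom v n 1 = qInt v n := by
  induction n with
  | zero => simp [qBinom, qInt_zero]
  | succ n ih =>
    rw [qBinom, ih, qBinom_zero_right]
    push_cast
    rw [qInt_add_one v hv h]; simp

theorem qInt_mul_qBinom_succ_succ (hv : v ≠ 0) (h : v - v⁻¹ ≠ 0) (n b : ℕ) :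
    qInt v (b + 1) * qBinom v (n + 1) (b + 1) = qInt v (n + 1) * qBinom v n b := by
  rcases le_or_gt b n with hb | hb
  · have := qBinom_trinomial v hv 1 b (n - b)
    rw [show 1 + b + (n - b) = n + 1 by omega, show 1 + (b + (n - b)) = n + 1 by omega,
      show b + (n - b) = n by omega, qBinom_one_right hv h, qBinom_one_right hv h,
      add_comm 1 b] at this
    push_cast at this
    linear_combination this
  · rw [qBinom_of_lt _ _ _ hb, qBinom_of_lt _ _ _ (by omega : n + 1 < b + 1)]; simp

theorem qBinom_succ_succ (n b : ℕ) : qBinom v (n + 1) (b + 1) =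
    v ^ (b + 1) * qBinom v n (b + 1) + v ^ ((b : ℤ) - n) * qBinom v n b := rfl

theorem qInt_mul_qBinom_succ (hv : v ≠ 0) (h : v - v⁻¹ ≠ 0) (n b : ℕ) :
    qInt v (b + 1) * qBinom v n (b + 1) = qInt v ((n : ℤ) - b) * qBinom v n b := by
  have h1 := qInt_mul_qBinom_succ_succ hv h n b
  rw [qBinom_succ_succ] at h1
  have h2 := qInt_add hv ((n : ℤ) - b) (b + 1)
  rw [show (n : ℤ) - b + (b + 1) = n + 1 by ring, neg_sub] at h2
  rw [h2] at h1
  have h3 : v ^ ((b : ℤ) + 1) = v ^ (b + 1) := by exact_mod_cast zpow_natCast v (b + 1)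
  rw [h3] at h1
  apply mul_left_cancel₀ (pow_ne_zero (b + 1) hv)
  linear_combination h1

theorem qBinom_succ_succ' (hv : v ≠ 0) (h : v - v⁻¹ ≠ 0) (n b : ℕ) : qBinom v (n + 1) (b + 1) =
    v ^ (-(b : ℤ) - 1) * qBinom v n (b + 1) + v ^ ((n : ℤ) - b) * qBinom v n b := by
  have h1 := qInt_mul_qBinom_succ hv h n b
  simp only [qInt] at h1
  rw [div_mul_eq_mul_div, div_mul_eq_mul_div, div_left_inj' h] at h1
  rw [qBinom_succ_succ]
  have h3 : v ^ ((b : ℤ) + 1) = v ^ (b + 1) := by exact_mod_cast zpow_natCast v (b + 1)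
  rw [h3, neg_add, neg_sub, ← sub_eq_add_neg] at h1
  linear_combination h1

theorem qBinom_symm (hv : v ≠ 0) (h : v - v⁻¹ ≠ 0) (a b : ℕ) :
    qBinom v (a + b) a = qBinom v (a + b) b := by
  induction hs : a + b generalizing a b with
  | zero =>
    obtain ⟨rfl, rfl⟩ : a = 0 ∧ b = 0 := by omega
    rfl
  | succ s ih =>
    rcases a with _ | a
    · rw [show s + 1 = b by omega, qBinom_self, qBinom_zero_right]
    rcases b with _ | b
    · rw [show s + 1 = a + 1 by omega, qBinom_self, qBinom_zero_right]
    rw [qBinom_succ_succ, qBinom_succ_succ' hv h, ih (a + 1) b (by omega),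
      ih a (b + 1) (by omega), add_comm, show (s : ℤ) - b = ((a + 1 : ℕ) : ℤ) by omega,
      show (a : ℤ) - s = -(b : ℤ) - 1 by omega, zpow_natCast]

end generic

section root

variable {p : ℕ}

theorem q_zpow_add_mul_p (hp : 2 ≤ p) (n : ℤ) (j : ℕ) :
    q p ^ (n + j * p) = (-1) ^ j * q p ^ n := by
  rw [zpow_add₀ (q_ne_zero p), mul_comm (j : ℤ), zpow_mul, zpow_natCast, zpow_natCast,
    q_pow_p p (by omega), mul_comm]

theorem q_zpow_sub_mul_p (hp : 2 ≤ p) (n : ℤ) (j : ℕ) :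
    q p ^ (n - j * p) = (-1) ^ j * q p ^ n := by
  have := q_zpow_add_mul_p hp (n - j * p) j
  rw [sub_add_cancel] at this
  rw [this, ← mul_assoc, ← mul_pow]; simp

theorem qInt_add_mul_p (hp : 2 ≤ p) (n : ℤ) (j : ℕ) :
    qInt (q p) (n + j * p) = (-1) ^ j * qInt (q p) n := by
  simp only [qInt]
  rw [q_zpow_add_mul_p hp, neg_add, ← sub_eq_add_neg, q_zpow_sub_mul_p hp]; ring

theorem q_primitive (hp : 2 ≤ p) : IsPrimitiveRoot (q p) (2 * p) := by
  have := Complex.isPrimitiveRoot_exp (2 * p) (by omega)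
  convert this using 1
  rw [q]; congr 1
  have : (p : ℂ) ≠ 0 := by exact_mod_cast (by omega : p ≠ 0)
  push_cast; field_simp

theorem qInt_eq_zero_iff (hp : 2 ≤ p) (n : ℤ) : qInt (q p) n = 0 ↔ (p : ℤ) ∣ n := by
  rw [qInt, div_eq_zero_iff, or_iff_left (q_sub_inv_ne_zero p hp), sub_eq_zero]
  have h : q p ^ n = q p ^ (-n) ↔ q p ^ (2 * n) = 1 := by
    rw [two_mul, zpow_add₀ (q_ne_zero p), zpow_neg, mul_eq_one_iff_eq_inv₀
      (zpow_ne_zero _ (q_ne_zero p))]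
  rw [h, (q_primitive hp).zpow_eq_one_iff_dvd]
  push_cast
  exact mul_dvd_mul_iff_left two_ne_zero

theorem qInt_ne_zero_of_lt (hp : 2 ≤ p) (n : ℕ) (h0 : 0 < n) (h : n < p) :
    qInt (q p) n ≠ 0 := fun h1 => by
  have := Nat.le_of_dvd h0 (Int.natCast_dvd_natCast.1 ((qInt_eq_zero_iff hp _).1 h1))
  omega

theorem qBinom_p_of_lt (hp : 2 ≤ p) (m : ℕ) (h0 : 0 < m) (h : m < p) :
    qBinom (q p) p m = 0 := by
  obtain ⟨b, rfl⟩ : ∃ b, m = b + 1 := ⟨m - 1, by omega⟩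
  obtain ⟨n, rfl⟩ : ∃ n, p = n + 1 := ⟨p - 1, by omega⟩
  have h1 := qInt_mul_qBinom_succ_succ (q_ne_zero (n + 1)) (q_sub_inv_ne_zero _ hp) n b
  have h2 : qInt (q (n + 1)) ((n : ℤ) + 1) = 0 := by
    rw [qInt_eq_zero_iff hp]; push_cast; rfl
  rw [h2, zero_mul, mul_eq_zero] at h1
  refine h1.resolve_left ?_
  exact_mod_cast qInt_ne_zero_of_lt hp (b + 1) h0 h

theorem qBinom_add_p (hp : 2 ≤ p) (n m : ℕ) (h : m < p) :
    qBinom (q p) (n + p) m = (-1) ^ m * qBinom (q p) n m := by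
  induction n generalizing m with
  | zero =>
    rcases m with _ | m
    · simp [qBinom_zero_right]
    · rw [zero_add, qBinom_p_of_lt hp _ (by omega) h]; simp [qBinom]
  | succ n ih =>
    rcases m with _ | m
    · simp [qBinom_zero_right]
    rw [show n + 1 + p = n + p + 1 by omega, qBinom_succ_succ, qBinom_succ_succ, ih _ h,
      ih _ (by omega)]
    have := q_zpow_sub_mul_p hp ((m : ℤ) - n) 1
    push_cast
    rw [show (m : ℤ) - (n + p) = m - n - ((1 : ℕ) : ℤ) * p by push_cast; ring, this]
    ring

theorem qBinom_mul_p_add (hp : 2 ≤ p) (M n m : ℕ) (h : m < p) :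
    qBinom (q p) (M * p + n) m = (-1) ^ (M * m) * qBinom (q p) n m := by
  induction M with
  | zero => simp
  | succ M ih =>
    rw [show (M + 1) * p + n = M * p + n + p by ring, qBinom_add_p hp _ _ h, ih]
    ring

theorem qBinom_p_right (hp : 2 ≤ p) (M m : ℕ) (h : m < p) :
    qBinom (q p) (M * p + m) p = M * (-1) ^ ((M + 1) * p + m) := by
  obtain ⟨r, hr⟩ : ∃ r, p = r + 1 := ⟨p - 1, by omega⟩
  have key (n : ℕ) : qBinom (q p) (n + 1) p =
      -qBinom (q p) n p + q p ^ ((r : ℤ) - n) * qBinom (q p) n r := by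
    have h1 : qBinom (q p) (n + 1) (r + 1) = _ := qBinom_succ_succ n r
    rw [← hr, q_pow_p p (by omega)] at h1
    rw [h1]; ring
  have low (M m : ℕ) (h : m < p) (h0 : qBinom (q p) (M * p) p = M * (-1) ^ ((M + 1) * p)) :
      qBinom (q p) (M * p + m) p = M * (-1) ^ ((M + 1) * p + m) := by
    induction m with
    | zero => simpa using h0
    | succ m ih =>
      rw [← add_assoc, key, ih (by omega), qBinom_mul_p_add hp _ _ _ (by omega),
        qBinom_of_lt _ m r (by omega)]
      ring
  apply low _ _ h
  induction M with
  | zero => rw [zero_mul, qBinom_of_lt _ _ _ (by omega)]; simp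
  | succ M ih =>
    rw [show (M + 1) * p = M * p + r + 1 by rw [add_mul]; omega, key, low _ _ (by omega) ih,
      qBinom_mul_p_add hp _ _ _ (by omega), qBinom_self]
    have := q_zpow_sub_mul_p hp 0 M
    rw [zpow_zero] at this
    push_cast
    rw [show (r : ℤ) - (M * p + r) = 0 - M * p by ring, this]
    have e1 : ((-1 : ℂ)) ^ (M * r) = (-1) ^ (M * p) * (-1) ^ M := by
      rw [hr, mul_add, mul_one, pow_add, mul_assoc, ← mul_pow]; simp
    have e2 : ((-1 : ℂ)) ^ ((M + 1) * p + r) = - (-1) ^ (M * p) := by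
      rw [add_mul, one_mul, add_assoc, pow_add, show p + r = 2 * r + 1 by omega]
      simp [pow_add]
    have e3 : ((-1 : ℂ)) ^ ((M + 1 + 1) * p) = (-1) ^ (M * p) := by
      rw [show (M + 1 + 1) * p = M * p + 2 * p by ring, pow_add]; simp
    rw [e1, e2, e3]
    have e4 : ((-1 : ℂ)) ^ M * (-1) ^ M = 1 := by rw [← mul_pow]; simp
    linear_combination (-1) ^ (M * p) * e4

theorem qBinom_mul_p_right (hp : 2 ≤ p) (M m : ℕ) (h : m < p) :
    qBinom (q p) (M * p + m) (M * p) = (-1) ^ (M * m) := by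
  rw [qBinom_symm (q_ne_zero p) (q_sub_inv_ne_zero p hp), qBinom_mul_p_add hp _ _ _ h,
    qBinom_self, mul_one]

end root

end QSl2

end

noncomputable section

namespace QSl2

/-! ### The divided powers on the span of the monomials -/

section plane

variable {k : Type*} [Field k]

/-- The monomial `x^(a) y^(b)` with integer exponents, zero if one of them is negative. -/
def mon (k : Type*) [Field k] (a b : ℤ) : ℕ × ℕ →₀ k :=
  if 0 ≤ a ∧ 0 ≤ b then Finsupp.single (a.toNat, b.toNat) 1 else 0

theorem mon_natCast (m n : ℕ) : mon k m n = Finsupp.single (m, n) 1 := by simp [mon]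

theorem mon_of_neg {a b : ℤ} (h : a < 0 ∨ b < 0) : mon k a b = 0 := if_neg (by omega)

theorem mon_cases {P : ℤ → ℤ → Prop} (a b : ℤ) (h : ∀ m n : ℕ, P m n)
    (h0 : ∀ a b : ℤ, a < 0 ∨ b < 0 → P a b) : P a b := by
  by_cases hab : a < 0 ∨ b < 0
  · exact h0 a b hab
  · push Not at hab
    lift a to ℕ using hab.1
    lift b to ℕ using hab.2
    exact h a b

theorem smul_mon_congr {c d : k} (a b : ℤ) (h : 0 ≤ a → 0 ≤ b → c = d) :
    c • mon k a b = d • mon k a b := by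
  by_cases hab : a < 0 ∨ b < 0
  · rw [mon_of_neg hab, smul_zero, smul_zero]
  · rw [h (by omega) (by omega)]

theorem plane_ext {M : Type*} [AddCommGroup M] [Module k M] {f g : (ℕ × ℕ →₀ k) →ₗ[k] M}
    (h : ∀ m n : ℕ, f (mon k m n) = g (mon k m n)) : f = g :=
  Finsupp.lhom_ext' fun s => LinearMap.ext_ring (by
    have := h s.1 s.2
    rwa [mon_natCast] at this)

variable (v : k)

/-- The divided power `E^(n)`. -/
def raise (n : ℕ) : Module.End k (ℕ × ℕ →₀ k) :=
  Finsupp.linearCombination k fun s : ℕ × ℕ =>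
    qBinom v (s.1 + n) n • mon k ((s.1 : ℤ) + n) ((s.2 : ℤ) - n)

/-- The divided power `F^(n)`. -/
def lower (n : ℕ) : Module.End k (ℕ × ℕ →₀ k) :=
  Finsupp.linearCombination k fun s : ℕ × ℕ =>
    qBinom v (s.2 + n) n • mon k ((s.1 : ℤ) - n) ((s.2 : ℤ) + n)

/-- The operator `K^j`. -/
def cartan (j : ℤ) : Module.End k (ℕ × ℕ →₀ k) :=
  Finsupp.linearCombination k fun s : ℕ × ℕ =>
    v ^ (j * ((s.1 : ℤ) - s.2)) • mon k (s.1 : ℤ) (s.2 : ℤ)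

theorem raise_mon (n : ℕ) (a b : ℤ) :
    raise v n (mon k a b) = qBinom v (a + n).toNat n • mon k (a + n) (b - n) := by
  induction a, b using mon_cases with
  | h m l =>
    rw [mon_natCast, raise, Finsupp.linearCombination_single, one_smul]
    congr 2
  | h0 a b h =>
    rw [mon_of_neg h, map_zero]
    by_cases h1 : a + n < 0 ∨ b - n < 0
    · rw [mon_of_neg h1, smul_zero]
    · rw [qBinom_of_lt _ _ _ (by omega), zero_smul]

theorem lower_mon (n : ℕ) (a b : ℤ) :
    lower v n (mon k a b) = qBinom v (b + n).toNat n • mon k (a - n) (b + n) := by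
  induction a, b using mon_cases with
  | h m l =>
    rw [mon_natCast, lower, Finsupp.linearCombination_single, one_smul]
    congr 2
  | h0 a b h =>
    rw [mon_of_neg h, map_zero]
    by_cases h1 : a - n < 0 ∨ b + n < 0
    · rw [mon_of_neg h1, smul_zero]
    · rw [qBinom_of_lt _ _ _ (by omega), zero_smul]

theorem cartan_mon (j a b : ℤ) : cartan v j (mon k a b) = v ^ (j * (a - b)) • mon k a b := by
  induction a, b using mon_cases with
  | h m l =>
    rw [mon_natCast, cartan, Finsupp.linearCombination_single, one_smul, mon_natCast]
  | h0 a b h => rw [mon_of_neg h, map_zero, smul_zero]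

theorem raise_zero : raise v 0 = 1 := plane_ext fun m n => by
  rw [raise_mon, qBinom_zero_right]; simp

theorem lower_zero : lower v 0 = 1 := plane_ext fun m n => by
  rw [lower_mon, qBinom_zero_right]; simp

variable {v}

theorem toNat_natCast_add (a n : ℕ) : ((a : ℤ) + n).toNat = a + n := by omega

theorem raise_one_mon (hv : v ≠ 0) (h : v - v⁻¹ ≠ 0) (a b : ℤ) :
    raise v 1 (mon k a b) = qInt v (a + 1) • mon k (a + 1) (b - 1) := by
  rw [raise_mon, qBinom_one_right hv h]
  refine smul_mon_congr _ _ fun h _ => ?_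
  congr 1; push_cast at h ⊢; omega

theorem lower_one_mon (hv : v ≠ 0) (h : v - v⁻¹ ≠ 0) (a b : ℤ) :
    lower v 1 (mon k a b) = qInt v (b + 1) • mon k (a - 1) (b + 1) := by
  rw [lower_mon, qBinom_one_right hv h]
  refine smul_mon_congr _ _ fun _ h => ?_
  congr 1; push_cast at h ⊢; omega

theorem raise_one_mul (hv : v ≠ 0) (h : v - v⁻¹ ≠ 0) (n : ℕ) :
    raise v 1 * raise v n = qInt v (n + 1) • raise v (n + 1) := plane_ext fun a b => by
  rw [Module.End.mul_apply, LinearMap.smul_apply, raise_mon, map_smul, raise_one_mon hv h,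
    raise_mon, smul_smul, smul_smul, toNat_natCast_add, toNat_natCast_add,
    ← add_assoc, qInt_mul_qBinom_succ_succ hv h, mul_comm]
  push_cast
  rw [add_assoc, sub_sub]

theorem lower_one_mul (hv : v ≠ 0) (h : v - v⁻¹ ≠ 0) (n : ℕ) :
    lower v 1 * lower v n = qInt v (n + 1) • lower v (n + 1) := plane_ext fun a b => by
  rw [Module.End.mul_apply, LinearMap.smul_apply, lower_mon, map_smul, lower_one_mon hv h,
    lower_mon, smul_smul, smul_smul, toNat_natCast_add, toNat_natCast_add,
    ← add_assoc, qInt_mul_qBinom_succ_succ hv h, mul_comm]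
  push_cast
  rw [add_assoc, sub_sub]

end plane

/-! ### The defining relations -/

/-- The defining relations of quantum `sl(2)` in an algebra. -/
structure QuantumTriple {k A : Type*} [Field k] [Ring A] [Algebra k A] (v : k) (E F K Ki : A) :
    Prop where
  K_Ki : K * Ki = 1
  Ki_K : Ki * K = 1
  K_E : K * E * Ki = v ^ 2 • E
  K_F : K * F * Ki = (v ^ 2)⁻¹ • F
  E_F : E * F - F * E = (v - v⁻¹)⁻¹ • (K - Ki)

theorem qFact_succ {k : Type*} [Field k] (v : k) (n : ℕ) :
    qFact v (n + 1) = qFact v n * qInt v (n + 1) := by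
  rw [qFact, Finset.prod_range_succ, ← qFact]

section plane

variable {k : Type*} [Field k] {v : k}

theorem plane_triple (hv : v ≠ 0) (h : v - v⁻¹ ≠ 0) :
    QuantumTriple v (raise v 1) (lower v 1) (cartan v 1) (cartan v (-1)) where
  K_Ki := plane_ext fun a b => by
    rw [Module.End.mul_apply, cartan_mon, map_smul, cartan_mon, smul_smul, ← zpow_add₀ hv]; simp
  Ki_K := plane_ext fun a b => by
    rw [Module.End.mul_apply, cartan_mon, map_smul, cartan_mon, smul_smul, ← zpow_add₀ hv]; simp
  K_E := plane_ext fun a b => by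
    rw [Module.End.mul_apply, Module.End.mul_apply, LinearMap.smul_apply, cartan_mon, map_smul,
      map_smul, raise_one_mon hv h, map_smul, cartan_mon, smul_smul, smul_smul, smul_smul,
      mul_right_comm, ← zpow_add₀ hv, ← zpow_natCast v 2]
    congr 3; push_cast; ring
  K_F := plane_ext fun a b => by
    rw [Module.End.mul_apply, Module.End.mul_apply, LinearMap.smul_apply, cartan_mon, map_smul,
      map_smul, lower_one_mon hv h, map_smul, cartan_mon, smul_smul, smul_smul, smul_smul,
      mul_right_comm, ← zpow_add₀ hv, ← zpow_natCast v 2, ← zpow_neg]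
    congr 3; push_cast; ring
  E_F := plane_ext fun a b => by
    have h1 := qInt_mul_sub v hv h a b
    have hR : ((v - v⁻¹)⁻¹ • (cartan v 1 - cartan v (-1))) (mon k a b) =
        qInt v ((a : ℤ) - b) • mon k a b := by
      rw [LinearMap.smul_apply, LinearMap.sub_apply, cartan_mon, cartan_mon, ← sub_smul,
        smul_smul, qInt, div_eq_inv_mul, one_mul, neg_one_mul]
    rw [hR, LinearMap.sub_apply, Module.End.mul_apply, Module.End.mul_apply, raise_one_mon hv h,
      lower_one_mon hv h, map_smul, map_smul, raise_one_mon hv h, lower_one_mon hv h, ← h1]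
    simp only [sub_add_cancel, add_sub_cancel_right]
    module

theorem raise_one_pow (hv : v ≠ 0) (h : v - v⁻¹ ≠ 0) (n : ℕ) :
    raise v 1 ^ n = qFact v n • raise v n := by
  induction n with
  | zero => simp [qFact, raise_zero]
  | succ n ih => rw [pow_succ', ih, mul_smul_comm, raise_one_mul hv h, smul_smul, qFact_succ]

theorem lower_one_pow (hv : v ≠ 0) (h : v - v⁻¹ ≠ 0) (n : ℕ) :
    lower v 1 ^ n = qFact v n • lower v n := by
  induction n with
  | zero => simp [qFact, lower_zero]
  | succ n ih => rw [pow_succ', ih, mul_smul_comm, lower_one_mul hv h, smul_smul, qFact_succ]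

end plane

namespace QuantumTriple

variable {A : Type*} [Ring A] [Algebra (RatFunc ℂ) A] {E F K Ki : A}

/-- The representation of generic quantum `sl(2)` given by elements that satisfy the relations. -/
def lift (h : QuantumTriple (RatFunc.X : RatFunc ℂ) E F K Ki) : GenericQG →ₐ[RatFunc ℂ] A :=
  RingQuot.liftAlgHom (RatFunc ℂ) ⟨FreeAlgebra.lift (RatFunc ℂ) fun
    | .E => E
    | .F => F
    | .K => K
    | .Ki => Ki, by
    intro x y hxy
    cases hxy <;> simp [h.K_Ki, h.Ki_K, h.K_E, h.K_F, h.E_F]⟩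

theorem lift_gen (h : QuantumTriple (RatFunc.X : RatFunc ℂ) E F K Ki) (g : Gen) :
    h.lift (GenericQG.gen g) = match g with
    | .E => E
    | .F => F
    | .K => K
    | .Ki => Ki := by
  refine (RingQuot.liftAlgHom_mkAlgHom_apply (RatFunc ℂ) _ _ _).trans ?_
  rw [FreeAlgebra.lift_ι_apply]

theorem lift_divPow (h : QuantumTriple (RatFunc.X : RatFunc ℂ) E F K Ki) (x : GenericQG) (n : ℕ)
    (y : A) (hy : h.lift x ^ n = qFact (RatFunc.X : RatFunc ℂ) n • y) :
    h.lift (GenericQG.divPow x n) = y := by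
  rw [GenericQG.divPow, map_smul, map_pow, hy, smul_smul,
    inv_mul_cancel₀ (GenericQG.qFact_ne_zero n), one_smul]

end QuantumTriple

/-! ### Evaluation of rational functions -/

/-- The rational function `r` is regular at `z`, with value `c`. -/
def EvalsTo (z : ℂ) (r : RatFunc ℂ) (c : ℂ) : Prop :=
  ∃ a b : Polynomial ℂ, b.eval z ≠ 0 ∧
    r * algebraMap _ (RatFunc ℂ) b = algebraMap _ (RatFunc ℂ) a ∧ c * b.eval z = a.eval z

namespace EvalsTo

variable {z : ℂ} {r s : RatFunc ℂ} {c d : ℂ}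

theorem add : EvalsTo z r c → EvalsTo z s d → EvalsTo z (r + s) (c + d) := by
  rintro ⟨a, b, h0, h1, h2⟩ ⟨a', b', h0', h1', h2'⟩
  refine ⟨a * b' + a' * b, b * b', ?_, ?_, ?_⟩
  · rw [Polynomial.eval_mul]; exact mul_ne_zero h0 h0'
  · rw [map_mul, map_add, map_mul, map_mul, ← h1, ← h1']; ring
  · simp only [Polynomial.eval_mul, Polynomial.eval_add, ← h2, ← h2']; ring

theorem mul : EvalsTo z r c → EvalsTo z s d → EvalsTo z (r * s) (c * d) := by
  rintro ⟨a, b, h0, h1, h2⟩ ⟨a', b', h0', h1', h2'⟩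
  refine ⟨a * a', b * b', ?_, ?_, ?_⟩
  · rw [Polynomial.eval_mul]; exact mul_ne_zero h0 h0'
  · rw [map_mul, map_mul, ← h1, ← h1']; ring
  · simp only [Polynomial.eval_mul, ← h2, ← h2']; ring

theorem const (z c : ℂ) : EvalsTo z (algebraMap ℂ (RatFunc ℂ) c) c :=
  ⟨Polynomial.C c, 1, by simp, by simp, by simp⟩

theorem zero (z : ℂ) : EvalsTo z 0 0 := by simpa using const z 0

theorem one (z : ℂ) : EvalsTo z 1 1 := by simpa using const z 1

theorem X (z : ℂ) : EvalsTo z RatFunc.X z := ⟨Polynomial.X, 1, by simp, by simp, by simp⟩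

theorem X_inv (hz : z ≠ 0) : EvalsTo z RatFunc.X⁻¹ z⁻¹ :=
  ⟨1, Polynomial.X, by simpa using hz, by simp [RatFunc.X_ne_zero], by simp [hz]⟩

theorem pow (h : EvalsTo z r c) (n : ℕ) : EvalsTo z (r ^ n) (c ^ n) := by
  induction n with
  | zero => simpa using one z
  | succ n ih => rw [pow_succ, pow_succ]; exact ih.mul h

theorem X_zpow (hz : z ≠ 0) (n : ℤ) : EvalsTo z (RatFunc.X ^ n) (z ^ n) := by
  obtain ⟨n, rfl | rfl⟩ := n.eq_nat_or_neg
  · simpa using (X z).pow n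
  · simpa using (X_inv hz).pow n

theorem qBinom (hz : z ≠ 0) (n m : ℕ) : EvalsTo z (qBinom RatFunc.X n m) (qBinom z n m) := by
  induction n generalizing m with
  | zero => cases m with
    | zero => exact one z
    | succ m => exact zero z
  | succ n ih => cases m with
    | zero => exact one z
    | succ m => exact (((X z).pow _).mul (ih _)).add ((X_zpow hz _).mul (ih _))

theorem unique (h : EvalsTo z r c) (h' : EvalsTo z r d) : c = d := by
  obtain ⟨a, b, h0, h1, h2⟩ := h
  obtain ⟨a', b', h0', h1', h2'⟩ := h'
  have h3 : a * b' = a' * b := by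
    apply RatFunc.algebraMap_injective ℂ
    rw [map_mul, map_mul, ← h1, ← h1']; ring
  have h4 := congrArg (Polynomial.eval z) h3
  rw [Polynomial.eval_mul, Polynomial.eval_mul, ← h2, ← h2'] at h4
  apply mul_right_cancel₀ (mul_ne_zero h0 h0')
  linear_combination h4

end EvalsTo

/-- The family of rational functions `f` is regular at `z`, with values `w`. -/
def Reduces (z : ℂ) {ι : Type*} (f : ι →₀ RatFunc ℂ) (w : ι →₀ ℂ) : Prop :=
  ∀ i, EvalsTo z (f i) (w i)

namespace Reduces

variable {z : ℂ} {ι κ : Type*} {f g : ι →₀ RatFunc ℂ} {w u : ι →₀ ℂ}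

theorem add (h : Reduces z f w) (h' : Reduces z g u) : Reduces z (f + g) (w + u) :=
  fun i => (h i).add (h' i)

theorem zero : Reduces z (0 : ι →₀ RatFunc ℂ) 0 := fun _ => EvalsTo.zero z

theorem smul {r : RatFunc ℂ} {c : ℂ} (h : EvalsTo z r c) (h' : Reduces z f w) :
    Reduces z (r • f) (c • w) := fun i => h.mul (h' i)

theorem sum {α : Type*} (s : Finset α) {f : α → ι →₀ RatFunc ℂ} {w : α → ι →₀ ℂ}
    (h : ∀ a, Reduces z (f a) (w a)) : Reduces z (∑ a ∈ s, f a) (∑ a ∈ s, w a) := by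
  classical
  induction s using Finset.induction_on with
  | empty => exact zero
  | insert a s ha ih => rw [Finset.sum_insert ha, Finset.sum_insert ha]; exact (h a).add ih

theorem unique (h : Reduces z f w) (h' : Reduces z f u) : w = u :=
  Finsupp.ext fun i => (h i).unique (h' i)

theorem exists_lift (w : ι →₀ ℂ) : ∃ f, Reduces z f w :=
  ⟨w.mapRange (algebraMap ℂ (RatFunc ℂ)) (map_zero _), fun i => by
    rw [Finsupp.mapRange_apply]; exact EvalsTo.const z _⟩

theorem linearCombination {φ : ι → κ →₀ RatFunc ℂ} {ψ : ι → κ →₀ ℂ}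
    (h : ∀ i, Reduces z (φ i) (ψ i)) (hf : Reduces z f w) :
    Reduces z (Finsupp.linearCombination (RatFunc ℂ) φ f) (Finsupp.linearCombination ℂ ψ w) := by
  rw [Finsupp.linearCombination_apply, Finsupp.linearCombination_apply]
  classical
  rw [Finsupp.sum_of_support_subset f (s := f.support ∪ w.support) Finset.subset_union_left _
    (by simp), Finsupp.sum_of_support_subset w (s := f.support ∪ w.support)
    Finset.subset_union_right _ (by simp)]
  exact sum _ fun i => smul (hf i) (h i)

theorem mon (a b : ℤ) : Reduces z (mon (RatFunc ℂ) a b) (mon ℂ a b) := fun i => by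
  unfold QSl2.mon
  split_ifs
  · rw [Finsupp.single_apply, Finsupp.single_apply]
    split_ifs
    · exact EvalsTo.one z
    · exact EvalsTo.zero z
  · exact EvalsTo.zero z

theorem raise (hz : z ≠ 0) {f : ℕ × ℕ →₀ RatFunc ℂ} {w : ℕ × ℕ →₀ ℂ} (h : Reduces z f w) (n : ℕ) :
    Reduces z (raise RatFunc.X n f) (raise z n w) :=
  linearCombination (fun _ => smul (EvalsTo.qBinom hz _ _) (mon _ _)) h

theorem lower (hz : z ≠ 0) {f : ℕ × ℕ →₀ RatFunc ℂ} {w : ℕ × ℕ →₀ ℂ} (h : Reduces z f w) (n : ℕ) :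
    Reduces z (lower RatFunc.X n f) (lower z n w) :=
  linearCombination (fun _ => smul (EvalsTo.qBinom hz _ _) (mon _ _)) h

theorem cartan (hz : z ≠ 0) {f : ℕ × ℕ →₀ RatFunc ℂ} {w : ℕ × ℕ →₀ ℂ} (h : Reduces z f w) (n : ℤ) :
    Reduces z (cartan RatFunc.X n f) (cartan z n w) :=
  linearCombination (fun _ => smul (EvalsTo.X_zpow hz _) (mon _ _)) h

end Reduces

end QSl2

end

noncomputable section

namespace QSl2

open QSl2.GenericQG (lusztigForm)

/-! ### Maps out of Lusztig's quantum group -/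

namespace Lusztig

variable (p : ℕ)

/-- The divided power `E^(n)`. -/
def dE (n : ℕ) : Lusztig p := mk p (GenericQG.Ediv n)

/-- The divided power `F^(n)`. -/
def dF (n : ℕ) : Lusztig p := mk p (GenericQG.Fdiv n)

/-- The generator `K`. -/
def K : Lusztig p := mk p GenericQG.K

/-- The generator `K⁻¹`. -/
def Ki : Lusztig p := mk p GenericQG.Ki

variable {p}

theorem mk_surjective : Function.Surjective (mk p) := RingQuot.mkAlgHom_surjective ℂ _

theorem lusztigForm_induction {P : lusztigForm → Prop}
    (scalar : ∀ c : ℂ, P (algebraMap ℂ _ c)) (v : P GenericQG.v) (vInv : P GenericQG.vInv)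
    (K : P GenericQG.K) (Ki : P GenericQG.Ki) (E : ∀ n, P (GenericQG.Ediv n))
    (F : ∀ n, P (GenericQG.Fdiv n)) (add : ∀ x y, P x → P y → P (x + y))
    (mul : ∀ x y, P x → P y → P (x * y)) (x : lusztigForm) : P x := by
  obtain ⟨x, hx⟩ := x
  refine Algebra.adjoin_induction (p := fun x hx => P ⟨x, hx⟩) ?_ scalar
    (fun x y hx hy => add ⟨x, hx⟩ ⟨y, hy⟩) (fun x y hx hy => mul ⟨x, hx⟩ ⟨y, hy⟩) hx
  rintro x (((rfl | rfl | rfl | rfl) | ⟨n, rfl⟩) | ⟨n, rfl⟩)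
  exacts [v, vInv, K, Ki, E n, F n]

theorem induction {P : Lusztig p → Prop}
    (scalar : ∀ c : ℂ, P (algebraMap ℂ _ c)) (hK : P (K p)) (hKi : P (Ki p))
    (hE : ∀ n, P (dE p n)) (hF : ∀ n, P (dF p n)) (add : ∀ x y, P x → P y → P (x + y))
    (mul : ∀ x y, P x → P y → P (x * y)) (x : Lusztig p) : P x := by
  obtain ⟨x, rfl⟩ := mk_surjective x
  refine lusztigForm_induction (P := fun x => P (mk p x)) (fun c => ?_) ?_ ?_ hK hKi hE hF
    (fun x y hx hy => ?_) (fun x y hx hy => ?_) x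
  · rw [AlgHom.commutes]; exact scalar c
  · rw [mk_v]; exact scalar _
  · rw [mk_vInv]; exact scalar _
  · rw [map_add]; exact add _ _ hx hy
  · rw [map_mul]; exact mul _ _ hx hy

/-- The algebra homomorphism given by one on Lusztig's form that satisfies the relations. -/
def lift {B : Type*} [Ring B] [Algebra ℂ B] (φ : lusztigForm →ₐ[ℂ] B)
    (h1 : φ GenericQG.v = algebraMap ℂ B (q p)) (h2 : φ GenericQG.K ^ (2 * p) = 1) :
    Lusztig p →ₐ[ℂ] B :=
  RingQuot.liftAlgHom ℂ ⟨φ, by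
    intro x y h
    cases h with
    | v => rw [h1, AlgHom.commutes]
    | K_pow => rw [map_pow, h2, map_one]⟩

theorem lift_mk {B : Type*} [Ring B] [Algebra ℂ B] (φ : lusztigForm →ₐ[ℂ] B)
    (h1 : φ GenericQG.v = algebraMap ℂ B (q p)) (h2 : φ GenericQG.K ^ (2 * p) = 1)
    (x : lusztigForm) : lift φ h1 h2 (mk p x) = φ x :=
  RingQuot.liftAlgHom_mkAlgHom_apply ℂ _ _ _

end Lusztig

/-! ### The action of Lusztig's quantum group on the quantum plane -/

section reduction

/-- The representation of generic quantum `sl(2)` on the generic plane. -/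
def planeRep : GenericQG →ₐ[RatFunc ℂ] Module.End (RatFunc ℂ) (ℕ × ℕ →₀ RatFunc ℂ) :=
  (plane_triple RatFunc.X_ne_zero GenericQG.X_sub_inv_ne_zero).lift

theorem planeRep_divPow_E (n : ℕ) :
    planeRep (GenericQG.divPow (GenericQG.gen .E) n) = raise RatFunc.X n :=
  QuantumTriple.lift_divPow _ _ _ _ (by
    rw [QuantumTriple.lift_gen]
    exact raise_one_pow RatFunc.X_ne_zero GenericQG.X_sub_inv_ne_zero n)

theorem planeRep_divPow_F (n : ℕ) :
    planeRep (GenericQG.divPow (GenericQG.gen .F) n) = lower RatFunc.X n :=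
  QuantumTriple.lift_divPow _ _ _ _ (by
    rw [QuantumTriple.lift_gen]
    exact lower_one_pow RatFunc.X_ne_zero GenericQG.X_sub_inv_ne_zero n)

/-- The operator `ψ` is the specialization at `z` of the action of `x`. -/
def IsSpecialization (z : ℂ) (x : GenericQG) (ψ : Module.End ℂ (ℕ × ℕ →₀ ℂ)) : Prop :=
  ∀ f w, Reduces z f w → Reduces z (planeRep x f) (ψ w)

namespace IsSpecialization

variable {z : ℂ} {x y : GenericQG} {ψ χ : Module.End ℂ (ℕ × ℕ →₀ ℂ)}

theorem unique (h : IsSpecialization z x ψ) (h' : IsSpecialization z x χ) : ψ = χ :=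
  LinearMap.ext fun w => by
    obtain ⟨f, hf⟩ := Reduces.exists_lift (z := z) w
    exact (h f w hf).unique (h' f w hf)

theorem add (h : IsSpecialization z x ψ) (h' : IsSpecialization z y χ) :
    IsSpecialization z (x + y) (ψ + χ) := fun f w hf => by
  rw [map_add]; exact (h f w hf).add (h' f w hf)

theorem mul (h : IsSpecialization z x ψ) (h' : IsSpecialization z y χ) :
    IsSpecialization z (x * y) (ψ * χ) := fun f w hf => by
  rw [map_mul]; exact h _ _ (h' f w hf)

theorem scalar {r : RatFunc ℂ} {c : ℂ} (h : EvalsTo z r c) :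
    IsSpecialization z (algebraMap _ GenericQG r) (algebraMap ℂ _ c) := fun f w hf => by
  rw [AlgHom.commutes]; exact hf.smul h

theorem K (hz : z ≠ 0) : IsSpecialization z (GenericQG.gen .K) (cartan z 1) := fun f w hf => by
  rw [planeRep, QuantumTriple.lift_gen]; exact hf.cartan hz 1

theorem Ki (hz : z ≠ 0) : IsSpecialization z (GenericQG.gen .Ki) (cartan z (-1)) := fun f w hf => by
  rw [planeRep, QuantumTriple.lift_gen]; exact hf.cartan hz (-1)

theorem divPow_E (hz : z ≠ 0) (n : ℕ) :
    IsSpecialization z (GenericQG.divPow (GenericQG.gen .E) n) (raise z n) := fun f w hf => by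
  rw [planeRep_divPow_E]; exact hf.raise hz n

theorem divPow_F (hz : z ≠ 0) (n : ℕ) :
    IsSpecialization z (GenericQG.divPow (GenericQG.gen .F) n) (lower z n) := fun f w hf => by
  rw [planeRep_divPow_F]; exact hf.lower hz n

theorem exists_of_mem (hz : z ≠ 0) (x : lusztigForm) : ∃ ψ, IsSpecialization z x ψ := by
  induction x using Lusztig.lusztigForm_induction with
  | scalar c => exact ⟨_, scalar (EvalsTo.const z c)⟩
  | v => exact ⟨_, scalar (EvalsTo.X z)⟩
  | vInv => exact ⟨_, scalar (EvalsTo.X_inv hz)⟩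
  | K => exact ⟨_, K hz⟩
  | Ki => exact ⟨_, Ki hz⟩
  | E n => exact ⟨_, divPow_E hz n⟩
  | F n => exact ⟨_, divPow_F hz n⟩
  | add x y hx hy => exact ⟨_, hx.choose_spec.add hy.choose_spec⟩
  | mul x y hx hy => exact ⟨_, hx.choose_spec.mul hy.choose_spec⟩

end IsSpecialization

/-- The specialization at `z` of the action of Lusztig's form on the generic plane. -/
def planeSpec (z : ℂ) (hz : z ≠ 0) : lusztigForm →ₐ[ℂ] Module.End ℂ (ℕ × ℕ →₀ ℂ) where
  toFun x := (IsSpecialization.exists_of_mem hz x).choose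
  map_one' := (IsSpecialization.exists_of_mem hz 1).choose_spec.unique
    (by simpa using IsSpecialization.scalar (EvalsTo.one z))
  map_zero' := (IsSpecialization.exists_of_mem hz 0).choose_spec.unique
    (by simpa using IsSpecialization.scalar (EvalsTo.zero z))
  map_mul' x y := (IsSpecialization.exists_of_mem hz (x * y)).choose_spec.unique
    ((IsSpecialization.exists_of_mem hz x).choose_spec.mul
      (IsSpecialization.exists_of_mem hz y).choose_spec)
  map_add' x y := (IsSpecialization.exists_of_mem hz (x + y)).choose_spec.unique
    ((IsSpecialization.exists_of_mem hz x).choose_spec.add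
      (IsSpecialization.exists_of_mem hz y).choose_spec)
  commutes' c := (IsSpecialization.exists_of_mem hz (algebraMap ℂ _ c)).choose_spec.unique
    (IsSpecialization.scalar (EvalsTo.const z c))

theorem planeSpec_eq {z : ℂ} (hz : z ≠ 0) {x : lusztigForm} {ψ : Module.End ℂ (ℕ × ℕ →₀ ℂ)}
    (h : IsSpecialization z x ψ) : planeSpec z hz x = ψ :=
  (IsSpecialization.exists_of_mem hz x).choose_spec.unique h

end reduction

namespace QPlane

variable (p : ℕ)

/-- The monomial `x^(a) y^(b)` with integer exponents, zero if one of them is negative. -/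
def xyZ (a b : ℤ) : QPlane p := mon ℂ a b

theorem xyZ_natCast (m n : ℕ) : xyZ p m n = xy p m n := mon_natCast m n

theorem xyZ_of_neg {a b : ℤ} (h : a < 0 ∨ b < 0) : xyZ p a b = 0 := mon_of_neg h

/-- The operator `E^(n)` on the quantum plane. -/
def opEd (n : ℕ) : Module.End ℂ (QPlane p) := raise (q p) n

/-- The operator `F^(n)` on the quantum plane. -/
def opFd (n : ℕ) : Module.End ℂ (QPlane p) := lower (q p) n

theorem opEd_xyZ (n : ℕ) (a b : ℤ) : opEd p n (xyZ p a b) =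
    qBinom (q p) (a + n).toNat n • xyZ p (a + n) (b - n) := raise_mon _ n a b

theorem opFd_xyZ (n : ℕ) (a b : ℤ) : opFd p n (xyZ p a b) =
    qBinom (q p) (b + n).toNat n • xyZ p (a - n) (b + n) := lower_mon _ n a b

variable {p} in
theorem hom_ext {M : Type*} [AddCommGroup M] [Module ℂ M] {f g : QPlane p →ₗ[ℂ] M}
    (h : ∀ m n : ℕ, f (xyZ p m n) = g (xyZ p m n)) : f = g :=
  (basis p).ext fun s => by
    have := h s.1 s.2
    rwa [xyZ_natCast] at this

theorem opK_xyZ (a b : ℤ) : opK p (xyZ p a b) = q p ^ (a - b) • xyZ p a b := by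
  induction a, b using mon_cases with
  | h m n => rw [xyZ_natCast, opK_xy]
  | h0 a b h => rw [xyZ_of_neg p h, map_zero, smul_zero]

theorem opKi_xyZ (a b : ℤ) : opKi p (xyZ p a b) = q p ^ (b - a) • xyZ p a b := by
  induction a, b using mon_cases with
  | h m n => rw [xyZ_natCast, opKi_xy]
  | h0 a b h => rw [xyZ_of_neg p h, map_zero, smul_zero]

theorem opEd_one_xyZ (hp : 2 ≤ p) (a b : ℤ) :
    opEd p 1 (xyZ p a b) = qInt (q p) (a + 1) • xyZ p (a + 1) (b - 1) :=
  raise_one_mon (q_ne_zero p) (q_sub_inv_ne_zero p hp) a b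

theorem opFd_one_xyZ (hp : 2 ≤ p) (a b : ℤ) :
    opFd p 1 (xyZ p a b) = qInt (q p) (b + 1) • xyZ p (a - 1) (b + 1) :=
  lower_one_mon (q_ne_zero p) (q_sub_inv_ne_zero p hp) a b

theorem opE_eq_opEd (hp : 2 ≤ p) : opE p = opEd p 1 := hom_ext fun m n => by
  rw [opEd_one_xyZ p hp, xyZ_natCast]
  cases n with
  | zero => rw [opE_zero, xyZ_of_neg p (by simp), smul_zero]
  | succ n => rw [opE_succ, ← xyZ_natCast]; push_cast; rw [add_sub_cancel_right]

theorem opF_eq_opFd (hp : 2 ≤ p) : opF p = opFd p 1 := hom_ext fun m n => by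
  rw [opFd_one_xyZ p hp, xyZ_natCast]
  cases m with
  | zero => rw [opF_zero, xyZ_of_neg p (by simp), smul_zero]
  | succ n => rw [opF_succ, ← xyZ_natCast]; push_cast; rw [add_sub_cancel_right]

theorem opK_eq_cartan : opK p = cartan (q p) 1 := hom_ext fun m n => by
  rw [opK_xyZ]; exact ((cartan_mon _ 1 _ _).trans (by rw [one_mul]; rfl)).symm

theorem opKi_eq_cartan : opKi p = cartan (q p) (-1) := hom_ext fun m n => by
  rw [opKi_xyZ]; exact ((cartan_mon _ (-1) _ _).trans (by rw [neg_one_mul, neg_sub]; rfl)).symm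

/-- The action of Lusztig's form on the quantum plane. -/
def formAction : lusztigForm →ₐ[ℂ] Module.End ℂ (QPlane p) := planeSpec (q p) (q_ne_zero p)

theorem formAction_eq {x : lusztigForm} {ψ : Module.End ℂ (QPlane p)}
    (h : IsSpecialization (q p) x ψ) : formAction p x = ψ := planeSpec_eq _ h

variable [hp : Fact (2 ≤ p)]

/-- The action of `U_q sl(2)` on the quantum plane. -/
def lusztigAction : Lusztig p →ₐ[ℂ] Module.End ℂ (QPlane p) :=
  Lusztig.lift (formAction p)
    (formAction_eq p (IsSpecialization.scalar (EvalsTo.X _)))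
    (by
      rw [formAction_eq p (IsSpecialization.K (q_ne_zero p)), ← opK_eq_cartan]
      exact opK_pow_two_p p (by have := hp.out; omega))

instance : Module (Lusztig p) (QPlane p) := Module.compHom (QPlane p) (lusztigAction p).toRingHom

theorem lusztig_smul_def (a : Lusztig p) (f : QPlane p) : a • f = lusztigAction p a f := rfl

instance : IsScalarTower ℂ (Lusztig p) (QPlane p) := ⟨fun c a f => by
  rw [lusztig_smul_def, map_smul]; rfl⟩

theorem lusztigAction_mk {x : lusztigForm} {ψ : Module.End ℂ (QPlane p)}
    (h : IsSpecialization (q p) x ψ) : lusztigAction p (Lusztig.mk p x) = ψ := by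
  rw [lusztigAction, Lusztig.lift_mk, formAction_eq p h]

theorem dE_smul (n : ℕ) (f : QPlane p) : Lusztig.dE p n • f = opEd p n f :=
  LinearMap.congr_fun (lusztigAction_mk p (IsSpecialization.divPow_E (q_ne_zero p) n)) f

theorem dF_smul (n : ℕ) (f : QPlane p) : Lusztig.dF p n • f = opFd p n f :=
  LinearMap.congr_fun (lusztigAction_mk p (IsSpecialization.divPow_F (q_ne_zero p) n)) f

theorem K_smul (f : QPlane p) : Lusztig.K p • f = opK p f := by
  rw [opK_eq_cartan]
  exact LinearMap.congr_fun (lusztigAction_mk p (IsSpecialization.K (q_ne_zero p))) f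

theorem Ki_smul (f : QPlane p) : Lusztig.Ki p • f = opKi p f := by
  rw [opKi_eq_cartan]
  exact LinearMap.congr_fun (lusztigAction_mk p (IsSpecialization.Ki (q_ne_zero p))) f

end QPlane

namespace SmallQG

variable {p : ℕ}

theorem induction {P : SmallQG p → Prop} (scalar : ∀ c : ℂ, P (algebraMap ℂ _ c))
    (hgen : ∀ g, P (gen p g)) (add : ∀ x y, P x → P y → P (x + y))
    (mul : ∀ x y, P x → P y → P (x * y)) (x : SmallQG p) : P x := by
  obtain ⟨x, rfl⟩ := RingQuot.mkAlgHom_surjective ℂ (SmallRel p) x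
  induction x using FreeAlgebra.induction with
  | grade0 c => rw [AlgHom.commutes]; exact scalar c
  | grade1 g => exact hgen g
  | mul x y hx hy => rw [map_mul]; exact mul _ _ hx hy
  | add x y hx hy => rw [map_add]; exact add _ _ hx hy

theorem hom_ext {A : Type*} [Ring A] [Algebra ℂ A] {f g : SmallQG p →ₐ[ℂ] A}
    (h : ∀ x, f (gen p x) = g (gen p x)) : f = g :=
  AlgHom.ext fun x => by
    induction x using SmallQG.induction with
    | scalar c => rw [AlgHom.commutes, AlgHom.commutes]
    | hgen x => exact h x
    | add x y hx hy => rw [map_add, map_add, hx, hy]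
    | mul x y hx hy => rw [map_mul, map_mul, hx, hy]

theorem lift_gen {A : Type*} [Ring A] [Algebra ℂ A] (g : Gen → A)
    (h1 : g .K * g .Ki = 1) (h2 : g .Ki * g .K = 1)
    (h3 : g .K * g .E * g .Ki = q p ^ 2 • g .E)
    (h4 : g .K * g .F * g .Ki = (q p ^ 2)⁻¹ • g .F)
    (h5 : g .E * g .F - g .F * g .E = (q p - (q p)⁻¹)⁻¹ • (g .K - g .Ki))
    (h6 : g .E ^ p = 0) (h7 : g .F ^ p = 0) (h8 : g .K ^ (2 * p) = 1) (x : Gen) :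
    lift g h1 h2 h3 h4 h5 h6 h7 h8 (gen p x) = g x := by
  refine (RingQuot.liftAlgHom_mkAlgHom_apply ℂ _ _ _).trans ?_
  rw [FreeAlgebra.lift_ι_apply]

end SmallQG

namespace Lusztig

variable {p : ℕ} [hp : Fact (2 ≤ p)]

theorem ofSmall_gen (x : Gen) : ofSmall p (SmallQG.gen p x) = match x with
    | .E => dE p 1
    | .F => dF p 1
    | .K => K p
    | .Ki => Ki p :=
  SmallQG.lift_gen _ _ _ _ _ _ _ _ _ x

theorem small_smul_def (s : SmallQG p) (a : Lusztig p) : s • a = ofSmall p s * a := rfl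

end Lusztig

theorem QPlane.action_eq (p : ℕ) [hp : Fact (2 ≤ p)] :
    QPlane.action p = (QPlane.lusztigAction p).comp (Lusztig.ofSmall p) :=
  SmallQG.hom_ext fun x => by
    rw [AlgHom.comp_apply, Lusztig.ofSmall_gen, QPlane.action, SmallQG.lift_gen]
    refine LinearMap.ext fun f => ?_
    cases x
    · exact (LinearMap.congr_fun (QPlane.opE_eq_opEd p hp.out) f).trans
        (QPlane.dE_smul p 1 f).symm
    · exact (LinearMap.congr_fun (QPlane.opF_eq_opFd p hp.out) f).trans
        (QPlane.dF_smul p 1 f).symm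
    · exact (QPlane.K_smul p f).symm
    · exact (QPlane.Ki_smul p f).symm

instance (p : ℕ) [hp : Fact (2 ≤ p)] : IsScalarTower (SmallQG p) (Lusztig p) (QPlane p) :=
  ⟨fun s a f => by
    rw [Lusztig.small_smul_def, mul_smul]
    change _ = QPlane.action p s (a • f)
    rw [QPlane.action_eq]; rfl⟩

end QSl2

end

noncomputable section

namespace QSl2

open QSl2.GenericQG (lusztigForm)

/-! ### The coproduct, as a representation by matrices over the algebra -/

namespace QuantumTriple

section

variable {k A : Type*} [Field k] [Ring A] [Algebra k A] {v : k} {E F K Ki : A}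

theorem K_mul_E (h : QuantumTriple v E F K Ki) : K * E = v ^ 2 • (E * K) := by
  rw [← smul_mul_assoc, ← h.K_E, mul_assoc, h.Ki_K, mul_one]

theorem K_mul_F (h : QuantumTriple v E F K Ki) : K * F = (v ^ 2)⁻¹ • (F * K) := by
  rw [← smul_mul_assoc, ← h.K_F, mul_assoc, h.Ki_K, mul_one]

theorem E_mul_Ki (h : QuantumTriple v E F K Ki) : E * Ki = v ^ 2 • (Ki * E) := by
  have := congrArg (fun x => Ki * x) h.K_E
  simp only [← mul_assoc, h.Ki_K, one_mul, mul_smul_comm] at this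
  exact this

theorem Ki_mul_F (hv : v ≠ 0) (h : QuantumTriple v E F K Ki) : Ki * F = v ^ 2 • (F * Ki) := by
  have := congrArg (fun x => v ^ 2 • (Ki * x)) h.K_F
  simp only [← mul_assoc, h.Ki_K, one_mul, mul_smul_comm, smul_smul] at this
  rw [mul_inv_cancel₀ (pow_ne_zero _ hv), one_smul] at this
  exact this.symm

/-- The matrix of `E`, acting on the tensor product with the module spanned by `ξ` and `η`. -/
def matE (v : k) (E : A) : Matrix (Fin 2) (Fin 2) A := !![v • E, 1; 0, v⁻¹ • E]

/-- The matrix of `F`. -/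
def matF (F Ki : A) : Matrix (Fin 2) (Fin 2) A := !![F, 0; Ki, F]

/-- The matrix of `K`. -/
def matK (v : k) (K : A) : Matrix (Fin 2) (Fin 2) A := !![v • K, 0; 0, v⁻¹ • K]

theorem matrix_ext {M N : Matrix (Fin 2) (Fin 2) A} (h00 : M 0 0 = N 0 0) (h01 : M 0 1 = N 0 1)
    (h10 : M 1 0 = N 1 0) (h11 : M 1 1 = N 1 1) : M = N := by
  ext i j; fin_cases i <;> fin_cases j <;> assumption

theorem mat (hv : v ≠ 0) (h1 : v - v⁻¹ ≠ 0) (h : QuantumTriple v E F K Ki) :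
    QuantumTriple v (matE v E) (matF F Ki) (matK v K) (matK v⁻¹ Ki) where
  K_Ki := by
    refine matrix_ext ?_ ?_ ?_ ?_ <;>
    simp [matK, Matrix.mul_fin_two, h.K_Ki, smul_smul, hv]
  Ki_K := by
    refine matrix_ext ?_ ?_ ?_ ?_ <;>
    simp [matK, Matrix.mul_fin_two, h.Ki_K, smul_smul, hv]
  K_E := by
    refine matrix_ext ?_ ?_ ?_ ?_ <;>
    simp [matK, matE, Matrix.mul_fin_two, h.K_Ki, h.K_E, smul_smul]
    · congr 1; field_simp
    · rw [pow_two]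
    · congr 1; field_simp
  K_F := by
    refine matrix_ext ?_ ?_ ?_ ?_ <;>
    simp [matK, matF, Matrix.mul_fin_two, h.K_Ki, h.K_F, smul_smul, hv]
    congr 1; field_simp
  E_F := by
    have hs : v ^ 2 - 1 ≠ 0 := fun h0 => h1 (by field_simp; rw [h0, mul_zero])
    have hi : (v - v⁻¹)⁻¹ = v / (v ^ 2 - 1) := by
      rw [inv_eq_iff_eq_inv, inv_div, eq_div_iff hv, sub_mul, inv_mul_cancel₀ hv, pow_two]
    have hEF : E * F = F * E + (v - v⁻¹)⁻¹ • (K - Ki) := by rw [← h.E_F]; abel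
    refine matrix_ext ?_ ?_ ?_ ?_ <;>
    simp [matK, matF, matE, Matrix.mul_fin_two, hEF, h.E_mul_Ki, smul_smul]
    · rw [hi]; match_scalars <;> field_simp <;> ring
    · rw [sub_eq_zero]; congr 1; field_simp
    · rw [hi]; match_scalars <;> field_simp <;> ring

theorem matE_pow (hv : v ≠ 0) (h1 : v - v⁻¹ ≠ 0) (E : A) (n : ℕ) : matE v E ^ (n + 1) =
    !![v ^ (n + 1) • E ^ (n + 1), qInt v (n + 1) • E ^ n; 0, v⁻¹ ^ (n + 1) • E ^ (n + 1)] := by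
  induction n with
  | zero => simp [matE, qInt_one h1]
  | succ n ih =>
    rw [pow_succ', ih, matE, Matrix.mul_fin_two]
    refine matrix_ext ?_ ?_ ?_ ?_
    · simp [smul_smul, ← pow_succ', ← pow_succ]
    · have := qInt_add_one v hv h1 (n + 1)
      push_cast
      simp only [Matrix.of_apply, Matrix.cons_val', Matrix.cons_val_zero, Matrix.cons_val_one,
        Matrix.cons_val_fin_one, smul_mul_smul_comm, ← pow_succ', one_mul, this, add_smul]
      congr 2
      rw [zpow_neg, inv_pow]; exact_mod_cast rfl
    · simp
    · simp only [Matrix.of_apply, Matrix.cons_val', Matrix.cons_val_zero, Matrix.cons_val_one,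
        Matrix.cons_val_fin_one, smul_mul_smul_comm, ← pow_succ', zero_mul, zero_add]

theorem matF_pow (hv : v ≠ 0) (h1 : v - v⁻¹ ≠ 0) (h : Ki * F = v ^ 2 • (F * Ki)) (n : ℕ) :
    matF F Ki ^ (n + 1) =
    !![F ^ (n + 1), 0; (v ^ n * qInt v (n + 1)) • (F ^ n * Ki), F ^ (n + 1)] := by
  have hK (n : ℕ) : Ki * F ^ n = v ^ (2 * n) • (F ^ n * Ki) := by
    induction n with
    | zero => simp
    | succ n ih =>
      rw [pow_succ, ← mul_assoc, ih, smul_mul_assoc, mul_assoc, h, mul_smul_comm, smul_smul,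
        ← mul_assoc]
      congr 1; ring
  induction n with
  | zero => simp [matF, qInt_one h1]
  | succ n ih =>
    rw [pow_succ', ih, matF, Matrix.mul_fin_two]
    refine matrix_ext ?_ ?_ ?_ ?_
    · simp [← pow_succ']
    · simp
    · have := qInt_add hv 1 ((n : ℤ) + 1)
      rw [add_comm, qInt_one h1] at this
      push_cast
      simp only [Matrix.of_apply, Matrix.cons_val', Matrix.cons_val_zero, Matrix.cons_val_one,
        Matrix.cons_val_fin_one, mul_smul_comm, ← mul_assoc, ← pow_succ', hK, this, ← add_smul]
      congr 1
      have e : v ^ ((n : ℤ) + 1) = v ^ (n + 1) := by exact_mod_cast zpow_natCast v (n + 1)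
      rw [e, zpow_neg, zpow_one, pow_succ v n]
      field_simp
      ring
    · simp [← pow_succ']

theorem matK_pow (K : A) (n : ℕ) : matK v K ^ n = matK (v ^ n) (K ^ n) := by
  induction n with
  | zero => simp [matK, Matrix.one_fin_two]
  | succ n ih =>
    rw [pow_succ, ih, matK, matK, Matrix.mul_fin_two]
    simp [matK, smul_smul, ← pow_succ, ← pow_succ', ← mul_inv]

end

end QuantumTriple

open QuantumTriple

theorem GenericQG.triple :
    QuantumTriple (RatFunc.X : RatFunc ℂ) (gen .E) (gen .F) (gen .K) (gen .Ki) :=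
  ⟨gen_K_Ki, gen_Ki_K, gen_K_E, gen_K_F, gen_E_F⟩

namespace SmallQG

variable (p : ℕ)

theorem gen_rel {a b : FreeAlgebra ℂ Gen} (h : SmallRel p a b) :
    FreeAlgebra.lift ℂ (gen p) a = FreeAlgebra.lift ℂ (gen p) b := by
  have h1 : FreeAlgebra.lift ℂ (gen p) =
      (RingQuot.mkAlgHom ℂ (SmallRel p) : FreeAlgebra ℂ Gen →ₐ[ℂ] RingQuot (SmallRel p)) :=
    FreeAlgebra.hom_ext (funext fun g => FreeAlgebra.lift_ι_apply _ g)
  rw [h1]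
  exact RingQuot.mkAlgHom_rel ℂ h

theorem triple : QuantumTriple (q p) (gen p .E) (gen p .F) (gen p .K) (gen p .Ki) where
  K_Ki := by simpa using gen_rel p (.base .K_Ki)
  Ki_K := by simpa using gen_rel p (.base .Ki_K)
  K_E := by simpa using gen_rel p (.base .K_E)
  K_F := by simpa using gen_rel p (.base .K_F)
  E_F := by simpa using gen_rel p (.base .E_F)

theorem gen_E_pow : gen p .E ^ p = 0 := by simpa using gen_rel p .E_pow

theorem gen_F_pow : gen p .F ^ p = 0 := by simpa using gen_rel p .F_pow

theorem gen_K_pow : gen p .K ^ (2 * p) = 1 := by simpa using gen_rel p .K_pow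

/-- The coproduct of `Ū_q sl(2)`, as a homomorphism to matrices. -/
def coprod [hp : Fact (2 ≤ p)] : SmallQG p →ₐ[ℂ] Matrix (Fin 2) (Fin 2) (SmallQG p) :=
  have h := (triple p).mat (q_ne_zero p) (q_sub_inv_ne_zero p hp.out)
  have hp0 : p - 1 + 1 = p := by have := hp.out; omega
  have h0 : qInt (q p) ((p - 1 : ℕ) + 1) = 0 := by
    rw [qInt_eq_zero_iff hp.out]; exact ⟨1, by omega⟩
  SmallQG.lift
    (fun
      | .E => matE (q p) (gen p .E)
      | .F => matF (gen p .F) (gen p .Ki)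
      | .K => matK (q p) (gen p .K)
      | .Ki => matK (q p)⁻¹ (gen p .Ki))
    h.K_Ki h.Ki_K h.K_E h.K_F h.E_F
    (by
      have := matE_pow (q_ne_zero p) (q_sub_inv_ne_zero p hp.out) (gen p .E) (p - 1)
      rw [h0, hp0, gen_E_pow] at this
      rw [this]; refine matrix_ext ?_ ?_ ?_ ?_ <;> simp)
    (by
      have := matF_pow (q_ne_zero p) (q_sub_inv_ne_zero p hp.out)
        ((triple p).Ki_mul_F (q_ne_zero p)) (p - 1)
      rw [h0, hp0, gen_F_pow] at this
      rw [this]; refine matrix_ext ?_ ?_ ?_ ?_ <;> simp)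
    (by
      have hp0 : p ≠ 0 := by omega
      simp only
      rw [matK_pow, gen_K_pow, q_pow_two_p p hp0]; simp [matK, Matrix.one_fin_two])

theorem coprod_gen [Fact (2 ≤ p)] (g : Gen) : coprod p (gen p g) = match g with
      | .E => matE (q p) (gen p .E)
      | .F => matF (gen p .F) (gen p .Ki)
      | .K => matK (q p) (gen p .K)
      | .Ki => matK (q p)⁻¹ (gen p .Ki) := by
  rw [coprod, lift_gen]

end SmallQG

namespace GenericQG

/-- The coproduct of generic quantum `sl(2)`, as a homomorphism to matrices. -/
def coprod : GenericQG →ₐ[RatFunc ℂ] Matrix (Fin 2) (Fin 2) GenericQG :=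
  (triple.mat RatFunc.X_ne_zero X_sub_inv_ne_zero).lift

theorem coprod_Ediv (n : ℕ) : coprod (divPow (gen .E) (n + 1)) =
    !![(RatFunc.X : RatFunc ℂ) ^ (n + 1) • divPow (gen .E) (n + 1), divPow (gen .E) n;
      0, (RatFunc.X⁻¹ : RatFunc ℂ) ^ (n + 1) • divPow (gen .E) (n + 1)] := by
  refine QuantumTriple.lift_divPow _ _ _ _ ?_
  rw [QuantumTriple.lift_gen]
  have h := qFact_ne_zero (n + 1)
  rw [qFact_succ] at h
  have h' := qFact_ne_zero n
  have h2 := right_ne_zero_of_mul h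
  refine (matE_pow RatFunc.X_ne_zero X_sub_inv_ne_zero _ _).trans ?_
  rw [qFact_succ]
  refine matrix_ext ?_ ?_ ?_ ?_ <;> simp [divPow, smul_smul, qFact_succ] <;> congr 1 <;> field_simp

theorem coprod_Fdiv (n : ℕ) : coprod (divPow (gen .F) (n + 1)) =
    !![divPow (gen .F) (n + 1), 0;
      (RatFunc.X : RatFunc ℂ) ^ n • (divPow (gen .F) n * gen .Ki), divPow (gen .F) (n + 1)] := by
  refine QuantumTriple.lift_divPow _ _ _ _ ?_
  rw [QuantumTriple.lift_gen]
  have h := qFact_ne_zero (n + 1)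
  rw [qFact_succ] at h
  have h' := qFact_ne_zero n
  have h2 := right_ne_zero_of_mul h
  have hm : qFact (RatFunc.X : RatFunc ℂ) n * qInt RatFunc.X (n + 1) *
      ((qInt RatFunc.X (n + 1))⁻¹ * (qFact RatFunc.X n)⁻¹) = 1 := by field_simp
  refine (matF_pow RatFunc.X_ne_zero X_sub_inv_ne_zero
    (triple.Ki_mul_F RatFunc.X_ne_zero) _).trans ?_
  rw [qFact_succ]
  refine matrix_ext ?_ ?_ ?_ ?_ <;> simp [divPow, smul_smul, qFact_succ]
  · rw [hm, one_smul]
  · congr 1; field_simp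
  · rw [hm, one_smul]

theorem coprod_K : coprod (gen .K) = matK (RatFunc.X : RatFunc ℂ) (gen .K) :=
  QuantumTriple.lift_gen _ _

theorem coprod_Ki : coprod (gen .Ki) = matK (RatFunc.X⁻¹ : RatFunc ℂ) (gen .Ki) :=
  QuantumTriple.lift_gen _ _

end GenericQG

namespace Lusztig

open QSl2.GenericQG (coprod coprod_Ediv coprod_Fdiv coprod_K coprod_Ki)

/-- The inclusion of the matrices over Lusztig's form. -/
def matIncl : Matrix (Fin 2) (Fin 2) lusztigForm →ₐ[ℂ] Matrix (Fin 2) (Fin 2) GenericQG :=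
  lusztigForm.val.mapMatrix

theorem matIncl_injective : Function.Injective matIncl := fun M N h => by
  ext i j
  exact congrFun (congrFun h i) j

theorem matIncl_scalar (c : ℂ) : matIncl (algebraMap ℂ _ c) =
    coprod (algebraMap (RatFunc ℂ) GenericQG (algebraMap ℂ _ c)) := by
  rw [AlgHom.commutes, AlgHom.commutes]; rfl

theorem matIncl_Ediv (n : ℕ) : matIncl !![GenericQG.v ^ (n + 1) * GenericQG.Ediv (n + 1),
    GenericQG.Ediv n; 0, GenericQG.vInv ^ (n + 1) * GenericQG.Ediv (n + 1)] =
    coprod (GenericQG.Ediv (n + 1)) := by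
  refine Eq.trans ?_ (coprod_Ediv n).symm
  refine matrix_ext ?_ ?_ ?_ ?_
  · simp [matIncl, GenericQG.coe_v, Algebra.smul_def]; rfl
  · simp [matIncl]; rfl
  · simp [matIncl]
  · simp [matIncl, GenericQG.coe_vInv, Algebra.smul_def, ← inv_pow, map_pow]; rfl

theorem matIncl_Fdiv (n : ℕ) : matIncl !![GenericQG.Fdiv (n + 1), 0;
    GenericQG.v ^ n * (GenericQG.Fdiv n * GenericQG.Ki), GenericQG.Fdiv (n + 1)] =
    coprod (GenericQG.Fdiv (n + 1)) := by
  refine Eq.trans ?_ (coprod_Fdiv n).symm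
  refine matrix_ext ?_ ?_ ?_ ?_
  · simp [matIncl]; rfl
  · simp [matIncl]
  · simp [matIncl, GenericQG.coe_v, Algebra.smul_def]; rfl
  · simp [matIncl]; rfl

theorem matIncl_K : matIncl !![GenericQG.v * GenericQG.K, 0; 0, GenericQG.vInv * GenericQG.K] =
    coprod GenericQG.K := by
  refine Eq.trans ?_ coprod_K.symm
  refine matrix_ext ?_ ?_ ?_ ?_
  · simp [matIncl, matK, GenericQG.coe_v, Algebra.smul_def]; rfl
  · simp [matIncl, matK]
  · simp [matIncl, matK]
  · simp [matIncl, matK, GenericQG.coe_vInv, Algebra.smul_def]; rfl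

theorem matIncl_Ki : matIncl !![GenericQG.vInv * GenericQG.Ki, 0; 0, GenericQG.v * GenericQG.Ki] =
    coprod GenericQG.Ki := by
  refine Eq.trans ?_ coprod_Ki.symm
  refine matrix_ext ?_ ?_ ?_ ?_
  · simp [matIncl, matK, GenericQG.coe_vInv, Algebra.smul_def]; rfl
  · simp [matIncl, matK]
  · simp [matIncl, matK]
  · simp [matIncl, matK, GenericQG.coe_v, Algebra.smul_def]; rfl

theorem matIncl_v : matIncl (Matrix.scalar _ GenericQG.v) = coprod GenericQG.v := by
  refine Eq.trans ?_ (AlgHom.commutes coprod RatFunc.X).symm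
  refine matrix_ext ?_ ?_ ?_ ?_ <;> simp [matIncl, GenericQG.coe_v, Matrix.algebraMap_matrix_apply]

theorem matIncl_vInv : matIncl (Matrix.scalar _ GenericQG.vInv) = coprod GenericQG.vInv := by
  refine Eq.trans ?_ (AlgHom.commutes coprod RatFunc.X⁻¹).symm
  refine matrix_ext ?_ ?_ ?_ ?_ <;>
    simp [matIncl, GenericQG.coe_vInv, Matrix.algebraMap_matrix_apply]

theorem Ediv_zero : GenericQG.Ediv 0 = 1 := Subtype.ext (by
  change GenericQG.divPow _ 0 = 1
  simp [GenericQG.divPow, qFact])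

theorem Fdiv_zero : GenericQG.Fdiv 0 = 1 := Subtype.ext (by
  change GenericQG.divPow _ 0 = 1
  simp [GenericQG.divPow, qFact])

theorem exists_matIncl (x : lusztigForm) : ∃ M, matIncl M = coprod x := by
  induction x using lusztigForm_induction with
  | scalar c => exact ⟨_, matIncl_scalar c⟩
  | v => exact ⟨_, matIncl_v⟩
  | vInv => exact ⟨_, matIncl_vInv⟩
  | K => exact ⟨_, matIncl_K⟩
  | Ki => exact ⟨_, matIncl_Ki⟩
  | E n => cases n with
    | zero => exact ⟨1, by rw [Ediv_zero, map_one, OneMemClass.coe_one, map_one]⟩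
    | succ n => exact ⟨_, matIncl_Ediv n⟩
  | F n => cases n with
    | zero => exact ⟨1, by rw [Fdiv_zero, map_one, OneMemClass.coe_one, map_one]⟩
    | succ n => exact ⟨_, matIncl_Fdiv n⟩
  | add x y hx hy =>
    obtain ⟨M, hM⟩ := hx
    obtain ⟨N, hN⟩ := hy
    exact ⟨M + N, by rw [map_add, hM, hN, Subalgebra.coe_add, map_add]⟩
  | mul x y hx hy =>
    obtain ⟨M, hM⟩ := hx
    obtain ⟨N, hN⟩ := hy
    exact ⟨M * N, by rw [map_mul, hM, hN, Subalgebra.coe_mul, map_mul]⟩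

/-- The coproduct of Lusztig's form, as a homomorphism to matrices. -/
def formCoprod : lusztigForm →ₐ[ℂ] Matrix (Fin 2) (Fin 2) lusztigForm where
  toFun x := (exists_matIncl x).choose
  map_one' := matIncl_injective (by
    rw [(exists_matIncl 1).choose_spec, OneMemClass.coe_one, map_one, map_one])
  map_zero' := matIncl_injective (by
    rw [(exists_matIncl 0).choose_spec, ZeroMemClass.coe_zero, map_zero, map_zero])
  map_mul' x y := matIncl_injective (by
    rw [(exists_matIncl (x * y)).choose_spec, map_mul, (exists_matIncl x).choose_spec,
      (exists_matIncl y).choose_spec, Subalgebra.coe_mul, map_mul])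
  map_add' x y := matIncl_injective (by
    rw [(exists_matIncl (x + y)).choose_spec, map_add, (exists_matIncl x).choose_spec,
      (exists_matIncl y).choose_spec, Subalgebra.coe_add, map_add])
  commutes' c := matIncl_injective (by
    rw [(exists_matIncl (algebraMap ℂ _ c)).choose_spec, matIncl_scalar]; rfl)

theorem formCoprod_eq {x : lusztigForm} {M : Matrix (Fin 2) (Fin 2) lusztigForm}
    (h : matIncl M = coprod x) : formCoprod x = M :=
  matIncl_injective (by rw [h]; exact (exists_matIncl x).choose_spec)

variable (p : ℕ)

theorem dE_zero : dE p 0 = 1 := by rw [dE, Ediv_zero, map_one]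

theorem dF_zero : dF p 0 = 1 := by rw [dF, Fdiv_zero, map_one]

theorem mk_K_pow : K p ^ (2 * p) = 1 := by
  have := RingQuot.mkAlgHom_rel ℂ (LusztigRel.K_pow (p := p))
  rw [map_one, map_pow] at this
  exact this

/-- The coproduct of `U_q sl(2)`, as a homomorphism to matrices. -/
def coprod [hp : Fact (2 ≤ p)] : Lusztig p →ₐ[ℂ] Matrix (Fin 2) (Fin 2) (Lusztig p) :=
  lift ((mk p).mapMatrix.comp formCoprod)
    (by
      rw [AlgHom.comp_apply, formCoprod_eq matIncl_v]
      refine matrix_ext ?_ ?_ ?_ ?_ <;> simp [Matrix.algebraMap_matrix_apply, mk_v])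
    (by
      have h : (mk p).mapMatrix.comp formCoprod GenericQG.K = matK (q p) (K p) := by
        rw [AlgHom.comp_apply, formCoprod_eq matIncl_K]
        refine matrix_ext ?_ ?_ ?_ ?_ <;>
          simp [matK, mk_v, mk_vInv, K, Algebra.smul_def]
      have hp0 : p ≠ 0 := by have := hp.out; omega
      rw [h, matK_pow, mk_K_pow, q_pow_two_p p hp0]; simp [matK, Matrix.one_fin_two])

variable [hp : Fact (2 ≤ p)]

theorem coprod_mk (x : lusztigForm) : coprod p (mk p x) = (mk p).mapMatrix (formCoprod x) :=
  lift_mk _ _ _ x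

theorem coprod_dE (n : ℕ) : coprod p (dE p (n + 1)) =
    !![q p ^ (n + 1) • dE p (n + 1), dE p n; 0, (q p)⁻¹ ^ (n + 1) • dE p (n + 1)] := by
  rw [dE, coprod_mk, formCoprod_eq (matIncl_Ediv n)]
  refine matrix_ext ?_ ?_ ?_ ?_ <;> simp [mk_v, mk_vInv, dE, Algebra.smul_def, ← inv_pow, map_pow]

theorem coprod_dF (n : ℕ) : coprod p (dF p (n + 1)) =
    !![dF p (n + 1), 0; q p ^ n • (dF p n * Ki p), dF p (n + 1)] := by
  rw [dF, coprod_mk, formCoprod_eq (matIncl_Fdiv n)]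
  refine matrix_ext ?_ ?_ ?_ ?_ <;> simp [mk_v, dF, Ki, Algebra.smul_def]

theorem coprod_K : coprod p (K p) = matK (q p) (K p) := by
  rw [K, coprod_mk, formCoprod_eq matIncl_K]
  refine matrix_ext ?_ ?_ ?_ ?_ <;> simp [matK, mk_v, mk_vInv, Algebra.smul_def]

theorem coprod_Ki : coprod p (Ki p) = matK (q p)⁻¹ (Ki p) := by
  rw [Ki, coprod_mk, formCoprod_eq matIncl_Ki]
  refine matrix_ext ?_ ?_ ?_ ?_ <;> simp [matK, mk_v, mk_vInv, Algebra.smul_def]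

end Lusztig

end QSl2

end

noncomputable section

namespace QSl2

open QuantumTriple

/-! ### The tensor product with the two-dimensional module -/

/-- The tensor product of a module with the module spanned by `ξ` and `η`, formed with the
coproduct `Δ`. -/
def Tw {A : Type*} [Ring A] [Algebra ℂ A] (_Δ : A →ₐ[ℂ] Matrix (Fin 2) (Fin 2) A) (N : Type*) :
    Type _ := N × N

namespace Tw

variable {A : Type*} [Ring A] [Algebra ℂ A] (Δ : A →ₐ[ℂ] Matrix (Fin 2) (Fin 2) A)
  {N : Type*} [AddCommGroup N]

instance : AddCommGroup (Tw Δ N) := inferInstanceAs (AddCommGroup (N × N))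

instance [Module ℂ N] : Module ℂ (Tw Δ N) := inferInstanceAs (Module ℂ (N × N))

/-- The element `x ξ + y η`. -/
def mk (x y : N) : Tw Δ N := (x, y)

variable {Δ} in
theorem ext {u w : Tw Δ N} (h1 : u.1 = w.1) (h2 : u.2 = w.2) : u = w := Prod.ext h1 h2

variable [Module A N]

instance : SMul A (Tw Δ N) := ⟨fun a u =>
  (Δ a 0 0 • u.1 + Δ a 0 1 • u.2, Δ a 1 0 • u.1 + Δ a 1 1 • u.2)⟩

theorem smul_fst (a : A) (u : Tw Δ N) : (a • u).1 = Δ a 0 0 • u.1 + Δ a 0 1 • u.2 := rfl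
theorem smul_snd (a : A) (u : Tw Δ N) : (a • u).2 = Δ a 1 0 • u.1 + Δ a 1 1 • u.2 := rfl
theorem add_fst (u w : Tw Δ N) : (u + w).1 = u.1 + w.1 := rfl
theorem add_snd (u w : Tw Δ N) : (u + w).2 = u.2 + w.2 := rfl
theorem zero_fst : (0 : Tw Δ N).1 = 0 := rfl
theorem zero_snd : (0 : Tw Δ N).2 = 0 := rfl
theorem csmul_fst [Module ℂ N] (c : ℂ) (u : Tw Δ N) : (c • u).1 = c • u.1 := rfl
theorem csmul_snd [Module ℂ N] (c : ℂ) (u : Tw Δ N) : (c • u).2 = c • u.2 := rfl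

instance : Module A (Tw Δ N) where
  one_smul u := ext (by simp [smul_fst]) (by simp [smul_snd])
  mul_smul a b u := ext
    (by simp only [smul_fst, smul_snd, map_mul, Matrix.mul_apply, Fin.sum_univ_two, smul_add,
          add_smul, mul_smul]; abel)
    (by simp only [smul_fst, smul_snd, map_mul, Matrix.mul_apply, Fin.sum_univ_two, smul_add,
          add_smul, mul_smul]; abel)
  smul_zero a := ext (by simp [smul_fst, zero_fst, zero_snd]) (by simp [smul_snd, zero_fst, zero_snd])
  smul_add a u w := ext
    (by simp only [smul_fst, add_fst, add_snd, smul_add]; abel)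
    (by simp only [smul_snd, add_fst, add_snd, smul_add]; abel)
  add_smul a b u := ext
    (by simp only [smul_fst, add_fst, map_add, Matrix.add_apply, add_smul]; abel)
    (by simp only [smul_snd, add_snd, map_add, Matrix.add_apply, add_smul]; abel)
  zero_smul u := ext (by simp [smul_fst, zero_fst]) (by simp [smul_snd, zero_snd])

instance [Module ℂ N] [IsScalarTower ℂ A N] : IsScalarTower ℂ A (Tw Δ N) := ⟨fun c a u => ext
    (by simp only [smul_fst, map_smul, Matrix.smul_apply, csmul_fst, smul_add, smul_assoc])
    (by simp only [smul_snd, map_smul, Matrix.smul_apply, csmul_snd, smul_add, smul_assoc])⟩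

instance [Module ℂ N] [FiniteDimensional ℂ N] : FiniteDimensional ℂ (Tw Δ N) :=
  inferInstanceAs (FiniteDimensional ℂ (N × N))

variable {Δ}

/-- The coproduct of a linear map and the identity. -/
def map {M : Type*} [AddCommGroup M] [Module A M] (f : N →ₗ[A] M) : Tw Δ N →ₗ[A] Tw Δ M where
  toFun u := (f u.1, f u.2)
  map_add' u w := ext (map_add f _ _) (map_add f _ _)
  map_smul' a u := ext
    ((map_add f _ _).trans (by rw [map_smul, map_smul]; rfl))
    ((map_add f _ _).trans (by rw [map_smul, map_smul]; rfl))

theorem map_fst {M : Type*} [AddCommGroup M] [Module A M] (f : N →ₗ[A] M) (u : Tw Δ N) :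
    (map f u).1 = f u.1 := rfl

theorem map_snd {M : Type*} [AddCommGroup M] [Module A M] (f : N →ₗ[A] M) (u : Tw Δ N) :
    (map f u).2 = f u.2 := rfl

variable [Module ℂ N] [IsScalarTower ℂ A N] {M : Type*} [AddCommGroup M] [Module ℂ M] [Module A M]
  [IsScalarTower ℂ A M]

/-- The transpose of a map out of the tensor product. -/
def curry (z : ℂ) (f : Tw Δ N →ₗ[A] M) : N →ₗ[ℂ] Tw Δ M :=
  ((LinearMap.prod ((f.restrictScalars ℂ) ∘ₗ (LinearMap.inr ℂ N N : N →ₗ[ℂ] Tw Δ N))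
    (-z • (f.restrictScalars ℂ) ∘ₗ (LinearMap.inl ℂ N N : N →ₗ[ℂ] Tw Δ N))) :)

theorem curry_fst (z : ℂ) (f : Tw Δ N →ₗ[A] M) (x : N) : (curry z f x).1 = f (mk Δ 0 x) := rfl

theorem curry_snd (z : ℂ) (f : Tw Δ N →ₗ[A] M) (x : N) :
    (curry z f x).2 = -z • f (mk Δ x 0) := rfl

/-- The transpose of a map into the tensor product. -/
def uncurry (z : ℂ) (h : N →ₗ[A] Tw Δ M) : Tw Δ N →ₗ[ℂ] M :=
  ((-z⁻¹ • (LinearMap.snd ℂ M M ∘ₗ (h.restrictScalars ℂ : N →ₗ[ℂ] M × M)) ∘ₗ LinearMap.fst ℂ N N +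
    (LinearMap.fst ℂ M M ∘ₗ (h.restrictScalars ℂ : N →ₗ[ℂ] M × M)) ∘ₗ LinearMap.snd ℂ N N :
      N × N →ₗ[ℂ] M) :)

theorem uncurry_apply (z : ℂ) (h : N →ₗ[A] Tw Δ M) (u : Tw Δ N) :
    uncurry z h u = -z⁻¹ • (h u.1).2 + (h u.2).1 := rfl

end Tw

/-! ### Linearity over the quantum groups -/

section linear

variable {p : ℕ} {M N : Type*} [AddCommGroup M] [Module ℂ M] [AddCommGroup N] [Module ℂ N]

/-- A linear map that commutes with the generators is `U_q sl(2)`-linear. -/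
def Lusztig.mkLinear [Module (Lusztig p) M] [IsScalarTower ℂ (Lusztig p) M]
    [Module (Lusztig p) N] [IsScalarTower ℂ (Lusztig p) N] (f : M →ₗ[ℂ] N)
    (hK : ∀ x, f (K p • x) = K p • f x) (hKi : ∀ x, f (Ki p • x) = Ki p • f x)
    (hE : ∀ n x, f (dE p (n + 1) • x) = dE p (n + 1) • f x)
    (hF : ∀ n x, f (dF p (n + 1) • x) = dF p (n + 1) • f x) : M →ₗ[Lusztig p] N :=
  { f with
    map_smul' := fun a => by
      induction a using Lusztig.induction with
      | scalar c => intro x; simp [algebraMap_smul]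
      | hK => exact hK
      | hKi => exact hKi
      | hE n => cases n with
        | zero => intro x; simp [dE_zero]
        | succ n => exact hE n
      | hF n => cases n with
        | zero => intro x; simp [dF_zero]
        | succ n => exact hF n
      | add a b ha hb => intro x; simp_all [add_smul]
      | mul a b ha hb => intro x; simp_all [mul_smul] }

/-- A linear map that commutes with the generators is `Ū_q sl(2)`-linear. -/
def SmallQG.mkLinear [Module (SmallQG p) M] [IsScalarTower ℂ (SmallQG p) M]
    [Module (SmallQG p) N] [IsScalarTower ℂ (SmallQG p) N] (f : M →ₗ[ℂ] N)
    (h : ∀ g x, f (gen p g • x) = gen p g • f x) : M →ₗ[SmallQG p] N :=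
  { f with
    map_smul' := fun a => by
      induction a using SmallQG.induction with
      | scalar c => intro x; simp [algebraMap_smul]
      | hgen g => exact h g
      | add a b ha hb => intro x; simp_all [add_smul]
      | mul a b ha hb => intro x; simp_all [mul_smul] }

end linear

/-! ### Formulas for the action on tensor products -/

namespace Lusztig

variable (p : ℕ) [hp : Fact (2 ≤ p)] {N : Type*} [AddCommGroup N] [Module ℂ N]
  [Module (Lusztig p) N] [IsScalarTower ℂ (Lusztig p) N]

theorem dE_smul_tw (n : ℕ) (x y : N) : dE p (n + 1) • Tw.mk (coprod p) x y =
    Tw.mk (coprod p) (q p ^ (n + 1) • dE p (n + 1) • x + dE p n • y)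
      ((q p)⁻¹ ^ (n + 1) • dE p (n + 1) • y) := by
  refine Tw.ext ?_ ?_ <;> simp only [Tw.smul_fst, Tw.smul_snd, coprod_dE] <;> simp [Tw.mk]

theorem dF_smul_tw (n : ℕ) (x y : N) : dF p (n + 1) • Tw.mk (coprod p) x y =
    Tw.mk (coprod p) (dF p (n + 1) • x)
      (q p ^ n • dF p n • Ki p • x + dF p (n + 1) • y) := by
  refine Tw.ext ?_ ?_ <;> simp only [Tw.smul_fst, Tw.smul_snd, coprod_dF] <;>
    simp [Tw.mk, mul_smul]

theorem K_smul_tw (x y : N) : K p • Tw.mk (coprod p) x y =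
    Tw.mk (coprod p) (q p • K p • x) ((q p)⁻¹ • K p • y) := by
  refine Tw.ext ?_ ?_ <;> simp only [Tw.smul_fst, Tw.smul_snd, coprod_K] <;> simp [Tw.mk, matK]

theorem Ki_smul_tw (x y : N) : Ki p • Tw.mk (coprod p) x y =
    Tw.mk (coprod p) ((q p)⁻¹ • Ki p • x) (q p • Ki p • y) := by
  refine Tw.ext ?_ ?_ <;> simp only [Tw.smul_fst, Tw.smul_snd, coprod_Ki] <;> simp [Tw.mk, matK]

end Lusztig

namespace SmallQG

variable (p : ℕ) [hp : Fact (2 ≤ p)] {N : Type*} [AddCommGroup N] [Module ℂ N]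
  [Module (SmallQG p) N] [IsScalarTower ℂ (SmallQG p) N]

theorem E_smul_tw (x y : N) : gen p .E • Tw.mk (coprod p) x y =
    Tw.mk (coprod p) (q p • gen p .E • x + y) ((q p)⁻¹ • gen p .E • y) := by
  refine Tw.ext ?_ ?_ <;> simp only [Tw.smul_fst, Tw.smul_snd, coprod_gen] <;> simp [Tw.mk, matE]

theorem F_smul_tw (x y : N) : gen p .F • Tw.mk (coprod p) x y =
    Tw.mk (coprod p) (gen p .F • x) (gen p .Ki • x + gen p .F • y) := by
  refine Tw.ext ?_ ?_ <;> simp only [Tw.smul_fst, Tw.smul_snd, coprod_gen] <;> simp [Tw.mk, matF]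

theorem K_smul_tw (x y : N) : gen p .K • Tw.mk (coprod p) x y =
    Tw.mk (coprod p) (q p • gen p .K • x) ((q p)⁻¹ • gen p .K • y) := by
  refine Tw.ext ?_ ?_ <;> simp only [Tw.smul_fst, Tw.smul_snd, coprod_gen] <;> simp [Tw.mk, matK]

theorem Ki_smul_tw (x y : N) : gen p .Ki • Tw.mk (coprod p) x y =
    Tw.mk (coprod p) ((q p)⁻¹ • gen p .Ki • x) (q p • gen p .Ki • y) := by
  refine Tw.ext ?_ ?_ <;> simp only [Tw.smul_fst, Tw.smul_snd, coprod_gen] <;> simp [Tw.mk, matK]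

end SmallQG

/-! ### The action of Lusztig's quantum group on one-forms -/

namespace OneForm

variable (p : ℕ) [hp : Fact (2 ≤ p)]

instance : Module (Lusztig p) (OneForm p) :=
  inferInstanceAs (Module (Lusztig p) (Tw (Lusztig.coprod p) (QPlane p)))

instance : IsScalarTower ℂ (Lusztig p) (OneForm p) :=
  inferInstanceAs (IsScalarTower ℂ (Lusztig p) (Tw (Lusztig.coprod p) (QPlane p)))

theorem dE_smul_mk (n : ℕ) (f g : QPlane p) : Lusztig.dE p (n + 1) • mk p f g =
    mk p (q p ^ (n + 1) • Lusztig.dE p (n + 1) • f + Lusztig.dE p n • g)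
      ((q p)⁻¹ ^ (n + 1) • Lusztig.dE p (n + 1) • g) := Lusztig.dE_smul_tw p n f g

theorem dF_smul_mk (n : ℕ) (f g : QPlane p) : Lusztig.dF p (n + 1) • mk p f g =
    mk p (Lusztig.dF p (n + 1) • f)
      (q p ^ n • Lusztig.dF p n • Lusztig.Ki p • f + Lusztig.dF p (n + 1) • g) :=
  Lusztig.dF_smul_tw p n f g

theorem K_smul_mk (f g : QPlane p) : Lusztig.K p • mk p f g =
    mk p (q p • Lusztig.K p • f) ((q p)⁻¹ • Lusztig.K p • g) := Lusztig.K_smul_tw p f g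

theorem Ki_smul_mk (f g : QPlane p) : Lusztig.Ki p • mk p f g =
    mk p ((q p)⁻¹ • Lusztig.Ki p • f) (q p • Lusztig.Ki p • g) := Lusztig.Ki_smul_tw p f g

theorem action_eq : action p = (Algebra.lsmul ℂ ℂ (OneForm p)).comp (Lusztig.ofSmall p) :=
  SmallQG.hom_ext fun x => end_ext fun f g => by
    rw [AlgHom.comp_apply, Lusztig.ofSmall_gen, action, SmallQG.lift_gen, Algebra.lsmul_coe]
    cases x <;> simp only
    · rw [opE_mk, dE_smul_mk, Lusztig.dE_zero, zero_add, QPlane.dE_smul, QPlane.dE_smul,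
        ← QPlane.opE_eq_opEd p hp.out]; simp
    · rw [opF_mk, dF_smul_mk, Lusztig.dF_zero, zero_add, QPlane.dF_smul, QPlane.dF_smul,
        ← QPlane.opF_eq_opFd p hp.out, QPlane.Ki_smul, add_comm]; simp
    · rw [opK_mk, K_smul_mk, QPlane.K_smul, QPlane.K_smul]
    · rw [opKi_mk, Ki_smul_mk, QPlane.Ki_smul, QPlane.Ki_smul]

instance : IsScalarTower (SmallQG p) (Lusztig p) (OneForm p) := ⟨fun s a f => by
  rw [Lusztig.small_smul_def, mul_smul]
  change _ = action p s (a • f)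
  rw [action_eq]; rfl⟩

end OneForm

/-! ### Self-adjointness of the tensor product -/

section adjoint

variable {p : ℕ} [hp : Fact (2 ≤ p)]

/-- The functor `Tw Δ` is left adjoint to itself, with respect to the given transposition. -/
class IsSelfAdjoint {A : Type} [Ring A] [Algebra ℂ A] (z : ℂ)
    (Δ : A →ₐ[ℂ] Matrix (Fin 2) (Fin 2) A) : Prop where
  curry_smul (N M : Type) [AddCommGroup N] [Module ℂ N] [Module A N] [IsScalarTower ℂ A N]
    [AddCommGroup M] [Module ℂ M] [Module A M] [IsScalarTower ℂ A M] (f : Tw Δ N →ₗ[A] M) :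
    ∃ h : N →ₗ[A] Tw Δ M, ∀ x, h x = Tw.curry z f x
  uncurry_smul (N M : Type) [AddCommGroup N] [Module ℂ N] [Module A N] [IsScalarTower ℂ A N]
    [AddCommGroup M] [Module ℂ M] [Module A M] [IsScalarTower ℂ A M] (h : N →ₗ[A] Tw Δ M) :
    ∃ f : Tw Δ N →ₗ[A] M, ∀ x, f x = Tw.uncurry z h x

theorem Tw.exists_lift {A : Type} [Ring A] [Algebra ℂ A] {z : ℂ} (hz : z ≠ 0)
    {Δ : A →ₐ[ℂ] Matrix (Fin 2) (Fin 2) A} [IsSelfAdjoint z Δ]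
    (Z N M : Type) [AddCommGroup Z] [Module ℂ Z] [Module A Z] [IsScalarTower ℂ A Z]
    [AddCommGroup N] [Module ℂ N] [Module A N] [IsScalarTower ℂ A N]
    [AddCommGroup M] [Module ℂ M] [Module A M] [IsScalarTower ℂ A M]
    (g : M →ₗ[A] N)
    (hZ : ∀ f : Z →ₗ[A] Tw Δ N, ∃ h : Z →ₗ[A] Tw Δ M, Tw.map g ∘ₗ h = f) (f : Tw Δ Z →ₗ[A] N) :
    ∃ h : Tw Δ Z →ₗ[A] M, g ∘ₗ h = f := by
  obtain ⟨f', hf'⟩ := IsSelfAdjoint.curry_smul (z := z) Z N f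
  obtain ⟨h', hh'⟩ := hZ f'
  obtain ⟨h, hh⟩ := IsSelfAdjoint.uncurry_smul (z := z) Z M h'
  refine ⟨h, LinearMap.ext fun u => ?_⟩
  have e1 (x : Z) : g (h' x).1 = f (Tw.mk Δ 0 x) := by
    rw [← Tw.map_fst, ← LinearMap.comp_apply, hh', hf', Tw.curry_fst]
  have e2 (x : Z) : g (h' x).2 = -z • f (Tw.mk Δ x 0) := by
    rw [← Tw.map_snd, ← LinearMap.comp_apply, hh', hf', Tw.curry_snd]
  rw [LinearMap.comp_apply, hh, Tw.uncurry_apply, map_add, LinearMap.map_smul_of_tower, e1, e2,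
    smul_smul, neg_mul_neg, inv_mul_cancel₀ hz, one_smul, ← map_add]
  congr 1
  exact Tw.ext (add_zero _) (zero_add _)

end adjoint

end QSl2

end

noncomputable section

namespace QSl2

open QuantumTriple

section adjoint

variable {p : ℕ} [hp : Fact (2 ≤ p)]

theorem Tw.mk_eq_add {A : Type*} [Ring A] [Algebra ℂ A] {Δ : A →ₐ[ℂ] Matrix (Fin 2) (Fin 2) A}
    {N : Type*} [AddCommGroup N] (x y : N) : mk Δ x y = mk Δ x 0 + mk Δ 0 y :=
  ext (add_zero _).symm (zero_add _).symm

theorem Tw.mk_eq {A : Type*} [Ring A] [Algebra ℂ A] {Δ : A →ₐ[ℂ] Matrix (Fin 2) (Fin 2) A}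
    {N : Type*} [AddCommGroup N] (u : Tw Δ N) : u = mk Δ u.1 u.2 := rfl

instance : IsSelfAdjoint (q p) (Lusztig.coprod p) where
  curry_smul N M _ _ _ _ _ _ _ _ f := by
    have hq := q_ne_zero p
    obtain ⟨f1, hf1⟩ : ∃ f1 : N →ₗ[ℂ] M, ∀ x, f1 x = f (Tw.mk (Lusztig.coprod p) x 0) :=
      ⟨f.restrictScalars ℂ ∘ₗ (LinearMap.inl ℂ N N : N →ₗ[ℂ] Tw (Lusztig.coprod p) N), fun _ => rfl⟩
    obtain ⟨f2, hf2⟩ : ∃ f2 : N →ₗ[ℂ] M, ∀ x, f2 x = f (Tw.mk (Lusztig.coprod p) 0 x) :=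
      ⟨f.restrictScalars ℂ ∘ₗ (LinearMap.inr ℂ N N : N →ₗ[ℂ] Tw (Lusztig.coprod p) N), fun _ => rfl⟩
    have hf (x y : N) : f (Tw.mk (Lusztig.coprod p) x y) = f1 x + f2 y := by
      rw [hf1, hf2, ← map_add, ← Tw.mk_eq_add]
    have E1 (n : ℕ) (x : N) : Lusztig.dE p n • f1 x = q p ^ n • f1 (Lusztig.dE p n • x) := by
      cases n with
      | zero => simp [Lusztig.dE_zero]
      | succ n => rw [hf1, ← map_smul, Lusztig.dE_smul_tw, hf]; simp
    have E2 (n : ℕ) (x : N) : Lusztig.dE p (n + 1) • f2 x =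
        (q p)⁻¹ ^ (n + 1) • f2 (Lusztig.dE p (n + 1) • x) + f1 (Lusztig.dE p n • x) := by
      rw [hf2, ← map_smul, Lusztig.dE_smul_tw, hf]; simp [add_comm]
    have F1 (n : ℕ) (x : N) : Lusztig.dF p (n + 1) • f1 x = f1 (Lusztig.dF p (n + 1) • x) +
        q p ^ n • f2 (Lusztig.dF p n • Lusztig.Ki p • x) := by
      rw [hf1, ← map_smul, Lusztig.dF_smul_tw, hf]; simp
    have F2 (n : ℕ) (x : N) : Lusztig.dF p n • f2 x = f2 (Lusztig.dF p n • x) := by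
      cases n with
      | zero => simp [Lusztig.dF_zero]
      | succ n => rw [hf2, ← map_smul, Lusztig.dF_smul_tw, hf]; simp
    have K1 (x : N) : Lusztig.K p • f1 x = q p • f1 (Lusztig.K p • x) := by
      rw [hf1, ← map_smul, Lusztig.K_smul_tw, hf]; simp
    have K2 (x : N) : Lusztig.K p • f2 x = (q p)⁻¹ • f2 (Lusztig.K p • x) := by
      rw [hf2, ← map_smul, Lusztig.K_smul_tw, hf]; simp
    have L1 (x : N) : Lusztig.Ki p • f1 x = (q p)⁻¹ • f1 (Lusztig.Ki p • x) := by
      rw [hf1, ← map_smul, Lusztig.Ki_smul_tw, hf]; simp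
    have L2 (x : N) : Lusztig.Ki p • f2 x = q p • f2 (Lusztig.Ki p • x) := by
      rw [hf2, ← map_smul, Lusztig.Ki_smul_tw, hf]; simp
    have hc (x : N) : Tw.curry (q p) f x = Tw.mk _ (f2 x) (-q p • f1 x) := by rw [hf1, hf2]; rfl
    refine ⟨Lusztig.mkLinear (Tw.curry (q p) f) (fun x => ?_) (fun x => ?_) (fun n x => ?_)
      (fun n x => ?_), fun x => rfl⟩
    · rw [hc, hc, Lusztig.K_smul_tw, K2, smul_comm (Lusztig.K p), K1]
      congr 1 <;> match_scalars <;> field_simp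
    · rw [hc, hc, Lusztig.Ki_smul_tw, L2, smul_comm (Lusztig.Ki p), L1]
      congr 1 <;> match_scalars <;> field_simp
    · rw [hc, hc, Lusztig.dE_smul_tw, E2, smul_comm (Lusztig.dE p n), smul_comm (Lusztig.dE p _),
        E1, E1]
      simp only [inv_pow]
      congr 1 <;> match_scalars <;> field_simp <;> ring
    · rw [hc, hc, Lusztig.dF_smul_tw, F2, L2, smul_comm (Lusztig.dF p n) (q p), F2,
        smul_comm (Lusztig.dF p _) (-q p), F1]
      congr 1; match_scalars <;> field_simp; ring
  uncurry_smul N M _ _ _ _ _ _ _ _ h := by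
    have hq := q_ne_zero p
    obtain ⟨h1, hh1⟩ : ∃ h1 : N →ₗ[ℂ] M, ∀ x, h1 x = (h x).1 :=
      ⟨LinearMap.fst ℂ M M ∘ₗ (h.restrictScalars ℂ : N →ₗ[ℂ] M × M), fun _ => rfl⟩
    obtain ⟨h2, hh2⟩ : ∃ h2 : N →ₗ[ℂ] M, ∀ x, h2 x = (h x).2 :=
      ⟨LinearMap.snd ℂ M M ∘ₗ (h.restrictScalars ℂ : N →ₗ[ℂ] M × M), fun _ => rfl⟩
    have hh (x : N) : h x = Tw.mk _ (h1 x) (h2 x) := by rw [hh1, hh2]; rfl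
    have E1 (n : ℕ) (x : N) : h1 (Lusztig.dE p (n + 1) • x) =
        q p ^ (n + 1) • Lusztig.dE p (n + 1) • h1 x + Lusztig.dE p n • h2 x := by
      rw [hh1, map_smul, hh, Lusztig.dE_smul_tw]; rfl
    have E2 (n : ℕ) (x : N) : h2 (Lusztig.dE p n • x) =
        (q p)⁻¹ ^ n • Lusztig.dE p n • h2 x := by
      cases n with
      | zero => simp [Lusztig.dE_zero]
      | succ n => rw [hh2, map_smul, hh, Lusztig.dE_smul_tw]; rfl
    have F1 (n : ℕ) (x : N) : h1 (Lusztig.dF p n • x) = Lusztig.dF p n • h1 x := by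
      cases n with
      | zero => simp [Lusztig.dF_zero]
      | succ n => rw [hh1, map_smul, hh, Lusztig.dF_smul_tw]; rfl
    have F2 (n : ℕ) (x : N) : h2 (Lusztig.dF p (n + 1) • x) =
        q p ^ n • Lusztig.dF p n • Lusztig.Ki p • h1 x + Lusztig.dF p (n + 1) • h2 x := by
      rw [hh2, map_smul, hh, Lusztig.dF_smul_tw]; rfl
    have K1 (x : N) : h1 (Lusztig.K p • x) = q p • Lusztig.K p • h1 x := by
      rw [hh1, map_smul, hh, Lusztig.K_smul_tw]; rfl
    have K2 (x : N) : h2 (Lusztig.K p • x) = (q p)⁻¹ • Lusztig.K p • h2 x := by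
      rw [hh2, map_smul, hh, Lusztig.K_smul_tw]; rfl
    have L1 (x : N) : h1 (Lusztig.Ki p • x) = (q p)⁻¹ • Lusztig.Ki p • h1 x := by
      rw [hh1, map_smul, hh, Lusztig.Ki_smul_tw]; rfl
    have L2 (x : N) : h2 (Lusztig.Ki p • x) = q p • Lusztig.Ki p • h2 x := by
      rw [hh2, map_smul, hh, Lusztig.Ki_smul_tw]; rfl
    have hc (x y : N) : Tw.uncurry (q p) h (Tw.mk _ x y) = -(q p)⁻¹ • h2 x + h1 y := by
      rw [hh1, hh2]; rfl
    refine ⟨Lusztig.mkLinear (Tw.uncurry (q p) h) (fun u => ?_) (fun u => ?_) (fun n u => ?_)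
      (fun n u => ?_), fun x => rfl⟩ <;> rw [Tw.mk_eq u] <;> generalize u.1 = x <;>
      generalize u.2 = y
    · rw [Lusztig.K_smul_tw, hc, hc, h2.map_smul, h1.map_smul, K1, K2, smul_add,
        smul_comm (Lusztig.K p)]
      generalize Lusztig.K p • h2 x = a0
      generalize Lusztig.K p • h1 y = a1
      match_scalars <;> field_simp
    · rw [Lusztig.Ki_smul_tw, hc, hc, h2.map_smul, h1.map_smul, L1, L2, smul_add,
        smul_comm (Lusztig.Ki p)]
      generalize Lusztig.Ki p • h2 x = a0
      generalize Lusztig.Ki p • h1 y = a1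
      match_scalars <;> field_simp
    · rw [Lusztig.dE_smul_tw, hc, hc, map_add, h2.map_smul, h1.map_smul, E1, E2, E2,
        smul_add (Lusztig.dE p _), smul_comm (Lusztig.dE p _) (-(q p)⁻¹)]
      simp only [inv_pow]
      generalize Lusztig.dE p (n + 1) • h2 x = a0
      generalize Lusztig.dE p (n + 1) • h1 y = a1
      generalize Lusztig.dE p n • h2 y = a2
      match_scalars <;> field_simp <;> ring
    · rw [Lusztig.dF_smul_tw, hc, hc, h1.map_add, h1.map_smul, F1, F1, F2, L1,
        smul_comm (Lusztig.dF p n) (q p)⁻¹, smul_add (Lusztig.dF p _),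
        smul_comm (Lusztig.dF p _) (-(q p)⁻¹)]
      generalize Lusztig.dF p (n + 1) • h2 x = a0
      generalize Lusztig.dF p (n + 1) • h1 y = a1
      generalize Lusztig.dF p n • Lusztig.Ki p • h1 x = a2
      match_scalars <;> field_simp <;> ring

instance : IsSelfAdjoint (q p) (SmallQG.coprod p) where
  curry_smul N M _ _ _ _ _ _ _ _ f := by
    have hq := q_ne_zero p
    obtain ⟨f1, hf1⟩ : ∃ f1 : N →ₗ[ℂ] M, ∀ x, f1 x = f (Tw.mk (SmallQG.coprod p) x 0) :=
      ⟨f.restrictScalars ℂ ∘ₗ (LinearMap.inl ℂ N N : N →ₗ[ℂ] Tw (SmallQG.coprod p) N), fun _ => rfl⟩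
    obtain ⟨f2, hf2⟩ : ∃ f2 : N →ₗ[ℂ] M, ∀ x, f2 x = f (Tw.mk (SmallQG.coprod p) 0 x) :=
      ⟨f.restrictScalars ℂ ∘ₗ (LinearMap.inr ℂ N N : N →ₗ[ℂ] Tw (SmallQG.coprod p) N), fun _ => rfl⟩
    have hf (x y : N) : f (Tw.mk (SmallQG.coprod p) x y) = f1 x + f2 y := by
      rw [hf1, hf2, ← map_add, ← Tw.mk_eq_add]
    have E1 (x : N) : SmallQG.gen p .E • f1 x = q p • f1 (SmallQG.gen p .E • x) := by
      rw [hf1, ← map_smul, SmallQG.E_smul_tw, hf]; simp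
    have E2 (x : N) : SmallQG.gen p .E • f2 x = (q p)⁻¹ • f2 (SmallQG.gen p .E • x) + f1 x := by
      rw [hf2, ← map_smul, SmallQG.E_smul_tw, hf]; simp [add_comm]
    have F1 (x : N) : SmallQG.gen p .F • f1 x = f1 (SmallQG.gen p .F • x) +
        f2 (SmallQG.gen p .Ki • x) := by
      rw [hf1, ← map_smul, SmallQG.F_smul_tw, hf]; simp
    have F2 (x : N) : SmallQG.gen p .F • f2 x = f2 (SmallQG.gen p .F • x) := by
      rw [hf2, ← map_smul, SmallQG.F_smul_tw, hf]; simp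
    have K1 (x : N) : SmallQG.gen p .K • f1 x = q p • f1 (SmallQG.gen p .K • x) := by
      rw [hf1, ← map_smul, SmallQG.K_smul_tw, hf]; simp
    have K2 (x : N) : SmallQG.gen p .K • f2 x = (q p)⁻¹ • f2 (SmallQG.gen p .K • x) := by
      rw [hf2, ← map_smul, SmallQG.K_smul_tw, hf]; simp
    have L1 (x : N) : SmallQG.gen p .Ki • f1 x = (q p)⁻¹ • f1 (SmallQG.gen p .Ki • x) := by
      rw [hf1, ← map_smul, SmallQG.Ki_smul_tw, hf]; simp
    have L2 (x : N) : SmallQG.gen p .Ki • f2 x = q p • f2 (SmallQG.gen p .Ki • x) := by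
      rw [hf2, ← map_smul, SmallQG.Ki_smul_tw, hf]; simp
    have hc (x : N) : Tw.curry (q p) f x = Tw.mk _ (f2 x) (-q p • f1 x) := by rw [hf1, hf2]; rfl
    refine ⟨SmallQG.mkLinear (Tw.curry (q p) f) (fun g x => ?_), fun x => rfl⟩
    cases g <;> rw [hc, hc]
    · rw [SmallQG.E_smul_tw, E2, smul_comm (SmallQG.gen p _), E1]
      congr 1 <;> match_scalars <;> field_simp <;> ring
    · rw [SmallQG.F_smul_tw, F2, L2, smul_comm (SmallQG.gen p _), F1]
      congr 1; match_scalars <;> field_simp; ring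
    · rw [SmallQG.K_smul_tw, K2, smul_comm (SmallQG.gen p _), K1]
      congr 1 <;> match_scalars <;> field_simp
    · rw [SmallQG.Ki_smul_tw, L2, smul_comm (SmallQG.gen p _), L1]
      congr 1 <;> match_scalars <;> field_simp
  uncurry_smul N M _ _ _ _ _ _ _ _ h := by
    have hq := q_ne_zero p
    obtain ⟨h1, hh1⟩ : ∃ h1 : N →ₗ[ℂ] M, ∀ x, h1 x = (h x).1 :=
      ⟨LinearMap.fst ℂ M M ∘ₗ (h.restrictScalars ℂ : N →ₗ[ℂ] M × M), fun _ => rfl⟩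
    obtain ⟨h2, hh2⟩ : ∃ h2 : N →ₗ[ℂ] M, ∀ x, h2 x = (h x).2 :=
      ⟨LinearMap.snd ℂ M M ∘ₗ (h.restrictScalars ℂ : N →ₗ[ℂ] M × M), fun _ => rfl⟩
    have hh (x : N) : h x = Tw.mk _ (h1 x) (h2 x) := by rw [hh1, hh2]; rfl
    have E1 (x : N) : h1 (SmallQG.gen p .E • x) = q p • SmallQG.gen p .E • h1 x + h2 x := by
      rw [hh1, map_smul, hh, SmallQG.E_smul_tw]; rfl
    have E2 (x : N) : h2 (SmallQG.gen p .E • x) = (q p)⁻¹ • SmallQG.gen p .E • h2 x := by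
      rw [hh2, map_smul, hh, SmallQG.E_smul_tw]; rfl
    have F1 (x : N) : h1 (SmallQG.gen p .F • x) = SmallQG.gen p .F • h1 x := by
      rw [hh1, map_smul, hh, SmallQG.F_smul_tw]; rfl
    have F2 (x : N) : h2 (SmallQG.gen p .F • x) =
        SmallQG.gen p .Ki • h1 x + SmallQG.gen p .F • h2 x := by
      rw [hh2, map_smul, hh, SmallQG.F_smul_tw]; rfl
    have K1 (x : N) : h1 (SmallQG.gen p .K • x) = q p • SmallQG.gen p .K • h1 x := by
      rw [hh1, map_smul, hh, SmallQG.K_smul_tw]; rfl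
    have K2 (x : N) : h2 (SmallQG.gen p .K • x) = (q p)⁻¹ • SmallQG.gen p .K • h2 x := by
      rw [hh2, map_smul, hh, SmallQG.K_smul_tw]; rfl
    have L1 (x : N) : h1 (SmallQG.gen p .Ki • x) = (q p)⁻¹ • SmallQG.gen p .Ki • h1 x := by
      rw [hh1, map_smul, hh, SmallQG.Ki_smul_tw]; rfl
    have L2 (x : N) : h2 (SmallQG.gen p .Ki • x) = q p • SmallQG.gen p .Ki • h2 x := by
      rw [hh2, map_smul, hh, SmallQG.Ki_smul_tw]; rfl
    have hc (x y : N) : Tw.uncurry (q p) h (Tw.mk _ x y) = -(q p)⁻¹ • h2 x + h1 y := by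
      rw [hh1, hh2]; rfl
    refine ⟨SmallQG.mkLinear (Tw.uncurry (q p) h) (fun g u => ?_), fun x => rfl⟩
    rw [Tw.mk_eq u]
    generalize u.1 = x
    generalize u.2 = y
    cases g
    · rw [SmallQG.E_smul_tw, hc, hc, map_add, h2.map_smul, h1.map_smul, E1, E2,
        smul_add (SmallQG.gen p _), smul_comm (SmallQG.gen p _) (-(q p)⁻¹)]
      generalize SmallQG.gen p .E • h2 x = a0
      generalize SmallQG.gen p .E • h1 y = a1
      match_scalars <;> field_simp <;> ring
    · rw [SmallQG.F_smul_tw, hc, hc, h1.map_add, F1, F2, L1, smul_add (SmallQG.gen p _),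
        smul_comm (SmallQG.gen p _) (-(q p)⁻¹)]
      generalize SmallQG.gen p .F • h2 x = a0
      generalize SmallQG.gen p .F • h1 y = a1
      generalize SmallQG.gen p .Ki • h1 x = a2
      match_scalars <;> field_simp <;> ring
    · rw [SmallQG.K_smul_tw, hc, hc, h2.map_smul, h1.map_smul, K1, K2, smul_add,
        smul_comm (SmallQG.gen p _)]
      generalize SmallQG.gen p .K • h2 x = a0
      generalize SmallQG.gen p .K • h1 y = a1
      match_scalars <;> field_simp
    · rw [SmallQG.Ki_smul_tw, hc, hc, h2.map_smul, h1.map_smul, L1, L2, smul_add,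
        smul_comm (SmallQG.gen p _)]
      generalize SmallQG.gen p .Ki • h2 x = a0
      generalize SmallQG.gen p .Ki • h1 y = a1
      match_scalars <;> field_simp

end adjoint

end QSl2

end

noncomputable section

namespace QSl2

open QPlane OneForm

theorem neg_one_pow_congr {a b : ℕ} (h : Even a ↔ Even b) : (-1 : ℂ) ^ a = (-1) ^ b := by
  by_cases ha : Even a
  · rw [ha.neg_one_pow, (h.1 ha).neg_one_pow]
  · rw [(Nat.not_even_iff_odd.1 ha).neg_one_pow,
      (Nat.not_even_iff_odd.1 (fun hb => ha (h.2 hb))).neg_one_pow]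

theorem neg_one_zpow_eq (M N p m n : ℕ) :
    (-1 : ℂ) ^ (((M : ℤ) + N - 1) * p + m + n) = (-1) ^ ((M + N + 1) * p + m + n) := by
  have : ((M : ℤ) + N - 1) * p + m + n = (((M + N + 1) * p + m + n : ℕ) : ℤ) - 2 * p := by
    push_cast; ring
  rw [this, zpow_sub₀ (by norm_num), zpow_natCast, zpow_mul]
  norm_num

variable (p : ℕ)

/-- The coefficient with which `X^M` is a multiple of `x^(Mp)`. -/
def frobCoeff : ℕ → ℂ
  | 0 => 1
  | M + 1 => frobCoeff M * ((M + 1) * (-1) ^ (M * p))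

theorem frobCoeff_ne_zero (M : ℕ) : frobCoeff p M ≠ 0 := by
  induction M with
  | zero => exact one_ne_zero
  | succ M ih =>
    refine mul_ne_zero ih (mul_ne_zero ?_ (pow_ne_zero _ (by norm_num)))
    exact_mod_cast M.succ_ne_zero

variable [hp : Fact (2 ≤ p)]

theorem qBinom_p_mul (M : ℕ) : qBinom (q p) ((M + 1) * p) p = (M + 1) * (-1) ^ (M * p) := by
  have := qBinom_p_right hp.out (M + 1) 0 (by have := hp.out; omega)
  rw [add_zero] at this
  rw [this]
  push_cast
  congr 1
  apply neg_one_pow_congr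
  simp [Nat.even_add, Nat.even_mul, Nat.even_add_one]

theorem X_pow (M : ℕ) : X p ^ M = frobCoeff p M • xy p (M * p) 0 := by
  induction M with
  | zero => simp [frobCoeff, one_def]
  | succ M ih =>
    rw [pow_succ, ih, smul_mul_assoc, X, xd, mul_def, mulMap_xy, smul_smul, frobCoeff]
    have h := qBinom_symm (q_ne_zero p) (q_sub_inv_ne_zero p hp.out) (M * p) p
    have h2 := qBinom_p_mul p M
    rw [add_mul M 1 p, one_mul] at h2 ⊢
    rw [h, h2, zero_mul, pow_zero, qBinom_zero_right, one_mul, mul_one]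

theorem Y_pow (M : ℕ) : Y p ^ M = frobCoeff p M • xy p 0 (M * p) := by
  induction M with
  | zero => simp [frobCoeff, one_def]
  | succ M ih =>
    rw [pow_succ, ih, smul_mul_assoc, Y, yd, mul_def, mulMap_xy, smul_smul, frobCoeff]
    have h := qBinom_symm (q_ne_zero p) (q_sub_inv_ne_zero p hp.out) (M * p) p
    have h2 := qBinom_p_mul p M
    rw [add_mul M 1 p, one_mul] at h2 ⊢
    rw [h, h2, mul_zero, pow_zero, qBinom_zero_right, one_mul, one_mul]

theorem frob_eq (M N m n : ℕ) (hm : m < p) (hn : n < p) : frob p M N m n =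
    (frobCoeff p M * frobCoeff p N * (-1) ^ ((M + N) * m + N * n)) •
      xyZ p ((M : ℤ) * p + m) ((N : ℤ) * p + n) := by
  have hq : q p ^ (N * p * m) = (-1) ^ (N * m) := by
    rw [mul_right_comm, mul_comm, pow_mul, q_pow_p p (by omega)]
  have e : xyZ p ((M : ℤ) * p + m) ((N : ℤ) * p + n) = xy p (M * p + m) (N * p + n) := by
    rw [← xyZ_natCast]; push_cast; rfl
  rw [frob, X_pow, Y_pow, smul_mul_assoc, smul_mul_assoc, smul_mul_assoc, mul_smul_comm,
    smul_mul_assoc, smul_mul_assoc, mul_def p (xy p (M * p) 0), mulMap_xy, smul_mul_assoc,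
    smul_mul_assoc, xd, mul_def p _ (xy p m 0), zero_add, mulMap_xy, smul_mul_assoc, yd, mul_def,
    mulMap_xy, e]
  simp only [add_zero, zero_add, zero_mul, mul_zero, pow_zero, qBinom_zero_right, qBinom_self,
    smul_smul, one_mul, mul_one]
  rw [qBinom_mul_p_right hp.out _ _ hm, qBinom_mul_p_right hp.out _ _ hn, hq]
  congr 1; ring

theorem qBinom_add_p_p (M m : ℕ) (hm : m < p) :
    qBinom (q p) ((M : ℤ) * p + m + p).toNat p = (M + 1) * (-1) ^ (M * p + m) := by
  have : ((M : ℤ) * p + m + p).toNat = (M + 1) * p + m := by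
    rw [← Int.toNat_natCast ((M + 1) * p + m)]; congr 1; push_cast; ring
  rw [this, qBinom_p_right hp.out _ _ hm]
  push_cast
  congr 1
  apply neg_one_pow_congr
  simp [Nat.even_add, Nat.even_mul, Nat.even_add_one]

theorem divE_frob_zero (M m n : ℕ) (hm : m < p) (hn : n < p) :
    opEd p p (frob p M 0 m n) = 0 := by
  rw [frob_eq p _ _ _ _ hm hn, map_smul, opEd_xyZ, xyZ_of_neg p (by right; push_cast; omega), smul_zero,
    smul_zero]

theorem divE_frob_succ (M N m n : ℕ) (hm : m < p) (hn : n < p) :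
    opEd p p (frob p M (N + 1) m n) =
      ((N + 1) * (-1) ^ (N * p + n + m) : ℂ) • frob p (M + 1) N m n := by
  rw [frob_eq p _ _ _ _ hm hn, frob_eq p _ _ _ _ hm hn, map_smul, opEd_xyZ,
    qBinom_add_p_p p M m hm, smul_smul, smul_smul]
  congr 1
  · simp only [frobCoeff]
    have : (-1 : ℂ) ^ (N * p) * (-1) ^ ((M + (N + 1)) * m + (N + 1) * n) * (-1) ^ (M * p + m) =
        (-1) ^ (N * p + n + m) * (-1) ^ (M * p) * (-1) ^ ((M + 1 + N) * m + N * n) := by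
      simp only [← pow_add]
      apply neg_one_pow_congr
      simp only [Nat.even_add, Nat.even_mul, Nat.even_add_one]
      grind
    linear_combination (frobCoeff p M * frobCoeff p N * (M + 1) * (N + 1)) * this
  · congr 1 <;> push_cast <;> ring

theorem divF_frob_zero (N m n : ℕ) (hm : m < p) (hn : n < p) :
    opFd p p (frob p 0 N m n) = 0 := by
  rw [frob_eq p _ _ _ _ hm hn, map_smul, opFd_xyZ, xyZ_of_neg p (by left; push_cast; omega), smul_zero,
    smul_zero]

theorem divF_frob_succ (M N m n : ℕ) (hm : m < p) (hn : n < p) :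
    opFd p p (frob p (M + 1) N m n) =
      ((M + 1) * (-1) ^ (M * p) : ℂ) • frob p M (N + 1) m n := by
  rw [frob_eq p _ _ _ _ hm hn, frob_eq p _ _ _ _ hm hn, map_smul, opFd_xyZ,
    qBinom_add_p_p p N n hn, smul_smul, smul_smul]
  congr 1
  · simp only [frobCoeff]
    have : (-1 : ℂ) ^ (M * p) * (-1) ^ ((M + 1 + N) * m + N * n) * (-1) ^ (N * p + n) =
        (-1) ^ (M * p) * (-1) ^ (N * p) * (-1) ^ ((M + (N + 1)) * m + (N + 1) * n) := by
      simp only [← pow_add]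
      apply neg_one_pow_congr
      simp only [Nat.even_add, Nat.even_mul, Nat.even_add_one]
      grind
    linear_combination (frobCoeff p M * frobCoeff p N * (M + 1) * (N + 1)) * this
  · congr 1 <;> push_cast <;> ring

theorem divE_frob (M N m n : ℕ) (hm : m < p) (hn : n < p) : opEd p p (frob p M N m n) =
    (N * (-1) ^ ((N - 1) * p + n + m) : ℂ) • frob p (M + 1) (N - 1) m n := by
  cases N with
  | zero => rw [divE_frob_zero p _ _ _ hm hn]; simp
  | succ N => rw [divE_frob_succ p _ _ _ _ hm hn]; simp

theorem divF_frob (M N m n : ℕ) (hm : m < p) (hn : n < p) : opFd p p (frob p M N m n) =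
    (M * (-1) ^ ((M - 1) * p) : ℂ) • frob p (M - 1) (N + 1) m n := by
  cases M with
  | zero => rw [divF_frob_zero p _ _ _ hm hn]; simp
  | succ N => rw [divF_frob_succ p _ _ _ _ hm hn]; simp

theorem 𝓔_smul_frob (M N m n : ℕ) (hm : m < p) (hn : n < p) : Lusztig.𝓔 p • frob p M N m n =
    (N * (-1) ^ ((N - 1) * p + n + m) : ℂ) • frob p (M + 1) (N - 1) m n :=
  (QPlane.dE_smul p p _).trans (divE_frob p M N m n hm hn)

theorem 𝓕_smul_frob (M N m n : ℕ) (hm : m < p) (hn : n < p) : Lusztig.𝓕 p • frob p M N m n =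
    (M * (-1) ^ ((M - 1) * p) : ℂ) • frob p (M - 1) (N + 1) m n :=
  (QPlane.dF_smul p p _).trans (divF_frob p M N m n hm hn)

theorem commutator_smul_frob (M N m n : ℕ) (hm : m < p) (hn : n < p) :
    (Lusztig.𝓔 p * Lusztig.𝓕 p - Lusztig.𝓕 p * Lusztig.𝓔 p) • frob p M N m n =
      ((-1) ^ (((M : ℤ) + N - 1) * p + m + n) * ((M : ℂ) - N)) • frob p M N m n := by
  have h1 : Lusztig.𝓔 p • Lusztig.𝓕 p • frob p M N m n =
      ((-1) ^ ((M + N + 1) * p + m + n) * (M * (N + 1)) : ℂ) • frob p M N m n := by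
    rw [𝓕_smul_frob p _ _ _ _ hm hn, smul_comm, 𝓔_smul_frob p _ _ _ _ hm hn, smul_smul]
    cases M with
    | zero => simp
    | succ M =>
      congr 1
      have : (-1 : ℂ) ^ (M * p) * (-1) ^ (N * p + n + m) =
          (-1) ^ ((M + 1 + N + 1) * p + m + n) := by
        rw [← pow_add]
        apply neg_one_pow_congr
        simp only [Nat.even_add, Nat.even_mul, Nat.even_add_one]
        grind
      simp only [Nat.add_sub_cancel]
      push_cast
      linear_combination ((M + 1) * (N + 1) : ℂ) * this
  have h2 : Lusztig.𝓕 p • Lusztig.𝓔 p • frob p M N m n =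
      ((-1) ^ ((M + N + 1) * p + m + n) * (N * (M + 1)) : ℂ) • frob p M N m n := by
    rw [𝓔_smul_frob p _ _ _ _ hm hn, smul_comm, 𝓕_smul_frob p _ _ _ _ hm hn, smul_smul]
    cases N with
    | zero => simp
    | succ N =>
      congr 1
      have : (-1 : ℂ) ^ (M * p) * (-1) ^ (N * p + n + m) =
          (-1) ^ ((M + (N + 1) + 1) * p + m + n) := by
        rw [← pow_add]
        apply neg_one_pow_congr
        simp only [Nat.even_add, Nat.even_mul, Nat.even_add_one]
        grind
      simp only [Nat.add_sub_cancel]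
      push_cast
      linear_combination ((M + 1) * (N + 1) : ℂ) * this
  rw [sub_smul, mul_smul, mul_smul, h1, h2, ← sub_smul, neg_one_zpow_eq]
  congr 1; ring

theorem OneForm.neg_mk (f g : QPlane p) : -OneForm.mk p f g = OneForm.mk p (-f) (-g) := rfl

theorem smul_ξ (f : QPlane p) : f • ξ p = OneForm.mk p f 0 := by
  refine Prod.ext (mul_one f) (mul_zero f)

theorem smul_η (f : QPlane p) : f • η p = OneForm.mk p 0 f := by
  refine Prod.ext (mul_zero f) (mul_one f)

theorem 𝓔_smul_mk (f g : QPlane p) : Lusztig.𝓔 p • OneForm.mk p f g =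
    OneForm.mk p (-opEd p p f + opEd p (p - 1) g) (-opEd p p g) := by
  obtain ⟨n, hn⟩ : ∃ n, p = n + 1 := ⟨p - 1, by have := hp.out; omega⟩
  have h := OneForm.dE_smul_mk p n f g
  rw [← hn, q_pow_p p (by omega), inv_pow, q_pow_p p (by omega)] at h
  refine h.trans ?_
  rw [QPlane.dE_smul, QPlane.dE_smul, QPlane.dE_smul, show p - 1 = n by omega]
  norm_num [neg_smul]

theorem 𝓕_smul_mk (f g : QPlane p) : Lusztig.𝓕 p • OneForm.mk p f g =
    OneForm.mk p (opFd p p f) (q p ^ (p - 1) • opFd p (p - 1) (opKi p f) + opFd p p g) := by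
  obtain ⟨n, hn⟩ : ∃ n, p = n + 1 := ⟨p - 1, by have := hp.out; omega⟩
  have h := OneForm.dF_smul_mk p n f g
  rw [← hn] at h
  refine h.trans ?_
  rw [QPlane.dF_smul, QPlane.dF_smul, QPlane.dF_smul, QPlane.Ki_smul, show p - 1 = n by omega]

theorem qBinom_add_p_sub_one (M m : ℕ) (hm : m < p) :
    qBinom (q p) ((M : ℤ) * p + m + (p - 1 : ℕ)).toNat (p - 1) =
      if m = 0 then (-1) ^ (M * (p - 1)) else 0 := by
  have hp := hp.out
  split_ifs with h
  · subst h
    have : ((M : ℤ) * p + (0 : ℕ) + (p - 1 : ℕ)).toNat = M * p + (p - 1) := by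
      rw [← Int.toNat_natCast (M * p + (p - 1))]; congr 1
    rw [this, qBinom_mul_p_add hp _ _ _ (by omega), qBinom_self, mul_one]
  · have : ((M : ℤ) * p + m + (p - 1 : ℕ)).toNat = (M + 1) * p + (m - 1) := by
      rw [← Int.toNat_natCast ((M + 1) * p + (m - 1))]; congr 1; push_cast
      rw [Nat.cast_sub (by omega), Nat.cast_sub (by omega)]; push_cast; ring
    rw [this, qBinom_mul_p_add hp _ _ _ (by omega), qBinom_of_lt _ _ _ (by omega), mul_zero]

theorem opEd_sub_one_frob (M N m n : ℕ) (hm : m < p) (hn : n < p) :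
    opEd p (p - 1) (frob p M N m n) =
      if m = 0 then
        if n = p - 1 then frob p M N (p - 1) 0
        else (N * (-1) ^ n : ℂ) • frob p M (N - 1) (p - 1) (n + 1)
      else 0 := by
  have hp' := hp.out
  rw [frob_eq p _ _ _ _ hm hn, map_smul, opEd_xyZ, qBinom_add_p_sub_one p M m hm, smul_smul]
  split_ifs with h1 h2
  · subst h1 h2
    rw [frob_eq p _ _ _ _ (by omega) (by omega)]
    congr 1
    · have : (-1 : ℂ) ^ ((M + N) * 0 + N * (p - 1)) * (-1) ^ (M * (p - 1)) =
          (-1) ^ ((M + N) * (p - 1) + N * 0) := by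
        rw [← pow_add]; congr 1; ring
      linear_combination (frobCoeff p M * frobCoeff p N) * this
    · congr 1 <;> push_cast [Nat.cast_sub (show 1 ≤ p by omega)] <;> ring
  · subst h1
    cases N with
    | zero =>
      rw [xyZ_of_neg p (by right; push_cast [Nat.cast_sub (show 1 ≤ p by omega)]; omega)]
      simp
    | succ N =>
      rw [frob_eq p _ _ _ _ (by omega) (by omega), smul_smul]
      congr 1
      · obtain ⟨r, rfl⟩ : ∃ r, p = r + 1 := ⟨p - 1, by omega⟩
        simp only [frobCoeff, Nat.add_sub_cancel]
        have : (-1 : ℂ) ^ (N * (r + 1)) * (-1) ^ ((M + (N + 1)) * 0 + (N + 1) * n) *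
              (-1) ^ (M * r) =
            (-1) ^ n * (-1) ^ ((M + N) * r + N * (n + 1)) := by
          simp only [← pow_add]
          apply neg_one_pow_congr
          simp only [Nat.even_add, Nat.even_mul, Nat.even_add_one]
          grind
        push_cast
        linear_combination (frobCoeff (r + 1) M * frobCoeff (r + 1) N * (N + 1)) * this
      · congr 1 <;> push_cast [Nat.cast_sub (show 1 ≤ p by omega)] <;> ring
  · simp

theorem opFd_sub_one_frob (M N m n : ℕ) (hm : m < p) (hn : n < p) :
    opFd p (p - 1) (frob p M N m n) =
      if n = 0 then
        if m = p - 1 then ((-1) ^ ((M + N) * (p - 1)) : ℂ) • frob p M N 0 (p - 1)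
        else (M * (-1) ^ ((M - 1) * (p + 1) + m + N) : ℂ) • frob p (M - 1) N (m + 1) (p - 1)
      else 0 := by
  have hp' := hp.out
  rw [frob_eq p _ _ _ _ hm hn, map_smul, opFd_xyZ, qBinom_add_p_sub_one p N n hn, smul_smul]
  split_ifs with h1 h2
  · subst h1 h2
    rw [frob_eq p _ _ _ _ (by omega) (by omega), smul_smul]
    congr 1
    · have : (-1 : ℂ) ^ ((M + N) * (p - 1) + N * 0) * (-1) ^ (N * (p - 1)) =
          (-1) ^ ((M + N) * (p - 1)) * (-1) ^ ((M + N) * 0 + N * (p - 1)) := by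
        simp
      linear_combination (frobCoeff p M * frobCoeff p N) * this
    · congr 1 <;> push_cast [Nat.cast_sub (show 1 ≤ p by omega)] <;> ring
  · subst h1
    cases M with
    | zero =>
      rw [xyZ_of_neg p (by left; push_cast [Nat.cast_sub (show 1 ≤ p by omega)]; omega)]
      simp
    | succ M =>
      rw [frob_eq p _ _ _ _ (by omega) (by omega), smul_smul]
      congr 1
      · obtain ⟨r, rfl⟩ : ∃ r, p = r + 1 := ⟨p - 1, by omega⟩
        simp only [frobCoeff, Nat.add_sub_cancel]
        have : (-1 : ℂ) ^ (M * (r + 1)) * (-1) ^ ((M + 1 + N) * m + N * 0) *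
              (-1) ^ (N * r) =
            (-1) ^ (M * (r + 1 + 1) + m + N) * (-1) ^ ((M + N) * (m + 1) + N * r) := by
          simp only [← pow_add]
          apply neg_one_pow_congr
          simp only [Nat.even_add, Nat.even_mul, Nat.even_add_one]
          grind
        push_cast
        linear_combination (frobCoeff (r + 1) M * frobCoeff (r + 1) N * (M + 1)) * this
      · congr 1 <;> push_cast [Nat.cast_sub (show 1 ≤ p by omega)] <;> ring
  · simp

theorem opKi_frob (M N m n : ℕ) (hm : m < p) (hn : n < p) : opKi p (frob p M N m n) =
    ((-1) ^ (M + N) * q p ^ ((n : ℤ) - m)) • frob p M N m n := by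
  rw [frob_eq p _ _ _ _ hm hn, map_smul, opKi_xyZ, smul_comm]
  congr 1
  rw [show (N : ℤ) * p + n - (M * p + m) = n - m + N * p - M * p by ring,
    q_zpow_sub_mul_p hp.out, q_zpow_add_mul_p hp.out]
  ring

theorem 𝓔_smul_frob_ξ (M N m n : ℕ) (hm : m < p) (hn : n < p) :
    Lusztig.𝓔 p • frob p M N m n • ξ p =
      (-(N * (-1) ^ ((N - 1) * p + n + m)) : ℂ) • frob p (M + 1) (N - 1) m n • ξ p := by
  rw [smul_ξ, smul_ξ, 𝓔_smul_mk, divE_frob p _ _ _ _ hm hn, OneForm.smul_mk]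
  simp

theorem 𝓔_smul_frob_η (M N m n : ℕ) (hm : m < p) (hn : n < p) :
    Lusztig.𝓔 p • frob p M N m n • η p =
      (-(N * (-1) ^ ((N - 1) * p + n + m)) : ℂ) • frob p (M + 1) (N - 1) m n • η p +
        (if m = 0 then
          if n = p - 1 then frob p M N (p - 1) 0 • ξ p
          else (N * (-1) ^ n : ℂ) • frob p M (N - 1) (p - 1) (n + 1) • ξ p
        else 0) := by
  simp only [smul_ξ, smul_η]
  rw [𝓔_smul_mk, divE_frob p _ _ _ _ hm hn, opEd_sub_one_frob p _ _ _ _ hm hn]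
  split_ifs <;> simp only [OneForm.smul_mk, OneForm.add_mk, map_zero, neg_zero, smul_zero, zero_add,
    add_zero, neg_smul, OneForm.neg_mk]

theorem 𝓕_smul_frob_ξ (M N m n : ℕ) (hm : m < p) (hn : n < p) :
    Lusztig.𝓕 p • frob p M N m n • ξ p =
      (M * (-1) ^ ((M - 1) * p) : ℂ) • frob p (M - 1) (N + 1) m n • ξ p +
        (if n = 0 then
          if m = p - 1 then ((-1) ^ ((M + N) * p) : ℂ) • frob p M N 0 (p - 1) • η p
          else (M * (-1) ^ ((M - 1) * p + m) * q p ^ (-(m : ℤ) - 1)) •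
            frob p (M - 1) N (m + 1) (p - 1) • η p
        else 0) := by
  have hp' := hp.out
  have hq (m : ℕ) : q p ^ (p - 1) * q p ^ (((0 : ℕ) : ℤ) - m) = -q p ^ (-(m : ℤ) - 1) := by
    rw [← zpow_natCast, ← zpow_add₀ (q_ne_zero p), Nat.cast_sub (by omega)]
    have := q_zpow_add_mul_p hp' (-(m : ℤ) - 1) 1
    rw [pow_one, neg_one_mul] at this
    rw [← this]; congr 1; push_cast; ring
  simp only [smul_ξ, smul_η]
  rw [𝓕_smul_mk, divF_frob p _ _ _ _ hm hn, opKi_frob p _ _ _ _ hm hn, map_smul,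
    opFd_sub_one_frob p _ _ _ _ hm hn]
  split_ifs with h1 h2
  · subst h1
    simp only [OneForm.smul_mk, OneForm.add_mk, map_zero, smul_zero, zero_add, add_zero, smul_smul]
    congr 2
    have h3 := hq m
    have h4 := q_zpow_add_mul_p hp' (-(m : ℤ) - 1) 1
    rw [h2, Nat.cast_sub (by omega), show -((p : ℤ) - (1 : ℕ)) - 1 + (1 : ℕ) * p = 0 by
      push_cast; ring, zpow_zero, pow_one] at h4
    have h5 : (-1 : ℂ) ^ (M + N) * (-1) ^ ((M + N) * (p - 1)) = (-1) ^ ((M + N) * p) := by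
      rw [← pow_add]; congr 1
      obtain ⟨r, rfl⟩ : ∃ r, p = r + 1 := ⟨p - 1, by omega⟩
      simp only [Nat.add_sub_cancel]; ring
    rw [h2, Nat.cast_sub (by omega)] at h3 ⊢
    linear_combination ((-1 : ℂ) ^ (M + N) * (-1) ^ ((M + N) * (p - 1))) * h3 -
      ((-1 : ℂ) ^ (M + N) * (-1) ^ ((M + N) * (p - 1))) * h4 + h5
  · subst h1
    simp only [OneForm.smul_mk, OneForm.add_mk, map_zero, smul_zero, zero_add, add_zero, smul_smul]
    congr 2
    cases M with
    | zero => simp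
    | succ M =>
      have h3 := hq m
      have h5 : (-1 : ℂ) ^ (M + 1 + N) * (-1) ^ (M * (p + 1) + m + N) =
          (-1) ^ (M * p + m + 1) := by
        rw [← pow_add]
        apply neg_one_pow_congr
        simp only [Nat.even_add, Nat.even_mul, Nat.even_add_one]
        grind
      simp only [Nat.add_sub_cancel]
      rw [pow_succ] at h5
      push_cast at h3 ⊢
      linear_combination ((-1 : ℂ) ^ (M + 1 + N) * (-1) ^ (M * (p + 1) + m + N) * (M + 1)) * h3 -
        ((M + 1) * q p ^ (-(m : ℤ) - 1)) * h5
  · simp [OneForm.smul_mk]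

theorem 𝓕_smul_frob_η (M N m n : ℕ) (hm : m < p) (hn : n < p) :
    Lusztig.𝓕 p • frob p M N m n • η p =
      (M * (-1) ^ ((M - 1) * p) : ℂ) • frob p (M - 1) (N + 1) m n • η p := by
  rw [smul_η, smul_η, 𝓕_smul_mk, divF_frob p _ _ _ _ hm hn, OneForm.smul_mk]
  simp

end QSl2

end

noncomputable section

namespace QSl2

/-! ### Homogeneous components -/

section independence

variable {A M ι : Type*} [Ring A] [AddCommGroup M] [Module A M]

theorem iSupIndep_of_proj {S : ι → Submodule A M} (π : ι → M →ₗ[A] M) (S' : ι → Submodule A M)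
    (h1 : ∀ k, ∀ x ∈ S k, π k x = x) (h2 : ∀ k j, j ≠ k → ∀ x ∈ S j, π k x ∈ S' k)
    (h3 : ∀ k, Disjoint (S k) (S' k)) : iSupIndep S := by
  intro k
  rw [Submodule.disjoint_def]
  intro x hx hx'
  refine Submodule.disjoint_def.1 (h3 k) x hx ?_
  rw [← h1 k x hx]
  have : ⨆ j, ⨆ (_ : j ≠ k), S j ≤ (S' k).comap (π k) :=
    iSup_le fun j => iSup_le fun hj y hy => h2 k j hj y hy
  exact this hx'

end independence

namespace QPlane

variable (p : ℕ)

instance [Fact (2 ≤ p)] : IsScalarTower ℂ (SmallQG p) (QPlane p) := ⟨fun c a f => by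
  change action p (c • a) f = c • action p a f
  rw [map_smul]; rfl⟩

open Classical in
/-- The projection onto the span of the monomials with degree in `D`, as a `ℂ`-linear map. -/
def truncLin (D : Set ℤ) : QPlane p →ₗ[ℂ] QPlane p :=
  (basis p).constr ℂ fun s => if (s.1 : ℤ) + s.2 ∈ D then xy p s.1 s.2 else 0

variable {p}

theorem truncLin_of_mem {D : Set ℤ} {a b : ℤ} (h : a + b ∈ D) :
    truncLin p D (xyZ p a b) = xyZ p a b := by
  induction a, b using mon_cases with
  | h m n => rw [xyZ_natCast, xy, truncLin, Module.Basis.constr_basis, if_pos h]; rfl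
  | h0 a b h' => rw [xyZ_of_neg p h', map_zero]

theorem truncLin_of_notMem {D : Set ℤ} {a b : ℤ} (h : a + b ∉ D) :
    truncLin p D (xyZ p a b) = 0 := by
  induction a, b using mon_cases with
  | h m n => rw [xyZ_natCast, xy, truncLin, Module.Basis.constr_basis, if_neg h]
  | h0 a b h' => rw [xyZ_of_neg p h', map_zero]

theorem commute_truncLin {D : Set ℤ} (T : Module.End ℂ (QPlane p))
    (h : ∀ m n : ℕ, ∃ (c : ℂ) (a b : ℤ), a + b = m + n ∧ T (xyZ p m n) = c • xyZ p a b)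
    (f : QPlane p) : truncLin p D (T f) = T (truncLin p D f) := by
  refine LinearMap.congr_fun (f := truncLin p D ∘ₗ T) (g := T ∘ₗ truncLin p D)
    (hom_ext fun m n => ?_) f
  obtain ⟨c, a, b, hab, hT⟩ := h m n
  rw [LinearMap.comp_apply, LinearMap.comp_apply, hT, map_smul]
  by_cases hD : (m : ℤ) + n ∈ D
  · rw [truncLin_of_mem hD, truncLin_of_mem (hab ▸ hD), hT]
  · rw [truncLin_of_notMem hD, truncLin_of_notMem (hab ▸ hD), map_zero, smul_zero]

variable (p) [hp : Fact (2 ≤ p)]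

/-- The projection onto the span of the monomials with degree in `D`. -/
def trunc (D : Set ℤ) : QPlane p →ₗ[Lusztig p] QPlane p :=
  Lusztig.mkLinear (truncLin p D)
    (fun f => by
      rw [K_smul, K_smul]
      exact commute_truncLin _ (fun m n => ⟨_, _, _, rfl, opK_xyZ p m n⟩) f)
    (fun f => by
      rw [Ki_smul, Ki_smul]
      exact commute_truncLin _ (fun m n => ⟨_, _, _, rfl, opKi_xyZ p m n⟩) f)
    (fun k f => by
      rw [dE_smul, dE_smul]
      exact commute_truncLin _ (fun m n => ⟨_, _, _, by ring, opEd_xyZ p _ m n⟩) f)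
    (fun k f => by
      rw [dF_smul, dF_smul]
      exact commute_truncLin _ (fun m n => ⟨_, _, _, by ring, opFd_xyZ p _ m n⟩) f)

variable {p}

theorem trunc_of_mem {D : Set ℤ} {a b : ℤ} (h : a + b ∈ D) :
    trunc p D (xyZ p a b) = xyZ p a b := truncLin_of_mem h

theorem trunc_of_notMem {D : Set ℤ} {a b : ℤ} (h : a + b ∉ D) :
    trunc p D (xyZ p a b) = 0 := truncLin_of_notMem h

theorem trunc_smul (D : Set ℤ) (c : ℂ) (f : QPlane p) : trunc p D (c • f) = c • trunc p D f :=
  (truncLin p D).map_smul c f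

theorem trunc_trunc (D D' : Set ℤ) (f : QPlane p) :
    trunc p D (trunc p D' f) = trunc p (D ∩ D') f := by
  refine LinearMap.congr_fun (f := truncLin p D ∘ₗ truncLin p D') (g := truncLin p (D ∩ D'))
    (hom_ext fun m n => ?_) f
  rw [LinearMap.comp_apply]
  by_cases h' : (m : ℤ) + n ∈ D'
  · rw [truncLin_of_mem h']
    by_cases h : (m : ℤ) + n ∈ D
    · rw [truncLin_of_mem h, truncLin_of_mem (Set.mem_inter h h')]
    · rw [truncLin_of_notMem h, truncLin_of_notMem (fun h'' => h h''.1)]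
  · rw [truncLin_of_notMem h', truncLin_of_notMem (fun h'' => h' h''.2), map_zero]

theorem trunc_empty (f : QPlane p) : trunc p ∅ f = 0 := by
  refine LinearMap.congr_fun (f := truncLin p ∅) (g := 0)
    (hom_ext fun m n => ?_) f
  rw [truncLin_of_notMem (Set.notMem_empty _), LinearMap.zero_apply]

variable (p) in
/-- The span of the monomials with degree in `D`. -/
def homog (D : Set ℤ) : Submodule (Lusztig p) (QPlane p) := LinearMap.range (trunc p D)

theorem mem_homog_iff {D : Set ℤ} {f : QPlane p} : f ∈ homog p D ↔ trunc p D f = f := by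
  refine ⟨?_, fun h => ⟨f, h⟩⟩
  rintro ⟨g, rfl⟩
  rw [trunc_trunc, Set.inter_self]

theorem xyZ_mem_homog {D : Set ℤ} {a b : ℤ} (h : a + b ∈ D) : xyZ p a b ∈ homog p D :=
  mem_homog_iff.2 (trunc_of_mem h)

theorem homog_induction {D : Set ℤ} {P : QPlane p → Prop} {f : QPlane p} (hf : f ∈ homog p D)
    (hxy : ∀ m n : ℕ, (m : ℤ) + n ∈ D → P (xyZ p m n)) (zero : P 0)
    (add : ∀ f g, P f → P g → P (f + g)) (smul : ∀ (c : ℂ) f, P f → P (c • f)) : P f := by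
  obtain ⟨f, rfl⟩ := hf
  induction f using QPlane.induction with
  | hxy m n =>
    rw [← xyZ_natCast]
    by_cases h : (m : ℤ) + n ∈ D
    · rw [trunc_of_mem h]; exact hxy m n h
    · rw [trunc_of_notMem h]; exact zero
  | hadd f g hf hg => rw [map_add]; exact add _ _ hf hg
  | hsmul c f hf => rw [trunc_smul]; exact smul _ _ hf

theorem homog_le {D : Set ℤ} {S : Submodule ℂ (QPlane p)}
    (h : ∀ m n : ℕ, (m : ℤ) + n ∈ D → xyZ p m n ∈ S) :
    (homog p D).restrictScalars ℂ ≤ S := fun f (hf : f ∈ homog p D) =>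
  homog_induction hf h S.zero_mem (fun _ _ => S.add_mem) (fun c _ => S.smul_mem c)

theorem homog_mono {D D' : Set ℤ} (h : D ⊆ D') : homog p D ≤ homog p D' := by
  rintro _ ⟨f, rfl⟩
  rw [mem_homog_iff, trunc_trunc, Set.inter_eq_self_of_subset_right h]

theorem span_eq_homog {D : Set ℤ} {s : Set (QPlane p)}
    (h : ∀ f, f ∈ s ↔ ∃ m n : ℕ, (m : ℤ) + n ∈ D ∧ f = xy p m n) :
    (homog p D).restrictScalars ℂ = Submodule.span ℂ s := by
  apply le_antisymm
  · exact homog_le fun m n hD => Submodule.subset_span ((h _).2 ⟨m, n, hD, xyZ_natCast p m n⟩)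
  · rw [Submodule.span_le]
    intro f hf
    obtain ⟨m, n, hD, rfl⟩ := (h f).1 hf
    rw [← xyZ_natCast]
    exact xyZ_mem_homog hD

theorem homog_eq_grade (i : ℕ) : (homog p {(i : ℤ)}).restrictScalars ℂ = grade₀ p i :=
  span_eq_homog fun f => by
    simp only [Set.mem_setOf_eq, Set.mem_singleton_iff]
    exact exists₂_congr fun m n => by rw [← Nat.cast_add, Nat.cast_inj]

theorem homog_eq_fil (i : ℕ) : (homog p (Set.Iio (i : ℤ))).restrictScalars ℂ = fil₀ p i :=
  span_eq_homog fun f => by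
    simp only [Set.mem_setOf_eq, Set.mem_Iio]
    exact exists₂_congr fun m n => by rw [← Nat.cast_add, Nat.cast_lt]

theorem homog_isDirectSum {ι : Type*} {D : Set ℤ} (S : ι → Set ℤ) (hS : ∀ k, S k ⊆ D)
    (hD : ∀ i ∈ D, 0 ≤ i → ∃ k, i ∈ S k) (hd : ∀ j k, j ≠ k → Disjoint (S j) (S k)) :
    IsDirectSum (homog p D) (fun k => homog p (S k)) := by
  refine ⟨iSupIndep_of_proj (fun k => trunc p (S k)) (fun _ => ⊥)
    (fun k x hx => mem_homog_iff.1 hx) (fun k j hj x hx => ?_) (fun _ => disjoint_bot_right),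
    le_antisymm (iSup_le fun k => homog_mono (hS k)) ?_⟩
  · rw [Submodule.mem_bot, ← mem_homog_iff.1 hx, trunc_trunc, (hd j k hj).symm.inter_eq,
      trunc_empty]
  · refine homog_le (S := (⨆ k, homog p (S k)).restrictScalars ℂ) fun m n hmn => ?_
    obtain ⟨k, hk⟩ := hD _ hmn (by positivity)
    exact Submodule.mem_iSup_of_mem (p := fun k => homog p (S k)) k (xyZ_mem_homog hk)

end QPlane

namespace OneForm

variable (p : ℕ)

instance [Fact (2 ≤ p)] : IsScalarTower ℂ (SmallQG p) (OneForm p) := ⟨fun c a f => by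
  change action p (c • a) f = c • action p a f
  rw [map_smul]; rfl⟩

variable [hp : Fact (2 ≤ p)]

open QSl2.QPlane (xy xyZ xyZ_natCast)

/-- The projection onto the one-forms whose coefficients have degrees in `D`. -/
def trunc (D : Set ℤ) : OneForm p →ₗ[Lusztig p] OneForm p :=
  (Tw.map (QPlane.trunc p D) : Tw (Lusztig.coprod p) (QPlane p) →ₗ[Lusztig p]
    Tw (Lusztig.coprod p) (QPlane p))

variable {p}

theorem trunc_mk (D : Set ℤ) (f g : QPlane p) :
    trunc p D (mk p f g) = mk p (QPlane.trunc p D f) (QPlane.trunc p D g) := rfl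

theorem mk_surj (u : OneForm p) : ∃ f g, u = mk p f g := ⟨u.1, u.2, rfl⟩

theorem mk_inj {f g f' g' : QPlane p} : mk p f g = mk p f' g' ↔ f = f' ∧ g = g' := Prod.mk_inj

theorem trunc_trunc (D D' : Set ℤ) (u : OneForm p) :
    trunc p D (trunc p D' u) = trunc p (D ∩ D') u := by
  obtain ⟨f, g, rfl⟩ := mk_surj u
  simp only [trunc_mk, QPlane.trunc_trunc]

theorem trunc_empty (u : OneForm p) : trunc p ∅ u = 0 := by
  obtain ⟨f, g, rfl⟩ := mk_surj u
  simp only [trunc_mk, QPlane.trunc_empty]; rfl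

variable (p) in
/-- The one-forms whose coefficients have degrees in `D`. -/
def homog (D : Set ℤ) : Submodule (Lusztig p) (OneForm p) := LinearMap.range (trunc p D)

theorem mem_homog_iff {D : Set ℤ} {u : OneForm p} : u ∈ homog p D ↔ trunc p D u = u := by
  refine ⟨?_, fun h => ⟨u, h⟩⟩
  rintro ⟨g, rfl⟩
  rw [trunc_trunc, Set.inter_self]

theorem mk_mem_homog_iff {D : Set ℤ} {f g : QPlane p} :
    mk p f g ∈ homog p D ↔ f ∈ QPlane.homog p D ∧ g ∈ QPlane.homog p D := by
  rw [mem_homog_iff, trunc_mk, mk_inj, QPlane.mem_homog_iff, QPlane.mem_homog_iff]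

theorem homog_mono {D D' : Set ℤ} (h : D ⊆ D') : homog p D ≤ homog p D' := by
  rintro _ ⟨f, rfl⟩
  rw [mem_homog_iff, trunc_trunc, Set.inter_eq_self_of_subset_right h]

theorem mk_add_mk (f g : QPlane p) : mk p f 0 + mk p 0 g = mk p f g := by
  rw [add_mk, add_zero, zero_add]

theorem homog_le {D : Set ℤ} {S : Submodule ℂ (OneForm p)}
    (h1 : ∀ m n : ℕ, (m : ℤ) + n ∈ D → mk p (xyZ p m n) 0 ∈ S)
    (h2 : ∀ m n : ℕ, (m : ℤ) + n ∈ D → mk p 0 (xyZ p m n) ∈ S) :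
    (homog p D).restrictScalars ℂ ≤ S := fun u (hu : u ∈ homog p D) => by
  obtain ⟨f, g, rfl⟩ := mk_surj u
  obtain ⟨hf, hg⟩ := mk_mem_homog_iff.1 hu
  rw [← mk_add_mk]
  refine S.add_mem ?_ ?_
  · exact QPlane.homog_le (S := S.comap (LinearMap.inl ℂ (QPlane p) (QPlane p) :)) h1 hf
  · exact QPlane.homog_le (S := S.comap (LinearMap.inr ℂ (QPlane p) (QPlane p) :)) h2 hg

theorem span_eq_homog {D : Set ℤ} {s : Set (OneForm p)}
    (h : ∀ f, f ∈ s ↔ ∃ m n : ℕ, (m : ℤ) + n ∈ D ∧ (f = xy p m n • ξ p ∨ f = xy p m n • η p)) :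
    (homog p D).restrictScalars ℂ = Submodule.span ℂ s := by
  apply le_antisymm
  · exact homog_le
      (fun m n hD => Submodule.subset_span ((h _).2 ⟨m, n, hD, .inl (by
        rw [smul_ξ, xyZ_natCast])⟩))
      (fun m n hD => Submodule.subset_span ((h _).2 ⟨m, n, hD, .inr (by
        rw [smul_η, xyZ_natCast])⟩))
  · rw [Submodule.span_le]
    intro f hf
    obtain ⟨m, n, hD, rfl | rfl⟩ := (h f).1 hf
    · rw [← xyZ_natCast, smul_ξ]
      exact mk_mem_homog_iff.2 ⟨QPlane.xyZ_mem_homog hD, Submodule.zero_mem _⟩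
    · rw [← xyZ_natCast, smul_η]
      exact mk_mem_homog_iff.2 ⟨Submodule.zero_mem _, QPlane.xyZ_mem_homog hD⟩

theorem homog_eq_grade (i : ℕ) : (homog p {(i : ℤ)}).restrictScalars ℂ = grade₁ p i :=
  span_eq_homog fun f => by
    simp only [Set.mem_setOf_eq, Set.mem_singleton_iff]
    exact exists₂_congr fun m n => by rw [← Nat.cast_add, Nat.cast_inj]

theorem homog_eq_fil (i : ℕ) : (homog p (Set.Iio (i : ℤ))).restrictScalars ℂ = fil₁ p i :=
  span_eq_homog fun f => by
    simp only [Set.mem_setOf_eq, Set.mem_Iio]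
    exact exists₂_congr fun m n => by rw [← Nat.cast_add, Nat.cast_lt]

end OneForm

instance WMod.isScalarTower (p r n : ℕ) (ε : ℤˣ) [Fact (2 ≤ p)] :
    IsScalarTower ℂ (SmallQG p) (WMod p r n ε) := ⟨fun c a f => by
  change action p r n ε (c • a) f = c • action p r n ε a f
  rw [map_smul]; rfl⟩

end QSl2

end

noncomputable section

namespace QSl2

open QPlane

section separation

variable {A N ι : Type*} [Ring A] [Algebra ℂ A] [AddCommGroup N] [Module ℂ N] [Module A N]
  [IsScalarTower ℂ A N]

theorem exists_separating (v : ι → N) (s : Finset ι) (j0 : ι)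
    (hsep : ∀ j ∈ s, j ≠ j0 → ∃ (T : A) (c : ι → ℂ), (∀ k ∈ s, T • v k = c k • v k) ∧ c j ≠ c j0) :
    ∃ (T : A) (c : ι → ℂ), (∀ k ∈ s, T • v k = c k • v k) ∧ c j0 = 1 ∧
      ∀ j ∈ s, j ≠ j0 → c j = 0 := by
  classical
  suffices h : ∀ t ⊆ s, ∃ (T : A) (c : ι → ℂ), (∀ k ∈ s, T • v k = c k • v k) ∧ c j0 = 1 ∧
      ∀ j ∈ t, j ≠ j0 → c j = 0 from h s subset_rfl
  intro t
  induction t using Finset.induction_on with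
  | empty => exact fun _ => ⟨1, fun _ => 1, by simp, rfl, by simp⟩
  | insert j t hj ih =>
    intro ht
    obtain ⟨T, c, h1, h2, h3⟩ := ih ((Finset.subset_insert _ _).trans ht)
    by_cases hj0 : j = j0
    · refine ⟨T, c, h1, h2, fun k hk hk0 => h3 k ?_ hk0⟩
      exact (Finset.mem_insert.1 hk).resolve_left (fun h => hk0 (h.trans hj0))
    · obtain ⟨T', c', h1', h2'⟩ := hsep j (ht (Finset.mem_insert_self _ _)) hj0
      refine ⟨((c' j0 - c' j)⁻¹ • (T' - c' j • 1)) * T,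
        fun k => (c' j0 - c' j)⁻¹ * (c' k - c' j) * c k, fun k hk => ?_, ?_, fun k hk hk0 => ?_⟩
      · rw [mul_smul, h1 k hk, smul_assoc, sub_smul, smul_comm, h1' k hk, smul_assoc, one_smul,
          smul_smul, smul_smul, ← sub_smul, smul_smul]
        congr 1; ring
      · simp only []
        rw [h2, mul_one, inv_mul_cancel₀ (sub_ne_zero.2 h2'.symm)]
      · rcases Finset.mem_insert.1 hk with rfl | hk
        · simp
        · simp [h3 k hk hk0]

end separation

namespace QPlane

variable {p : ℕ} [hp : Fact (2 ≤ p)]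

theorem xyZ_natCast_ne_zero (m n : ℕ) : xyZ p m n ≠ 0 := by
  rw [xyZ_natCast]; exact (basis p).ne_zero _

theorem xyZ_sub_ne_zero {i b : ℕ} (h : b ≤ i) : xyZ p ((i : ℤ) - b) b ≠ 0 := by
  rw [← Nat.cast_sub h]; exact xyZ_natCast_ne_zero _ _

theorem exists_eq_sum {i : ℕ} {f : QPlane p} (hf : f ∈ homog p {(i : ℤ)}) :
    ∃ c : ℕ → ℂ, f = ∑ b ∈ Finset.range (i + 1), c b • xyZ p ((i : ℤ) - b) b := by
  classical
  refine homog_induction (P := fun f => ∃ c : ℕ → ℂ,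
    f = ∑ b ∈ Finset.range (i + 1), c b • xyZ p ((i : ℤ) - b) b) hf (fun m n h => ?_) ?_ ?_ ?_
  · rw [Set.mem_singleton_iff] at h
    refine ⟨Pi.single n 1, ?_⟩
    rw [Finset.sum_eq_single n]
    · rw [Pi.single_eq_same, one_smul]; congr 1; omega
    · intro b _ hb; rw [Pi.single_eq_of_ne hb, zero_smul]
    · intro h; simp at h; omega
  · exact ⟨0, by simp⟩
  · rintro _ _ ⟨c, rfl⟩ ⟨c', rfl⟩
    exact ⟨c + c', by simp [add_smul, Finset.sum_add_distrib]⟩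
  · rintro a _ ⟨c, rfl⟩
    exact ⟨a • c, by simp [mul_smul, Finset.smul_sum]⟩

theorem commutator_smul_xyZ (M N m n : ℕ) (hm : m < p) (hn : n < p) :
    (Lusztig.𝓔 p * Lusztig.𝓕 p - Lusztig.𝓕 p * Lusztig.𝓔 p) •
        xyZ p ((M : ℤ) * p + m) ((N : ℤ) * p + n) =
      ((-1) ^ (((M : ℤ) + N - 1) * p + m + n) * ((M : ℂ) - N)) •
        xyZ p ((M : ℤ) * p + m) ((N : ℤ) * p + n) := by
  have h := commutator_smul_frob p M N m n hm hn
  rw [frob_eq p _ _ _ _ hm hn, smul_comm, smul_comm _ (_ * _ * _)] at h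
  exact smul_right_injective _ (mul_ne_zero (mul_ne_zero (frobCoeff_ne_zero p M)
    (frobCoeff_ne_zero p N)) (pow_ne_zero _ (by norm_num))) h

theorem exists_projectors (i : ℕ) : ∃ T : ℕ → Lusztig p,
    (∀ b ≤ i, T b • xyZ p ((i : ℤ) - b) b = xyZ p ((i : ℤ) - b) b) ∧
    ∀ f ∈ homog p {(i : ℤ)}, (∀ b ≤ i, ∃ c : ℂ, T b • f = c • xyZ p ((i : ℤ) - b) b) ∧
      f = ∑ b ∈ Finset.range (i + 1), T b • f := by
  have hp2 := hp.out
  have key : ∀ b0 ∈ Finset.range (i + 1), ∃ (T : Lusztig p) (c : ℕ → ℂ),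
      (∀ k ∈ Finset.range (i + 1),
        T • xyZ p ((i : ℤ) - k) k = c k • xyZ p ((i : ℤ) - k) k) ∧ c b0 = 1 ∧
      ∀ j ∈ Finset.range (i + 1), j ≠ b0 → c j = 0 := by
    intro b0 hb0
    refine exists_separating (fun b : ℕ => xyZ p ((i : ℤ) - b) b) _ b0 fun b hb hne => ?_
    simp only [Finset.mem_range] at hb hb0
    by_cases h : (p : ℤ) ∣ b - b0
    · refine ⟨Lusztig.𝓔 p * Lusztig.𝓕 p - Lusztig.𝓕 p * Lusztig.𝓔 p, fun k =>
        (-1) ^ ((i : ℤ) - p) * (((i - k) / p : ℕ) - (k / p : ℕ)), fun k hk => ?_, ?_⟩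
      · simp only [Finset.mem_range] at hk
        have e1 := Nat.div_add_mod' (i - k) p
        have e2 := Nat.div_add_mod' k p
        have h1 := commutator_smul_xyZ (p := p) ((i - k) / p) (k / p) ((i - k) % p) (k % p)
          (Nat.mod_lt _ (by omega)) (Nat.mod_lt _ (by omega))
        have e1' : (((i - k) / p : ℕ) : ℤ) * p + ((i - k) % p : ℕ) = (i : ℤ) - k := by
          rw [← Nat.cast_sub (by omega)]; exact_mod_cast e1
        have e2' : ((k / p : ℕ) : ℤ) * p + (k % p : ℕ) = (k : ℤ) := by exact_mod_cast e2
        have e3 : ((((i - k) / p : ℕ) : ℤ) + (k / p : ℕ) - 1) * p + ((i - k) % p : ℕ) +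
            (k % p : ℕ) = i - p := by linear_combination e1' + e2'
        rwa [e1', e2', e3] at h1
      · obtain ⟨t, ht⟩ := h
        have ht0 : t ≠ 0 := by rintro rfl; omega
        intro he
        have he := mul_left_cancel₀ (zpow_ne_zero _ (by norm_num)) he
        have he' : (((i - b) / p : ℕ) : ℤ) - (b / p : ℕ) = ((i - b0) / p : ℕ) - (b0 / p : ℕ) := by
          exact_mod_cast he
        have hp0 : (p : ℤ) ≠ 0 := by omega
        push_cast [Nat.cast_sub (show b ≤ i by omega), Nat.cast_sub (show b0 ≤ i by omega)] at he'
        have hb' : (b : ℤ) = b0 + p * t := by linarith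
        rw [hb', show (i : ℤ) - (b0 + p * t) = i - b0 + p * (-t) by ring,
          Int.add_mul_ediv_left _ _ hp0, Int.add_mul_ediv_left _ _ hp0] at he'
        omega
    · refine ⟨Lusztig.K p, fun k => q p ^ ((i : ℤ) - k - k), fun k _ => ?_, ?_⟩
      · rw [K_smul, opK_xyZ]
      · intro he
        apply h
        have h1 : q p ^ (2 * ((b : ℤ) - b0)) = 1 := by
          have h2 : q p ^ ((i : ℤ) - b - b) ≠ 0 := zpow_ne_zero _ (q_ne_zero p)
          rw [show 2 * ((b : ℤ) - b0) = (i - b0 - b0) - (i - b - b) by ring,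
            zpow_sub₀ (q_ne_zero p)]
          simp only at he
          rw [← he, div_self h2]
        rw [(q_primitive hp2).zpow_eq_one_iff_dvd] at h1
        push_cast at h1
        exact Int.dvd_of_mul_dvd_mul_left (by norm_num) h1
  choose! T c h1 h2 h3 using key
  refine ⟨T, fun b hb => ?_, fun f hf => ?_⟩
  · have hb : b ∈ Finset.range (i + 1) := by simpa [Nat.lt_succ_iff] using hb
    rw [h1 b hb b hb, h2 b hb, one_smul]
  · obtain ⟨a, rfl⟩ := exists_eq_sum hf
    have h4 : ∀ b ∈ Finset.range (i + 1),
        T b • ∑ b ∈ Finset.range (i + 1), a b • xyZ p ((i : ℤ) - b) b =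
          a b • xyZ p ((i : ℤ) - b) b := by
      intro b hb
      rw [Finset.smul_sum, Finset.sum_eq_single b]
      · rw [smul_comm, h1 b hb b hb, h2 b hb, one_smul]
      · intro k hk hkb
        rw [smul_comm, h1 b hb k hk, h3 b hb k hk hkb, zero_smul, smul_zero]
      · exact fun h => absurd hb h
    exact ⟨fun b hb => ⟨_, h4 b (by simpa [Nat.lt_succ_iff] using hb)⟩,
      (Finset.sum_congr rfl h4).symm⟩

theorem homog_le_of_forall {i : ℕ} {S : Submodule (Lusztig p) (QPlane p)}
    (h : ∀ b ≤ i, xyZ p ((i : ℤ) - b) b ∈ S) : homog p {(i : ℤ)} ≤ S :=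
  homog_le (S := S.restrictScalars ℂ) fun m n hmn => by
    have := h n (by simp at hmn; omega)
    rw [Set.mem_singleton_iff] at hmn
    rwa [← hmn, add_sub_cancel_right] at this

theorem exists_mem_of_ne_bot {i : ℕ} {S : Submodule (Lusztig p) (QPlane p)}
    (hS : S ≤ homog p {(i : ℤ)}) (h0 : S ≠ ⊥) : ∃ b ≤ i, xyZ p ((i : ℤ) - b) b ∈ S := by
  obtain ⟨T, hT1, hT2⟩ := exists_projectors (p := p) i
  by_contra! hc
  refine h0 (eq_bot_iff.2 fun f hf => ?_)
  obtain ⟨h1, h2⟩ := hT2 f (hS hf)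
  rw [Submodule.mem_bot, h2]
  refine Finset.sum_eq_zero fun b hb => ?_
  have hb : b ≤ i := by simpa [Nat.lt_succ_iff] using hb
  obtain ⟨c, h⟩ := h1 b hb
  by_contra h3
  have hc0 : c ≠ 0 := by rintro rfl; exact h3 (by rw [h, zero_smul])
  refine hc b hb ?_
  have h4 : c • xyZ p ((i : ℤ) - b) b ∈ S := h ▸ S.smul_mem _ hf
  have h5 := S.smul_of_tower_mem c⁻¹ h4
  rwa [smul_smul, inv_mul_cancel₀ hc0, one_smul] at h5

theorem mem_or_mem_of_sup {i : ℕ} {S T : Submodule (Lusztig p) (QPlane p)}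
    (h : S ⊔ T = homog p {(i : ℤ)}) {b : ℕ} (hb : b ≤ i) :
    xyZ p ((i : ℤ) - b) b ∈ S ∨ xyZ p ((i : ℤ) - b) b ∈ T := by
  obtain ⟨P, hP1, hP2⟩ := exists_projectors (p := p) i
  have hmem : xyZ p ((i : ℤ) - b) b ∈ S ⊔ T := h ▸ xyZ_mem_homog (by simp)
  obtain ⟨s, hs, t, ht, hst⟩ := Submodule.mem_sup.1 hmem
  obtain ⟨c, hc⟩ := (hP2 s (h ▸ Submodule.mem_sup_left hs)).1 b hb
  obtain ⟨c', hc'⟩ := (hP2 t (h ▸ Submodule.mem_sup_right ht)).1 b hb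
  have h1 : (c + c') • xyZ p ((i : ℤ) - b) b = (1 : ℂ) • xyZ p ((i : ℤ) - b) b := by
    rw [add_smul, ← hc, ← hc', ← smul_add, hst, hP1 b hb, one_smul]
  have h2 : c + c' = 1 := smul_left_injective _ (xyZ_sub_ne_zero hb) h1
  by_cases hc0 : c = 0
  · right
    have h4 := P b |> fun a => T.smul_mem a ht
    rw [hc'] at h4
    rw [hc0, zero_add] at h2
    rwa [h2, one_smul] at h4
  · left
    have h4 := S.smul_of_tower_mem c⁻¹ (S.smul_mem (P b) hs)
    rwa [hc, smul_smul, inv_mul_cancel₀ hc0, one_smul] at h4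

theorem dE_one_smul_xyZ (a b : ℤ) :
    Lusztig.dE p 1 • xyZ p a b = qInt (q p) (a + 1) • xyZ p (a + 1) (b - 1) := by
  rw [dE_smul, opEd_one_xyZ p hp.out]

theorem dF_one_smul_xyZ (a b : ℤ) :
    Lusztig.dF p 1 • xyZ p a b = qInt (q p) (b + 1) • xyZ p (a - 1) (b + 1) := by
  rw [dF_smul, opFd_one_xyZ p hp.out]

theorem mem_of_smul_mem {S : Submodule (Lusztig p) (QPlane p)} {c : ℂ} (hc : c ≠ 0) {f : QPlane p}
    (h : c • f ∈ S) : f ∈ S := by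
  have := S.smul_of_tower_mem c⁻¹ h
  rwa [smul_smul, inv_mul_cancel₀ hc, one_smul] at this

end QPlane

section lattice

variable {A M : Type*} [Ring A] [AddCommGroup M] [Module A M]

theorem isIndecomposable_of_forall {W : Submodule A M} (h0 : W ≠ ⊥)
    (h : ∀ S T : Submodule A M, S ⊔ T = W → Disjoint S T → W ≤ S ∨ W ≤ T) :
    IsIndecomposable A W := by
  refine ⟨Submodule.nontrivial_iff_ne_bot.2 h0, fun S T hST => ?_⟩
  have hd : Disjoint (S.map W.subtype) (T.map W.subtype) := by
    rw [disjoint_iff, ← Submodule.map_inf _ W.injective_subtype, hST.inf_eq_bot, Submodule.map_bot]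
  have hs : S.map W.subtype ⊔ T.map W.subtype = W := by
    rw [← Submodule.map_sup, hST.sup_eq_top, Submodule.map_top, Submodule.range_subtype]
  rcases h _ _ hs hd with h | h
  · right
    have : T.map W.subtype = ⊥ := by
      rw [← hd.symm.eq_bot]; exact (inf_eq_left.2 ((Submodule.map_subtype_le _ _).trans h)).symm
    exact Submodule.map_injective_of_injective W.injective_subtype (this.trans (Submodule.map_bot _).symm)
  · left
    have : S.map W.subtype = ⊥ := by
      rw [← hd.eq_bot]; exact (inf_eq_left.2 ((Submodule.map_subtype_le _ _).trans h)).symm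
    exact Submodule.map_injective_of_injective W.injective_subtype (this.trans (Submodule.map_bot _).symm)

theorem IsIndecomposable.congr {N : Type*} [AddCommGroup N] [Module A N] (e : M ≃ₗ[A] N)
    (h : IsIndecomposable A M) : IsIndecomposable A N := by
  obtain ⟨h1, h2⟩ := h
  refine ⟨e.symm.toEquiv.nontrivial, fun S T hST => ?_⟩
  have := h2 (S.comap e.toLinearMap) (T.comap e.toLinearMap)
    (hST.map (Submodule.orderIsoMapComap e).symm)
  rw [Submodule.comap_equiv_eq_map_symm, Submodule.comap_equiv_eq_map_symm] at this
  have hinj := Submodule.map_injective_of_injective (f := (e.symm : N →ₗ[A] M)) e.symm.injective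
  exact this.imp (fun h => hinj (h.trans (Submodule.map_bot _).symm))
    (fun h => hinj (h.trans (Submodule.map_bot _).symm))

theorem isSimpleModule_of_forall {W : Submodule A M} (h0 : W ≠ ⊥)
    (h : ∀ S ≤ W, S ≠ ⊥ → W ≤ S) : IsSimpleModule A W := by
  rw [isSimpleModule_iff_isAtom]
  refine ⟨h0, fun S hS => ?_⟩
  by_contra hS0
  exact hS.not_ge (h S hS.le hS0)

end lattice

namespace QPlane

variable {p : ℕ} [hp : Fact (2 ≤ p)]

theorem homog_ne_bot (i : ℕ) : homog p {(i : ℤ)} ≠ ⊥ := fun h => by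
  have : xyZ p ((i : ℤ) - (0 : ℕ)) (0 : ℕ) ∈ homog p {(i : ℤ)} := xyZ_mem_homog (by simp)
  rw [h, Submodule.mem_bot] at this
  exact xyZ_sub_ne_zero (Nat.zero_le i) this

theorem isIndecomposable_homog {i : ℕ} (hi : ¬ p ∣ i + 1) :
    IsIndecomposable (Lusztig p) (homog p {(i : ℤ)}) := by
  refine isIndecomposable_of_forall (homog_ne_bot i) fun S T hST hd => ?_
  have step : ∀ S : Submodule (Lusztig p) (QPlane p), ∀ b < i,
      ((b + 1 : ℕ) : ℤ) % p ≠ 0 → xyZ p ((i : ℤ) - b) b ∈ S →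
        xyZ p ((i : ℤ) - (b + 1 : ℕ)) (b + 1 : ℕ) ∈ S := by
    intro S b hb h h1
    have := S.smul_mem (Lusztig.dF p 1) h1
    rw [dF_one_smul_xyZ] at this
    have := mem_of_smul_mem (by
      rw [Ne, qInt_eq_zero_iff hp.out]; intro h2; exact h (Int.emod_eq_zero_of_dvd (by exact_mod_cast h2))) this
    rwa [sub_sub, ← Nat.cast_succ] at this
  have step' : ∀ S : Submodule (Lusztig p) (QPlane p), ∀ b < i,
      ((b + 1 : ℕ) : ℤ) % p = 0 → xyZ p ((i : ℤ) - (b + 1 : ℕ)) (b + 1 : ℕ) ∈ S →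
        xyZ p ((i : ℤ) - b) b ∈ S := by
    intro S b hb h h1
    have := S.smul_mem (Lusztig.dE p 1) h1
    rw [dE_one_smul_xyZ] at this
    have := mem_of_smul_mem (by
      rw [Ne, qInt_eq_zero_iff hp.out]
      intro h2
      have h3 := dvd_add h2 (Int.dvd_of_emod_eq_zero h)
      rw [show (i : ℤ) - (b + 1 : ℕ) + 1 + (b + 1 : ℕ) = (i + 1 : ℕ) by push_cast; ring] at h3
      exact hi (by exact_mod_cast h3)) this
    rwa [show (i : ℤ) - (b + 1 : ℕ) + 1 = i - b by push_cast; ring,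
      show ((b + 1 : ℕ) : ℤ) - 1 = b by push_cast; ring] at this
  have main : ∀ S T : Submodule (Lusztig p) (QPlane p), S ⊔ T = homog p {(i : ℤ)} →
      Disjoint S T → xyZ p ((i : ℤ) - (0 : ℕ)) (0 : ℕ) ∈ S → homog p {(i : ℤ)} ≤ S := by
    intro S T hST hd h0
    refine homog_le_of_forall fun b hb => ?_
    induction b with
    | zero => exact h0
    | succ b ih =>
      have ih := ih (by omega)
      by_cases h : ((b + 1 : ℕ) : ℤ) % p = 0
      · refine (mem_or_mem_of_sup hST hb).resolve_right fun hT => ?_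
        exact xyZ_sub_ne_zero (by omega : b ≤ i)
          (Submodule.disjoint_def.1 hd _ ih (step' T b (by omega) h hT))
      · exact step S b (by omega) h ih
  rcases mem_or_mem_of_sup hST (Nat.zero_le i) with h | h
  · exact .inl (main S T hST hd h)
  · exact .inr (main T S (sup_comm S T ▸ hST) hd.symm h)

theorem isSimpleModule_homog {i : ℕ} (hi : p ∣ i + 1 ∨ i < p) :
    IsSimpleModule (Lusztig p) (homog p {(i : ℤ)}) := by
  have hp2 := hp.out
  refine isSimpleModule_of_forall (homog_ne_bot i) fun S hS h0 => ?_
  obtain ⟨b, hb, hbS⟩ := exists_mem_of_ne_bot hS h0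
  have h0 : xyZ p i 0 ∈ S := by
    induction b using Nat.strong_induction_on with
    | _ b ih =>
    rcases Nat.eq_zero_or_pos b with rfl | hb0
    · simpa using hbS
    by_cases h : (p : ℤ) ∣ i - b + 1
    · obtain ⟨t, ht⟩ := h
      have hi : p ∣ i + 1 := hi.resolve_right fun hi => by
        have ht0 : 0 < t := by
          by_contra hc
          have := mul_nonpos_of_nonneg_of_nonpos (Int.natCast_nonneg p) (not_lt.1 hc)
          omega
        have : (p : ℤ) * 1 ≤ p * t := by gcongr; omega
        omega
      obtain ⟨s, hs⟩ := hi
      have hbp : p ≤ b := by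
        refine Nat.le_of_dvd hb0 (Int.natCast_dvd_natCast.1 ⟨s - t, ?_⟩)
        have : ((i + 1 : ℕ) : ℤ) = p * s := by exact_mod_cast hs
        push_cast at this
        linarith
      have ht0 : 0 < t := by
        by_contra hc
        have := mul_nonpos_of_nonneg_of_nonpos (Int.natCast_nonneg p) (not_lt.1 hc)
        omega
      lift t to ℕ using ht0.le
      refine ih (b - p) (by omega) (by omega) (mem_of_smul_mem (c := t * (-1) ^ ((t + 1) * p + (p - 1))) ?_ ?_)
      · exact mul_ne_zero (by exact_mod_cast ht0.ne') (pow_ne_zero _ (by norm_num))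
      · have h1 := S.smul_mem (Lusztig.dE p p) hbS
        rw [dE_smul, opEd_xyZ] at h1
        have h2 : ((i : ℤ) - b + p).toNat = t * p + (p - 1) := by
          rw [← Int.toNat_natCast (t * p + (p - 1)), Nat.cast_add, Nat.cast_sub (by omega)]
          congr 1; push_cast; linarith
        rw [h2, qBinom_p_right hp2 _ _ (by omega)] at h1
        rw [Nat.cast_sub hbp]
        convert h1 using 3
        ring
    · refine ih (b - 1) (by omega) (by omega) (mem_of_smul_mem
        (c := qInt (q p) (i - b + 1)) (by rwa [Ne, qInt_eq_zero_iff hp2]) ?_)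
      have h1 := S.smul_mem (Lusztig.dE p 1) hbS
      rw [dE_one_smul_xyZ] at h1
      rwa [show ((b - 1 : ℕ) : ℤ) = b - 1 by omega, sub_sub_eq_add_sub, add_sub_right_comm]
  refine homog_le_of_forall fun b hb => ?_
  have := S.smul_mem (Lusztig.dF p b) h0
  rwa [dF_smul, opFd_xyZ, zero_add, Int.toNat_natCast, qBinom_self, one_smul] at this

end QPlane

end QSl2

end

noncomputable section

namespace QSl2

open QPlane

theorem Lusztig.smul_eq_ofSmall_smul {p : ℕ} [Fact (2 ≤ p)] {N : Type*} [AddCommGroup N]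
    [Module (Lusztig p) N] [Module (SmallQG p) N] [IsScalarTower (SmallQG p) (Lusztig p) N]
    (s : SmallQG p) (x : N) : s • x = Lusztig.ofSmall p s • x := by
  rw [← one_smul (Lusztig p) x, ← smul_assoc, one_smul, Lusztig.small_smul_def, mul_one]

namespace WMod

variable {p r n : ℕ} {ε : ℤˣ} [hp : Fact (2 ≤ p)]

theorem gen_smul (g : Gen) (x : WMod p r n ε) : SmallQG.gen p g • x =
    (match g with
      | .E => opE p r n ε
      | .F => opF p r n ε
      | .K => opK p r n ε
      | .Ki => opKi p r n ε) x := by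
  change action p r n ε (SmallQG.gen p g) x = _
  rw [action, SmallQG.lift_gen]
  all_goals cases g <;> rfl

variable (p r)

/-- The coefficient of the image of `w_l` in a graded component of the quantum plane. -/
def planeCoeff (j k : ℕ) : ℕ → ℂ
  | 0 => 1
  | l + 1 => if p ∣ l + 1 then planeCoeff j k l * (qInt (q p) ((k : ℤ) * p + r - 1 - l))⁻¹
      else planeCoeff j k l * qInt (q p) ((j : ℤ) * p + l + 1)

variable (n ε)

/-- The linear map to the quantum plane that sends `w_l` to a multiple of the monomial
`x^(kp+r-1-l) y^(jp+l)`. -/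
def toPlane (j k : ℕ) : WMod p r n ε →ₗ[ℂ] QPlane p :=
  (basis p r n ε).constr ℂ fun l =>
    planeCoeff p r j k l • xyZ p ((k : ℤ) * p + r - 1 - (l : ℕ)) ((j : ℤ) * p + (l : ℕ))

variable {p r n ε}

theorem toPlane_w (j k l : ℕ) (h : l < (n - 1) * p + r) : toPlane p r n ε j k (w p r n ε l) =
    planeCoeff p r j k l • xyZ p ((k : ℤ) * p + r - 1 - l) ((j : ℤ) * p + l) := by
  have := w_fin p r n ε ⟨l, h⟩
  simp only at this
  rw [this, toPlane, Module.Basis.constr_basis]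

theorem planeCoeff_ne_zero (j k : ℕ) (hr : 1 ≤ r) (h : r < p ∨ r = p ∧ n = 1) (l : ℕ)
    (hl : l < (n - 1) * p + r) : planeCoeff p r j k l ≠ 0 := by
  have hp2 := hp.out
  induction l with
  | zero => exact one_ne_zero
  | succ l ih =>
    rw [planeCoeff]
    split_ifs with hd
    · refine mul_ne_zero (ih (by omega)) (inv_ne_zero ?_)
      rw [Ne, qInt_eq_zero_iff hp2]
      intro h2
      have hr' : r < p := h.resolve_right (by
        rintro ⟨rfl, rfl⟩
        have := Nat.le_of_dvd (by omega) hd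
        omega)
      have h3 := dvd_add h2 (Int.natCast_dvd_natCast.2 hd)
      rw [show (k : ℤ) * p + r - 1 - l + (l + 1 : ℕ) = k * p + r by push_cast; ring,
        dvd_add_right (dvd_mul_left _ _)] at h3
      have := Nat.le_of_dvd hr (Int.natCast_dvd_natCast.1 h3)
      omega
    · refine mul_ne_zero (ih (by omega)) ?_
      rw [Ne, qInt_eq_zero_iff hp2, add_assoc, dvd_add_right (dvd_mul_left _ _)]
      exact_mod_cast hd

theorem lin_ext {N : Type*} [AddCommGroup N] [Module ℂ N] {f g : WMod p r n ε →ₗ[ℂ] N}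
    (h : ∀ l < (n - 1) * p + r, f (w p r n ε l) = g (w p r n ε l)) : f = g :=
  (basis p r n ε).ext fun l => by
    have := h l l.2
    rwa [w_fin] at this

theorem toPlane_opE (j k : ℕ) (hr : 1 ≤ r) (hε : ((ε : ℤ) : ℂ) = (-1) ^ (j + k))
    (h : r < p ∧ j = 0 ∧ n = k + 1 ∨ r = p ∧ n = 1) :
    toPlane p r n ε j k ∘ₗ opE p r n ε = opEd p 1 ∘ₗ toPlane p r n ε j k := by
  have hp2 := hp.out
  refine lin_ext fun l hl => ?_
  rw [LinearMap.comp_apply, LinearMap.comp_apply, toPlane_w _ _ _ hl, map_smul,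
    opEd_one_xyZ p hp2]
  cases l with
  | zero =>
    rw [opE_zero, map_zero]
    rcases h with ⟨h1, rfl, rfl⟩ | ⟨rfl, rfl⟩
    · rw [xyZ_of_neg p (by right; simp), smul_zero, smul_zero]
    · rw [(qInt_eq_zero_iff hp2 _).2 ⟨k + 1, by push_cast; ring⟩, zero_smul, smul_zero]
  | succ l =>
    rw [opE_succ _ _ _ _ _ hl, map_smul, toPlane_w _ _ _ (by omega), smul_smul, smul_smul]
    have e1 : (k : ℤ) * p + r - 1 - (l + 1 : ℕ) + 1 = k * p + r - 1 - l := by push_cast; ring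
    have e2 : (j : ℤ) * p + (l + 1 : ℕ) - 1 = j * p + l := by push_cast; ring
    rw [e1, e2]
    congr 1
    rw [coeffE, planeCoeff]
    by_cases hd : p ∣ l + 1
    · have hne : qInt (q p) ((k : ℤ) * p + r - 1 - l) ≠ 0 := by
        have := planeCoeff_ne_zero (p := p) (r := r) (n := n) j k hr (h.imp And.left id) _ hl
        rw [planeCoeff, if_pos hd] at this
        exact fun h0 => right_ne_zero_of_mul this (by rw [h0, inv_zero])
      have hnr : ¬ p ∣ r := by
        intro hr'
        have := Nat.le_of_dvd hr hr'
        rcases h with ⟨h1, -, -⟩ | ⟨rfl, rfl⟩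
        · omega
        · have := Nat.le_of_dvd (by omega) hd
          omega
      rw [if_pos hd, if_pos ⟨hd, hnr⟩, inv_mul_cancel_right₀ hne, one_mul]
    · rw [if_neg hd, if_neg (fun h => hd h.1), hε, show (j : ℤ) * p + l + 1 = (l + 1 : ℕ) + j * p by
        push_cast; ring, qInt_add_mul_p hp2, show (k : ℤ) * p + r - 1 - l =
        r - (l + 1 : ℕ) + k * p by push_cast; ring, qInt_add_mul_p hp2, pow_add]
      ring

theorem toPlane_opF (j k : ℕ) (h : r < p ∧ j = 0 ∧ n = k + 1 ∨ r = p ∧ n = 1) :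
    toPlane p r n ε j k ∘ₗ opF p r n ε = opFd p 1 ∘ₗ toPlane p r n ε j k := by
  have hp2 := hp.out
  refine lin_ext fun l hl => ?_
  rw [LinearMap.comp_apply, LinearMap.comp_apply, toPlane_w _ _ _ hl, map_smul,
    opFd_one_xyZ p hp2, opF_w, map_smul, coeffF]
  by_cases hd : p ∣ l + 1
  · rw [if_pos hd, zero_smul, (qInt_eq_zero_iff hp2 _).2, zero_smul, smul_zero]
    rw [add_assoc]
    exact dvd_add (dvd_mul_left _ _) (by exact_mod_cast hd)
  · rw [if_neg hd, one_smul]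
    by_cases hl' : l + 1 < (n - 1) * p + r
    · rw [toPlane_w _ _ _ hl', planeCoeff, if_neg hd, smul_smul]
      congr 2 <;> push_cast <;> ring
    · rw [w_eq_zero _ _ _ _ _ hl', map_zero]
      rcases h with ⟨h1, -, rfl⟩ | ⟨rfl, rfl⟩
      · rw [xyZ_of_neg p, smul_zero, smul_zero]
        left
        rw [Nat.add_sub_cancel] at hl hl'
        have : ((l + 1 : ℕ) : ℤ) = (k * p + r : ℕ) := by rw [Nat.cast_inj]; omega
        push_cast at this
        linarith
      · rw [Nat.sub_self, zero_mul, zero_add] at hl hl'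
        exact absurd ⟨1, by omega⟩ hd

theorem toPlane_opK (j k : ℕ) (hε : ((ε : ℤ) : ℂ) = (-1) ^ (j + k)) :
    toPlane p r n ε j k ∘ₗ opK p r n ε = QPlane.opK p ∘ₗ toPlane p r n ε j k := by
  refine lin_ext fun l hl => ?_
  rw [LinearMap.comp_apply, LinearMap.comp_apply, toPlane_w _ _ _ hl, map_smul,
    opK_xyZ, opK_w, map_smul, toPlane_w _ _ _ hl, smul_comm]
  congr 2
  rw [hε, show (k : ℤ) * p + r - 1 - l - (j * p + l) = r - 1 - 2 * l + k * p - j * p by ring,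
    q_zpow_sub_mul_p hp.out, q_zpow_add_mul_p hp.out]
  ring

theorem toPlane_opKi (j k : ℕ) (hε : ((ε : ℤ) : ℂ) = (-1) ^ (j + k)) :
    toPlane p r n ε j k ∘ₗ opKi p r n ε = QPlane.opKi p ∘ₗ toPlane p r n ε j k := by
  refine lin_ext fun l hl => ?_
  rw [LinearMap.comp_apply, LinearMap.comp_apply, toPlane_w _ _ _ hl, map_smul,
    opKi_xyZ, opKi_w, map_smul, toPlane_w _ _ _ hl, smul_comm]
  congr 2
  rw [hε, show (j : ℤ) * p + l - (k * p + r - 1 - l) = -((r : ℤ) - 1 - 2 * l) + j * p - k * p by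
    ring, q_zpow_sub_mul_p hp.out, q_zpow_add_mul_p hp.out]
  ring

theorem toPlane_gen_smul (j k : ℕ) (hr : 1 ≤ r) (hε : ε = (-1) ^ (j + k))
    (h : r < p ∧ j = 0 ∧ n = k + 1 ∨ r = p ∧ n = 1) (g : Gen) (x : WMod p r n ε) :
    toPlane p r n ε j k (SmallQG.gen p g • x) = SmallQG.gen p g • toPlane p r n ε j k x := by
  have hε' : ((ε : ℤ) : ℂ) = (-1) ^ (j + k) := by rw [hε]; push_cast; rfl
  rw [gen_smul, Lusztig.smul_eq_ofSmall_smul (N := QPlane p), Lusztig.ofSmall_gen]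
  cases g
  · exact (LinearMap.congr_fun (toPlane_opE j k hr hε' h) x).trans (QPlane.dE_smul p 1 _).symm
  · exact (LinearMap.congr_fun (toPlane_opF j k h) x).trans (QPlane.dF_smul p 1 _).symm
  · exact (LinearMap.congr_fun (toPlane_opK j k hε') x).trans (QPlane.K_smul p _).symm
  · exact (LinearMap.congr_fun (toPlane_opKi j k hε') x).trans (QPlane.Ki_smul p _).symm

end WMod

namespace QPlane

variable {p : ℕ} [hp : Fact (2 ≤ p)]

theorem nonempty_homog_equiv {N ι : Type*} [AddCommGroup N] [Module ℂ N] [Module (SmallQG p) N]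
    [IsScalarTower ℂ (SmallQG p) N] (φ : N →ₗ[SmallQG p] QPlane p) (B : Module.Basis ι ℂ N)
    (f : ι → ℕ × ℕ) (hf : Function.Injective f) (c : ι → ℂ) (hc : ∀ x, c x ≠ 0)
    (hφ : ∀ x, φ (B x) = c x • xy p (f x).1 (f x).2) (D : Set ℤ)
    (hD : ∀ m n : ℕ, (m : ℤ) + n ∈ D ↔ ∃ x, f x = (m, n)) :
    Nonempty (homog p D ≃ₗ[SmallQG p] N) := by
  have hmem (x : N) : φ x ∈ homog p D := by
    have hx : x ∈ Submodule.span ℂ (Set.range B) := by rw [B.span_eq]; trivial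
    induction hx using Submodule.span_induction with
    | mem x h =>
      obtain ⟨x, rfl⟩ := h
      rw [hφ, ← xyZ_natCast]
      exact (homog p D).smul_of_tower_mem _ (xyZ_mem_homog ((hD _ _).2 ⟨x, rfl⟩))
    | zero => rw [map_zero]; exact Submodule.zero_mem _
    | add x y _ _ h1 h2 => rw [map_add]; exact Submodule.add_mem _ h1 h2
    | smul a x _ h => rw [LinearMap.map_smul_of_tower]; exact (homog p D).smul_of_tower_mem _ h
  let ψ : QPlane p →ₗ[ℂ] N := (basis p).constr ℂ (Function.extend f (fun x => (c x)⁻¹ • B x) 0)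
  have hψ (x : N) : ψ (φ x) = x := by
    refine LinearMap.congr_fun (f := ψ ∘ₗ φ.restrictScalars ℂ) (g := LinearMap.id) (B.ext fun x => ?_) x
    rw [LinearMap.comp_apply, LinearMap.restrictScalars_apply, hφ, map_smul, xy,
      Module.Basis.constr_basis, hf.extend_apply, smul_smul, mul_inv_cancel₀ (hc x), one_smul]; rfl
  let φ' : N →ₗ[SmallQG p] homog p D :=
    { toFun := fun x => ⟨φ x, hmem x⟩
      map_add' := fun x y => Subtype.ext (map_add φ x y)
      map_smul' := fun a x => Subtype.ext (map_smul φ a x) }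
  refine ⟨(LinearEquiv.ofBijective φ' ⟨fun x y hxy => ?_, fun y => ?_⟩).symm⟩
  · rw [← hψ x, ← hψ y]
    exact congrArg ψ (congrArg Subtype.val hxy)
  · obtain ⟨y, hy⟩ := y
    obtain ⟨x, hx⟩ := homog_le (S := LinearMap.range (φ.restrictScalars ℂ)) (fun m n hmn => by
      obtain ⟨x, hx⟩ := (hD m n).1 hmn
      refine ⟨(c x)⁻¹ • B x, ?_⟩
      rw [map_smul, LinearMap.restrictScalars_apply, hφ, hx, smul_smul, inv_mul_cancel₀ (hc x),
        one_smul, xyZ_natCast]) hy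
    exact ⟨x, Subtype.ext hx⟩

theorem nonempty_homog_equiv_wmod {r n : ℕ} (hr : 1 ≤ r) (hrp : r < p) (hn : 1 ≤ n) :
    Nonempty (homog p {((n : ℤ) - 1) * p + r - 1} ≃ₗ[SmallQG p] WMod p r n (sgn n)) := by
  obtain ⟨k, rfl⟩ : ∃ k, n = k + 1 := ⟨n - 1, by omega⟩
  have hε : sgn (k + 1) = (-1) ^ (0 + k) := by rw [sgn, zero_add, add_assoc, pow_add]; simp
  refine nonempty_homog_equiv
    (SmallQG.mkLinear (WMod.toPlane p r (k + 1) (sgn (k + 1)) 0 k)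
      (WMod.toPlane_gen_smul 0 k hr hε (.inl ⟨hrp, rfl, rfl⟩)))
    (WMod.basis p r (k + 1) (sgn (k + 1))) (fun l => (k * p + r - 1 - (l : ℕ), (l : ℕ)))
    (fun l l' h => Fin.ext (Prod.ext_iff.1 h).2)
    (fun l => WMod.planeCoeff p r 0 k l)
    (fun l => WMod.planeCoeff_ne_zero (n := k + 1) 0 k hr (.inl hrp) _ l.2) (fun l => ?_) _ fun m n => ?_
  · refine (congrArg _ (WMod.w_fin _ _ _ _ l)).symm.trans
      ((WMod.toPlane_w _ _ _ l.2).trans ?_)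
    have := l.2
    simp only [Nat.add_sub_cancel] at this
    have e : ((k * p + r - 1 - (l : ℕ) : ℕ) : ℤ) = (k : ℤ) * p + r - 1 - (l : ℕ) := by
      rw [← Nat.cast_mul]; omega
    rw [← xyZ_natCast, e]
    congr 2
    push_cast; ring
  · simp only [Set.mem_singleton_iff, Prod.mk.injEq]
    push_cast
    rw [add_sub_cancel_right]
    have : (m : ℤ) + n = k * p + r - 1 ↔ m + n = k * p + r - 1 := by
      rw [← Nat.cast_mul, ← Nat.cast_add, ← Nat.cast_add]; omega
    rw [this]
    constructor
    · intro h
      exact ⟨⟨n, by simp only [Nat.add_sub_cancel]; omega⟩, by simp only; omega, rfl⟩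
    · rintro ⟨⟨l, hl⟩, h1, rfl⟩
      have hl' := hl
      rw [Nat.add_sub_cancel] at hl'
      change k * p + r - 1 - l = m at h1
      change m + l = k * p + r - 1
      omega

theorem nonempty_homog_equiv_pi (n : ℕ) (ε : ℤˣ) (hε : ε = (-1) ^ (n + 1)) :
    Nonempty (homog p {(n : ℤ) * p - 1} ≃ₗ[SmallQG p] (Fin n → XMod p p ε)) := by
  have hp2 := hp.out
  have hε' (j : Fin n) : ε = (-1) ^ ((j : ℕ) + (n - 1 - j)) := by
    obtain ⟨k, rfl⟩ : ∃ k, n = k + 1 := ⟨n - 1, by have := j.2; omega⟩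
    rw [hε, show (j : ℕ) + (k + 1 - 1 - j) = k by have := j.2; omega, pow_add, pow_add]; simp
  let φ (j : Fin n) : XMod p p ε →ₗ[SmallQG p] QPlane p :=
    SmallQG.mkLinear (WMod.toPlane p p 1 ε j (n - 1 - j))
      (WMod.toPlane_gen_smul j (n - 1 - j) (by omega) (hε' j) (.inr ⟨rfl, rfl⟩))
  refine nonempty_homog_equiv (∑ j, φ j ∘ₗ LinearMap.proj j)
    (Pi.basis fun _ : Fin n => WMod.basis p p 1 ε)
    (fun x => ((n - 1 - (x.1 : ℕ)) * p + (p - 1 - (x.2 : ℕ)), (x.1 : ℕ) * p + (x.2 : ℕ)))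
    ?_ (fun x => WMod.planeCoeff p p x.1 (n - 1 - x.1) x.2)
    (fun x => WMod.planeCoeff_ne_zero (n := 1) _ _ (by omega) (.inr ⟨rfl, rfl⟩) _ x.2.2) ?_ _ ?_
  · rintro ⟨j, l, hl⟩ ⟨j', l', hl'⟩ h
    have h := (Prod.ext_iff.1 h).2
    simp only [Nat.sub_self, zero_mul, zero_add] at h hl hl'
    have e1 : l = l' := by
      have := congrArg (· % p) h
      simpa [Nat.mul_add_mod_self_right, Nat.mod_eq_of_lt hl, Nat.mod_eq_of_lt hl'] using this
    subst e1
    have e2 : j = j' := Fin.ext (Nat.eq_of_mul_eq_mul_right (by omega : 0 < p) (Nat.add_right_cancel h))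
    subst e2
    rfl
  · rintro ⟨j, l⟩
    rw [Pi.basis_apply, LinearMap.sum_apply, Finset.sum_eq_single j]
    · rw [LinearMap.comp_apply, LinearMap.proj_apply, Pi.single_eq_same]
      refine (congrArg _ (WMod.w_fin _ _ _ _ l)).symm.trans
        ((WMod.toPlane_w _ _ _ l.2).trans ?_)
      have := l.2
      simp only [Nat.sub_self, zero_mul, zero_add] at this
      rw [← xyZ_natCast]
      congr 2 <;> push_cast [Nat.cast_sub (show (l : ℕ) ≤ p - 1 by omega),
        Nat.cast_sub (show 1 ≤ p by omega)] <;> ring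
    · intro j' _ hj'
      rw [LinearMap.comp_apply, LinearMap.proj_apply, Pi.single_eq_of_ne hj', map_zero]
    · exact fun h => absurd (Finset.mem_univ _) h
  · intro a b
    simp only [Set.mem_singleton_iff, Prod.mk.injEq]
    constructor
    · intro h
      have h' : a + b + 1 = n * p := by
        have : ((a + b + 1 : ℕ) : ℤ) = (n * p : ℕ) := by push_cast; linarith
        exact_mod_cast this
      have hj : b / p < n := Nat.div_lt_of_lt_mul (by rw [mul_comm]; omega)
      have hb := Nat.div_add_mod' b p
      have hm := Nat.mod_lt b (by omega : 0 < p)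
      refine ⟨⟨⟨b / p, hj⟩, ⟨b % p, by simpa using hm⟩⟩, ?_, hb⟩
      simp only
      obtain ⟨t, rfl⟩ : ∃ t, n = b / p + t + 1 := ⟨n - 1 - b / p, by omega⟩
      rw [show b / p + t + 1 - 1 - b / p = t by omega]
      rw [add_mul, add_mul, one_mul] at h'
      omega
    · rintro ⟨⟨⟨j, hj⟩, ⟨l, hl⟩⟩, h1, h2⟩
      simp only [Nat.sub_self, zero_mul, zero_add] at h1 h2 hl
      obtain ⟨t, rfl⟩ : ∃ t, n = j + t + 1 := ⟨n - 1 - j, by omega⟩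
      rw [show j + t + 1 - 1 - j = t by omega] at h1
      have : ((a + b + 1 : ℕ) : ℤ) = ((j + t + 1) * p : ℕ) := by
        rw [Nat.cast_inj, add_mul, add_mul, one_mul]; omega
      push_cast at this ⊢
      linarith

end QPlane

end QSl2

end

noncomputable section

namespace QSl2

open QPlane OneForm

section qBinom

variable {k : Type*} [Field k] {v : k}

theorem qInt_mul_qBinom_add (hv : v ≠ 0) (h : v - v⁻¹ ≠ 0) (a n : ℕ) :
    qInt v (a + 1) * qBinom v (a + 1 + n) n = qInt v (a + n + 1) * qBinom v (a + n) n := by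
  have h1 := qInt_mul_qBinom_succ_succ hv h (a + n) a
  rw [show a + n + 1 = (a + 1) + n by ring, qBinom_symm hv h (a + 1) n, qBinom_symm hv h a n] at h1
  rw [h1]
  push_cast; rfl

end qBinom

variable (p : ℕ) [hp : Fact (2 ≤ p)]

theorem d_xyZ (a b : ℤ) : d p (xyZ p a b) =
    OneForm.mk p (q p ^ (a + b - 1) • xyZ p (a - 1) b) (q p ^ (b - 1) • xyZ p a (b - 1)) := by
  induction a, b using mon_cases with
  | h m n =>
    rw [xyZ_natCast, xy, d, Module.Basis.constr_basis, ← mk_add_mk]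
    congr 1
    · cases m with
      | zero => rw [xyZ_of_neg p (by simp), smul_zero]; rfl
      | succ m =>
        simp only
        rw [smul_ξ, show ((m + 1 : ℕ) : ℤ) - 1 = m by push_cast; ring, xyZ_natCast,
          OneForm.smul_mk, smul_zero, ← zpow_natCast]
        congr 3; push_cast; ring
    · cases n with
      | zero => rw [xyZ_of_neg p (a := m) (by simp), smul_zero]; rfl
      | succ n =>
        simp only
        rw [smul_η, show ((n + 1 : ℕ) : ℤ) - 1 = n by push_cast; ring, xyZ_natCast,
          OneForm.smul_mk, smul_zero, ← zpow_natCast]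
  | h0 a b h =>
    rw [xyZ_of_neg p h, xyZ_of_neg p (a := a - 1) (by omega), xyZ_of_neg p (b := b - 1) (by omega),
      map_zero, smul_zero, smul_zero]; rfl

/-- Multiplication by the invariant one-form `y ξ - q x η`. -/
def kappa : QPlane p →ₗ[ℂ] OneForm p :=
  (basis p).constr ℂ fun s => OneForm.mk p (qInt (q p) ((s.2 : ℤ) + 1) • xyZ p s.1 (s.2 + 1))
    (-(q p ^ ((s.2 : ℤ) + 1) * qInt (q p) ((s.1 : ℤ) + 1)) • xyZ p (s.1 + 1) s.2)

theorem kappa_xyZ (a b : ℤ) : kappa p (xyZ p a b) =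
    OneForm.mk p (qInt (q p) (b + 1) • xyZ p a (b + 1))
      (-(q p ^ (b + 1) * qInt (q p) (a + 1)) • xyZ p (a + 1) b) := by
  induction a, b using mon_cases with
  | h m n => rw [xyZ_natCast, xy, kappa, Module.Basis.constr_basis]
  | h0 a b h =>
    have h1 : qInt (q p) (b + 1) • xyZ p a (b + 1) = 0 := by
      by_cases hb : b = -1
      · rw [hb, neg_add_cancel, qInt_zero, zero_smul]
      · rw [xyZ_of_neg p (by omega), smul_zero]
    have h2 : -(q p ^ (b + 1) * qInt (q p) (a + 1)) • xyZ p (a + 1) b = 0 := by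
      by_cases hb : a = -1
      · rw [hb, neg_add_cancel, qInt_zero, mul_zero, neg_zero, zero_smul]
      · rw [xyZ_of_neg p (by omega), smul_zero]
    rw [xyZ_of_neg p h, map_zero, h1, h2]; rfl

/-- The contraction `f ξ + g η ↦ f x + g y`. -/
def contraction : OneForm p →ₗ[ℂ] QPlane p :=
  (LinearMap.coprod
    ((basis p).constr ℂ fun s =>
      (q p ^ (s.2 : ℤ) * qInt (q p) ((s.1 : ℤ) + 1)) • xyZ p (s.1 + 1) s.2)
    ((basis p).constr ℂ fun s => qInt (q p) ((s.2 : ℤ) + 1) • xyZ p s.1 (s.2 + 1)) :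
    QPlane p × QPlane p →ₗ[ℂ] QPlane p)

theorem contraction_mk (f g : QPlane p) : contraction p (OneForm.mk p f g) =
    contraction p (OneForm.mk p f 0) + contraction p (OneForm.mk p 0 g) := by
  rw [← map_add, mk_add_mk]

theorem contraction_xyZ_left (a b : ℤ) : contraction p (OneForm.mk p (xyZ p a b) 0) =
    (q p ^ b * qInt (q p) (a + 1)) • xyZ p (a + 1) b := by
  induction a, b using mon_cases with
  | h m n =>
    refine (LinearMap.coprod_apply _ _ _).trans ?_
    change _ + (Module.Basis.constr _ _ _) (0 : QPlane p) = _
    rw [map_zero, add_zero]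
    change (Module.Basis.constr _ _ _) (xyZ p m n) = _
    rw [xyZ_natCast, xy, Module.Basis.constr_basis]
  | h0 a b h =>
    have h2 : (q p ^ b * qInt (q p) (a + 1)) • xyZ p (a + 1) b = 0 := by
      by_cases hb : a = -1
      · rw [hb, neg_add_cancel, qInt_zero, mul_zero, zero_smul]
      · rw [xyZ_of_neg p (by omega), smul_zero]
    rw [xyZ_of_neg p h, h2]
    exact map_zero _

theorem contraction_xyZ_right (a b : ℤ) : contraction p (OneForm.mk p 0 (xyZ p a b)) =
    qInt (q p) (b + 1) • xyZ p a (b + 1) := by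
  induction a, b using mon_cases with
  | h m n =>
    refine (LinearMap.coprod_apply _ _ _).trans ?_
    change (Module.Basis.constr _ _ _) (0 : QPlane p) + _ = _
    rw [map_zero, zero_add]
    change (Module.Basis.constr _ _ _) (xyZ p m n) = _
    rw [xyZ_natCast, xy, Module.Basis.constr_basis]
  | h0 a b h =>
    have h2 : qInt (q p) (b + 1) • xyZ p a (b + 1) = 0 := by
      by_cases hb : b = -1
      · rw [hb, neg_add_cancel, qInt_zero, zero_smul]
      · rw [xyZ_of_neg p (by omega), smul_zero]
    rw [xyZ_of_neg p h, h2]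
    exact map_zero _

/-- The linear map from one-forms to the quantum plane that vanishes on exact forms and
inverts `kappa` up to scalars on the graded components. -/
def curl : OneForm p →ₗ[ℂ] QPlane p :=
  (LinearMap.coprod
    ((basis p).constr ℂ fun s => q p ^ (-((s.1 : ℤ) + 1)) • xyZ p s.1 (s.2 - 1))
    ((basis p).constr ℂ fun s => -xyZ p (s.1 - 1) s.2) :
    QPlane p × QPlane p →ₗ[ℂ] QPlane p)

theorem curl_mk (f g : QPlane p) : curl p (OneForm.mk p f g) =
    curl p (OneForm.mk p f 0) + curl p (OneForm.mk p 0 g) := by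
  rw [← map_add, mk_add_mk]

theorem curl_xyZ_left (a b : ℤ) : curl p (OneForm.mk p (xyZ p a b) 0) =
    q p ^ (-(a + 1)) • xyZ p a (b - 1) := by
  induction a, b using mon_cases with
  | h m n =>
    refine (LinearMap.coprod_apply _ _ _).trans ?_
    change _ + (Module.Basis.constr _ _ _) (0 : QPlane p) = _
    rw [map_zero, add_zero]
    change (Module.Basis.constr _ _ _) (xyZ p m n) = _
    rw [xyZ_natCast, xy, Module.Basis.constr_basis]
  | h0 a b h =>
    rw [xyZ_of_neg p h, xyZ_of_neg p (b := b - 1) (by omega), smul_zero]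
    exact map_zero _

theorem curl_xyZ_right (a b : ℤ) : curl p (OneForm.mk p 0 (xyZ p a b)) =
    -xyZ p (a - 1) b := by
  induction a, b using mon_cases with
  | h m n =>
    refine (LinearMap.coprod_apply _ _ _).trans ?_
    change (Module.Basis.constr _ _ _) (0 : QPlane p) + _ = _
    rw [map_zero, zero_add]
    change (Module.Basis.constr _ _ _) (xyZ p m n) = _
    rw [xyZ_natCast, xy, Module.Basis.constr_basis]
  | h0 a b h =>
    rw [xyZ_of_neg p h, xyZ_of_neg p (a := a - 1) (by omega), neg_zero]
    exact map_zero _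

theorem OneForm.mk_smul_left (c : ℂ) (f : QPlane p) :
    OneForm.mk p (c • f) 0 = c • OneForm.mk p f 0 := by rw [OneForm.smul_mk, smul_zero]

theorem OneForm.mk_smul_right (c : ℂ) (f : QPlane p) :
    OneForm.mk p 0 (c • f) = c • OneForm.mk p 0 f := by rw [OneForm.smul_mk, smul_zero]

theorem contraction_d (a b : ℤ) : contraction p (d p (xyZ p a b)) =
    (q p ^ (a + b - 1) * qInt (q p) (a + b)) • xyZ p a b := by
  have hq := q_ne_zero p
  rw [d_xyZ, contraction_mk, mk_smul_left, mk_smul_right, map_smul, map_smul,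
    contraction_xyZ_left, contraction_xyZ_right, sub_add_cancel, sub_add_cancel, smul_smul,
    smul_smul, ← add_smul, qInt_add hq]
  congr 1
  simp only [zpow_sub₀ hq, zpow_add₀ hq, zpow_neg]
  have := zpow_ne_zero a hq
  field_simp

theorem contraction_kappa (a b : ℤ) : contraction p (kappa p (xyZ p a b)) = 0 := by
  rw [kappa_xyZ, contraction_mk, mk_smul_left, mk_smul_right, map_smul, map_smul,
    contraction_xyZ_left, contraction_xyZ_right, smul_smul, smul_smul, ← add_smul]
  convert zero_smul ℂ _ using 2
  ring

theorem curl_kappa (a b : ℤ) : curl p (kappa p (xyZ p a b)) =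
    qInt (q p) (a + b + 2) • xyZ p a b := by
  have hq := q_ne_zero p
  rw [kappa_xyZ, curl_mk, mk_smul_left, mk_smul_right, map_smul, map_smul,
    curl_xyZ_left, curl_xyZ_right, add_sub_cancel_right, add_sub_cancel_right, smul_smul, smul_neg,
    ← sub_eq_add_neg, ← sub_smul, show a + b + 2 = (a + 1) + (b + 1) by ring,
    qInt_add hq (a + 1) (b + 1)]
  congr 1
  ring

theorem d_contraction_left (a b : ℤ) :
    q p ^ (-(a + b)) • d p (contraction p (OneForm.mk p (xyZ p a b) 0)) +
      kappa p (curl p (OneForm.mk p (xyZ p a b) 0)) =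
    qInt (q p) (a + b + 1) • OneForm.mk p (xyZ p a b) 0 := by
  have hq := q_ne_zero p
  rw [contraction_xyZ_left, curl_xyZ_left, map_smul, map_smul, d_xyZ, kappa_xyZ, sub_add_cancel,
    add_sub_cancel_right]
  simp only [OneForm.smul_mk, OneForm.add_mk, smul_smul, ← add_smul, smul_zero]
  rw [show a + b + 1 = (a + 1) + b by ring, qInt_add hq (a + 1) b]
  have h0 : ∀ z : ℤ, q p ^ z ≠ 0 := fun z => zpow_ne_zero z hq
  congr 1
  · congr 1
    simp only [zpow_sub₀ hq, zpow_add₀ hq, zpow_neg, zpow_one]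
    field_simp [h0 a, h0 b]
  · convert zero_smul ℂ _ using 2
    simp only [zpow_sub₀ hq, zpow_add₀ hq, zpow_neg, zpow_one]
    field_simp [h0 a, h0 b]
    ring

theorem d_contraction_right (a b : ℤ) :
    q p ^ (-(a + b)) • d p (contraction p (OneForm.mk p 0 (xyZ p a b))) +
      kappa p (curl p (OneForm.mk p 0 (xyZ p a b))) =
    qInt (q p) (a + b + 1) • OneForm.mk p 0 (xyZ p a b) := by
  have hq := q_ne_zero p
  rw [contraction_xyZ_right, curl_xyZ_right, map_smul, map_neg, d_xyZ, kappa_xyZ, sub_add_cancel,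
    add_sub_cancel_right]
  simp only [OneForm.smul_mk, OneForm.neg_mk, ← neg_smul, OneForm.add_mk, smul_smul, ← add_smul,
    smul_zero]
  rw [show a + b + 1 = a + (b + 1) by ring, qInt_add hq a (b + 1)]
  have h0 : ∀ z : ℤ, q p ^ z ≠ 0 := fun z => zpow_ne_zero z hq
  congr 1
  · convert zero_smul ℂ _ using 2
    simp only [zpow_sub₀ hq, zpow_add₀ hq, zpow_neg, zpow_one]
    field_simp [h0 a, h0 b]
    ring
  · congr 1
    simp only [zpow_sub₀ hq, zpow_add₀ hq, zpow_neg, zpow_one]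
    field_simp [h0 a, h0 b]
    ring

variable {p} in
/-- A linear map out of the quantum plane that commutes with the generators on monomials. -/
def QPlane.mkLinear {N : Type*} [AddCommGroup N] [Module ℂ N] [Module (Lusztig p) N]
    [IsScalarTower ℂ (Lusztig p) N] (f : QPlane p →ₗ[ℂ] N)
    (hK : ∀ m n : ℕ, f (Lusztig.K p • xyZ p m n) = Lusztig.K p • f (xyZ p m n))
    (hKi : ∀ m n : ℕ, f (Lusztig.Ki p • xyZ p m n) = Lusztig.Ki p • f (xyZ p m n))
    (hE : ∀ k m n : ℕ,
      f (Lusztig.dE p (k + 1) • xyZ p m n) = Lusztig.dE p (k + 1) • f (xyZ p m n))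
    (hF : ∀ k m n : ℕ,
      f (Lusztig.dF p (k + 1) • xyZ p m n) = Lusztig.dF p (k + 1) • f (xyZ p m n)) :
    QPlane p →ₗ[Lusztig p] N :=
  have key (a : Lusztig p) (h : ∀ m n : ℕ, f (a • xyZ p m n) = a • f (xyZ p m n)) (x : QPlane p) :
      f (a • x) = a • f x :=
    LinearMap.congr_fun (f := f ∘ₗ Algebra.lsmul ℂ ℂ (QPlane p) a)
      (g := Algebra.lsmul ℂ ℂ N a ∘ₗ f) (QPlane.hom_ext h) x
  Lusztig.mkLinear f (key _ hK) (key _ hKi) (fun k => key _ (hE k)) (fun k => key _ (hF k))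

theorem toNat_add_natCast (a n : ℕ) : ((a : ℤ) + (n : ℕ)).toNat = a + n := by
  rw [← Nat.cast_add, Int.toNat_natCast]

theorem toNat_pred_add (a n : ℕ) : ((a : ℤ) - 1 + ((n + 1 : ℕ) : ℤ)).toNat = a + n := by
  rw [← Int.toNat_natCast (a + n)]; congr 1; push_cast; ring

theorem toNat_succ_add (a n : ℕ) : ((a : ℤ) + 1 + (n : ℤ)).toNat = a + 1 + n := by
  rw [← Int.toNat_natCast (a + 1 + n)]; congr 1

/-- The differential commutes with the action of `U_q sl(2)`. -/
def dHom : QPlane p →ₗ[Lusztig p] OneForm p :=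
  QPlane.mkLinear (d p)
    (fun m n => by
      have hq := q_ne_zero p
      rw [QPlane.K_smul, opK_xyZ, map_smul, d_xyZ, OneForm.K_smul_mk, QPlane.K_smul, QPlane.K_smul,
        map_smul, map_smul, opK_xyZ, opK_xyZ]
      simp only [OneForm.smul_mk, smul_smul]
      have h0 : ∀ z : ℤ, q p ^ z ≠ 0 := fun z => zpow_ne_zero z hq
      congr 2 <;> simp only [zpow_sub₀ hq, zpow_add₀ hq, zpow_neg, zpow_one] <;> field_simp)
    (fun m n => by
      have hq := q_ne_zero p
      rw [QPlane.Ki_smul, opKi_xyZ, map_smul, d_xyZ, OneForm.Ki_smul_mk, QPlane.Ki_smul,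
        QPlane.Ki_smul, map_smul, map_smul, opKi_xyZ, opKi_xyZ]
      simp only [OneForm.smul_mk, smul_smul]
      have h0 : ∀ z : ℤ, q p ^ z ≠ 0 := fun z => zpow_ne_zero z hq
      congr 2 <;> simp only [zpow_sub₀ hq, zpow_add₀ hq, zpow_neg, zpow_one] <;> field_simp)
    (fun k m n => by
      have hq := q_ne_zero p
      have h0 : ∀ z : ℤ, q p ^ z ≠ 0 := fun z => zpow_ne_zero z hq
      rw [QPlane.dE_smul, opEd_xyZ, map_smul, d_xyZ, d_xyZ, OneForm.dE_smul_mk]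
      simp only [QPlane.dE_smul, map_smul, opEd_xyZ, OneForm.smul_mk, smul_smul]
      rw [toNat_pred_add, toNat_add_natCast, toNat_add_natCast,
        show (m : ℤ) + (k + 1 : ℕ) - 1 = m + k by push_cast; ring,
        show (m : ℤ) - 1 + (k + 1 : ℕ) = m + k by push_cast; ring,
        show (n : ℤ) - (k + 1 : ℕ) - 1 = n - 1 - (k + 1 : ℕ) by push_cast; ring,
        show (n : ℤ) - 1 - k = n - (k + 1 : ℕ) by push_cast; ring, ← add_smul]
      congr 2
      · rw [← add_assoc m k 1, qBinom_succ_succ]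
        push_cast
        simp only [zpow_sub₀ hq, zpow_add₀ hq, zpow_neg, zpow_one, zpow_natCast]
        field_simp [h0]
      · push_cast
        simp only [zpow_sub₀ hq, zpow_add₀ hq, zpow_neg, zpow_one, zpow_natCast, inv_pow]
        field_simp [h0]
        ring)
    (fun k m n => by
      have hq := q_ne_zero p
      have h0 : ∀ z : ℤ, q p ^ z ≠ 0 := fun z => zpow_ne_zero z hq
      rw [QPlane.dF_smul, opFd_xyZ, map_smul, d_xyZ, d_xyZ, OneForm.dF_smul_mk]
      simp only [QPlane.dF_smul, QPlane.Ki_smul, map_smul, opKi_xyZ, opFd_xyZ, OneForm.smul_mk,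
        smul_smul]
      rw [toNat_pred_add, toNat_add_natCast, toNat_add_natCast,
        show (n : ℤ) + (k + 1 : ℕ) - 1 = n + k by push_cast; ring,
        show (n : ℤ) - 1 + (k + 1 : ℕ) = n + k by push_cast; ring,
        show (m : ℤ) - (k + 1 : ℕ) - 1 = m - 1 - (k + 1 : ℕ) by push_cast; ring,
        show (m : ℤ) - 1 - k = m - (k + 1 : ℕ) by push_cast; ring, ← add_smul]
      congr 2
      · push_cast
        simp only [zpow_sub₀ hq, zpow_add₀ hq, zpow_neg, zpow_one, zpow_natCast]
        field_simp [h0]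
      · rw [← add_assoc n k 1, qBinom_succ_succ' hq (q_sub_inv_ne_zero p hp.out)]
        push_cast
        simp only [zpow_sub₀ hq, zpow_add₀ hq, zpow_neg, zpow_one, zpow_natCast]
        field_simp [h0]
        try ring)

/-- The map `kappa` commutes with the action of `U_q sl(2)`. -/
def kappaHom : QPlane p →ₗ[Lusztig p] OneForm p :=
  QPlane.mkLinear (kappa p)
    (fun m n => by
      have hq := q_ne_zero p
      rw [QPlane.K_smul, opK_xyZ, map_smul, kappa_xyZ, OneForm.K_smul_mk, QPlane.K_smul,
        QPlane.K_smul, map_smul, map_smul, opK_xyZ, opK_xyZ]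
      simp only [OneForm.smul_mk, smul_smul]
      have h0 : ∀ z : ℤ, q p ^ z ≠ 0 := fun z => zpow_ne_zero z hq
      congr 2 <;> simp only [zpow_sub₀ hq, zpow_add₀ hq, zpow_neg, zpow_one] <;> field_simp)
    (fun m n => by
      have hq := q_ne_zero p
      rw [QPlane.Ki_smul, opKi_xyZ, map_smul, kappa_xyZ, OneForm.Ki_smul_mk, QPlane.Ki_smul,
        QPlane.Ki_smul, map_smul, map_smul, opKi_xyZ, opKi_xyZ]
      simp only [OneForm.smul_mk, smul_smul]
      have h0 : ∀ z : ℤ, q p ^ z ≠ 0 := fun z => zpow_ne_zero z hq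
      congr 2 <;> simp only [zpow_sub₀ hq, zpow_add₀ hq, zpow_neg, zpow_one] <;> field_simp)
    (fun k m n => by
      have hq := q_ne_zero p
      have hs := q_sub_inv_ne_zero p hp.out
      have h0 : ∀ z : ℤ, q p ^ z ≠ 0 := fun z => zpow_ne_zero z hq
      have h1 := qInt_mul_qBinom_succ hq hs (m + k + 1) k
      have h2 := qInt_mul_qBinom_add hq hs m (k + 1)
      have h3 := qInt_add hq (-((k : ℤ) + 1)) (n + 1)
      rw [QPlane.dE_smul, opEd_xyZ, map_smul, kappa_xyZ, kappa_xyZ, OneForm.dE_smul_mk]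
      simp only [QPlane.dE_smul, map_smul, opEd_xyZ, OneForm.smul_mk, smul_smul]
      rw [toNat_add_natCast, toNat_succ_add, toNat_succ_add,
        show (m : ℤ) + 1 + k = m + (k + 1 : ℕ) by push_cast; ring,
        show (m : ℤ) + 1 + (k + 1 : ℕ) = m + (k + 1 : ℕ) + 1 by push_cast; ring,
        show (n : ℤ) + 1 - (k + 1 : ℕ) = n - (k + 1 : ℕ) + 1 by push_cast; ring,
        show (n : ℤ) - k = n - (k + 1 : ℕ) + 1 by push_cast; ring, ← add_smul,
        show m + 1 + k = m + (k + 1) by ring]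
      rw [show ((m + k + 1 : ℕ) : ℤ) - k = m + 1 by push_cast; ring,
        show m + k + 1 = m + (k + 1) by ring] at h1
      rw [neg_neg, qInt_neg, show -((k : ℤ) + 1) + (n + 1) = n - (k + 1) + 1 by ring] at h3
      push_cast at h2 ⊢
      rw [show (m : ℤ) + (k + 1) + 1 = m + (k + 1) + 1 by ring] at *
      congr 2
      · rw [h3]
        simp only [zpow_add₀ hq, zpow_one, zpow_natCast, pow_succ]
        linear_combination (-(q p ^ n * q p)) * h1
      · have h4 : q p ^ ((n : ℤ) - (k + 1) + 1) = (q p)⁻¹ ^ (k + 1) * q p ^ ((n : ℤ) + 1) := by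
          rw [inv_pow, ← zpow_natCast, ← zpow_neg, ← zpow_add₀ hq]
          congr 1; push_cast; ring
        rw [h4]
        linear_combination ((q p)⁻¹ ^ (k + 1) * q p ^ ((n : ℤ) + 1)) * h2)
    (fun k m n => by
      have hq := q_ne_zero p
      have hs := q_sub_inv_ne_zero p hp.out
      have h0 : ∀ z : ℤ, q p ^ z ≠ 0 := fun z => zpow_ne_zero z hq
      have h1 := qInt_mul_qBinom_succ hq hs (n + k + 1) k
      have h2 := qInt_mul_qBinom_add hq hs n (k + 1)
      have h3 := qInt_add hq ((m : ℤ) - k) (k + 1)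
      rw [QPlane.dF_smul, opFd_xyZ, map_smul, kappa_xyZ, kappa_xyZ, OneForm.dF_smul_mk]
      simp only [QPlane.dF_smul, QPlane.Ki_smul, map_smul, opFd_xyZ, opKi_xyZ, OneForm.smul_mk,
        smul_smul]
      rw [toNat_add_natCast, toNat_succ_add, toNat_succ_add,
        show (n : ℤ) + 1 + k = n + (k + 1 : ℕ) by push_cast; ring,
        show (n : ℤ) + 1 + (k + 1 : ℕ) = n + (k + 1 : ℕ) + 1 by push_cast; ring,
        show (m : ℤ) + 1 - (k + 1 : ℕ) = m - (k + 1 : ℕ) + 1 by push_cast; ring,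
        show (m : ℤ) - k = m - (k + 1 : ℕ) + 1 by push_cast; ring, ← add_smul,
        show n + 1 + k = n + (k + 1) by ring]
      rw [show ((n + k + 1 : ℕ) : ℤ) - k = n + 1 by push_cast; ring,
        show n + k + 1 = n + (k + 1) by ring] at h1
      rw [show (m : ℤ) - k + (k + 1) = m + 1 by ring,
        show (m : ℤ) - k = m - (k + 1) + 1 by ring] at h3
      push_cast at h2 ⊢
      congr 2
      · linear_combination -h2
      · have h5 := h0 m
        have h6 := h0 n
        have h7 := h0 k
        have h8 : q p ^ (-((m : ℤ) - (k + 1) + 1)) = q p ^ (k : ℤ) / q p ^ (m : ℤ) := by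
          rw [← zpow_sub₀ hq]; congr 1; ring
        rw [h3, h8]
        simp only [zpow_sub₀ hq, zpow_add₀ hq, zpow_one, ← zpow_natCast]
        field_simp
        linear_combination h1)

end QSl2

end

noncomputable section

namespace QSl2

open QPlane OneForm

section

variable {p : ℕ} [hp : Fact (2 ≤ p)]

theorem dHom_apply (f : QPlane p) : dHom p f = d p f := rfl

theorem kappaHom_apply (f : QPlane p) : kappaHom p f = kappa p f := rfl

theorem contraction_d_of_mem {i : ℤ} {f : QPlane p} (hf : f ∈ QPlane.homog p {i}) :
    contraction p (d p f) = (q p ^ (i - 1) * qInt (q p) i) • f := by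
  refine homog_induction (P := fun f => contraction p (d p f) = (q p ^ (i - 1) * qInt (q p) i) • f)
    hf (fun m n h => ?_) ?_ (fun f g hf hg => ?_) (fun c f hf => ?_)
  · rw [Set.mem_singleton_iff] at h
    rw [contraction_d, h]
  · rw [map_zero, map_zero, smul_zero]
  · rw [map_add, map_add, hf, hg, smul_add]
  · rw [map_smul, map_smul, hf, smul_comm]

theorem curl_kappa_of_mem {i : ℤ} {f : QPlane p} (hf : f ∈ QPlane.homog p {i}) :
    curl p (kappa p f) = qInt (q p) (i + 2) • f := by
  refine homog_induction (P := fun f => curl p (kappa p f) = qInt (q p) (i + 2) • f)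
    hf (fun m n h => ?_) ?_ (fun f g hf hg => ?_) (fun c f hf => ?_)
  · rw [Set.mem_singleton_iff] at h
    rw [curl_kappa, h]
  · rw [map_zero, map_zero, smul_zero]
  · rw [map_add, map_add, hf, hg, smul_add]
  · rw [map_smul, map_smul, hf, smul_comm]

theorem contraction_kappa_eq_zero (f : QPlane p) : contraction p (kappa p f) = 0 :=
  LinearMap.congr_fun (f := contraction p ∘ₗ kappa p) (g := 0)
    (QPlane.hom_ext fun m n => contraction_kappa p m n) f

theorem d_injOn {i : ℤ} (hi : ¬ (p : ℤ) ∣ i) {f : QPlane p} (hf : f ∈ QPlane.homog p {i})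
    (h : d p f = 0) : f = 0 := by
  have := contraction_d_of_mem hf
  rw [h, map_zero] at this
  refine (smul_eq_zero.1 this.symm).resolve_left (mul_ne_zero (zpow_ne_zero _ (q_ne_zero p)) ?_)
  rwa [Ne, qInt_eq_zero_iff hp.out]

theorem kappa_injOn {i : ℤ} (hi : ¬ (p : ℤ) ∣ i + 2) {f : QPlane p}
    (hf : f ∈ QPlane.homog p {i}) (h : kappa p f = 0) : f = 0 := by
  have := curl_kappa_of_mem hf
  rw [h, map_zero] at this
  refine (smul_eq_zero.1 this.symm).resolve_left ?_
  rwa [qInt_eq_zero_iff hp.out]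

variable (p) in
/-- The exact one-forms with coefficients of degree `g`. -/
def dPart (g : ℤ) : Submodule (Lusztig p) (OneForm p) := (QPlane.homog p {g + 1}).map (dHom p)

variable (p) in
/-- The multiples of the invariant one-form with coefficients of degree `g`. -/
def kappaPart (g : ℤ) : Submodule (Lusztig p) (OneForm p) :=
  (QPlane.homog p {g - 1}).map (kappaHom p)

theorem dPart_le (g : ℤ) : dPart p g ≤ OneForm.homog p {g} := by
  rintro _ ⟨f, hf, rfl⟩
  refine homog_le (S := ((OneForm.homog p {g}).restrictScalars ℂ).comap (d p)) (fun m n h => ?_) hf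
  rw [Set.mem_singleton_iff] at h
  rw [Submodule.mem_comap, d_xyZ]
  refine mk_mem_homog_iff.2 ⟨Submodule.smul_of_tower_mem _ _ (xyZ_mem_homog ?_),
    Submodule.smul_of_tower_mem _ _ (xyZ_mem_homog ?_)⟩ <;> rw [Set.mem_singleton_iff] <;> omega

theorem kappaPart_le (g : ℤ) : kappaPart p g ≤ OneForm.homog p {g} := by
  rintro _ ⟨f, hf, rfl⟩
  refine homog_le (S := ((OneForm.homog p {g}).restrictScalars ℂ).comap (kappa p))
    (fun m n h => ?_) hf
  rw [Set.mem_singleton_iff] at h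
  rw [Submodule.mem_comap, kappa_xyZ]
  refine mk_mem_homog_iff.2 ⟨Submodule.smul_of_tower_mem _ _ (xyZ_mem_homog ?_),
    Submodule.smul_of_tower_mem _ _ (xyZ_mem_homog ?_)⟩ <;> rw [Set.mem_singleton_iff] <;> omega

theorem disjoint_dPart_kappaPart {g : ℤ} (hg : ¬ (p : ℤ) ∣ g + 1) :
    Disjoint (dPart p g) (kappaPart p g) := by
  rw [Submodule.disjoint_def]
  rintro _ ⟨f, hf, rfl⟩ ⟨h, -, hh⟩
  have h1 := contraction_d_of_mem hf
  rw [← dHom_apply, ← hh, kappaHom_apply, contraction_kappa_eq_zero] at h1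
  have : f = 0 := by
    refine (smul_eq_zero.1 h1.symm).resolve_left (mul_ne_zero (zpow_ne_zero _ (q_ne_zero p)) ?_)
    rwa [Ne, qInt_eq_zero_iff hp.out]
  rw [this, map_zero]

theorem homog_le_dPart_sup_kappaPart {g : ℤ} (hg : ¬ (p : ℤ) ∣ g + 1) :
    OneForm.homog p {g} ≤ dPart p g ⊔ kappaPart p g := by
  have h0 : qInt (q p) (g + 1) ≠ 0 := by rwa [Ne, qInt_eq_zero_iff hp.out]
  have key (u : OneForm p) (h1 : contraction p u ∈ QPlane.homog p {g + 1})
      (h2 : curl p u ∈ QPlane.homog p {g - 1})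
      (h : q p ^ (-g) • d p (contraction p u) + kappa p (curl p u) = qInt (q p) (g + 1) • u) :
      u ∈ dPart p g ⊔ kappaPart p g := by
    have h3 : qInt (q p) (g + 1) • u ∈ dPart p g ⊔ kappaPart p g := by
      rw [← h]
      exact Submodule.add_mem _
        (Submodule.smul_of_tower_mem _ _ (Submodule.mem_sup_left ⟨_, h1, rfl⟩))
        (Submodule.mem_sup_right ⟨_, h2, rfl⟩)
    have h4 := Submodule.smul_of_tower_mem (dPart p g ⊔ kappaPart p g) (qInt (q p) (g + 1))⁻¹ h3
    rwa [smul_smul, inv_mul_cancel₀ h0, one_smul] at h4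
  refine OneForm.homog_le (S := (dPart p g ⊔ kappaPart p g).restrictScalars ℂ)
    (fun m n h => ?_) (fun m n h => ?_) <;> rw [Set.mem_singleton_iff] at h
  · refine key _ ?_ ?_ ?_
    · rw [contraction_xyZ_left]
      exact Submodule.smul_of_tower_mem _ _ (xyZ_mem_homog (by rw [Set.mem_singleton_iff]; omega))
    · rw [curl_xyZ_left]
      exact Submodule.smul_of_tower_mem _ _ (xyZ_mem_homog (by rw [Set.mem_singleton_iff]; omega))
    · rw [← h]; exact d_contraction_left p m n
  · refine key _ ?_ ?_ ?_
    · rw [contraction_xyZ_right]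
      exact Submodule.smul_of_tower_mem _ _ (xyZ_mem_homog (by rw [Set.mem_singleton_iff]; omega))
    · rw [curl_xyZ_right]
      exact Submodule.neg_mem _ (xyZ_mem_homog (by rw [Set.mem_singleton_iff]; omega))
    · rw [← h]; exact d_contraction_right p m n

/-- A linear map that is injective on a submodule maps it isomorphically to its image. -/
def Submodule.equivMapOfInjOn {A M N : Type*} [Ring A] [AddCommGroup M] [Module A M]
    [AddCommGroup N] [Module A N] (S : Submodule A M) (f : M →ₗ[A] N)
    (h : ∀ x ∈ S, f x = 0 → x = 0) : S ≃ₗ[A] S.map f :=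
  LinearEquiv.ofBijective (f.submoduleMap S)
    ⟨(injective_iff_map_eq_zero _).2 fun x hx =>
      Subtype.ext (h x x.2 (congrArg Subtype.val hx)), f.submoduleMap_surjective S⟩

/-- The exact one-forms of a degree are isomorphic to a component of the quantum plane. -/
def dPartEquiv {g : ℤ} (hg : ¬ (p : ℤ) ∣ g + 1) : QPlane.homog p {g + 1} ≃ₗ[Lusztig p] dPart p g :=
  Submodule.equivMapOfInjOn _ _ fun _ hx h => d_injOn hg hx h

/-- The multiples of the invariant one-form are isomorphic to a component of the quantum plane. -/
def kappaPartEquiv {g : ℤ} (hg : ¬ (p : ℤ) ∣ g + 1) :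
    QPlane.homog p {g - 1} ≃ₗ[Lusztig p] kappaPart p g :=
  Submodule.equivMapOfInjOn _ _ fun _ hx h =>
    kappa_injOn (by rwa [show g - 1 + 2 = g + 1 by ring]) hx h

/-- The kinds of direct summands of the one-forms. -/
inductive Piece
  | full (D : Set ℤ)
  | exact (g : ℤ)
  | inv (g : ℤ)

namespace Piece

/-- The degrees of the coefficients. -/
def degrees : Piece → Set ℤ
  | full D => D
  | exact g => {g}
  | inv g => {g}

/-- The complementary summand of the component. -/
def compl : Piece → Piece
  | full _ => full ∅
  | exact g => inv g
  | inv g => exact g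

variable (p) in
/-- The submodule of the one-forms. -/
def toSubmodule : Piece → Submodule (Lusztig p) (OneForm p)
  | full D => OneForm.homog p D
  | exact g => dPart p g
  | inv g => kappaPart p g

/-- The condition for an exact or invariant summand to have a complement. -/
def Splits (p : ℕ) : Piece → Prop
  | full _ => True
  | exact g => ¬ (p : ℤ) ∣ g + 1
  | inv g => ¬ (p : ℤ) ∣ g + 1

theorem toSubmodule_le (P : Piece) : P.toSubmodule p ≤ OneForm.homog p P.degrees := by
  cases P with
  | full D => exact le_rfl
  | exact g => exact dPart_le g
  | inv g => exact kappaPart_le g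

theorem disjoint_compl {P : Piece} (h : P.Splits p) :
    Disjoint (P.toSubmodule p) (P.compl.toSubmodule p) := by
  cases P with
  | full D =>
    have : OneForm.homog p ∅ = ⊥ := by
      rw [eq_bot_iff]
      rintro _ ⟨u, rfl⟩
      rw [OneForm.trunc_empty]; exact Submodule.zero_mem _
    exact (disjoint_bot_right (a := OneForm.homog p D)).mono_right this.le
  | exact g => exact disjoint_dPart_kappaPart h
  | inv g => exact (disjoint_dPart_kappaPart h).symm

theorem isDirectSum {ι : Type*} (P : ι → Piece) (D : Set ℤ) (hP : ∀ k, (P k).Splits p)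
    (hle : ∀ k, (P k).degrees ⊆ D)
    (hd : ∀ j k, j ≠ k → Disjoint (P j).degrees (P k).degrees ∨ P j = (P k).compl)
    (hD : ∀ i ∈ D, 0 ≤ i → (∃ k E, P k = full E ∧ i ∈ E) ∨
      (∃ j k, P j = exact i ∧ P k = inv i)) :
    IsDirectSum (OneForm.homog p D) fun k => (P k).toSubmodule p := by
  refine ⟨iSupIndep_of_proj (fun k => OneForm.trunc p (P k).degrees)
    (fun k => (P k).compl.toSubmodule p)
    (fun k x hx => OneForm.mem_homog_iff.1 (toSubmodule_le _ hx)) (fun k j hj x hx => ?_)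
    (fun k => disjoint_compl (hP k)),
    le_antisymm (iSup_le fun k => (toSubmodule_le _).trans (OneForm.homog_mono (hle k))) ?_⟩
  · have hx' := OneForm.mem_homog_iff.1 (toSubmodule_le _ hx)
    rcases hd j k hj with h | h
    · rw [← hx', OneForm.trunc_trunc, h.symm.inter_eq, OneForm.trunc_empty]
      exact Submodule.zero_mem _
    · have : (P j).degrees = (P k).degrees ∨ (P j).degrees = ∅ := by
        rw [h]; cases P k <;> simp [compl, degrees]
      rcases this with h' | h'
      · rw [← h', hx', ← h]; exact hx
      · rw [← hx', OneForm.trunc_trunc, h', Set.inter_empty, OneForm.trunc_empty]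
        exact Submodule.zero_mem _
  · have key : ∀ i ∈ D, 0 ≤ i → OneForm.homog p {i} ≤ ⨆ k, (P k).toSubmodule p := by
      intro i hi h0
      rcases hD i hi h0 with ⟨k, E, hk, hiE⟩ | ⟨j, k, hj, hk⟩
      · refine le_trans ?_ (le_iSup (fun k => (P k).toSubmodule p) k)
        simp only [hk]
        exact OneForm.homog_mono (Set.singleton_subset_iff.2 hiE)
      · have hs := hP j
        rw [hj] at hs
        refine (homog_le_dPart_sup_kappaPart hs).trans (sup_le ?_ ?_)
        · refine le_trans ?_ (le_iSup (fun k => (P k).toSubmodule p) j)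
          simp only [hj]; exact le_rfl
        · refine le_trans ?_ (le_iSup (fun k => (P k).toSubmodule p) k)
          simp only [hk]; exact le_rfl
    refine OneForm.homog_le (S := (⨆ k, (P k).toSubmodule p).restrictScalars ℂ)
      (fun m n h => key _ h (by positivity) (mk_mem_homog_iff.2 ⟨xyZ_mem_homog rfl, ?_⟩))
      (fun m n h => key _ h (by positivity) (mk_mem_homog_iff.2 ⟨?_, xyZ_mem_homog rfl⟩)) <;>
      exact Submodule.zero_mem _

end Piece

theorem plane_isDirectSum (n : ℕ) :
    IsDirectSum (QPlane.homog p (Set.Iio ((n : ℤ) * p)))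
      (Sum.elim ![QPlane.homog p (Set.Iio (((n : ℤ) - 1) * p)), QPlane.homog p {(n : ℤ) * p - 1}]
        (fun r : Finset.Icc 1 (p - 1) => QPlane.homog p {((n : ℤ) - 1) * p + (r : ℕ) - 1})) := by
  have hp2 := hp.out
  have h : (Sum.elim ![QPlane.homog p (Set.Iio (((n : ℤ) - 1) * p)),
      QPlane.homog p {(n : ℤ) * p - 1}] (fun r : Finset.Icc 1 (p - 1) =>
        QPlane.homog p {((n : ℤ) - 1) * p + (r : ℕ) - 1})) = fun k => QPlane.homog p
      (Sum.elim ![Set.Iio (((n : ℤ) - 1) * p), {(n : ℤ) * p - 1}] (fun r : Finset.Icc 1 (p - 1) =>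
        {((n : ℤ) - 1) * p + (r : ℕ) - 1}) k) := by
    funext k
    rcases k with k | k
    · fin_cases k <;> rfl
    · rfl
  rw [h]
  have e : (n : ℤ) * p = (n - 1) * p + p := by ring
  rw [e]
  generalize ((n : ℤ) - 1) * p = B
  refine homog_isDirectSum _ (fun k => ?_) (fun i hi _ => ?_) (fun j k hjk => ?_)
  · rcases k with k | ⟨r, hr⟩
    · fin_cases k
      · exact Set.Iio_subset_Iio (by omega)
      · simp
    · rw [Finset.mem_Icc] at hr
      simp only [Sum.elim_inr, Set.singleton_subset_iff, Set.mem_Iio]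
      omega
  · rw [Set.mem_Iio] at hi
    by_cases h1 : i < B
    · exact ⟨.inl 0, h1⟩
    by_cases h2 : i = B + p - 1
    · exact ⟨.inl 1, h2⟩
    · refine ⟨.inr ⟨(i - B + 1).toNat, ?_⟩, ?_⟩
      · rw [Finset.mem_Icc]; omega
      · simp only [Sum.elim_inr, Set.mem_singleton_iff]; omega
  · rcases j with j | ⟨r, hr⟩ <;> rcases k with k | ⟨s, hs⟩ <;>
      (try have hr' := Finset.mem_Icc.1 hr) <;>
      (try have hs' := Finset.mem_Icc.1 hs) <;> (try fin_cases j) <;> (try fin_cases k) <;>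
      simp at hjk ⊢ <;> omega

theorem form_isDirectSum (n : ℕ) :
    IsDirectSum (OneForm.homog p (Set.Iio ((n : ℤ) * p)))
      (Sum.elim ![OneForm.homog p (Set.Iio (((n : ℤ) - 1) * p)), dPart p ((n : ℤ) * p - 2),
          kappaPart p (((n : ℤ) - 1) * p), OneForm.homog p {(n : ℤ) * p - 1}]
        (Sum.elim (fun r : Finset.Icc 2 (p - 1) => dPart p (((n : ℤ) - 1) * p + (r : ℕ) - 2))
          (fun r : Finset.Icc 1 (p - 2) => kappaPart p (((n : ℤ) - 1) * p + (r : ℕ))))) := by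
  have hp2 := hp.out
  let P : Fin 4 ⊕ (Finset.Icc 2 (p - 1) ⊕ Finset.Icc 1 (p - 2)) → Piece :=
    Sum.elim ![.full (Set.Iio (((n : ℤ) - 1) * p)), .exact ((n : ℤ) * p - 2),
          .inv (((n : ℤ) - 1) * p), .full {(n : ℤ) * p - 1}]
        (Sum.elim (fun r => .exact (((n : ℤ) - 1) * p + (r : ℕ) - 2))
          (fun r => .inv (((n : ℤ) - 1) * p + (r : ℕ))))
  suffices h : IsDirectSum (OneForm.homog p (Set.Iio ((n : ℤ) * p)))
      fun k => (P k).toSubmodule p by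
    convert h using 1
    funext k
    rcases k with k | k | k
    · fin_cases k <;> rfl
    · rfl
    · rfl
  have hdvd (t : ℤ) (h1 : 0 ≤ t) (h2 : t < p - 1) : ¬ (p : ℤ) ∣ (((n : ℤ) - 1) * p + t) + 1 := by
    rw [add_assoc, dvd_add_right (dvd_mul_left _ _)]
    intro h
    have := Int.le_of_dvd (by omega) h
    omega
  have e : (n : ℤ) * p = (n - 1) * p + p := by ring
  revert P
  rw [e]
  generalize ((n : ℤ) - 1) * p = B at *
  intro P
  refine Piece.isDirectSum P _ ?_ ?_ ?_ ?_
  · rintro (k | ⟨r, hr⟩ | ⟨r, hr⟩) <;> (try have hr' := Finset.mem_Icc.1 hr)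
    · fin_cases k
      · trivial
      · have := hdvd (p - 2) (by omega) (by omega)
        rwa [← add_sub_assoc] at this
      · have := hdvd 0 le_rfl (by omega)
        rwa [add_zero] at this
      · trivial
    · have := hdvd (r - 2) (by omega) (by omega)
      rwa [← add_sub_assoc] at this
    · exact hdvd r (by omega) (by omega)
  · rintro (k | ⟨r, hr⟩ | ⟨r, hr⟩) <;> (try have hr' := Finset.mem_Icc.1 hr) <;> (try fin_cases k) <;>
      simp [P, Piece.degrees] <;> omega
  · rintro (j | ⟨r, hr⟩ | ⟨r, hr⟩) (k | ⟨s, hs⟩ | ⟨s, hs⟩) hjk <;>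
      (try have hr' := Finset.mem_Icc.1 hr) <;>
      (try have hs' := Finset.mem_Icc.1 hs) <;> (try fin_cases j) <;> (try fin_cases k) <;>
      simp [P, Piece.degrees, Piece.compl] at hjk ⊢ <;> omega
  · intro i hi h0
    rw [Set.mem_Iio] at hi
    by_cases h1 : i < B
    · exact .inl ⟨.inl 0, _, rfl, h1⟩
    by_cases h2 : i = B + p - 1
    · exact .inl ⟨.inl 3, _, rfl, h2⟩
    · right
      have hj : ∃ j, P j = .exact i := by
        by_cases h3 : i = B + p - 2
        · exact ⟨.inl 1, h3 ▸ rfl⟩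
        · refine ⟨.inr (.inl ⟨(i - B + 2).toNat, by rw [Finset.mem_Icc]; omega⟩), ?_⟩
          simp only [P, Sum.elim_inr, Sum.elim_inl, Piece.exact.injEq]; omega
      have hk : ∃ k, P k = .inv i := by
        by_cases h3 : i = B
        · exact ⟨.inl 2, h3 ▸ rfl⟩
        · refine ⟨.inr (.inr ⟨(i - B).toNat, by rw [Finset.mem_Icc]; omega⟩), ?_⟩
          simp only [P, Sum.elim_inr, Piece.inv.injEq]; omega
      obtain ⟨j, hj⟩ := hj
      obtain ⟨k, hk⟩ := hk
      exact ⟨j, k, hj, hk⟩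

end

end QSl2

end

noncomputable section

namespace QSl2

/-! ### Projectors onto weight spaces -/

section weightProj

variable {A : Type*} [Ring A] [Algebra ℂ A] (k : A) (c : ℂ) (s : ℕ)

/-- The projector onto the eigenspace of `k` with eigenvalue `c`, if `k ^ s = 1` and `c ^ s = 1`. -/
def weightProj : A := (s : ℂ)⁻¹ • ∑ j ∈ Finset.range s, (c⁻¹) ^ j • k ^ j

variable {k c s}

theorem mul_weightProj (hc : c ≠ 0) (hk : k ^ s = 1) (hcs : c ^ s = 1) :
    k * weightProj k c s = c • weightProj k c s := by
  rw [weightProj, mul_smul_comm, smul_comm c]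
  congr 1
  have h1 : k * ∑ j ∈ Finset.range s, (c⁻¹) ^ j • k ^ j =
      c • ∑ j ∈ Finset.range s, (c⁻¹) ^ (j + 1) • k ^ (j + 1) := by
    rw [Finset.mul_sum, Finset.smul_sum]
    refine Finset.sum_congr rfl fun j _ => ?_
    rw [smul_smul, pow_succ' (c⁻¹), ← mul_assoc, mul_inv_cancel₀ hc, one_mul, mul_smul_comm,
      pow_succ']
  rw [h1]
  congr 1
  have h2 := Finset.sum_range_succ (fun j => (c⁻¹) ^ j • k ^ j) s
  rw [Finset.sum_range_succ', hk, inv_pow c s, hcs] at h2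
  simpa using h2

variable {N : Type*} [AddCommGroup N] [Module ℂ N] [Module A N] [IsScalarTower ℂ A N]

theorem weightProj_smul_of_eq (hc : c ≠ 0) (hs : s ≠ 0) {x : N} (hx : k • x = c • x) :
    weightProj k c s • x = x := by
  have h (j : ℕ) : k ^ j • x = c ^ j • x := by
    induction j with
    | zero => simp
    | succ j ih => rw [pow_succ, mul_smul, hx, smul_comm, ih, smul_smul, pow_succ' c]
  have h' (j : ℕ) : ((c⁻¹) ^ j • k ^ j) • x = x := by
    rw [smul_assoc, h, smul_smul, ← mul_pow, inv_mul_cancel₀ hc, one_pow, one_smul]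
  rw [weightProj, smul_assoc, Finset.sum_smul, Finset.sum_congr rfl fun j _ => h' j,
    Finset.sum_const, Finset.card_range, ← Nat.cast_smul_eq_nsmul ℂ, smul_smul,
    inv_mul_cancel₀ (Nat.cast_ne_zero.2 hs), one_smul]

end weightProj

/-! ### Projectivity of the Steinberg module -/

theorem sign_mul_q_zpow_pow (p : ℕ) (hp : p ≠ 0) (ε : ℤˣ) (s : ℤ) :
    (((ε : ℤ) : ℂ) * q p ^ s) ^ (2 * p) = 1 := by
  rw [mul_pow, ← zpow_natCast (q p ^ s), ← zpow_mul, mul_comm s, zpow_mul, zpow_natCast,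
    q_pow_two_p p hp, one_zpow, mul_one, pow_mul, pow_two, WMod.sign_mul_sign, one_pow]

theorem sign_mul_q_zpow_ne_zero (p : ℕ) (ε : ℤˣ) (s : ℤ) : ((ε : ℤ) : ℂ) * q p ^ s ≠ 0 :=
  mul_ne_zero (by simp) (zpow_ne_zero _ (q_ne_zero p))

section steinberg

variable {p : ℕ} [hp : Fact (2 ≤ p)] {M : Type*} [AddCommGroup M] [Module ℂ M]
  [Module (SmallQG p) M] [IsScalarTower ℂ (SmallQG p) M]

namespace SmallQG

theorem Ki_smul_of_K_smul {m : M} {c : ℂ} (hc : c ≠ 0) (h : gen p .K • m = c • m) :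
    gen p .Ki • m = c⁻¹ • m := by
  have h1 : gen p .Ki • gen p .K • m = m := by rw [← mul_smul, (triple p).Ki_K, one_smul]
  rw [h, smul_comm] at h1
  exact (eq_inv_smul_iff₀ hc).2 h1

theorem K_smul_E_smul {m : M} {c : ℂ} (h : gen p .K • m = c • m) :
    gen p .K • gen p .E • m = (q p ^ 2 * c) • gen p .E • m := by
  rw [← mul_smul, (triple p).K_mul_E, smul_assoc, mul_smul, h, smul_comm _ c, smul_smul]

theorem K_smul_F_smul {m : M} {c : ℂ} (h : gen p .K • m = c • m) :
    gen p .K • gen p .F • m = ((q p ^ 2)⁻¹ * c) • gen p .F • m := by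
  rw [← mul_smul, (triple p).K_mul_F, smul_assoc, mul_smul, h, smul_comm _ c, smul_smul]

theorem E_smul_F_smul (m : M) : gen p .E • gen p .F • m =
    gen p .F • gen p .E • m + (q p - (q p)⁻¹)⁻¹ • (gen p .K • m - gen p .Ki • m) := by
  rw [← sub_eq_iff_eq_add', ← mul_smul, ← mul_smul, ← sub_smul, (triple p).E_F, smul_assoc,
    sub_smul]

variable {m : M} {ε : ℤˣ} {s : ℤ}

theorem K_smul_F_pow_smul (h : gen p .K • m = (((ε : ℤ) : ℂ) * q p ^ s) • m) (l : ℕ) :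
    gen p .K • gen p .F ^ l • m = (((ε : ℤ) : ℂ) * q p ^ (s - 2 * l)) • gen p .F ^ l • m := by
  induction l with
  | zero => simpa using h
  | succ l ih =>
    rw [pow_succ', mul_smul, K_smul_F_smul ih]
    congr 1
    rw [show s - 2 * (l + 1 : ℕ) = s - 2 * l - 2 by push_cast; ring, zpow_sub₀ (q_ne_zero p) _ 2]
    have := q_ne_zero p
    field_simp

theorem K_smul_E_pow_smul (h : gen p .K • m = (((ε : ℤ) : ℂ) * q p ^ s) • m) (l : ℕ) :
    gen p .K • gen p .E ^ l • m = (((ε : ℤ) : ℂ) * q p ^ (s + 2 * l)) • gen p .E ^ l • m := by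
  induction l with
  | zero => simpa using h
  | succ l ih =>
    rw [pow_succ', mul_smul, K_smul_E_smul ih]
    congr 1
    rw [show s + 2 * (l + 1 : ℕ) = s + 2 * l + 2 by push_cast; ring, zpow_add₀ (q_ne_zero p) _ 2]
    rw [zpow_ofNat]
    ring

theorem E_smul_F_pow_smul (h : gen p .K • m = (((ε : ℤ) : ℂ) * q p ^ s) • m)
    (hE : gen p .E • m = 0) (l : ℕ) : gen p .E • gen p .F ^ (l + 1) • m =
      (((ε : ℤ) : ℂ) * (qInt (q p) (l + 1) * qInt (q p) (s - l))) • gen p .F ^ l • m := by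
  have key (l : ℕ) : (q p - (q p)⁻¹)⁻¹ • (gen p .K • gen p .F ^ l • m -
      gen p .Ki • gen p .F ^ l • m) =
      (((ε : ℤ) : ℂ) * qInt (q p) (s - 2 * l)) • gen p .F ^ l • m := by
    have h1 := K_smul_F_pow_smul h l
    rw [h1, Ki_smul_of_K_smul (sign_mul_q_zpow_ne_zero p ε _) h1, ← sub_smul, smul_smul, qInt]
    congr 1
    rw [mul_inv, zpow_neg, show (((ε : ℤ) : ℂ))⁻¹ = ((ε : ℤ) : ℂ) from
      inv_eq_of_mul_eq_one_left (WMod.sign_mul_sign ε)]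
    ring
  induction l with
  | zero =>
    have := E_smul_F_smul (p := p) m
    rw [hE, smul_zero, zero_add] at this
    rw [zero_add, pow_one, this]
    simpa [qInt_one (q_sub_inv_ne_zero p hp.out)] using key 0
  | succ l ih =>
    rw [pow_succ', mul_smul, E_smul_F_smul, ih, key, smul_comm, ← mul_smul (gen p .F), ← pow_succ',
      ← add_smul]
    congr 1
    have := qInt_mul_sub (q p) (q_ne_zero p) (q_sub_inv_ne_zero p hp.out) (s - l - 1) (l + 1)
    push_cast
    rw [show s - (l + 1) = s - l - 1 by ring, show s - 2 * ((l : ℤ) + 1) = s - l - 1 - (l + 1) by ring,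
      ← this, sub_add_cancel]
    ring

end SmallQG

namespace WMod

theorem coeffE_ne_zero {r l : ℕ} (hr : r ≤ p) (ε : ℤˣ) (hl : l + 1 < r) :
    coeffE p r ε (l + 1) ≠ 0 := by
  rw [coeffE, if_neg]
  · refine mul_ne_zero (by simp) (mul_ne_zero ?_ ?_) <;> rw [Ne, qInt_eq_zero_iff hp.out]
    · intro h
      have := Nat.le_of_dvd (by omega) (Int.natCast_dvd_natCast.1 h)
      omega
    · intro h
      rw [← Nat.cast_sub hl.le] at h
      have := Nat.le_of_dvd (by omega) (Int.natCast_dvd_natCast.1 h)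
      omega
  · rintro ⟨h, -⟩
    have := Nat.le_of_dvd (by omega) h
    omega

theorem gen_pow_smul_w (l k : ℕ) (ε : ℤˣ) (r n : ℕ) :
    SmallQG.gen p .E ^ k • w p r n ε l = (opE p r n ε ^ k) (w p r n ε l) := by
  induction k with
  | zero => simp
  | succ k ih => rw [pow_succ', mul_smul, ih, gen_smul, pow_succ', Module.End.mul_apply]

theorem exists_hom {ε : ℤˣ} {m : M}
    (hKm : SmallQG.gen p .K • m = (((ε : ℤ) : ℂ) * q p ^ ((p : ℤ) - 1)) • m)
    (hEm : SmallQG.gen p .E • m = 0) :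
    ∃ h : XMod p p ε →ₗ[SmallQG p] M, h (w p p 1 ε 0) = m := by
  have hp2 := hp.out
  let h₀ : XMod p p ε →ₗ[ℂ] M := (basis p p 1 ε).constr ℂ fun l => SmallQG.gen p .F ^ (l : ℕ) • m
  have hw (l : ℕ) : h₀ (w p p 1 ε l) = SmallQG.gen p .F ^ l • m := by
    by_cases hl : l < (1 - 1) * p + p
    · have := w_fin p p 1 ε ⟨l, hl⟩
      simp only at this
      rw [this, Module.Basis.constr_basis]
    · rw [w_eq_zero _ _ _ _ _ hl, map_zero, show l = p + (l - p) by omega, pow_add,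
        SmallQG.gen_F_pow, zero_mul, zero_smul]
  have hgen (x : Gen) : h₀ ∘ₗ Algebra.lsmul ℂ ℂ (XMod p p ε) (SmallQG.gen p x) =
      Algebra.lsmul ℂ ℂ M (SmallQG.gen p x) ∘ₗ h₀ := by
    refine lin_ext fun l hl => ?_
    change h₀ (SmallQG.gen p x • _) = SmallQG.gen p x • h₀ _
    rw [hw, gen_smul]
    cases x <;> simp only
    · cases l with
      | zero => rw [opE_zero, map_zero, pow_zero, one_smul, hEm]
      | succ l =>
        rw [opE_succ _ _ _ _ _ hl, map_smul, hw, SmallQG.E_smul_F_pow_smul hKm hEm, coeffE,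
          if_neg (by simp), show (p : ℤ) - (l + 1 : ℕ) = p - 1 - l by push_cast; ring]
        push_cast
        rfl
    · rw [opF_w, map_smul, hw, ← mul_smul, ← pow_succ', coeffF]
      split_ifs with hd
      · have : l + 1 = p := le_antisymm (by omega) (Nat.le_of_dvd (by omega) hd)
        rw [this, SmallQG.gen_F_pow, zero_smul, zero_smul]
      · rw [one_smul]
    · rw [opK_w, map_smul, hw, SmallQG.K_smul_F_pow_smul hKm]
    · rw [opKi_w, map_smul, hw, SmallQG.Ki_smul_of_K_smul (sign_mul_q_zpow_ne_zero p ε _)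
        (SmallQG.K_smul_F_pow_smul hKm l)]
      congr 1
      rw [mul_inv, ← zpow_neg, show (((ε : ℤ) : ℂ))⁻¹ = ((ε : ℤ) : ℂ) from
        inv_eq_of_mul_eq_one_left (WMod.sign_mul_sign ε)]
  exact ⟨SmallQG.mkLinear h₀ fun x y => LinearMap.congr_fun (hgen x) y,
    (hw 0).trans (by rw [pow_zero, one_smul])⟩

theorem hom_ext {ε : ℤˣ} {f g : XMod p p ε →ₗ[SmallQG p] M}
    (h : f (w p p 1 ε 0) = g (w p p 1 ε 0)) : f = g := by
  refine LinearMap.restrictScalars_injective ℂ (lin_ext fun l hl => ?_)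
  change f _ = g _
  have hdim : (1 - 1) * p + p = p := by simp
  rw [hdim] at hl
  induction l with
  | zero => exact h
  | succ l ih =>
    have e : SmallQG.gen p .F • w p p 1 ε l = w p p 1 ε (l + 1) := by
      rw [gen_smul]
      simp only
      rw [opF_w, coeffF, if_neg, one_smul]
      intro hd
      have := Nat.le_of_dvd (by omega) hd
      omega
    rw [← e, map_smul, map_smul, ih (by omega)]

theorem exists_lift {N : Type*} [AddCommGroup N] [Module ℂ N] [Module (SmallQG p) N]
    [IsScalarTower ℂ (SmallQG p) N] (ε : ℤˣ) (g : M →ₗ[SmallQG p] N)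
    (hg : Function.Surjective g) (f : XMod p p ε →ₗ[SmallQG p] N) :
    ∃ h : XMod p p ε →ₗ[SmallQG p] M, g ∘ₗ h = f := by
  have hp2 := hp.out
  obtain ⟨t, ht⟩ : ∃ t, p = t + 1 := ⟨p - 1, by omega⟩
  obtain ⟨m₀, hm₀⟩ := hg (f (w p p 1 ε t))
  have hK (l : ℕ) : SmallQG.gen p .K • w p p 1 ε l =
      (((ε : ℤ) : ℂ) * q p ^ ((p : ℤ) - 1 - 2 * l)) • w p p 1 ε l := (gen_smul _ _).trans (opK_w _ _ _ _ _)
  set c : ℂ := ((ε : ℤ) : ℂ) * q p ^ ((p : ℤ) - 1 - 2 * t) with hc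
  have hc0 : c ≠ 0 := sign_mul_q_zpow_ne_zero p ε _
  obtain ⟨m₁, hm₁⟩ : ∃ m₁, m₁ = weightProj (SmallQG.gen p .K) c (2 * p) • m₀ := ⟨_, rfl⟩
  have hKm₁ : SmallQG.gen p .K • m₁ = c • m₁ := by
    rw [hm₁, ← mul_smul, mul_weightProj hc0 (SmallQG.gen_K_pow p)
      (sign_mul_q_zpow_pow p (by omega) ε _), smul_assoc]
  have hgm₁ : g m₁ = f (w p p 1 ε t) := by
    rw [hm₁, map_smul, hm₀, ← map_smul, weightProj_smul_of_eq hc0 (by omega) (hK t)]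
  obtain ⟨b, hb⟩ : ∃ b, b = ∏ i ∈ Finset.range t, coeffE p p ε (i + 1) := ⟨_, rfl⟩
  have hb0 : b ≠ 0 := by
    rw [hb]
    exact Finset.prod_ne_zero_iff.2 fun i hi => coeffE_ne_zero le_rfl ε (by
      have := Finset.mem_range.1 hi; omega)
  have hEw : SmallQG.gen p .E ^ t • w p p 1 ε t = b • w p p 1 ε 0 := by
    have := opE_pow p p 1 ε t 0 (by omega)
    simp only [zero_add] at this
    rw [gen_pow_smul_w, this, hb]
  obtain ⟨m, hm⟩ : ∃ m, m = b⁻¹ • SmallQG.gen p .E ^ t • m₁ := ⟨_, rfl⟩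
  have hgm : g m = f (w p p 1 ε 0) := by
    rw [hm, LinearMap.map_smul_of_tower, map_smul, hgm₁, ← map_smul, hEw,
      LinearMap.map_smul_of_tower, smul_smul, inv_mul_cancel₀ hb0, one_smul]
  have hEm : SmallQG.gen p .E • m = 0 := by
    rw [hm, smul_comm, ← mul_smul, ← pow_succ', ← ht, SmallQG.gen_E_pow, zero_smul, smul_zero]
  have hKm : SmallQG.gen p .K • m = (((ε : ℤ) : ℂ) * q p ^ ((p : ℤ) - 1)) • m := by
    rw [hm, smul_comm, SmallQG.K_smul_E_pow_smul hKm₁, smul_comm, sub_add_cancel]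
  obtain ⟨h, hh⟩ := exists_hom hKm hEm
  exact ⟨h, hom_ext (by rw [LinearMap.comp_apply, hh, hgm])⟩

instance (ε : ℤˣ) : Module.Projective (SmallQG p) (Tw (SmallQG.coprod p) (XMod p p ε)) := by
  refine .of_lifting_property'' fun g hg => ?_
  refine Tw.exists_lift (q_ne_zero p) (XMod p p ε) _ _ g (fun f => ?_) LinearMap.id
  exact exists_lift ε (Tw.map g) (fun u => by
    obtain ⟨x, hx⟩ := hg u.1
    obtain ⟨y, hy⟩ := hg u.2
    exact ⟨Tw.mk _ x y, Tw.ext hx hy⟩) f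

end WMod

end steinberg

end QSl2

end

noncomputable section

namespace QSl2

/-! ### One-forms as a tensor product -/

namespace Tw

variable {A : Type*} [Ring A] [Algebra ℂ A] (Δ : A →ₐ[ℂ] Matrix (Fin 2) (Fin 2) A)
  {N M : Type*} [AddCommGroup N] [Module A N] [AddCommGroup M] [Module A M]

/-- The tensor product of an isomorphism and the identity. -/
def congr (e : N ≃ₗ[A] M) : Tw Δ N ≃ₗ[A] Tw Δ M :=
  { map (Δ := Δ) (e : N →ₗ[A] M) with
    invFun := map (Δ := Δ) (e.symm : M →ₗ[A] N)
    left_inv := fun u => ext (e.symm_apply_apply u.1) (e.symm_apply_apply u.2)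
    right_inv := fun u => ext (e.apply_symm_apply u.1) (e.apply_symm_apply u.2) }

/-- The tensor product commutes with finite powers. -/
def piEquiv (ι : Type*) : Tw Δ (ι → N) ≃ₗ[A] (ι → Tw Δ N) where
  toFun u i := mk Δ (u.1 i) (u.2 i)
  invFun f := mk Δ (fun i => (f i).1) (fun i => (f i).2)
  map_add' _ _ := rfl
  map_smul' _ _ := rfl
  left_inv _ := rfl
  right_inv _ := rfl

end Tw

namespace OneForm

variable {p : ℕ} [hp : Fact (2 ≤ p)]

theorem small_smul_eq (s : SmallQG p) (f g : QPlane p) : s • mk p f g =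
    mk p (SmallQG.coprod p s 0 0 • f + SmallQG.coprod p s 0 1 • g)
      (SmallQG.coprod p s 1 0 • f + SmallQG.coprod p s 1 1 • g) := by
  have h0 (x : Gen) (f : QPlane p) : SmallQG.gen p x • f = (match x with
      | .E => QPlane.opE p
      | .F => QPlane.opF p
      | .K => QPlane.opK p
      | .Ki => QPlane.opKi p) f := by
    change QPlane.action p (SmallQG.gen p x) f = _
    rw [QPlane.action, SmallQG.lift_gen]
    all_goals cases x <;> rfl
  have h1 (x : Gen) (u : OneForm p) : SmallQG.gen p x • u = (match x with
      | .E => opE p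
      | .F => opF p
      | .K => opK p
      | .Ki => opKi p) u := by
    change action p (SmallQG.gen p x) u = _
    rw [action, SmallQG.lift_gen]
    all_goals cases x <;> rfl
  let T : OneForm p → Tw (SmallQG.coprod p) (QPlane p) := fun u => Tw.mk _ u.1 u.2
  suffices h : ∀ u, T (s • u) = s • T u from h (mk p f g)
  induction s using SmallQG.induction with
  | scalar c => intro u; rw [algebraMap_smul, algebraMap_smul]; rfl
  | hgen x =>
    intro u
    obtain ⟨f, g, rfl⟩ := mk_surj u
    change _ = SmallQG.gen p x • Tw.mk _ f g
    cases x
    · rw [h1, SmallQG.E_smul_tw, h0, h0]; rfl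
    · rw [h1, SmallQG.F_smul_tw, h0, h0, h0, add_comm]; rfl
    · rw [h1, SmallQG.K_smul_tw, h0, h0]; rfl
    · rw [h1, SmallQG.Ki_smul_tw, h0, h0]; rfl
  | add a b ha hb =>
    intro u
    rw [add_smul, add_smul, ← ha, ← hb]; rfl
  | mul a b ha hb => intro u; rw [mul_smul, ha, hb, mul_smul]

/-- A graded component of the one-forms is the tensor product of a graded component of the quantum
plane with the span of `ξ` and `η`. -/
def homogEquiv (D : Set ℤ) :
    homog p D ≃ₗ[Lusztig p] Tw (Lusztig.coprod p) (QPlane.homog p D) where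
  toFun u := Tw.mk _ ⟨u.1.1, (mk_mem_homog_iff.1 (show mk p u.1.1 u.1.2 ∈ _ from u.2)).1⟩
    ⟨u.1.2, (mk_mem_homog_iff.1 (show mk p u.1.1 u.1.2 ∈ _ from u.2)).2⟩
  invFun u := ⟨mk p u.1 u.2, mk_mem_homog_iff.2 ⟨u.1.2, u.2.2⟩⟩
  map_add' _ _ := rfl
  map_smul' _ _ := rfl
  left_inv _ := rfl
  right_inv _ := rfl

/-- The isomorphism `homogEquiv` over the small quantum group. -/
def smallHomogEquiv (D : Set ℤ) :
    homog p D ≃ₗ[SmallQG p] Tw (SmallQG.coprod p) (QPlane.homog p D) where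
  toFun u := Tw.mk _ ⟨u.1.1, (mk_mem_homog_iff.1 (show mk p u.1.1 u.1.2 ∈ _ from u.2)).1⟩
    ⟨u.1.2, (mk_mem_homog_iff.1 (show mk p u.1.1 u.1.2 ∈ _ from u.2)).2⟩
  invFun u := ⟨mk p u.1 u.2, mk_mem_homog_iff.2 ⟨u.1.2, u.2.2⟩⟩
  map_add' _ _ := rfl
  map_smul' s u := by
    have h := mk_inj.1 (small_smul_eq s u.1.1 u.1.2)
    exact Tw.ext (Subtype.ext h.1) (Subtype.ext h.2)
  left_inv _ := rfl
  right_inv _ := rfl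

end OneForm

/-! ### The projective cover -/

namespace WMod

variable {p : ℕ} [hp : Fact (2 ≤ p)]

theorem K_smul_w (r n : ℕ) (ε : ℤˣ) (l : ℕ) : SmallQG.gen p .K • w p r n ε l =
    (((ε : ℤ) : ℂ) * q p ^ ((r : ℤ) - 1 - 2 * l)) • w p r n ε l :=
  (gen_smul _ _).trans (opK_w _ _ _ _ _)

theorem F_smul_w (r n : ℕ) (ε : ℤˣ) (l : ℕ) : SmallQG.gen p .F • w p r n ε l =
    coeffF p l • w p r n ε (l + 1) := (gen_smul _ _).trans (opF_w _ _ _ _ _)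

theorem E_smul_w_zero (r n : ℕ) (ε : ℤˣ) : SmallQG.gen p .E • w p r n ε 0 = 0 :=
  (gen_smul _ _).trans (opE_zero _ _ _ _)

theorem coeffF_of_lt {l : ℕ} (h : l + 1 < p) : coeffF p l = 1 := by
  rw [coeffF, if_neg]
  intro hd
  have := Nat.le_of_dvd (by omega) hd
  omega

variable {r : ℕ} {ε : ℤˣ}

theorem E_smul_w_succ (hr : r ≤ p) {l : ℕ} (hl : l + 1 < r) :
    SmallQG.gen p .E • w p r 1 ε (l + 1) =
      (((ε : ℤ) : ℂ) * (qInt (q p) (l + 1) * qInt (q p) ((r : ℤ) - 1 - l))) • w p r 1 ε l := by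
  refine ((gen_smul _ _).trans (opE_succ _ _ _ _ _ (by simpa using hl))).trans ?_
  rw [coeffE, if_neg, show (r : ℤ) - (l + 1 : ℕ) = r - 1 - l by push_cast; ring]
  · push_cast; rfl
  · rintro ⟨h, -⟩
    have := Nat.le_of_dvd (by omega) h
    omega

theorem w_ne_zero {n l : ℕ} (h : l < (n - 1) * p + r) : w p r n ε l ≠ 0 := by
  have := w_fin p r n ε ⟨l, h⟩
  simp only at this
  rw [this]
  exact (basis p r n ε).ne_zero _

theorem exists_eq_smul_w (hr : r ≤ p) {l : ℕ} (hl : l < r) {x : XMod p r ε}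
    (hx : SmallQG.gen p .K • x = (((ε : ℤ) : ℂ) * q p ^ ((r : ℤ) - 1 - 2 * l)) • x) :
    ∃ a : ℂ, x = a • w p r 1 ε l := by
  have hl' : l < (1 - 1) * p + r := by simpa using hl
  have hw := w_fin p r 1 ε ⟨l, hl'⟩
  simp only at hw
  have hK : ∀ (x : XMod p r ε) (j : Fin ((1 - 1) * p + r)),
      (basis p r 1 ε).repr (SmallQG.gen p .K • x) j =
        (((ε : ℤ) : ℂ) * q p ^ ((r : ℤ) - 1 - 2 * (j : ℕ))) * (basis p r 1 ε).repr x j := by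
    intro x j
    have : (basis p r 1 ε).coord j ∘ₗ Algebra.lsmul ℂ ℂ _ (SmallQG.gen p .K) =
        (((ε : ℤ) : ℂ) * q p ^ ((r : ℤ) - 1 - 2 * (j : ℕ))) • (basis p r 1 ε).coord j := by
      refine (basis p r 1 ε).ext fun i => ?_
      change (basis p r 1 ε).repr (SmallQG.gen p .K • basis p r 1 ε i) j =
        _ * (basis p r 1 ε).repr (basis p r 1 ε i) j
      rw [← w_fin, K_smul_w, w_fin, map_smul, Finsupp.smul_apply, Module.Basis.repr_self,
        Finsupp.single_apply, smul_eq_mul]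
      split_ifs with h
      · rw [h]
      · simp
    exact LinearMap.congr_fun this x
  refine ⟨(basis p r 1 ε).repr x ⟨l, hl'⟩, (basis p r 1 ε).repr.injective (Finsupp.ext fun j => ?_)⟩
  rw [hw, map_smul, Module.Basis.repr_self, Finsupp.smul_apply, Finsupp.single_apply, smul_eq_mul]
  split_ifs with hj
  · rw [hj, mul_one]
  · have h1 := hK x j
    rw [hx, map_smul, Finsupp.smul_apply, smul_eq_mul, mul_assoc, mul_assoc] at h1
    have h2 := mul_left_cancel₀ (by simp : ((ε : ℤ) : ℂ) ≠ 0) h1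
    rw [mul_zero]
    by_contra h0
    have h3 := mul_right_cancel₀ h0 h2
    have hj2 : (j : ℕ) < r := by simpa using j.2
    have h4 : ((q p) ^ 2) ^ l = (q p ^ 2) ^ (j : ℕ) := by
      have hq := q_ne_zero p
      rw [zpow_sub₀ hq, zpow_sub₀ hq _ (2 * (j : ℤ))] at h3
      have h5 : q p ^ (2 * (l : ℤ)) = q p ^ (2 * ((j : ℕ) : ℤ)) := by
        have h7 := zpow_ne_zero (2 * (l : ℤ)) hq
        have h8 := zpow_ne_zero (2 * ((j : ℕ) : ℤ)) hq
        have h9 := zpow_ne_zero ((r : ℤ) - 1) hq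
        rw [div_eq_div_iff h7 h8] at h3
        exact (mul_left_cancel₀ h9 h3).symm
      rw [zpow_mul, zpow_mul, zpow_natCast, zpow_natCast, zpow_ofNat] at h5
      exact h5
    have h6 : IsPrimitiveRoot (q p ^ 2) p :=
      (q_primitive (by have := hp.out; omega)).pow (by have := hp.out; omega) rfl
    exact hj (Fin.ext (h6.pow_inj (by omega) (by omega) h4))

variable (p ε)

/-- The first component of the projection of `P^ε_{p-1}` to `X^ε_{p-1}`. -/
def coverFst : XMod p p ε →ₗ[ℂ] XMod p (p - 1) ε :=
  (basis p p 1 ε).constr ℂ fun l =>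
    (((ε : ℤ) : ℂ) * q p ^ (l : ℕ) * qInt (q p) (l : ℕ)) • w p (p - 1) 1 ε (l - 1)

/-- The second component of the projection of `P^ε_{p-1}` to `X^ε_{p-1}`. -/
def coverSnd : XMod p p ε →ₗ[ℂ] XMod p (p - 1) ε :=
  (basis p p 1 ε).constr ℂ fun l => w p (p - 1) 1 ε l

variable {p ε}

theorem coverFst_w {l : ℕ} (hl : l < p) : coverFst p ε (w p p 1 ε l) =
    (((ε : ℤ) : ℂ) * q p ^ l * qInt (q p) l) • w p (p - 1) 1 ε (l - 1) := by
  have := w_fin p p 1 ε ⟨l, by simpa using hl⟩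
  simp only at this
  rw [this, coverFst, Module.Basis.constr_basis]

theorem coverSnd_w (l : ℕ) : coverSnd p ε (w p p 1 ε l) = w p (p - 1) 1 ε l := by
  by_cases hl : l < (1 - 1) * p + p
  · have := w_fin p p 1 ε ⟨l, hl⟩
    simp only at this
    rw [this, coverSnd, Module.Basis.constr_basis]
  · rw [w_eq_zero _ _ _ _ _ hl, map_zero, w_eq_zero _ _ _ _ _ (by omega)]

theorem lin_ext_of_lt {N : Type*} [AddCommGroup N] [Module ℂ N] {f g : XMod p p ε →ₗ[ℂ] N}
    (h : ∀ l < p, f (w p p 1 ε l) = g (w p p 1 ε l)) : f = g :=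
  lin_ext fun l hl => h l (by simpa using hl)

theorem coverFst_E (x : XMod p p ε) :
    q p • coverFst p ε (SmallQG.gen p .E • x) = SmallQG.gen p .E • coverFst p ε x := by
  suffices h : q p • coverFst p ε ∘ₗ Algebra.lsmul ℂ ℂ _ (SmallQG.gen p .E) =
      Algebra.lsmul ℂ ℂ _ (SmallQG.gen p .E) ∘ₗ coverFst p ε from LinearMap.congr_fun h x
  refine lin_ext_of_lt fun l hl => ?_
  change q p • coverFst p ε (SmallQG.gen p .E • w p p 1 ε l) =
    SmallQG.gen p .E • coverFst p ε (w p p 1 ε l)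
  rw [coverFst_w hl, smul_comm]
  rcases l with _ | _ | l
  · simp [E_smul_w_zero, qInt_zero]
  · rw [zero_add, Nat.sub_self, E_smul_w_zero, smul_zero, E_smul_w_succ le_rfl hl,
      LinearMap.map_smul, coverFst_w (by omega)]
    simp [qInt_zero]
  · rw [E_smul_w_succ le_rfl hl, LinearMap.map_smul, coverFst_w (by omega),
      show l + 1 + 1 - 1 = l + 1 by omega, E_smul_w_succ (by omega) (by omega), smul_smul,
      smul_smul, smul_smul]
    congr 1
    push_cast [Nat.cast_sub (show 1 ≤ p by omega)]
    rw [show (p : ℤ) - 1 - (l + 1) = p - 1 - 1 - l by ring]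
    ring

theorem coverSnd_E (x : XMod p p ε) : coverFst p ε x +
    (q p)⁻¹ • coverSnd p ε (SmallQG.gen p .E • x) = SmallQG.gen p .E • coverSnd p ε x := by
  have hq := q_ne_zero p
  have hp2 := hp.out
  suffices h : coverFst p ε + (q p)⁻¹ • coverSnd p ε ∘ₗ Algebra.lsmul ℂ ℂ _ (SmallQG.gen p .E) =
      Algebra.lsmul ℂ ℂ _ (SmallQG.gen p .E) ∘ₗ coverSnd p ε from LinearMap.congr_fun h x
  refine lin_ext_of_lt fun l hl => ?_
  change coverFst p ε _ + (q p)⁻¹ • coverSnd p ε (SmallQG.gen p .E • w p p 1 ε l) =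
    SmallQG.gen p .E • coverSnd p ε (w p p 1 ε l)
  rw [coverFst_w hl, coverSnd_w]
  cases l with
  | zero => simp [E_smul_w_zero, qInt_zero]
  | succ l =>
    have h1 := qInt_add_one (q p) hq (q_sub_inv_ne_zero p hp2) ((p : ℤ) - 1 - 1 - l)
    rw [show (p : ℤ) - 1 - 1 - l + 1 = p - 1 - l by ring] at h1
    have h2 : q p ^ (-((p : ℤ) - 1 - 1 - l)) = - (q p * q p ^ (l + 1)) := by
      rw [show -((p : ℤ) - 1 - 1 - l) = ((l + 1 + 1 : ℕ) : ℤ) - (1 : ℕ) * p by push_cast; ring,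
        q_zpow_sub_mul_p hp2]
      rw [zpow_natCast, pow_succ' (q p) (l + 1)]
      simp
    rw [E_smul_w_succ le_rfl hl, LinearMap.map_smul, coverSnd_w, Nat.add_sub_cancel, smul_smul,
      ← add_smul, h1, h2]
    by_cases hl' : l + 1 < p - 1
    · rw [E_smul_w_succ (by omega) hl']
      congr 1
      push_cast [Nat.cast_sub (show 1 ≤ p by omega)]
      field_simp
      ring
    · rw [w_eq_zero _ _ _ _ (l + 1) (by omega), smul_zero, show (p : ℤ) - 1 - 1 - l = 0 by omega,
        qInt_zero]
      convert zero_smul ℂ _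
      push_cast
      field_simp
      ring

theorem coverFst_F (x : XMod p p ε) : coverFst p ε (SmallQG.gen p .F • x) +
    coverSnd p ε (SmallQG.gen p .Ki • x) = SmallQG.gen p .F • coverFst p ε x := by
  have hq := q_ne_zero p
  have hp2 := hp.out
  suffices h : coverFst p ε ∘ₗ Algebra.lsmul ℂ ℂ _ (SmallQG.gen p .F) +
      coverSnd p ε ∘ₗ Algebra.lsmul ℂ ℂ _ (SmallQG.gen p .Ki) =
      Algebra.lsmul ℂ ℂ _ (SmallQG.gen p .F) ∘ₗ coverFst p ε from LinearMap.congr_fun h x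
  refine lin_ext_of_lt fun l hl => ?_
  change coverFst p ε (SmallQG.gen p .F • w p p 1 ε l) +
    coverSnd p ε (SmallQG.gen p .Ki • w p p 1 ε l) = SmallQG.gen p .F • coverFst p ε (w p p 1 ε l)
  rw [gen_smul .Ki, coverFst_w hl, smul_comm]
  simp only
  rw [opKi_w, F_smul_w, LinearMap.map_smul, LinearMap.map_smul, coverSnd_w]
  by_cases hl' : l + 1 < p
  · have h1 := qInt_add (v := q p) hq 1 l
    rw [qInt_one (q_sub_inv_ne_zero p hp2), add_comm (1 : ℤ)] at h1
    have h2 : q p ^ (-((p : ℤ) - 1 - 2 * l)) = - (q p * q p ^ l * q p ^ l) := by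
      rw [show -((p : ℤ) - 1 - 2 * l) = ((1 + l + l : ℕ) : ℤ) - (1 : ℕ) * p by push_cast; ring,
        q_zpow_sub_mul_p hp2, zpow_natCast, pow_add, pow_add]
      simp
    rw [coverFst_w hl', coeffF_of_lt hl', one_smul, Nat.add_sub_cancel, ← add_smul, h2]
    push_cast
    rw [h1]
    cases l with
    | zero => simp [qInt_zero]
    | succ l =>
      rw [Nat.add_sub_cancel, F_smul_w, coeffF_of_lt (by omega), one_smul]
      congr 1
      rw [zpow_neg_one, zpow_natCast]
      field_simp
      ring
  · have h3 : l + 1 = p := by omega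
    rw [h3, w_eq_zero _ _ _ _ p (by simp), map_zero, smul_zero,
      w_eq_zero _ _ _ _ l (by omega), smul_zero, zero_add, F_smul_w,
      w_eq_zero _ _ _ _ (l - 1 + 1) (by omega), smul_zero, smul_zero]

theorem coverSnd_F (x : XMod p p ε) :
    coverSnd p ε (SmallQG.gen p .F • x) = SmallQG.gen p .F • coverSnd p ε x := by
  suffices h : coverSnd p ε ∘ₗ Algebra.lsmul ℂ ℂ _ (SmallQG.gen p .F) =
      Algebra.lsmul ℂ ℂ _ (SmallQG.gen p .F) ∘ₗ coverSnd p ε from LinearMap.congr_fun h x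
  refine lin_ext_of_lt fun l hl => ?_
  change coverSnd p ε (SmallQG.gen p .F • w p p 1 ε l) =
    SmallQG.gen p .F • coverSnd p ε (w p p 1 ε l)
  rw [F_smul_w, LinearMap.map_smul, coverSnd_w, coverSnd_w, F_smul_w]

theorem coverFst_K (x : XMod p p ε) :
    q p • coverFst p ε (SmallQG.gen p .K • x) = SmallQG.gen p .K • coverFst p ε x := by
  suffices h : q p • coverFst p ε ∘ₗ Algebra.lsmul ℂ ℂ _ (SmallQG.gen p .K) =
      Algebra.lsmul ℂ ℂ _ (SmallQG.gen p .K) ∘ₗ coverFst p ε from LinearMap.congr_fun h x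
  refine lin_ext_of_lt fun l hl => ?_
  change q p • coverFst p ε (SmallQG.gen p .K • w p p 1 ε l) =
    SmallQG.gen p .K • coverFst p ε (w p p 1 ε l)
  rw [K_smul_w, LinearMap.map_smul, coverFst_w hl, smul_comm (SmallQG.gen p .K), K_smul_w,
    smul_smul, smul_smul, smul_smul]
  cases l with
  | zero => simp [qInt_zero]
  | succ l =>
    congr 1
    push_cast [Nat.cast_sub (show 1 ≤ p by omega), Nat.add_sub_cancel]
    rw [show (p : ℤ) - 1 - 1 - 2 * l = 1 + (p - 1 - 2 * (l + 1)) by ring, zpow_add₀ (q_ne_zero p) 1,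
      zpow_one]
    ring

theorem coverSnd_K (x : XMod p p ε) :
    (q p)⁻¹ • coverSnd p ε (SmallQG.gen p .K • x) = SmallQG.gen p .K • coverSnd p ε x := by
  suffices h : (q p)⁻¹ • coverSnd p ε ∘ₗ Algebra.lsmul ℂ ℂ _ (SmallQG.gen p .K) =
      Algebra.lsmul ℂ ℂ _ (SmallQG.gen p .K) ∘ₗ coverSnd p ε from LinearMap.congr_fun h x
  refine lin_ext_of_lt fun l hl => ?_
  change (q p)⁻¹ • coverSnd p ε (SmallQG.gen p .K • w p p 1 ε l) =
    SmallQG.gen p .K • coverSnd p ε (w p p 1 ε l)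
  rw [K_smul_w, LinearMap.map_smul, coverSnd_w, K_smul_w, smul_smul]
  congr 1
  push_cast [Nat.cast_sub (show 1 ≤ p by omega)]
  rw [show (p : ℤ) - 1 - 1 - 2 * l = -1 + (p - 1 - 2 * l) by ring, zpow_add₀ (q_ne_zero p) (-1),
    zpow_neg_one]
  ring

variable (p ε)

/-- The projection of `P^ε_{p-1}` to `X^ε_{p-1}`, as a linear map. -/
def coverLin : Tw (SmallQG.coprod p) (XMod p p ε) →ₗ[ℂ] XMod p (p - 1) ε :=
  (LinearMap.coprod (coverFst p ε) (coverSnd p ε) :)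

variable {p ε}

theorem coverLin_mk (x y : XMod p p ε) :
    coverLin p ε (Tw.mk _ x y) = coverFst p ε x + coverSnd p ε y := rfl

theorem coverLin_K (u : Tw (SmallQG.coprod p) (XMod p p ε)) :
    coverLin p ε (SmallQG.gen p .K • u) = SmallQG.gen p .K • coverLin p ε u := by
  rw [Tw.mk_eq u, SmallQG.K_smul_tw, coverLin_mk, coverLin_mk, smul_add, ← coverFst_K,
    ← coverSnd_K, LinearMap.map_smul, LinearMap.map_smul]

variable (p ε)

/-- The projection of `P^ε_{p-1}` to `X^ε_{p-1}`. -/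
def cover : Tw (SmallQG.coprod p) (XMod p p ε) →ₗ[SmallQG p] XMod p (p - 1) ε :=
  SmallQG.mkLinear (coverLin p ε) fun g u => by
    cases g
    · rw [Tw.mk_eq u, SmallQG.E_smul_tw, coverLin_mk, coverLin_mk, smul_add, ← coverFst_E,
        ← coverSnd_E, map_add, LinearMap.map_smul, LinearMap.map_smul, add_assoc]
    · rw [Tw.mk_eq u, SmallQG.F_smul_tw, coverLin_mk, coverLin_mk, smul_add, ← coverFst_F,
        ← coverSnd_F, map_add, add_assoc]
    · exact coverLin_K u
    · have h := coverLin_K (SmallQG.gen p .Ki • u)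
      rw [← mul_smul, (SmallQG.triple p).K_Ki, one_smul] at h
      rw [h, ← mul_smul, (SmallQG.triple p).Ki_K, one_smul]

variable {p ε}

theorem cover_mk (x y : XMod p p ε) :
    cover p ε (Tw.mk _ x y) = coverFst p ε x + coverSnd p ε y := rfl

theorem cover_surjective : Function.Surjective (cover p ε) := by
  rw [← LinearMap.range_eq_top, ← Submodule.restrictScalars_eq_top_iff ℂ (SmallQG p) _, eq_top_iff,
    ← (basis p (p - 1) 1 ε).span_eq, Submodule.span_le]
  rintro _ ⟨l, rfl⟩
  exact ⟨Tw.mk _ 0 (w p p 1 ε l), by rw [cover_mk, map_zero, zero_add, coverSnd_w, w_fin]⟩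

theorem eq_top_of_sup_ker_cover (S : Submodule (SmallQG p) (Tw (SmallQG.coprod p) (XMod p p ε)))
    (hS : S ⊔ LinearMap.ker (cover p ε) = ⊤) : S = ⊤ := by
  have hq := q_ne_zero p
  have hp2 := hp.out
  obtain ⟨s₀, hs₀, k, hk, hsk⟩ := Submodule.mem_sup.1
    (show Tw.mk _ 0 (w p p 1 ε 0) ∈ S ⊔ LinearMap.ker (cover p ε) by rw [hS]; trivial)
  have hπ₀ : cover p ε s₀ = w p (p - 1) 1 ε 0 := by
    have := congrArg (cover p ε) hsk
    rwa [map_add, LinearMap.mem_ker.1 hk, add_zero, cover_mk, map_zero, zero_add, coverSnd_w] at this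
  set c : ℂ := ((ε : ℤ) : ℂ) * q p ^ ((p : ℤ) - 1 - 1) with hc
  have hc0 : c ≠ 0 := sign_mul_q_zpow_ne_zero p ε _
  have hKw : SmallQG.gen p .K • w p (p - 1) 1 ε 0 = c • w p (p - 1) 1 ε 0 := by
    rw [K_smul_w, hc]
    push_cast [Nat.cast_sub (show 1 ≤ p by omega)]
    simp
  obtain ⟨s, hs⟩ : ∃ s, s = weightProj (SmallQG.gen p .K) c (2 * p) • s₀ := ⟨_, rfl⟩
  have hsS : s ∈ S := by rw [hs]; exact S.smul_mem _ hs₀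
  have hKs : SmallQG.gen p .K • s = c • s := by
    rw [hs, ← mul_smul, mul_weightProj hc0 (SmallQG.gen_K_pow p)
      (sign_mul_q_zpow_pow p (by omega) ε _), smul_assoc]
  have hπ : cover p ε s = w p (p - 1) 1 ε 0 := by
    rw [hs, map_smul, hπ₀, weightProj_smul_of_eq hc0 (by omega) hKw]
  obtain ⟨x, y, rfl⟩ : ∃ x y, s = Tw.mk _ x y := ⟨s.1, s.2, rfl⟩
  rw [SmallQG.K_smul_tw] at hKs
  have hx1 : q p • SmallQG.gen p .K • x = c • x := (Prod.mk_inj.1 hKs).1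
  have hy1 : (q p)⁻¹ • SmallQG.gen p .K • y = c • y := (Prod.mk_inj.1 hKs).2
  obtain ⟨a, rfl⟩ : ∃ a : ℂ, x = a • w p p 1 ε 1 := by
    refine exists_eq_smul_w le_rfl (by omega) ?_
    rw [(eq_inv_smul_iff₀ hq).2 hx1, smul_smul, hc, Nat.cast_one, mul_one,
      show (p : ℤ) - 1 - 1 = 1 + (p - 1 - 2) by ring, zpow_add₀ hq 1, zpow_one]
    congr 1
    field_simp
  obtain ⟨b, rfl⟩ : ∃ b : ℂ, y = b • w p p 1 ε 0 := by
    refine exists_eq_smul_w le_rfl (by omega) ?_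
    rw [inv_smul_eq_iff₀ hq] at hy1
    rw [hy1, smul_smul, hc, Nat.cast_zero, mul_zero, sub_zero,
      show (p : ℤ) - 1 = 1 + (p - 1 - 1) by ring, zpow_add₀ hq 1, zpow_one]
    congr 1
    rw [show (1 : ℤ) + (p - 1 - 1) - 1 = p - 1 - 1 by ring]
    ring
  have h01 : qInt (q p) (0 + 1) = 1 := by
    rw [zero_add, qInt_one (q_sub_inv_ne_zero p hp2)]
  have hEw : SmallQG.gen p .E • w p p 1 ε 1 = ((ε : ℤ) : ℂ) • w p p 1 ε 0 := by
    have := E_smul_w_succ (ε := ε) (le_refl p) (l := 0) (by omega)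
    rw [zero_add] at this
    rw [this, Nat.cast_zero, h01, sub_zero, one_mul,
      show (p : ℤ) - 1 = -1 + (1 : ℕ) * p by push_cast; ring, qInt_add_mul_p hp2, qInt_neg, qInt_one (q_sub_inv_ne_zero p hp2)]
    simp
  have hab : q p * ((ε : ℤ) : ℂ) * a + b = 1 := by
    rw [cover_mk, map_smul, map_smul, coverFst_w (by omega), coverSnd_w, Nat.sub_self, smul_smul,
      ← add_smul] at hπ
    have h1 := sub_eq_zero.2 hπ
    nth_rewrite 2 [← one_smul ℂ (w p (p - 1) 1 ε 0)] at h1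
    rw [← sub_smul, smul_eq_zero] at h1
    have h2 := sub_eq_zero.1 (h1.resolve_right (w_ne_zero (by omega)))
    rw [Nat.cast_one, qInt_one (q_sub_inv_ne_zero p hp2)] at h2
    linear_combination h2
  have hw0 : Tw.mk _ (w p p 1 ε 0) 0 ∈ S := by
    have h := S.smul_mem (SmallQG.gen p .E) hsS
    rw [SmallQG.E_smul_tw, smul_comm _ a, smul_comm _ b, hEw, E_smul_w_zero, smul_zero, smul_zero,
      smul_smul, smul_smul, ← add_smul] at h
    rwa [show q p * a * ((ε : ℤ) : ℂ) + b = 1 by rw [← hab]; ring, one_smul] at h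
  have h0w : Tw.mk _ 0 (w p p 1 ε 0) ∈ S := by
    have h := S.sub_mem hsS (S.smul_of_tower_mem a (S.smul_mem (SmallQG.gen p .F) hw0))
    rw [SmallQG.F_smul_tw, smul_zero, add_zero, F_smul_w, coeffF_of_lt (by omega), one_smul,
      gen_smul .Ki] at h
    simp only at h
    rw [opKi_w] at h
    convert h using 1
    refine Tw.ext ?_ ?_
    · change 0 = a • w p p 1 ε 1 - a • w p p 1 ε 1
      rw [sub_self]
    · change w p p 1 ε 0 = b • w p p 1 ε 0 - a • _ • w p p 1 ε 0
      rw [smul_smul, ← sub_smul, show -((p : ℤ) - 1 - 2 * (0 : ℕ)) = 1 - (1 : ℕ) * p by push_cast; ring,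
        q_zpow_sub_mul_p hp2, zpow_one, pow_one]
      rw [show b - a * (((ε : ℤ) : ℂ) * (-1 * q p)) = 1 by linear_combination hab, one_smul]
  have h0wl (l : ℕ) (hl : l < p) : Tw.mk _ 0 (w p p 1 ε l) ∈ S := by
    induction l with
    | zero => exact h0w
    | succ l ih =>
      have h := S.smul_mem (SmallQG.gen p .F) (ih (by omega))
      rwa [SmallQG.F_smul_tw, smul_zero, smul_zero, zero_add, F_smul_w, coeffF_of_lt hl,
        one_smul] at h
  have hwl (l : ℕ) (hl : l < p) : Tw.mk _ (w p p 1 ε l) 0 ∈ S := by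
    cases l with
    | zero => exact hw0
    | succ l =>
      have h := S.smul_mem (SmallQG.gen p .E) (h0wl (l + 1) hl)
      rw [SmallQG.E_smul_tw, E_smul_w_succ le_rfl hl, smul_zero, smul_zero, zero_add,
        smul_smul] at h
      have h' := S.sub_mem h (S.smul_of_tower_mem ((q p)⁻¹ * (((ε : ℤ) : ℂ) *
        (qInt (q p) (l + 1) * qInt (q p) ((p : ℤ) - 1 - l)))) (h0wl l (by omega)))
      convert h' using 1
      refine Tw.ext ?_ ?_
      · change w p p 1 ε (l + 1) = w p p 1 ε (l + 1) - _ • 0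
        rw [smul_zero, sub_zero]
      · exact (sub_self _).symm
  refine eq_top_iff.2 fun u _ => ?_
  obtain ⟨x, y, rfl⟩ : ∃ x y, u = Tw.mk _ x y := ⟨u.1, u.2, rfl⟩
  rw [Tw.mk_eq_add]
  have hspan (f : XMod p p ε →ₗ[ℂ] Tw (SmallQG.coprod p) (XMod p p ε))
      (hf : ∀ l < p, f (w p p 1 ε l) ∈ S) (x : XMod p p ε) : f x ∈ S := by
    have : (⊤ : Submodule ℂ (XMod p p ε)) ≤ (S.restrictScalars ℂ).comap f := by
      rw [← (basis p p 1 ε).span_eq, Submodule.span_le]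
      rintro _ ⟨l, rfl⟩
      have := hf l (by simpa using l.2)
      rw [w_fin] at this
      exact this
    exact this (Submodule.mem_top (x := x))
  exact S.add_mem (hspan (LinearMap.inl ℂ (XMod p p ε) (XMod p p ε) :) hwl x)
    (hspan (LinearMap.inr ℂ (XMod p p ε) (XMod p p ε) :) h0wl y)

theorem isProjectiveCover (p : ℕ) [Fact (2 ≤ p)] (ε : ℤˣ) :
    IsProjectiveCover (SmallQG p) (Tw (SmallQG.coprod p) (XMod p p ε)) (XMod p (p - 1) ε) :=
  ⟨inferInstance, cover p ε, cover_surjective, eq_top_of_sup_ker_cover⟩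

end WMod

theorem OneForm.nonempty_homog_equiv_pi {p : ℕ} [Fact (2 ≤ p)] (n : ℕ) (ε : ℤˣ)
    (hε : ε = (-1) ^ (n + 1)) : Nonempty (OneForm.homog p {(n : ℤ) * p - 1} ≃ₗ[SmallQG p]
      (Fin n → Tw (SmallQG.coprod p) (XMod p p ε))) := by
  obtain ⟨e⟩ := QPlane.nonempty_homog_equiv_pi (p := p) n ε hε
  exact ⟨(smallHomogEquiv _).trans ((Tw.congr _ e).trans (Tw.piEquiv _ _))⟩

end QSl2

end

noncomputable section

namespace QSl2

/-! ### Commutation of the divided powers -/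

theorem smul_smul_sub_smul {k V : Type*} [Field k] [AddCommGroup V] [Module k V] {x y : V}
    {m a b p₁ p₂ q₁ q₂ r₁ r₂ : k} (h₁ : m * p₁ = a * q₁ + b * r₁) (h₂ : m * p₂ = a * q₂ + b * r₂) :
    m • (p₁ • x - p₂ • y) = a • (q₁ • x - q₂ • y) + b • (r₁ • x - r₂ • y) := by
  simp only [smul_sub, smul_smul, h₁, h₂, add_smul]
  abel

namespace GenericQG

/-- The element `v^c K - v^{-c} K⁻¹`. -/
def cartanLin (c : ℤ) : GenericQG :=
  (RatFunc.X : RatFunc ℂ) ^ c • gen .K - (RatFunc.X : RatFunc ℂ) ^ (-c) • gen .Ki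

/-- The element `[K; c; t] = ∏_{s=1}^t (v^{c-s+1} K - v^{-c+s-1} K⁻¹) / (v^s - v^{-s})`. -/
def cartanBinom (c : ℤ) : ℕ → GenericQG
  | 0 => 1
  | t + 1 => ((RatFunc.X : RatFunc ℂ) ^ ((t + 1 : ℕ) : ℤ) - RatFunc.X ^ (-((t + 1 : ℕ) : ℤ)))⁻¹ •
      (cartanLin c * cartanBinom (c - 1) t)

/-- The divided powers, with the convention that those of negative index are zero. -/
def divPowZ (a : GenericQG) : ℤ → GenericQG
  | Int.ofNat n => divPow a n
  | Int.negSucc _ => 0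

theorem divPowZ_natCast (a : GenericQG) (n : ℕ) : divPowZ a n = divPow a n := rfl

theorem divPowZ_of_neg (a : GenericQG) {n : ℤ} (hn : n < 0) : divPowZ a n = 0 := by
  obtain ⟨m, rfl⟩ : ∃ m, n = Int.negSucc m := ⟨(-n - 1).toNat, by omega⟩
  rfl

theorem divPow_zero (a : GenericQG) : divPow a 0 = 1 := by simp [divPow, qFact]

theorem qInt_X_ne_zero (n : ℕ) : qInt (RatFunc.X : RatFunc ℂ) ((n : ℤ) + 1) ≠ 0 :=
  div_ne_zero (by exact_mod_cast X_pow_sub_ne_zero (n + 1) (by omega)) X_sub_inv_ne_zero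

theorem mul_divPow (a : GenericQG) (n : ℕ) :
    a * divPow a n = qInt (RatFunc.X : RatFunc ℂ) ((n : ℤ) + 1) • divPow a (n + 1) := by
  rw [divPow, divPow, mul_smul_comm, ← pow_succ', smul_smul, qFact, qFact,
    Finset.prod_range_succ, mul_inv, mul_comm, mul_assoc, inv_mul_cancel₀ (qInt_X_ne_zero n),
    mul_one]

theorem mul_divPowZ (a : GenericQG) (n : ℤ) :
    a * divPowZ a n = qInt (RatFunc.X : RatFunc ℂ) (n + 1) • divPowZ a (n + 1) := by
  rcases lt_or_ge n 0 with hn | hn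
  · rw [divPowZ_of_neg a hn, mul_zero]
    rcases (show n + 1 < 0 ∨ n + 1 = 0 by omega) with h | h
    · rw [divPowZ_of_neg a h, smul_zero]
    · rw [h, qInt_zero, zero_smul]
  · lift n to ℕ using hn
    exact mul_divPow a n

theorem E_mul_cartanLin (c : ℤ) : gen .E * cartanLin c = cartanLin (c - 2) * gen .E := by
  have hX : (RatFunc.X : RatFunc ℂ) ≠ 0 := RatFunc.X_ne_zero
  have h1 := triple.K_mul_E
  have h2 := triple.E_mul_Ki
  rw [cartanLin, cartanLin, mul_sub, sub_mul, mul_smul_comm, mul_smul_comm, smul_mul_assoc,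
    smul_mul_assoc, h1, h2, smul_smul, smul_smul, neg_sub, zpow_sub₀ hX, sub_eq_add_neg 2 c,
    zpow_add₀ hX 2, zpow_ofNat]
  congr 2
  · field_simp
  · rw [mul_comm]

theorem cartanLin_mul_F (c : ℤ) : cartanLin c * gen .F = gen .F * cartanLin (c - 2) := by
  have hX : (RatFunc.X : RatFunc ℂ) ≠ 0 := RatFunc.X_ne_zero
  have h1 := triple.K_mul_F
  have h2 := triple.Ki_mul_F hX
  rw [cartanLin, cartanLin, mul_sub, sub_mul, mul_smul_comm, mul_smul_comm, smul_mul_assoc,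
    smul_mul_assoc, h1, h2, smul_smul, smul_smul, neg_sub, zpow_sub₀ hX, sub_eq_add_neg 2 c,
    zpow_add₀ hX 2, zpow_ofNat]
  congr 2
  · field_simp
  · rw [mul_comm]

theorem Ki_mul_cartanLin (c : ℤ) : gen .Ki * cartanLin c = cartanLin c * gen .Ki := by
  rw [cartanLin, mul_sub, sub_mul, mul_smul_comm, mul_smul_comm, smul_mul_assoc, smul_mul_assoc,
    gen_Ki_K, gen_K_Ki]

theorem cartanLin_mul_cartanLin (c d : ℤ) :
    cartanLin c * cartanLin d = cartanLin d * cartanLin c := by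
  have hK : gen .K * cartanLin c = cartanLin c * gen .K := by
    rw [cartanLin, mul_sub, sub_mul, mul_smul_comm, mul_smul_comm, smul_mul_assoc, smul_mul_assoc,
      gen_Ki_K, gen_K_Ki]
  conv_lhs => rw [cartanLin.eq_1 d, mul_sub, mul_smul_comm, mul_smul_comm, ← hK, ← Ki_mul_cartanLin]
  conv_rhs => rw [cartanLin.eq_1 d, sub_mul, smul_mul_assoc, smul_mul_assoc]

theorem cartanLin_mul_cartanBinom (c d : ℤ) (t : ℕ) :
    cartanLin c * cartanBinom d t = cartanBinom d t * cartanLin c := by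
  induction t generalizing d with
  | zero => rw [cartanBinom, mul_one, one_mul]
  | succ t ih =>
    rw [cartanBinom, mul_smul_comm, smul_mul_assoc, ← mul_assoc, cartanLin_mul_cartanLin,
      mul_assoc, ih, mul_assoc]

theorem E_mul_cartanBinom (c : ℤ) (t : ℕ) :
    gen .E * cartanBinom c t = cartanBinom (c - 2) t * gen .E := by
  induction t generalizing c with
  | zero => rw [cartanBinom, cartanBinom, mul_one, one_mul]
  | succ t ih =>
    rw [cartanBinom, cartanBinom, mul_smul_comm, smul_mul_assoc, ← mul_assoc, E_mul_cartanLin,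
      mul_assoc, ih, mul_assoc, sub_right_comm]

theorem cartanBinom_mul_F (c : ℤ) (t : ℕ) :
    cartanBinom c t * gen .F = gen .F * cartanBinom (c - 2) t := by
  induction t generalizing c with
  | zero => rw [cartanBinom, cartanBinom, mul_one, one_mul]
  | succ t ih =>
    rw [cartanBinom, cartanBinom, mul_smul_comm, smul_mul_assoc, mul_assoc, ih, ← mul_assoc,
      cartanLin_mul_F, mul_assoc, sub_right_comm]

theorem cartanBinom_succ (c : ℤ) (t : ℕ) : cartanBinom c (t + 1) =
    ((RatFunc.X : RatFunc ℂ) ^ ((t + 1 : ℕ) : ℤ) - RatFunc.X ^ (-((t + 1 : ℕ) : ℤ)))⁻¹ •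
      (cartanLin (c - t) * cartanBinom c t) := by
  induction t generalizing c with
  | zero => simp [cartanBinom]
  | succ t ih =>
    rw [cartanBinom, ih, cartanBinom, mul_smul_comm, mul_smul_comm, ← mul_assoc, ← mul_assoc,
      cartanLin_mul_cartanLin]
    push_cast
    rw [sub_sub, add_comm (1 : ℤ)]

theorem cartanBinom_add_one (c : ℤ) (t : ℕ) : cartanBinom (c + 1) (t + 1) =
    (RatFunc.X : RatFunc ℂ) ^ (t + 1) • cartanBinom c (t + 1) +
      (RatFunc.X : RatFunc ℂ) ^ ((t : ℤ) - c) • (gen .Ki * cartanBinom c t) := by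
  have hX : (RatFunc.X : RatFunc ℂ) ≠ 0 := RatFunc.X_ne_zero
  have hd := X_pow_sub_ne_zero (t + 1) (by omega)
  have hl : cartanLin (c + 1) = (RatFunc.X : RatFunc ℂ) ^ (t + 1) • cartanLin (c - t) +
      ((RatFunc.X : RatFunc ℂ) ^ ((t : ℤ) - c) * ((RatFunc.X : RatFunc ℂ) ^ ((t + 1 : ℕ) : ℤ) -
        RatFunc.X ^ (-((t + 1 : ℕ) : ℤ)))) • gen .Ki := by
    have h := smul_smul_sub_smul (x := gen .K) (y := gen .Ki) (m := 1) (r₁ := 0) (r₂ := -1)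
      (a := (RatFunc.X : RatFunc ℂ) ^ (t + 1))
      (b := (RatFunc.X : RatFunc ℂ) ^ ((t : ℤ) - c) * ((RatFunc.X : RatFunc ℂ) ^ ((t + 1 : ℕ) : ℤ) -
        RatFunc.X ^ (-((t + 1 : ℕ) : ℤ))))
      (p₁ := RatFunc.X ^ (c + 1)) (q₁ := RatFunc.X ^ (c - t)) (p₂ := RatFunc.X ^ (-(c + 1)))
      (q₂ := RatFunc.X ^ (-(c - t))) ?_ ?_
    · rw [cartanLin, cartanLin]
      simpa using h
    · rw [← zpow_natCast, ← zpow_add₀ hX, one_mul, mul_zero, add_zero]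
      congr 1; push_cast; ring
    · rw [mul_sub, ← zpow_natCast, ← zpow_add₀ hX, ← zpow_add₀ hX, ← zpow_add₀ hX,
        show (t : ℤ) - c + -((t + 1 : ℕ) : ℤ) = -(c + 1) by push_cast; ring,
        show (t : ℤ) - c + ((t + 1 : ℕ) : ℤ) = ((t + 1 : ℕ) : ℤ) + -(c - t) by ring]
      ring
  rw [cartanBinom, add_sub_cancel_right, hl, add_mul, smul_add, cartanBinom_succ, smul_mul_assoc,
    smul_mul_assoc, smul_comm _⁻¹ (_ ^ (t + 1)), smul_smul _⁻¹, mul_comm _⁻¹, mul_assoc, mul_inv_cancel₀ hd, mul_one]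

theorem qInt_smul_cartanBinom (c m : ℤ) (t : ℕ) :
    qInt (RatFunc.X : RatFunc ℂ) m • cartanBinom c (t + 1) =
      qInt (RatFunc.X : RatFunc ℂ) (m - t - 1) • cartanBinom (c - 1) (t + 1) +
      ((RatFunc.X : RatFunc ℂ) - RatFunc.X⁻¹)⁻¹ •
        (cartanLin (c + m - t - 1) * cartanBinom (c - 1) t) := by
  have hX : (RatFunc.X : RatFunc ℂ) ≠ 0 := RatFunc.X_ne_zero
  have hd := X_pow_sub_ne_zero (t + 1) (by omega)
  have h0 := X_sub_inv_ne_zero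
  have hl : qInt (RatFunc.X : RatFunc ℂ) m • cartanLin c =
      qInt (RatFunc.X : RatFunc ℂ) (m - t - 1) • cartanLin (c - 1 - t) +
      qInt (RatFunc.X : RatFunc ℂ) ((t + 1 : ℕ) : ℤ) • cartanLin (c + m - t - 1) := by
    simp only [cartanLin]
    refine smul_smul_sub_smul (k := RatFunc ℂ) (V := GenericQG) ?_ ?_
    · have h := qInt_add (v := (RatFunc.X : RatFunc ℂ)) hX ((t + 1 : ℕ) : ℤ) (m - t - 1)
      rw [show ((t + 1 : ℕ) : ℤ) + (m - t - 1) = m by push_cast; ring] at h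
      rw [h, show c - 1 - t = c + -((t + 1 : ℕ) : ℤ) by push_cast; ring, zpow_add₀ hX,
        show c + m - t - 1 = c + (m - t - 1) by ring, zpow_add₀ hX]
      ring
    · have h := qInt_add (v := (RatFunc.X : RatFunc ℂ)) hX (m - t - 1) ((t + 1 : ℕ) : ℤ)
      rw [show (m - t - 1) + ((t + 1 : ℕ) : ℤ) = m by push_cast; ring] at h
      rw [h, show -(c - 1 - t) = -c + ((t + 1 : ℕ) : ℤ) by push_cast; ring, zpow_add₀ hX,
        show -(c + m - t - 1) = -c + -(m - t - 1) by ring, zpow_add₀ hX]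
      ring
  rw [cartanBinom_succ (c - 1), cartanBinom, smul_comm, ← smul_mul_assoc, hl, add_mul, smul_add,
    smul_mul_assoc, smul_mul_assoc, smul_comm _ (qInt _ _)]
  congr 1
  rw [smul_smul, qInt]
  congr 1
  field_simp

theorem E_mul_F_pow (n : ℕ) : gen .E * gen .F ^ (n + 1) = gen .F ^ (n + 1) * gen .E +
    (qInt (RatFunc.X : RatFunc ℂ) ((n : ℤ) + 1) * ((RatFunc.X : RatFunc ℂ) - RatFunc.X⁻¹)⁻¹) •
      (gen .F ^ n * cartanLin (-n)) := by
  have hX : (RatFunc.X : RatFunc ℂ) ≠ 0 := RatFunc.X_ne_zero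
  have h0 := X_sub_inv_ne_zero
  have hEF : gen .E * gen .F = gen .F * gen .E +
      ((RatFunc.X : RatFunc ℂ) - RatFunc.X⁻¹)⁻¹ • cartanLin 0 := by
    rw [← sub_eq_iff_eq_add', gen_E_F, cartanLin, neg_zero, zpow_zero, one_smul, one_smul]
  induction n with
  | zero => simp [hEF, qInt_one h0]
  | succ n ih =>
    have hl : qInt (RatFunc.X : RatFunc ℂ) (((n + 1 : ℕ) : ℤ) + 1) • cartanLin (-((n + 1 : ℕ) : ℤ)) =
        cartanLin 0 + qInt (RatFunc.X : RatFunc ℂ) ((n : ℤ) + 1) • cartanLin (-(n : ℤ) - 2) := by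
      rw [← one_smul (RatFunc ℂ) (cartanLin 0)]
      simp only [cartanLin]
      refine smul_smul_sub_smul (k := RatFunc ℂ) (V := GenericQG) ?_ ?_
      · have h := qInt_add (v := (RatFunc.X : RatFunc ℂ)) hX 1 ((n + 1 : ℕ) : ℤ)
        rw [qInt_one h0, add_comm (1 : ℤ)] at h
        rw [h, show -(n : ℤ) - 2 = -((n + 1 : ℕ) : ℤ) + -1 by push_cast; ring, zpow_add₀ hX, zpow_zero]
        have e : (RatFunc.X : RatFunc ℂ) ^ ((n + 1 : ℕ) : ℤ) * RatFunc.X ^ (-((n + 1 : ℕ) : ℤ)) = 1 := by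
          rw [← zpow_add₀ hX, add_neg_cancel, zpow_zero]
        push_cast at e ⊢
        linear_combination e
      · have h := qInt_add (v := (RatFunc.X : RatFunc ℂ)) hX ((n + 1 : ℕ) : ℤ) 1
        rw [qInt_one h0] at h
        rw [h, show -(-(n : ℤ) - 2) = ((n + 1 : ℕ) : ℤ) + 1 by push_cast; ring, zpow_add₀ hX, zpow_neg,
          neg_neg, neg_zero, zpow_zero]
        have := zpow_ne_zero ((n + 1 : ℕ) : ℤ) hX
        field_simp
        push_cast
        ring
    rw [pow_succ _ (n + 1), ← mul_assoc, ih, add_mul, mul_assoc, hEF, smul_mul_assoc, mul_assoc,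
      cartanLin_mul_F, ← mul_assoc (gen .F ^ n), ← pow_succ, mul_add, mul_assoc, add_assoc,
      mul_comm (qInt _ _), mul_smul, mul_smul_comm, mul_comm (qInt _ _), mul_smul, ← smul_add,
      ← mul_smul_comm, ← mul_smul_comm (qInt _ _), hl, mul_add]

theorem E_mul_divPow_F (n : ℕ) : gen .E * divPow (gen .F) (n + 1) =
    divPow (gen .F) (n + 1) * gen .E + ((RatFunc.X : RatFunc ℂ) - RatFunc.X⁻¹)⁻¹ •
      (divPow (gen .F) n * cartanLin (-n)) := by
  have h1 := qInt_X_ne_zero n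
  rw [divPow, divPow, mul_smul_comm, E_mul_F_pow, smul_add, smul_mul_assoc, smul_mul_assoc,
    smul_smul, smul_smul, qFact, qFact, Finset.prod_range_succ]
  congr 2
  field_simp

theorem E_mul_divPowZ_F (n : ℤ) : gen .E * divPowZ (gen .F) n =
    divPowZ (gen .F) n * gen .E + ((RatFunc.X : RatFunc ℂ) - RatFunc.X⁻¹)⁻¹ •
      (divPowZ (gen .F) (n - 1) * cartanLin (1 - n)) := by
  rcases lt_or_ge n 0 with hn | hn
  · rw [divPowZ_of_neg _ hn, divPowZ_of_neg _ (by omega)]; simp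
  · lift n to ℕ using hn
    cases n with
    | zero => rw [divPowZ_of_neg _ (by simp : ((0 : ℕ) : ℤ) - 1 < 0), divPowZ_natCast, divPow_zero]; simp
    | succ n =>
      rw [show ((n + 1 : ℕ) : ℤ) - 1 = n by simp, divPowZ_natCast, divPowZ_natCast, E_mul_divPow_F]
      congr 4
      push_cast; ring

theorem divPow_E_mul_divPow_F (a b : ℕ) : divPow (gen .E) a * divPow (gen .F) b =
    ∑ t ∈ Finset.range (a + 1), divPowZ (gen .F) ((b : ℤ) - t) *
      cartanBinom (2 * (t : ℤ) - a - b) t * divPowZ (gen .E) ((a : ℤ) - t) := by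
  induction a with
  | zero => simp [divPow_zero, cartanBinom, divPowZ_natCast, show divPowZ (gen .E) 0 = 1 from divPow_zero _]
  | succ a ih =>
    refine smul_right_injective _ (qInt_X_ne_zero a) ?_
    simp only
    rw [← smul_mul_assoc, ← mul_divPow, mul_assoc, ih, Finset.mul_sum, Finset.smul_sum]
    have hterm (t : ℕ) : gen .E * (divPowZ (gen .F) ((b : ℤ) - t) *
        cartanBinom (2 * (t : ℤ) - a - b) t * divPowZ (gen .E) ((a : ℤ) - t)) =
        qInt (RatFunc.X : RatFunc ℂ) ((a : ℤ) - t + 1) • (divPowZ (gen .F) ((b : ℤ) - t) *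
          cartanBinom (2 * (t : ℤ) - a - b - 2) t * divPowZ (gen .E) ((a : ℤ) - t + 1)) +
        ((RatFunc.X : RatFunc ℂ) - RatFunc.X⁻¹)⁻¹ • (divPowZ (gen .F) ((b : ℤ) - t - 1) *
          (cartanLin (1 - (b - t)) * cartanBinom (2 * (t : ℤ) - a - b) t) *
            divPowZ (gen .E) ((a : ℤ) - t)) := by
      rw [← mul_assoc, ← mul_assoc, E_mul_divPowZ_F, add_mul, add_mul, mul_assoc (divPowZ _ _) (gen .E),
        E_mul_cartanBinom, ← mul_assoc, mul_assoc _ (gen .E), mul_divPowZ, mul_smul_comm,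
        smul_mul_assoc, smul_mul_assoc, mul_assoc _ (cartanLin _)]
    rw [Finset.sum_congr rfl fun t _ => hterm t, Finset.sum_add_distrib]
    have hfirst := Finset.sum_range_succ (fun t : ℕ => qInt (RatFunc.X : RatFunc ℂ) ((a : ℤ) - t + 1) •
      (divPowZ (gen .F) ((b : ℤ) - t) * cartanBinom (2 * (t : ℤ) - a - b - 2) t *
        divPowZ (gen .E) ((a : ℤ) - t + 1))) (a + 1)
    rw [show (a : ℤ) - (a + 1 : ℕ) + 1 = 0 by push_cast; ring, qInt_zero, zero_smul, add_zero] at hfirst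
    rw [← hfirst, Finset.sum_range_succ', Finset.sum_range_succ' _ (a + 1), add_right_comm,
      ← Finset.sum_add_distrib]
    congr 1
    · refine Finset.sum_congr rfl fun t _ => ?_
      have h := qInt_smul_cartanBinom (2 * ((t + 1 : ℕ) : ℤ) - (a + 1 : ℕ) - b) (a + 1) t
      have e1 : (a : ℤ) - (t + 1 : ℕ) + 1 = a - t := by push_cast; ring
      have e2 : ((a + 1 : ℕ) : ℤ) - (t + 1 : ℕ) = a - t := by push_cast; ring
      have e3 : (b : ℤ) - (t + 1 : ℕ) = b - t - 1 := by push_cast; ring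
      have e4 : 2 * ((t + 1 : ℕ) : ℤ) - a - b - 2 = 2 * t - a - b := by push_cast; ring
      have e5 : 2 * ((t + 1 : ℕ) : ℤ) - (a + 1 : ℕ) - b - 1 = 2 * t - a - b := by push_cast; ring
      have e6 : 2 * ((t + 1 : ℕ) : ℤ) - (a + 1 : ℕ) - b + (a + 1) - t - 1 = 1 - (b - t) := by
        push_cast; ring
      have e7 : (a : ℤ) + 1 - t - 1 = a - t := by ring
      rw [e5, e6, e7] at h
      have h' := congrArg (fun z => divPowZ (gen .F) ((b : ℤ) - t - 1) * z *
        divPowZ (gen .E) ((a : ℤ) - t)) h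
      rw [e1, e2, e3, e4]
      simp only [mul_add, add_mul, mul_smul_comm, smul_mul_assoc] at h' ⊢
      exact h'.symm

end GenericQG

end QSl2

end

noncomputable section

namespace QSl2

open QSl2.GenericQG (lusztigForm)

namespace GenericQG

theorem qBinom_mul_qFact (a b : ℕ) : qBinom (RatFunc.X : RatFunc ℂ) (a + b) a *
    (qFact RatFunc.X a * qFact RatFunc.X b) = qFact RatFunc.X (a + b) := by
  induction a with
  | zero => simp [qBinom_zero_right, qFact]
  | succ a ih =>
    have h := qInt_mul_qBinom_succ_succ (v := (RatFunc.X : RatFunc ℂ)) RatFunc.X_ne_zero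
      X_sub_inv_ne_zero (a + b) a
    rw [add_right_comm, qFact_succ, qFact_succ _ (a + b), ← ih]
    linear_combination (qFact RatFunc.X a * qFact RatFunc.X b : RatFunc ℂ) * h

theorem divPow_mul_divPow (x : GenericQG) (a b : ℕ) : divPow x a * divPow x b =
    qBinom (RatFunc.X : RatFunc ℂ) (a + b) a • divPow x (a + b) := by
  rw [divPow, divPow, divPow, smul_mul_smul_comm, ← pow_add, smul_smul]
  congr 1
  rw [← qBinom_mul_qFact, mul_inv, mul_inv]
  have h1 := qFact_ne_zero a
  have h2 := qFact_ne_zero b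
  have h3 : qBinom (RatFunc.X : RatFunc ℂ) (a + b) a ≠ 0 :=
    left_ne_zero_of_mul (b := qFact RatFunc.X a * qFact RatFunc.X b) (by
      rw [qBinom_mul_qFact]; exact qFact_ne_zero _)
  field_simp

theorem divPow_E_mul_cartanBinom (n : ℕ) (c : ℤ) (t : ℕ) :
    divPow (gen .E) n * cartanBinom c t = cartanBinom (c - 2 * n) t * divPow (gen .E) n := by
  rw [divPow, smul_mul_assoc, mul_smul_comm]
  congr 1
  induction n generalizing c with
  | zero => simp
  | succ n ih =>
    rw [pow_succ, mul_assoc, E_mul_cartanBinom, ← mul_assoc, ih, mul_assoc]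
    congr 2; push_cast; ring

theorem cartanBinom_mul_divPow_F (n : ℕ) (c : ℤ) (t : ℕ) :
    cartanBinom c t * divPow (gen .F) n = divPow (gen .F) n * cartanBinom (c - 2 * n) t := by
  rw [divPow, smul_mul_assoc, mul_smul_comm]
  congr 1
  induction n generalizing c with
  | zero => simp
  | succ n ih =>
    rw [pow_succ', ← mul_assoc, cartanBinom_mul_F, mul_assoc, ih, mul_assoc]
    congr 3; push_cast; ring

theorem smul_cartanBinom_succ (c : ℤ) (t : ℕ) :
    ((RatFunc.X : RatFunc ℂ) ^ ((t + 1 : ℕ) : ℤ) - RatFunc.X ^ (-((t + 1 : ℕ) : ℤ))) •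
      cartanBinom c (t + 1) = cartanBinom (c - 1) t * cartanLin c := by
  rw [cartanBinom, smul_smul, mul_inv_cancel₀ (X_pow_sub_ne_zero _ (by omega)), one_smul,
    cartanLin_mul_cartanBinom]

end GenericQG

/-! ### Specialization of elements of generic quantum `sl(2)` -/

/-- The element `x` of generic quantum `sl(2)` lies in Lusztig's form, and `y` is its image in the
specialization. -/
def SpecializesTo (p : ℕ) (x : GenericQG) (y : Lusztig p) : Prop :=
  ∃ z : lusztigForm, (z : GenericQG) = x ∧ Lusztig.mk p z = y

namespace SpecializesTo

variable {p : ℕ} {x x' : GenericQG} {y y' : Lusztig p}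

theorem unique (h : SpecializesTo p x y) (h' : SpecializesTo p x y') : y = y' := by
  obtain ⟨z, rfl, rfl⟩ := h
  obtain ⟨z', hz, rfl⟩ := h'
  rw [Subtype.ext hz]

theorem add (h : SpecializesTo p x y) (h' : SpecializesTo p x' y') :
    SpecializesTo p (x + x') (y + y') := by
  obtain ⟨z, rfl, rfl⟩ := h
  obtain ⟨z', rfl, rfl⟩ := h'
  exact ⟨z + z', rfl, map_add _ _ _⟩

theorem sub (h : SpecializesTo p x y) (h' : SpecializesTo p x' y') :
    SpecializesTo p (x - x') (y - y') := by
  obtain ⟨z, rfl, rfl⟩ := h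
  obtain ⟨z', rfl, rfl⟩ := h'
  exact ⟨z - z', rfl, map_sub _ _ _⟩

theorem mul (h : SpecializesTo p x y) (h' : SpecializesTo p x' y') :
    SpecializesTo p (x * x') (y * y') := by
  obtain ⟨z, rfl, rfl⟩ := h
  obtain ⟨z', rfl, rfl⟩ := h'
  exact ⟨z * z', rfl, map_mul _ _ _⟩

theorem zero : SpecializesTo p 0 0 := ⟨0, rfl, map_zero _⟩

theorem one : SpecializesTo p 1 1 := ⟨1, rfl, map_one _⟩

theorem sum {ι : Type*} (s : Finset ι) {x : ι → GenericQG} {y : ι → Lusztig p}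
    (h : ∀ i ∈ s, SpecializesTo p (x i) (y i)) : SpecializesTo p (∑ i ∈ s, x i) (∑ i ∈ s, y i) := by
  classical
  induction s using Finset.induction_on with
  | empty => exact zero
  | insert a s ha ih =>
    rw [Finset.sum_insert ha, Finset.sum_insert ha]
    exact (h _ (Finset.mem_insert_self _ _)).add (ih fun i hi => h i (Finset.mem_insert_of_mem hi))

theorem mk {x : GenericQG} (h : x ∈ lusztigForm) : SpecializesTo p x (Lusztig.mk p ⟨x, h⟩) :=
  ⟨_, rfl, rfl⟩

theorem mem (h : SpecializesTo p x y) : x ∈ lusztigForm := by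
  obtain ⟨z, rfl, -⟩ := h
  exact z.2

theorem K : SpecializesTo p (GenericQG.gen .K) (Lusztig.K p) := ⟨GenericQG.K, rfl, rfl⟩

theorem Ki : SpecializesTo p (GenericQG.gen .Ki) (Lusztig.Ki p) := ⟨GenericQG.Ki, rfl, rfl⟩

theorem divPow_E (n : ℕ) : SpecializesTo p (GenericQG.divPow (GenericQG.gen .E) n) (dE p n) :=
  ⟨GenericQG.Ediv n, rfl, rfl⟩

theorem divPow_F (n : ℕ) : SpecializesTo p (GenericQG.divPow (GenericQG.gen .F) n) (dF p n) :=
  ⟨GenericQG.Fdiv n, rfl, rfl⟩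

variable (p) in
/-- The rational function `r` of `v` is a Laurent polynomial in Lusztig's form with value `c`. -/
def Scalar (r : RatFunc ℂ) (c : ℂ) : Prop :=
  SpecializesTo p (algebraMap (RatFunc ℂ) GenericQG r) (algebraMap ℂ (Lusztig p) c)

variable {r s : RatFunc ℂ} {c d : ℂ}

theorem smul (h : Scalar p r c) (h' : SpecializesTo p x y) : SpecializesTo p (r • x) (c • y) := by
  rw [Algebra.smul_def, Algebra.smul_def]
  exact mul h h'

theorem Scalar.add (h : Scalar p r c) (h' : Scalar p s d) : Scalar p (r + s) (c + d) := by
  rw [Scalar, map_add, map_add]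
  exact SpecializesTo.add h h'

theorem Scalar.sub (h : Scalar p r c) (h' : Scalar p s d) : Scalar p (r - s) (c - d) := by
  rw [Scalar, map_sub, map_sub]
  exact SpecializesTo.sub h h'

theorem Scalar.mul (h : Scalar p r c) (h' : Scalar p s d) : Scalar p (r * s) (c * d) := by
  rw [Scalar, map_mul, map_mul]
  exact SpecializesTo.mul h h'

theorem Scalar.one : Scalar p 1 1 := by
  rw [Scalar, map_one, map_one]
  exact SpecializesTo.one

theorem Scalar.zero : Scalar p 0 0 := by
  rw [Scalar, map_zero, map_zero]
  exact SpecializesTo.zero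

theorem Scalar.pow (h : Scalar p r c) (n : ℕ) : Scalar p (r ^ n) (c ^ n) := by
  induction n with
  | zero => simpa using Scalar.one
  | succ n ih => rw [pow_succ, pow_succ]; exact ih.mul h

theorem Scalar.zpow (n : ℤ) : Scalar p (RatFunc.X ^ n) (q p ^ n) := by
  have h1 : Scalar p RatFunc.X (q p) := ⟨GenericQG.v, rfl, mk_v p⟩
  have h2 : Scalar p RatFunc.X⁻¹ (q p)⁻¹ := ⟨GenericQG.vInv, rfl, mk_vInv p⟩
  obtain ⟨n, rfl | rfl⟩ := n.eq_nat_or_neg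
  · rw [zpow_natCast, zpow_natCast]; exact h1.pow n
  · rw [zpow_neg, zpow_neg, ← inv_zpow, ← inv_zpow, zpow_natCast, zpow_natCast]; exact h2.pow n

theorem Scalar.qBinom (n m : ℕ) : Scalar p (qBinom RatFunc.X n m) (qBinom (q p) n m) := by
  have h1 (k : ℕ) : Scalar p (RatFunc.X ^ k) (q p ^ k) := by
    rw [← zpow_natCast, ← zpow_natCast]; exact Scalar.zpow _
  induction n generalizing m with
  | zero => cases m with
    | zero => exact Scalar.one
    | succ m => exact Scalar.zero
  | succ n ih => cases m with
    | zero => exact Scalar.one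
    | succ m => exact ((h1 _).mul (ih _)).add ((Scalar.zpow _).mul (ih _))

end SpecializesTo

namespace GenericQG

open SpecializesTo

theorem divPowZ_E_mem (n : ℤ) : divPowZ (gen .E) n ∈ lusztigForm := by
  rcases lt_or_ge n 0 with hn | hn
  · rw [divPowZ_of_neg _ hn]; exact lusztigForm.zero_mem
  · lift n to ℕ using hn
    exact (Ediv n).2

theorem divPowZ_F_mem (n : ℤ) : divPowZ (gen .F) n ∈ lusztigForm := by
  rcases lt_or_ge n 0 with hn | hn
  · rw [divPowZ_of_neg _ hn]; exact lusztigForm.zero_mem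
  · lift n to ℕ using hn
    exact (Fdiv n).2

theorem zpow_smul_mem (n : ℤ) {x : GenericQG} (hx : x ∈ lusztigForm) :
    (RatFunc.X : RatFunc ℂ) ^ n • x ∈ lusztigForm :=
  (SpecializesTo.smul (Scalar.zpow (p := 2) n) (SpecializesTo.mk hx)).mem

theorem cartanBinom_mem (c : ℤ) (t : ℕ) : cartanBinom c t ∈ lusztigForm := by
  induction t using Nat.strong_induction_on generalizing c with
  | _ t ih =>
  cases t with
  | zero => exact lusztigForm.one_mem
  | succ t =>
    have h0 : cartanBinom 0 (t + 1) ∈ lusztigForm := by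
      have h := divPow_E_mul_divPow_F (t + 1) (t + 1)
      rw [Finset.sum_range_succ, sub_self, show 2 * ((t + 1 : ℕ) : ℤ) - (t + 1 : ℕ) - (t + 1 : ℕ) = 0
        by ring, show divPowZ (gen .F) 0 = 1 from divPow_zero _,
        show divPowZ (gen .E) 0 = 1 from divPow_zero _, one_mul, mul_one, ← sub_eq_iff_eq_add'] at h
      rw [← h]
      refine lusztigForm.sub_mem (lusztigForm.mul_mem (Ediv _).2 (Fdiv _).2)
        (lusztigForm.sum_mem fun s hs => ?_)
      exact lusztigForm.mul_mem (lusztigForm.mul_mem (divPowZ_F_mem _)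
        (ih s (Finset.mem_range.1 hs) _)) (divPowZ_E_mem _)
    induction c using Int.induction_on with
    | zero => exact h0
    | succ c hc =>
      rw [cartanBinom_add_one, ← zpow_natCast]
      exact lusztigForm.add_mem (zpow_smul_mem _ hc)
        (zpow_smul_mem _ (lusztigForm.mul_mem Ki.2 (ih t (by omega) _)))
    | pred c hc =>
      have h := cartanBinom_add_one (-c - 1) t
      rw [sub_add_cancel, ← sub_eq_iff_eq_add, ← zpow_natCast] at h
      have h' := zpow_smul_mem (-((t + 1 : ℕ) : ℤ)) (lusztigForm.sub_mem hc
        (zpow_smul_mem (t - (-c - 1)) (lusztigForm.mul_mem Ki.2 (ih t (by omega) (-c - 1)))))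
      change _ • (_ - _ • (gen .Ki * _)) ∈ _ at h'
      rwa [h, smul_smul, ← zpow_add₀ RatFunc.X_ne_zero, neg_add_cancel, zpow_zero, one_smul] at h'

end GenericQG

namespace Lusztig

variable (p : ℕ)

/-- The image of `[K; c; t]`. -/
def cartanBinom (c : ℤ) (t : ℕ) : Lusztig p := mk p ⟨_, GenericQG.cartanBinom_mem c t⟩

/-- The divided powers of `E`, with the convention that those of negative index are zero. -/
def dEZ (n : ℤ) : Lusztig p := mk p ⟨_, GenericQG.divPowZ_E_mem n⟩

/-- The divided powers of `F`, with the convention that those of negative index are zero. -/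
def dFZ (n : ℤ) : Lusztig p := mk p ⟨_, GenericQG.divPowZ_F_mem n⟩

theorem dEZ_natCast (n : ℕ) : dEZ p n = dE p n := rfl

theorem dFZ_natCast (n : ℕ) : dFZ p n = dF p n := rfl

theorem dFZ_of_neg {n : ℤ} (hn : n < 0) : dFZ p n = 0 :=
  (SpecializesTo.mk _).unique (by rw [GenericQG.divPowZ_of_neg _ hn]; exact SpecializesTo.zero)

open SpecializesTo

theorem dE_mul_dE (a b : ℕ) : dE p a * dE p b = qBinom (q p) (a + b) a • dE p (a + b) :=
  ((SpecializesTo.divPow_E a).mul (SpecializesTo.divPow_E b)).unique (by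
    rw [GenericQG.divPow_mul_divPow]
    exact SpecializesTo.smul (Scalar.qBinom _ _) (SpecializesTo.divPow_E _))

theorem dF_mul_dF (a b : ℕ) : dF p a * dF p b = qBinom (q p) (a + b) a • dF p (a + b) :=
  ((SpecializesTo.divPow_F a).mul (SpecializesTo.divPow_F b)).unique (by
    rw [GenericQG.divPow_mul_divPow]
    exact SpecializesTo.smul (Scalar.qBinom _ _) (SpecializesTo.divPow_F _))

theorem dE_mul_cartanBinom (n : ℕ) (c : ℤ) (t : ℕ) :
    dE p n * cartanBinom p c t = cartanBinom p (c - 2 * n) t * dE p n :=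
  ((SpecializesTo.divPow_E n).mul (SpecializesTo.mk _)).unique (by
    rw [GenericQG.divPow_E_mul_cartanBinom]
    exact (SpecializesTo.mk _).mul (SpecializesTo.divPow_E _))

theorem cartanBinom_mul_dF (n : ℕ) (c : ℤ) (t : ℕ) :
    cartanBinom p c t * dF p n = dF p n * cartanBinom p (c - 2 * n) t :=
  ((SpecializesTo.mk _).mul (SpecializesTo.divPow_F n)).unique (by
    rw [GenericQG.cartanBinom_mul_divPow_F]
    exact (SpecializesTo.divPow_F _).mul (SpecializesTo.mk _))

theorem cartanBinom_zero (c : ℤ) : cartanBinom p c 0 = 1 := map_one (mk p)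

theorem cartanBinom_add_one (c : ℤ) (t : ℕ) : cartanBinom p (c + 1) (t + 1) =
    q p ^ (t + 1) • cartanBinom p c (t + 1) +
      q p ^ ((t : ℤ) - c) • (Ki p * cartanBinom p c t) :=
  (SpecializesTo.mk _).unique (by
    rw [GenericQG.cartanBinom_add_one, ← zpow_natCast, ← zpow_natCast]
    exact (SpecializesTo.smul (Scalar.zpow _) (SpecializesTo.mk _)).add
      (SpecializesTo.smul (Scalar.zpow _) (SpecializesTo.Ki.mul (SpecializesTo.mk _))))

theorem smul_cartanBinom_succ (c : ℤ) (t : ℕ) :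
    (q p ^ ((t + 1 : ℕ) : ℤ) - q p ^ (-((t + 1 : ℕ) : ℤ))) • cartanBinom p c (t + 1) =
      cartanBinom p (c - 1) t * (q p ^ c • K p - q p ^ (-c) • Ki p) :=
  (SpecializesTo.smul ((Scalar.zpow _).sub (Scalar.zpow _)) (SpecializesTo.mk _)).unique (by
    rw [GenericQG.smul_cartanBinom_succ, GenericQG.cartanLin]
    exact (SpecializesTo.mk _).mul
      ((SpecializesTo.smul (Scalar.zpow _) SpecializesTo.K).sub
        (SpecializesTo.smul (Scalar.zpow _) SpecializesTo.Ki)))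

theorem dE_mul_dF (a b : ℕ) : dE p a * dF p b =
    ∑ t ∈ Finset.range (a + 1), dFZ p ((b : ℤ) - t) *
      cartanBinom p (2 * (t : ℤ) - a - b) t * dEZ p ((a : ℤ) - t) :=
  ((SpecializesTo.divPow_E a).mul (SpecializesTo.divPow_F b)).unique (by
    rw [GenericQG.divPow_E_mul_divPow_F]
    exact SpecializesTo.sum _ fun t _ =>
      ((SpecializesTo.mk _).mul (SpecializesTo.mk _)).mul (SpecializesTo.mk _))

theorem K_mul_dF (n : ℕ) : K p * dF p n = (q p ^ (-2 * (n : ℤ))) • (dF p n * K p) := by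
  refine (SpecializesTo.K.mul (SpecializesTo.divPow_F n)).unique ?_
  have h : GenericQG.gen .K * GenericQG.divPow (GenericQG.gen .F) n =
      (RatFunc.X : RatFunc ℂ) ^ (-2 * (n : ℤ)) •
        (GenericQG.divPow (GenericQG.gen .F) n * GenericQG.gen .K) := by
    rw [GenericQG.divPow, mul_smul_comm, smul_mul_assoc, smul_comm]
    congr 1
    induction n with
    | zero => simp
    | succ n ih =>
      rw [pow_succ, ← mul_assoc, ih, smul_mul_assoc, mul_assoc, GenericQG.triple.K_mul_F,
        mul_smul_comm, smul_smul, ← mul_assoc]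
      congr 1
      rw [show -2 * ((n + 1 : ℕ) : ℤ) = -2 * n + -2 by push_cast; ring, zpow_add₀ RatFunc.X_ne_zero _ (-2)]
      rfl
  rw [h]
  exact SpecializesTo.smul (Scalar.zpow _) ((SpecializesTo.divPow_F n).mul SpecializesTo.K)

theorem K_mul_Ki : K p * Ki p = 1 :=
  (SpecializesTo.K.mul SpecializesTo.Ki).unique (by
    rw [GenericQG.gen_K_Ki]; exact SpecializesTo.one)

theorem Ki_mul_K : Ki p * K p = 1 :=
  (SpecializesTo.Ki.mul SpecializesTo.K).unique (by
    rw [GenericQG.gen_Ki_K]; exact SpecializesTo.one)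

end Lusztig

end QSl2

end

noncomputable section

namespace QSl2

open Polynomial hiding X

open scoped Polynomial

/-! ### Lifting primitive vectors of finite-dimensional `sl(2)`-modules -/

/-- The relations of `sl(2)`. -/
structure Sl2Rel {A : Type*} [Ring A] (e f h : A) : Prop where
  h_e : h * e = e * (h + 2)
  h_f : h * f = f * (h - 2)
  e_f : e * f = f * e + h

theorem aeval_apply_of_eigenvector {H : Type*} [AddCommGroup H] [Module ℂ H] {T : Module.End ℂ H}
    {c : ℂ} {v : H} (hv : T v = c • v) (P : ℂ[X]) : aeval T P v = P.eval c • v := by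
  induction P using Polynomial.induction_on' with
  | add P Q hP hQ => rw [map_add, LinearMap.add_apply, hP, hQ, eval_add, add_smul]
  | monomial n a =>
    have h (n : ℕ) : (T ^ n) v = c ^ n • v := by
      induction n with
      | zero => simp
      | succ n ih => rw [pow_succ, Module.End.mul_apply, hv, map_smul, ih, smul_smul, pow_succ']
    rw [aeval_monomial, Module.End.mul_apply, h, eval_monomial, map_smul,
      Module.algebraMap_end_apply, smul_smul, mul_comm]

theorem exists_eval_eq_one {H : Type*} [AddCommGroup H] [Module ℂ H] [FiniteDimensional ℂ H]
    (T : Module.End ℂ H) (c : ℂ) :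
    ∃ (P : ℂ[X]) (N : ℕ), P.eval c = 1 ∧ aeval T ((Polynomial.X - C c) ^ N * P) = 0 := by
  obtain ⟨r, hr, hc⟩ := exists_eq_pow_rootMultiplicity_mul_and_not_dvd (minpoly ℂ T)
    (minpoly.ne_zero (Algebra.IsIntegral.isIntegral T)) c
  rw [dvd_iff_isRoot, IsRoot] at hc
  refine ⟨C (r.eval c)⁻¹ * r, (minpoly ℂ T).rootMultiplicity c, ?_, ?_⟩
  · rw [eval_mul, eval_C, inv_mul_cancel₀ hc]
  · rw [mul_left_comm, ← hr, map_mul, minpoly.aeval, mul_zero]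

theorem eq_zero_of_isCoprime {H : Type*} [AddCommGroup H] [Module ℂ H] {T : Module.End ℂ H}
    {P Q : ℂ[X]} (hPQ : IsCoprime P Q) {v : H} (hP : aeval T P v = 0) (hQ : aeval T Q v = 0) :
    v = 0 := by
  obtain ⟨a, b, hab⟩ := hPQ
  have h := congrArg (fun R => aeval T R v) hab
  simpa [hP, hQ] using h.symm

theorem isCoprime_X_sub_C {a b : ℂ} (h : a ≠ b) : IsCoprime (Polynomial.X - C a) (Polynomial.X - C b) :=
  isCoprime_X_sub_C_of_isUnit_sub (sub_ne_zero.2 h).isUnit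

namespace Sl2Rel

variable {H : Type*} [AddCommGroup H] [Module ℂ H] {e f h : Module.End ℂ H}

theorem h_e_apply (r : Sl2Rel e f h) (v : H) : h (e v) = e (h v) + (2 : ℂ) • e v := by
  have := LinearMap.congr_fun r.h_e v
  rw [mul_add, LinearMap.add_apply, mul_two] at this
  rw [two_smul]
  exact this

theorem h_f_apply (r : Sl2Rel e f h) (v : H) : h (f v) = f (h v) - (2 : ℂ) • f v := by
  have := LinearMap.congr_fun r.h_f v
  rw [mul_sub, LinearMap.sub_apply, mul_two] at this
  rw [two_smul]
  exact this

theorem e_f_apply (r : Sl2Rel e f h) (v : H) : e (f v) = f (e v) + h v :=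
  LinearMap.congr_fun r.e_f v

theorem h_f_pow_apply (r : Sl2Rel e f h) (k : ℕ) (v : H) :
    h ((f ^ k) v) = (f ^ k) (h v) - (2 * k : ℂ) • (f ^ k) v := by
  induction k with
  | zero => simp
  | succ k ih =>
    rw [pow_succ', Module.End.mul_apply, r.h_f_apply, ih, map_sub, map_smul]
    push_cast
    rw [Module.End.mul_apply]
    module

theorem e_f_pow_apply (r : Sl2Rel e f h) {v : H} (hv : e v = 0) (k : ℕ) :
    e ((f ^ (k + 1)) v) = (k + 1 : ℂ) • (f ^ k) (h v - (k : ℂ) • v) := by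
  induction k with
  | zero => simp [r.e_f_apply, hv]
  | succ k ih =>
    rw [pow_succ', Module.End.mul_apply, r.e_f_apply, ih, map_smul, ← Module.End.mul_apply f,
      ← pow_succ', r.h_f_pow_apply]
    simp only [map_sub, map_smul]
    push_cast
    module

/-- The translate of `(X - a)^N` that kills `e v` if `(X - a)^N` kills `v`. -/
theorem aeval_e_apply (r : Sl2Rel e f h) (a : ℂ) (N : ℕ) (v : H) :
    aeval h ((Polynomial.X - C (a + 2)) ^ N) (e v) = e (aeval h ((Polynomial.X - C a) ^ N) v) := by
  induction N generalizing v with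
  | zero => simp
  | succ N ih =>
    have h1 (a : ℂ) (v : H) : aeval h (Polynomial.X - C a) v = h v - a • v := by simp
    rw [pow_succ, pow_succ, map_mul, map_mul, Module.End.mul_apply, Module.End.mul_apply, h1, h1,
      ← ih, r.h_e_apply, map_sub e, map_smul e]
    congr 1
    module

theorem aeval_f_apply (r : Sl2Rel e f h) (a : ℂ) (N : ℕ) (v : H) :
    aeval h ((Polynomial.X - C (a - 2)) ^ N) (f v) = f (aeval h ((Polynomial.X - C a) ^ N) v) := by
  induction N generalizing v with
  | zero => simp
  | succ N ih =>
    have h1 (a : ℂ) (v : H) : aeval h (Polynomial.X - C a) v = h v - a • v := by simp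
    rw [pow_succ, pow_succ, map_mul, map_mul, Module.End.mul_apply, Module.End.mul_apply, h1, h1,
      ← ih, r.h_f_apply, map_sub f, map_smul f]
    congr 1
    module

theorem exists_pow_apply_eq_zero [FiniteDimensional ℂ H] {t : Module.End ℂ H} {s : ℂ} (hs : s ≠ 0)
    (ht : ∀ (a : ℂ) (N : ℕ) (v : H),
      aeval h ((Polynomial.X - C (a + s)) ^ N) (t v) = t (aeval h ((Polynomial.X - C a) ^ N) v))
    {v : H} {a : ℂ} {N : ℕ} (hv : aeval h ((Polynomial.X - C a) ^ N) v = 0) : ∃ k, (t ^ k) v = 0 := by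
  by_contra! hne
  have h1 (k : ℕ) : aeval h ((Polynomial.X - C (a + k * s)) ^ N) ((t ^ k) v) = 0 := by
    induction k with
    | zero => simpa using hv
    | succ k ih =>
      rw [pow_succ', Module.End.mul_apply, show a + (k + 1 : ℕ) * s = a + k * s + s by
        push_cast; ring, ht, ih, map_zero]
  have h2 (k : ℕ) : h.HasEigenvalue (a + k * s) := by
    refine Module.End.hasEigenvalue_of_hasGenEigenvalue (k := N) ?_
    refine fun hbot => hne k ?_
    rw [← Submodule.mem_bot ℂ, ← hbot]
    rw [Module.End.mem_genEigenspace_nat, LinearMap.mem_ker]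
    have h3 := h1 k
    rw [map_pow, map_sub, aeval_X, aeval_C] at h3
    exact h3
  have h3 : Function.Injective fun k : ℕ => a + k * s := fun k l hkl => by
    simpa [hs] using hkl
  exact Set.infinite_range_of_injective h3
    ((Module.End.finite_hasEigenvalue h).subset (by rintro _ ⟨k, rfl⟩; exact h2 k))

theorem aeval_prod_apply (r : Sl2Rel e f h) {k : ℕ} {v : H} (hv : e v = 0) (hk : (f ^ k) v = 0) :
    aeval h (∏ j ∈ Finset.range k, (Polynomial.X - C (j : ℂ))) v = 0 := by
  induction k generalizing v with
  | zero => simpa using hk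
  | succ k ih =>
    have h1 := r.e_f_pow_apply hv k
    rw [hk, map_zero, eq_comm, smul_eq_zero_iff_right (by exact_mod_cast k.succ_ne_zero)] at h1
    have h2 := ih (v := h v - (k : ℂ) • v) (by
      have := r.h_e_apply v
      rw [hv, map_zero, smul_zero, add_zero] at this
      rw [map_sub, map_smul, hv, ← this, smul_zero, sub_zero]) h1
    rw [Finset.prod_range_succ, map_mul, Module.End.mul_apply]
    convert h2 using 2
    simp [Nat.cast_smul_eq_nsmul]

variable (e f h) in
/-- The Casimir element. -/
def casimir : Module.End ℂ H := h * h + 2 * h + 1 + 4 * (f * e)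

theorem commute_casimir_h (r : Sl2Rel e f h) : casimir e f h * h = h * casimir e f h := by
  rw [casimir]
  linear_combination (norm := noncomm_ring) -4 * (r.h_f * e) - 4 * (f * r.h_e)

theorem commute_casimir_e (r : Sl2Rel e f h) : casimir e f h * e = e * casimir e f h := by
  rw [casimir]
  linear_combination (norm := noncomm_ring) h * r.h_e + r.h_e * (h + 2) - 2 * r.h_e - 4 * (r.e_f * e)

theorem casimir_apply (v : H) : casimir e f h v =
    h (h v) + (2 : ℂ) • h v + v + (4 : ℂ) • f (e v) := by
  rw [casimir, show (2 : Module.End ℂ H) = (2 : ℂ) • 1 by rw [ofNat_smul_eq_nsmul]; simp,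
    show (4 : Module.End ℂ H) = (4 : ℂ) • 1 by rw [ofNat_smul_eq_nsmul]; simp, smul_one_mul,
    smul_one_mul]
  rfl

theorem casimir_apply_of_e_eq_zero {v : H} (hv : e v = 0) :
    casimir e f h v = aeval h ((Polynomial.X + 1) ^ 2 : ℂ[X]) v := by
  rw [casimir_apply, hv, map_zero, smul_zero, add_zero, map_pow, map_add, aeval_X, map_one, pow_two,
    Module.End.mul_apply]
  simp only [LinearMap.add_apply, map_add, Module.End.one_apply]
  module

theorem e_aeval_h_apply (r : Sl2Rel e f h) {v : H} (hv : e v = 0) (P : ℂ[X]) :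
    e (aeval h P v) = 0 := by
  have hh (v : H) (hv : e v = 0) : e (h v) = 0 := by
    have := r.h_e_apply v
    rwa [hv, map_zero, smul_zero, add_zero, eq_comm] at this
  induction P using Polynomial.induction_on generalizing v with
  | C a => simp [hv]
  | add P Q hP hQ => rw [map_add, LinearMap.add_apply, map_add, hP hv, hQ hv, add_zero]
  | monomial n a ih =>
    rw [pow_succ, ← mul_assoc, map_mul, aeval_X, Module.End.mul_apply]
    exact ih (hh v hv)

theorem aeval_casimir_pow_apply (r : Sl2Rel e f h) {v : H} (hv : e v = 0) (c : ℂ) (N : ℕ) :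
    aeval (casimir e f h) ((Polynomial.X - C c) ^ N) v =
      aeval h (((Polynomial.X + 1) ^ 2 - C c) ^ N) v := by
  induction N generalizing v with
  | zero => simp
  | succ N ih =>
    rw [pow_succ, pow_succ, map_mul, map_mul, Module.End.mul_apply, Module.End.mul_apply,
      ← ih (r.e_aeval_h_apply hv _)]
    congr 1
    rw [map_sub, map_sub, LinearMap.sub_apply, LinearMap.sub_apply, aeval_X,
      casimir_apply_of_e_eq_zero hv, aeval_C, aeval_C]

variable [FiniteDimensional ℂ H]

theorem e_eq_zero_of_casimir (r : Sl2Rel e f h) (μ : ℕ) {v : H} {N M : ℕ}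
    (h1 : aeval h ((Polynomial.X - C (μ : ℂ)) ^ N) v = 0)
    (h2 : aeval (casimir e f h) ((Polynomial.X - C ((μ + 1 : ℂ) ^ 2)) ^ M) v = 0) : e v = 0 := by
  classical
  have hk := exists_pow_apply_eq_zero (two_ne_zero) r.aeval_e_apply h1
  obtain ⟨k, hk0, hmin⟩ : ∃ k, (e ^ k) v = 0 ∧ ∀ j < k, (e ^ j) v ≠ 0 :=
    ⟨Nat.find hk, Nat.find_spec hk, fun j hj => Nat.find_min hk hj⟩
  rcases k with _ | _ | k
  · rw [pow_zero, Module.End.one_apply] at hk0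
    rw [hk0, map_zero]
  · simpa using hk0
  exfalso
  refine hmin (k + 1) (by omega) ?_
  have h3 (j : ℕ) : aeval h ((Polynomial.X - C (μ + 2 * j : ℂ)) ^ N) ((e ^ j) v) = 0 := by
    induction j with
    | zero => simpa using h1
    | succ j ih =>
      rw [pow_succ', Module.End.mul_apply, show (μ + 2 * (j + 1 : ℕ) : ℂ) = μ + 2 * j + 2 by
        push_cast; ring, r.aeval_e_apply, ih, map_zero]
  have h4 : aeval (casimir e f h) ((Polynomial.X - C ((μ + 1 : ℂ) ^ 2)) ^ M) ((e ^ (k + 1)) v) =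
      0 := by
    have hc : Commute (aeval (casimir e f h) ((Polynomial.X - C ((μ + 1 : ℂ) ^ 2)) ^ M))
        (e ^ (k + 1)) := by
      refine Commute.pow_right ?_ _
      rw [map_pow]
      refine Commute.pow_left ?_ _
      rw [map_sub, aeval_X, aeval_C]
      exact Commute.sub_left r.commute_casimir_e (Algebra.commute_algebraMap_left _ _)
    rw [← Module.End.mul_apply, hc.eq, Module.End.mul_apply, h2, map_zero]
  rw [r.aeval_casimir_pow_apply (by rwa [← Module.End.mul_apply, ← pow_succ'])] at h4
  refine eq_zero_of_isCoprime ?_ (h3 (k + 1)) h4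
  refine IsCoprime.pow ?_
  have hf : ((Polynomial.X + 1) ^ 2 - C ((μ + 1 : ℂ) ^ 2) : ℂ[X]) =
      (Polynomial.X - C (μ : ℂ)) * (Polynomial.X - C (-μ - 2 : ℂ)) := by
    simp only [map_pow, map_add, map_sub, map_neg, map_one, map_natCast, map_ofNat]
    ring
  rw [hf]
  refine IsCoprime.mul_right (isCoprime_X_sub_C ?_) (isCoprime_X_sub_C ?_)
  · intro hh
    have : (2 * (k + 1 : ℕ) : ℂ) = 0 := by linear_combination hh
    norm_cast at this
  · intro hh
    have : (2 * μ + 2 * (k + 1 : ℕ) + 2 : ℂ) = 0 := by linear_combination hh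
    norm_cast at this

theorem h_apply_eq (r : Sl2Rel e f h) (μ : ℕ) {v : H} {N : ℕ} (hv : e v = 0)
    (h1 : aeval h ((Polynomial.X - C (μ : ℂ)) ^ N) v = 0) : h v = (μ : ℂ) • v := by
  obtain ⟨k, hk⟩ := exists_pow_apply_eq_zero (t := f) (s := -2) (by simp) (by
    intro a N v; rw [← sub_eq_add_neg]; exact r.aeval_f_apply a N v) h1
  have hk' : (f ^ (k + μ + 1)) v = 0 := by
    rw [show k + μ + 1 = μ + 1 + k by ring, pow_add, Module.End.mul_apply, hk, map_zero]
  have h2 := r.aeval_prod_apply hv hk'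
  rw [← Finset.mul_prod_erase _ _ (Finset.mem_range.2 (by omega : μ < k + μ + 1)), mul_comm, map_mul,
    Module.End.mul_apply] at h2
  have h3 := eq_zero_of_isCoprime (T := h) (P := (Polynomial.X - C (μ : ℂ)) ^ N)
    (Q := ∏ j ∈ (Finset.range (k + μ + 1)).erase μ, (Polynomial.X - C (j : ℂ))) (IsCoprime.pow_left
    (IsCoprime.prod_right fun j hj => isCoprime_X_sub_C (b := (j : ℂ)) ?_)) ?_ h2
  · simpa [sub_eq_zero, Nat.cast_smul_eq_nsmul] using h3
  · exact_mod_cast (Finset.ne_of_mem_erase hj).symm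
  · rw [← Module.End.mul_apply, ← map_mul, mul_comm, map_mul, Module.End.mul_apply, h1, map_zero]

theorem f_pow_apply_eq_zero (r : Sl2Rel e f h) (μ : ℕ) {v : H} (hv : e v = 0)
    (hh : h v = (μ : ℂ) • v) : (f ^ (μ + 1)) v = 0 := by
  have h1 : e ((f ^ (μ + 1)) v) = 0 := by
    rw [r.e_f_pow_apply hv, hh, sub_self, map_zero, smul_zero]
  have h2 : h ((f ^ (μ + 1)) v) = (-μ - 2 : ℂ) • (f ^ (μ + 1)) v := by
    rw [r.h_f_pow_apply, hh, map_smul, ← sub_smul]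
    congr 1
    push_cast
    ring
  obtain ⟨k, hk⟩ := exists_pow_apply_eq_zero (t := f) (s := -2) (h := h) (by simp) (by
    intro a N v; rw [← sub_eq_add_neg]; exact r.aeval_f_apply a N v)
    (v := (f ^ (μ + 1)) v) (a := (-μ - 2 : ℂ)) (N := 1) (by
      rw [aeval_apply_of_eigenvector h2]; simp)
  have h3 := r.aeval_prod_apply h1 hk
  rw [aeval_apply_of_eigenvector h2, eval_prod, smul_eq_zero, Finset.prod_eq_zero_iff] at h3
  refine h3.resolve_left ?_
  rintro ⟨j, -, hj⟩
  rw [eval_sub, Polynomial.eval_X, eval_C] at hj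
  have : ((μ + 2 + j : ℕ) : ℂ) = 0 := by push_cast; linear_combination -hj
  have := Nat.cast_eq_zero.1 this
  omega

/-- Primitive vectors of dominant weight lift along surjections of finite-dimensional
`sl(2)`-modules. -/
theorem exists_primitive_lift (r : Sl2Rel e f h) {H' : Type*} [AddCommGroup H'] [Module ℂ H']
    {e' f' h' : Module.End ℂ H'} {g : H →ₗ[ℂ] H'} (hg : Function.Surjective g)
    (he : ∀ v, g (e v) = e' (g v)) (hf : ∀ v, g (f v) = f' (g v)) (hh : ∀ v, g (h v) = h' (g v))
    {μ : ℕ} {w : H'} (hew : e' w = 0) (hhw : h' w = (μ : ℂ) • w) :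
    ∃ v, g v = w ∧ e v = 0 ∧ h v = (μ : ℂ) • v ∧ (f ^ (μ + 1)) v = 0 := by
  have hpoly {T : Module.End ℂ H} {T' : Module.End ℂ H'} (hT : ∀ v, g (T v) = T' (g v)) (P : ℂ[X])
      (v : H) : g (aeval T P v) = aeval T' P (g v) := by
    induction P using Polynomial.induction_on generalizing v with
    | C a => simp
    | add P Q hP hQ => rw [map_add, LinearMap.add_apply, map_add, hP, hQ, map_add]; rfl
    | monomial n a ih =>
      rw [pow_succ, ← mul_assoc, map_mul, map_mul (aeval T'), aeval_X, aeval_X, Module.End.mul_apply,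
        ih, hT]
      rfl
  have hc (v : H) : g (casimir e f h v) = casimir e' f' h' (g v) := by
    simp only [casimir_apply, map_add, map_smul, he, hf, hh]
  have hcw : casimir e' f' h' w = ((μ + 1 : ℂ) ^ 2) • w := by
    simp only [casimir_apply, hew, hhw, map_smul, map_zero]
    module
  obtain ⟨v₀, rfl⟩ := hg w
  obtain ⟨P, N, hP1, hP⟩ := exists_eval_eq_one (casimir e f h) ((μ + 1 : ℂ) ^ 2)
  obtain ⟨R, M, hR1, hR⟩ := exists_eval_eq_one h (μ : ℂ)
  have h1 : aeval h ((Polynomial.X - C (μ : ℂ)) ^ M)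
      (aeval h R (aeval (casimir e f h) P v₀)) = 0 := by
    rw [← Module.End.mul_apply, ← map_mul, hR, LinearMap.zero_apply]
  have hcomm : Commute (aeval (casimir e f h) ((Polynomial.X - C ((μ + 1 : ℂ) ^ 2)) ^ N))
      (aeval h R) := by
    have h0 : Commute (casimir e f h) h := r.commute_casimir_h
    have h2 (R : ℂ[X]) : Commute (casimir e f h) (aeval h R) := by
      induction R using Polynomial.induction_on' with
      | add P Q hP hQ => rw [map_add]; exact hP.add_right hQ
      | monomial n a =>
        rw [aeval_monomial]
        exact (Algebra.commute_algebraMap_right _ _).mul_right (h0.pow_right n)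
    rw [map_pow]
    refine Commute.pow_left ?_ _
    rw [map_sub, aeval_X, aeval_C]
    exact Commute.sub_left (h2 R) (Algebra.commute_algebraMap_left _ _)
  have h2 : aeval (casimir e f h) ((Polynomial.X - C ((μ + 1 : ℂ) ^ 2)) ^ N)
      (aeval h R (aeval (casimir e f h) P v₀)) = 0 := by
    rw [← Module.End.mul_apply, hcomm.eq, Module.End.mul_apply,
      ← Module.End.mul_apply (aeval (casimir e f h) _), ← map_mul, hP, LinearMap.zero_apply, map_zero]
  have he0 := r.e_eq_zero_of_casimir μ h1 h2
  have hh0 := r.h_apply_eq μ he0 h1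
  refine ⟨_, ?_, he0, hh0, r.f_pow_apply_eq_zero μ he0 hh0⟩
  rw [hpoly hh, hpoly hc, aeval_apply_of_eigenvector hcw, map_smul, hP1, one_smul,
    aeval_apply_of_eigenvector hhw, hR1, one_smul]

end Sl2Rel

end QSl2

end

noncomputable section

namespace QSl2

namespace Lusztig

variable (p : ℕ)

open SpecializesTo in
theorem K_mul_dE (n : ℕ) : K p * dE p n = (q p ^ (2 * (n : ℤ))) • (dE p n * K p) := by
  refine (SpecializesTo.K.mul (SpecializesTo.divPow_E n)).unique ?_
  have h : GenericQG.gen .K * GenericQG.divPow (GenericQG.gen .E) n =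
      (RatFunc.X : RatFunc ℂ) ^ (2 * (n : ℤ)) •
        (GenericQG.divPow (GenericQG.gen .E) n * GenericQG.gen .K) := by
    rw [GenericQG.divPow, mul_smul_comm, smul_mul_assoc, smul_comm]
    congr 1
    induction n with
    | zero => simp
    | succ n ih =>
      rw [pow_succ, ← mul_assoc, ih, smul_mul_assoc, mul_assoc, GenericQG.triple.K_mul_E,
        mul_smul_comm, smul_smul, ← mul_assoc]
      congr 1
      rw [show 2 * ((n + 1 : ℕ) : ℤ) = 2 * n + 2 by push_cast; ring,
        zpow_add₀ RatFunc.X_ne_zero _ 2]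
      rfl
  rw [h]
  exact SpecializesTo.smul (Scalar.zpow _) ((SpecializesTo.divPow_E n).mul SpecializesTo.K)

variable {p} [hp : Fact (2 ≤ p)]

theorem qBinom_succ_self_ne_zero {s : ℕ} (h : ¬ p ∣ s + 1) : qBinom (q p) (s + 1) s ≠ 0 := by
  have hv := q_ne_zero p
  have hv' := q_sub_inv_ne_zero p hp.out
  rw [qBinom_symm hv hv' s 1, qBinom_one_right hv hv', Ne, qInt_eq_zero_iff hp.out]
  exact_mod_cast h

theorem qBinom_mul_p_ne_zero (b : ℕ) : qBinom (q p) (b * p + p) (b * p) ≠ 0 := by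
  have hp2 := hp.out
  rw [qBinom_symm (q_ne_zero p) (q_sub_inv_ne_zero p hp.out) (b * p) p]
  have h := qBinom_p_right hp2 (b + 1) 0 (by omega)
  rw [add_zero, add_one_mul] at h
  rw [h]
  exact mul_ne_zero (by exact_mod_cast b.succ_ne_zero) (pow_ne_zero _ (by simp))

/-- The divided powers are generated by the first and the `p`-th one. -/
theorem dE_mem (S : Subalgebra ℂ (Lusztig p)) (h1 : dE p 1 ∈ S) (hE : dE p p ∈ S) (n : ℕ) :
    dE p n ∈ S := by
  have hp2 := hp.out
  induction n using Nat.strong_induction_on with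
  | _ n ih =>
  rcases n with _ | n
  · rw [dE_zero]; exact S.one_mem
  by_cases h : p ∣ n + 1
  · obtain ⟨b, hb⟩ := h
    obtain ⟨b, rfl⟩ : ∃ c, b = c + 1 := ⟨b - 1, by
      rcases b with _ | b
      · omega
      · rfl⟩
    rw [mul_comm, add_one_mul] at hb
    have h2 := S.mul_mem (ih (b * p) (by omega)) hE
    rw [dE_mul_dE] at h2
    have h3 := S.smul_mem h2 (qBinom (q p) (b * p + p) (b * p))⁻¹
    rwa [smul_smul, inv_mul_cancel₀ (qBinom_mul_p_ne_zero b), one_smul, ← hb] at h3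
  · have h2 := S.mul_mem (ih n (by omega)) h1
    rw [dE_mul_dE] at h2
    have h3 := S.smul_mem h2 (qBinom (q p) (n + 1) n)⁻¹
    rwa [smul_smul, inv_mul_cancel₀ (qBinom_succ_self_ne_zero h), one_smul] at h3

variable {M : Type*} [AddCommGroup M] [Module ℂ M] [Module (Lusztig p) M]
  [IsScalarTower ℂ (Lusztig p) M] {m : M} {i : ℕ}

theorem dE_smul_eq_zero (hE : dE p 1 • m = 0) {s : ℕ} (h0 : 0 < s) (hs : s < p) :
    dE p s • m = 0 := by
  obtain ⟨s, rfl⟩ : ∃ t, s = t + 1 := ⟨s - 1, by omega⟩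
  have h := congrArg (· • m) (dE_mul_dE p s 1)
  simp only [mul_smul, hE, smul_zero, smul_assoc] at h
  exact (smul_eq_zero.1 h.symm).resolve_left (qBinom_succ_self_ne_zero
    fun hd => by have := Nat.le_of_dvd (by omega) hd; omega)

theorem Ki_smul_of_K_smul {c : ℂ} (hc : c ≠ 0) (hK : K p • m = c • m) :
    Ki p • m = c⁻¹ • m := by
  have h1 : Ki p • K p • m = m := by rw [← mul_smul, Ki_mul_K, one_smul]
  rw [hK, smul_comm] at h1
  exact (eq_inv_smul_iff₀ hc).2 h1

theorem cartanBinom_smul (hK : K p • m = q p ^ (i : ℤ) • m) (j : ℕ) {t : ℕ} (ht : t < p) :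
    cartanBinom p ((j : ℤ) - i) t • m = qBinom (q p) j t • m := by
  have hp2 := hp.out
  have hv := q_ne_zero p
  have hv' := q_sub_inv_ne_zero p hp2
  induction t generalizing j with
  | zero => rw [cartanBinom_zero, one_smul, qBinom_zero_right, one_smul]
  | succ t ih =>
    have h0 : q p ^ ((t + 1 : ℕ) : ℤ) - q p ^ (-((t + 1 : ℕ) : ℤ)) ≠ 0 := by
      have := qInt_ne_zero_of_lt hp2 (t + 1) (by omega) ht
      rw [qInt] at this
      exact (div_ne_zero_iff.1 this).1
    have h1 := congrArg (· • m) (smul_cartanBinom_succ p ((j : ℤ) - i) t)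
    simp only [smul_assoc, mul_smul, sub_smul, hK,
      Ki_smul_of_K_smul (zpow_ne_zero _ hv) hK, ← zpow_neg, smul_smul, ← zpow_add₀ hv] at h1
    rw [← sub_smul, ← sub_smul, smul_comm (cartanBinom p _ t), sub_add_cancel,
      show -((j : ℤ) - i) + -i = -j by ring] at h1
    rw [← (IsUnit.mk0 _ h0).smul_left_cancel, h1, smul_smul]
    rcases j with _ | j
    · rw [qBinom_of_lt _ _ _ (Nat.succ_pos t)]
      simp
    · rw [show ((j + 1 : ℕ) : ℤ) - i - 1 = j - i by push_cast; ring, ih j (by omega), smul_smul]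
      congr 1
      have h2 := qInt_mul_qBinom_succ_succ hv hv' j t
      rw [qInt, qInt, div_mul_eq_mul_div, div_mul_eq_mul_div, div_left_inj' hv'] at h2
      push_cast
      exact h2.symm

theorem cartanBinom_p_smul_add_one (hK : K p • m = q p ^ (i : ℤ) • m) (j : ℕ) :
    cartanBinom p (((j + 1 : ℕ) : ℤ) - i) p • m - qBinom (q p) (j + 1) p • m =
      q p ^ p • (cartanBinom p ((j : ℤ) - i) p • m - qBinom (q p) j p • m) := by
  have hp2 := hp.out
  obtain ⟨t, ht⟩ : ∃ t, p = t + 1 := ⟨p - 1, by omega⟩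
  have h := congrArg (· • m) (cartanBinom_add_one p ((j : ℤ) - i) t)
  simp only [add_smul, smul_assoc, mul_smul] at h
  rw [cartanBinom_smul hK j (by omega : t < p), smul_comm (Ki p),
    Ki_smul_of_K_smul (zpow_ne_zero _ (q_ne_zero p)) hK, ← zpow_neg, smul_smul, smul_smul,
    mul_right_comm, ← zpow_add₀ (q_ne_zero p), ← ht,
    show (j : ℤ) - i + 1 = ((j + 1 : ℕ) : ℤ) - i by push_cast; ring,
    show (t : ℤ) - (j - i) + -i = t - j by ring] at h
  have h2 : qBinom (q p) (j + 1) p = q p ^ p * qBinom (q p) j p +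
      q p ^ ((t : ℤ) - j) * qBinom (q p) j t := by
    rw [ht]
    exact qBinom_succ_succ j t
  rw [h, h2]
  generalize cartanBinom p ((j : ℤ) - i) p • m = x
  module

theorem cartanBinom_p_smul_add (hK : K p • m = q p ^ (i : ℤ) • m) (j k : ℕ) :
    cartanBinom p (((j + k : ℕ) : ℤ) - i) p • m - qBinom (q p) (j + k) p • m =
      (q p ^ p) ^ k • (cartanBinom p ((j : ℤ) - i) p • m - qBinom (q p) j p • m) := by
  induction k with
  | zero => simp
  | succ k ih => rw [← add_assoc, cartanBinom_p_smul_add_one hK, ih, smul_smul, pow_succ']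

theorem cartanBinom_p_smul (hK : K p • m = q p ^ (i : ℤ) • m)
    (h : cartanBinom p 0 p • m = qBinom (q p) i p • m) (j : ℕ) :
    cartanBinom p ((j : ℤ) - i) p • m = qBinom (q p) j p • m := by
  have h0 : cartanBinom p ((0 : ℕ) - i : ℤ) p • m - qBinom (q p) 0 p • m = 0 := by
    have := cartanBinom_p_smul_add hK 0 i
    rw [zero_add, sub_self, h, sub_self, eq_comm] at this
    exact (smul_eq_zero.1 this).resolve_left (pow_ne_zero _ (pow_ne_zero _ (q_ne_zero p)))
  have := cartanBinom_p_smul_add hK 0 j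
  rwa [zero_add, h0, smul_zero, sub_eq_zero] at this

theorem cartanBinom_two_mul_p_smul (hK : K p • m = q p ^ (i : ℤ) • m) :
    cartanBinom p (2 * p) p • m = cartanBinom p 0 p • m +
      (qBinom (q p) (i + 2 * p) p - qBinom (q p) i p) • m := by
  have h := cartanBinom_p_smul_add hK i (2 * p)
  rw [sub_self, show ((i + 2 * p : ℕ) : ℤ) - i = 2 * p by push_cast; ring, ← pow_mul, mul_comm p,
    pow_mul, q_pow_two_p p (by have := hp.out; omega), one_pow, one_smul] at h
  rw [sub_eq_iff_eq_add] at h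
  rw [h, sub_smul]
  abel

theorem dE_one_smul_dF_smul (hE : dE p 1 • m = 0) (b : ℕ) : dE p 1 • dF p (b + 1) • m =
    dF p b • cartanBinom p (-b) 1 • m := by
  have h := congrArg (· • m) (dE_mul_dF p 1 (b + 1))
  rw [Finset.sum_range_succ, Finset.sum_range_one] at h
  simp only [add_smul, mul_smul] at h
  rw [show ((1 : ℕ) : ℤ) - ((0 : ℕ) : ℤ) = (1 : ℕ) by simp, dEZ_natCast, hE, smul_zero, smul_zero,
    zero_add, sub_self, show dEZ p 0 = 1 from dE_zero p, one_smul,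
    show ((b + 1 : ℕ) : ℤ) - (1 : ℕ) = b by push_cast; ring, dFZ_natCast] at h
  rw [h]
  congr 3
  push_cast
  ring

theorem dE_p_smul_dF_smul (hE : dE p 1 • m = 0) (b : ℕ) : dE p p • dF p b • m =
    dFZ p b • dE p p • m + dFZ p ((b : ℤ) - p) • cartanBinom p ((p : ℤ) - b) p • m := by
  have hp2 := hp.out
  have h := congrArg (· • m) (dE_mul_dF p p b)
  simp only [Finset.sum_smul, mul_smul] at h
  rw [Finset.sum_range_succ, Finset.sum_eq_single_of_mem 0 (Finset.mem_range.2 (by omega))] at h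
  · rw [h, cartanBinom_zero, one_smul, sub_self, show dEZ p 0 = 1 from dE_zero p, one_smul]
    rw [show (p : ℤ) - (0 : ℕ) = p by simp, dEZ_natCast, show (b : ℤ) - (0 : ℕ) = b by simp,
      show 2 * (p : ℤ) - p - b = p - b by ring]
  · intro t ht h0
    rw [← Nat.cast_sub (Finset.mem_range.1 ht).le, dEZ_natCast,
      dE_smul_eq_zero hE (Nat.sub_pos_of_lt (Finset.mem_range.1 ht)) (by omega), smul_zero,
      smul_zero]

end Lusztig

end QSl2

end

noncomputable section

namespace QSl2

namespace Lusztig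

variable {p : ℕ}

/-- The elements of `U_q sl(2)` that commute with a linear map. -/
def equivariance {N M : Type*} [AddCommGroup N] [Module ℂ N] [Module (Lusztig p) N]
    [IsScalarTower ℂ (Lusztig p) N] [AddCommGroup M] [Module ℂ M] [Module (Lusztig p) M]
    [IsScalarTower ℂ (Lusztig p) M] (f : N →ₗ[ℂ] M) : Subalgebra ℂ (Lusztig p) where
  carrier := {u | ∀ x, f (u • x) = u • f x}
  mul_mem' {a b} ha hb x := by rw [mul_smul, ha, hb, mul_smul]
  add_mem' {a b} ha hb x := by rw [add_smul, map_add, ha, hb, add_smul]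
  algebraMap_mem' c x := by rw [algebraMap_smul, algebraMap_smul, map_smul]

variable [hp : Fact (2 ≤ p)] {M : Type*} [AddCommGroup M] [Module ℂ M] [Module (Lusztig p) M]
  [IsScalarTower ℂ (Lusztig p) M] {m : M} {i : ℕ}

theorem dE_mul_comm (a b : ℕ) : dE p a * dE p b = dE p b * dE p a := by
  rw [dE_mul_dE, dE_mul_dE, add_comm b a,
    qBinom_symm (q_ne_zero p) (q_sub_inv_ne_zero p hp.out) a b]

/-- The graded component of degree `i` of the quantum plane is the Weyl module of highest
weight `i`. -/
theorem exists_hom_homog (hK : K p • m = q p ^ (i : ℤ) • m) (hE : dE p 1 • m = 0)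
    (hEp : dE p p • m = 0) (hh : cartanBinom p 0 p • m = qBinom (q p) i p • m)
    (hF : ∀ b, i < b → dF p b • m = 0) :
    ∃ φ : QPlane.homog p {(i : ℤ)} →ₗ[Lusztig p] M,
      ∀ x : QPlane.homog p {(i : ℤ)}, x.1 = xyZ p i 0 → φ x = m := by
  have hp2 := hp.out
  obtain ⟨Φ, hΦ'⟩ : ∃ Φ : QPlane p →ₗ[ℂ] M, ∀ a b : ℕ, Φ (xyZ p a b) = dF p b • m :=
    ⟨(basis p).constr ℂ fun s => dF p s.2 • m, fun a b => by
      rw [xyZ_natCast, xy, Module.Basis.constr_basis]⟩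
  have hΦ (a b : ℤ) (hab : a + b = i) : Φ (xyZ p a b) = dFZ p b • m := by
    rcases lt_or_ge b 0 with hb | hb
    · rw [xyZ_of_neg p (Or.inr hb), map_zero, dFZ_of_neg p hb, zero_smul]
    lift b to ℕ using hb
    rw [dFZ_natCast]
    rcases lt_or_ge a 0 with ha | ha
    · rw [xyZ_of_neg p (Or.inl ha), map_zero, hF b (by omega)]
    · lift a to ℕ using ha
      exact hΦ' a b
  have key (u : Lusztig p)
      (h : ∀ a b : ℕ, a + b = i → Φ (u • xyZ p a b) = u • dF p b • m) (x : QPlane.homog p {(i : ℤ)}) :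
      Φ (u • x.1) = u • Φ x.1 := by
    refine QPlane.homog_induction (P := fun f => Φ (u • f) = u • Φ f) x.2 (fun a b hab => ?_) ?_ ?_ ?_
    · rw [h a b (by exact_mod_cast (show (a : ℤ) + b = i from hab)), hΦ' a b]
    · rw [smul_zero, map_zero, smul_zero]
    · intro f g hf hg
      rw [smul_add, map_add, hf, hg, map_add, smul_add]
    · intro c f hf
      rw [smul_comm, map_smul, hf, map_smul, smul_comm]
  have hK' (x : QPlane.homog p {(i : ℤ)}) : Φ (K p • x.1) = K p • Φ x.1 := by
    refine key _ (fun a b hab => ?_) x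
    rw [QPlane.K_smul, opK_xyZ, map_smul, hΦ' a b, ← mul_smul, K_mul_dF, smul_assoc, mul_smul, hK,
      smul_comm (dF p b), smul_smul, ← zpow_add₀ (q_ne_zero p)]
    congr 2
    rw [← hab]
    push_cast
    ring
  let φ : QPlane.homog p {(i : ℤ)} →ₗ[ℂ] M :=
    Φ ∘ₗ ((QPlane.homog p {(i : ℤ)}).subtype.restrictScalars ℂ)
  have hE' : ∀ n, dE p n ∈ equivariance φ := by
    refine dE_mem _ (key _ fun a b hab => ?_) (key _ fun a b hab => ?_)
    · rw [QPlane.dE_smul, opEd_xyZ, map_smul, hΦ _ _ (by push_cast; omega)]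
      rcases b with _ | b
      · rw [dF_zero, one_smul, hE, dFZ_of_neg p (by simp), zero_smul, smul_zero]
      · rw [dE_one_smul_dF_smul hE, show (-b : ℤ) = ((a + 1 : ℕ) : ℤ) - i by
          rw [← hab]; push_cast; ring, cartanBinom_smul hK _ (by omega), smul_comm (dF p b),
          show ((b + 1 : ℕ) : ℤ) - (1 : ℕ) = b by push_cast; ring, dFZ_natCast]
        rfl
    · rw [QPlane.dE_smul, opEd_xyZ, map_smul, hΦ _ _ (by push_cast; omega), dE_p_smul_dF_smul hE,
        hEp, smul_zero, zero_add, show (p : ℤ) - b = ((a + p : ℕ) : ℤ) - i by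
          rw [← hab]; push_cast; ring, cartanBinom_p_smul hK hh, smul_comm (dFZ p _)]
      rfl
  refine ⟨Lusztig.mkLinear φ hK' (fun x => ?_) (fun n => hE' (n + 1)) fun n => key _
    fun a b hab => ?_, fun x hx => ?_⟩
  · have h1 := hK' (Ki p • x)
    change Φ (K p • Ki p • x.1) = K p • Φ (Ki p • x.1) at h1
    rw [← mul_smul, K_mul_Ki, one_smul] at h1
    change Φ (Ki p • x.1) = Ki p • Φ x.1
    rw [h1, ← mul_smul, Ki_mul_K, one_smul]
  · rw [QPlane.dF_smul, opFd_xyZ, map_smul, hΦ _ _ (by omega), ← mul_smul, dF_mul_dF, smul_assoc,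
      ← Nat.cast_add, dFZ_natCast, add_comm b]
    rfl
  · change Φ x.1 = m
    rw [hx]
    have := hΦ' i 0
    rwa [dF_zero, one_smul] at this

variable (p M i) in
/-- The vectors of weight `q^i` that are killed by `E`. -/
def primitive : Submodule ℂ M where
  carrier := {m | K p • m = q p ^ (i : ℤ) • m ∧ dE p 1 • m = 0}
  zero_mem' := by simp
  add_mem' {a b} ha hb := ⟨by rw [smul_add, ha.1, hb.1, smul_add], by
    rw [smul_add, ha.2, hb.2, add_zero]⟩
  smul_mem' c a ha := ⟨by rw [smul_comm, ha.1, smul_comm], by rw [smul_comm, ha.2, smul_zero]⟩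

theorem dE_p_smul_mem (hm : m ∈ primitive p M i) : dE p p • m ∈ primitive p M i := by
  refine ⟨?_, ?_⟩
  · rw [← mul_smul, K_mul_dE, smul_assoc, mul_smul, hm.1, smul_comm (dE p p), zpow_mul,
      zpow_natCast, zpow_ofNat, ← pow_mul, q_pow_two_p p (by have := hp.out; omega), one_smul]
  · rw [← mul_smul, dE_mul_comm, mul_smul, hm.2, smul_zero]

variable {k : ℕ}

theorem dF_p_smul_mem (hm : m ∈ primitive p M (k * p + (p - 1))) :
    dF p p • m ∈ primitive p M (k * p + (p - 1)) := by
  have hp2 := hp.out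
  obtain ⟨t, ht⟩ : ∃ t, p = t + 1 := ⟨p - 1, by omega⟩
  refine ⟨?_, ?_⟩
  · rw [← mul_smul, K_mul_dF, smul_assoc, mul_smul, hm.1, smul_comm (dF p p), zpow_mul,
      zpow_natCast, zpow_neg, inv_pow, zpow_ofNat, ← pow_mul, q_pow_two_p p (by omega), inv_one,
      one_smul]
  · have h := dE_one_smul_dF_smul hm.2 t
    rw [← ht, show (-t : ℤ) = ((k * p : ℕ) : ℤ) - (k * p + (p - 1) : ℕ) by
      rw [Nat.cast_add, sub_add_cancel_left]; omega, cartanBinom_smul hm.1 _ (by omega),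
      qBinom_one_right (q_ne_zero p) (q_sub_inv_ne_zero p hp2),
      (qInt_eq_zero_iff hp2 _).2 (by push_cast; exact dvd_mul_left _ _), zero_smul, smul_zero] at h
    exact h

theorem dE_p_smul_dF_p_smul (hm : m ∈ primitive p M i) :
    dE p p • dF p p • m = dF p p • dE p p • m + cartanBinom p 0 p • m := by
  rw [dE_p_smul_dF_smul hm.2, sub_self, show dFZ p 0 = 1 from dF_zero p, one_smul]
  rfl

theorem cartanBinom_smul_mem (hm : m ∈ primitive p M (k * p + (p - 1))) :
    cartanBinom p 0 p • m ∈ primitive p M (k * p + (p - 1)) := by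
  rw [← sub_eq_iff_eq_add'.2 (dE_p_smul_dF_p_smul hm)]
  exact Submodule.sub_mem _ (dE_p_smul_mem (dF_p_smul_mem hm)) (dF_p_smul_mem (dE_p_smul_mem hm))

variable (p k) in
/-- The sign by which the action of `U_q sl(2)` on the primitive vectors of weight
`(k + 1) p - 1` differs from an action of `sl(2)`. -/
def primSign : ℂ := (-1) ^ ((k + 1) * p + (p - 1))

theorem primSign_mul_self : primSign p k * primSign p k = 1 := by
  rw [primSign, ← pow_add, ← two_mul, pow_mul]; simp

theorem qBinom_primitive : qBinom (q p) (k * p + (p - 1)) p = k * primSign p k :=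
  qBinom_p_right hp.out k (p - 1) (by have := hp.out; omega)

theorem qBinom_primitive_add : qBinom (q p) (k * p + (p - 1) + 2 * p) p =
    (k + 2) * primSign p k := by
  have h := qBinom_p_right hp.out (k + 2) (p - 1) (by have := hp.out; omega)
  rw [show (k + 2) * p + (p - 1) = k * p + (p - 1) + 2 * p by ring,
    show (k + 2 + 1) * p + (p - 1) = (k + 1) * p + (p - 1) + 2 * p by ring, pow_add _ _ (2 * p),
    pow_mul] at h
  rw [h, primSign]
  simp

theorem cartanBinom_two_mul_p_smul_primitive (hm : m ∈ primitive p M (k * p + (p - 1))) :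
    cartanBinom p (2 * p) p • m = cartanBinom p 0 p • m + (2 * primSign p k) • m := by
  rw [cartanBinom_two_mul_p_smul hm.1, qBinom_primitive, qBinom_primitive_add]
  congr 2
  ring

theorem cartanBinom_smul_dE_p_smul (hm : m ∈ primitive p M (k * p + (p - 1))) :
    cartanBinom p 0 p • dE p p • m =
      dE p p • cartanBinom p 0 p • m + (2 * primSign p k) • dE p p • m := by
  have h := dE_mul_cartanBinom p p (2 * p) p
  rw [sub_self] at h
  rw [← mul_smul, ← h, mul_smul, cartanBinom_two_mul_p_smul_primitive hm, smul_add,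
    smul_comm (dE p p) (2 * primSign p k)]

theorem cartanBinom_smul_dF_p_smul (hm : m ∈ primitive p M (k * p + (p - 1))) :
    cartanBinom p 0 p • dF p p • m =
      dF p p • cartanBinom p 0 p • m - (2 * primSign p k) • dF p p • m := by
  have h := cartanBinom_mul_dF p p (2 * p) p
  rw [sub_self] at h
  rw [eq_sub_iff_add_eq, ← cartanBinom_two_mul_p_smul_primitive (dF_p_smul_mem hm), ← mul_smul, h,
    mul_smul]

variable (p M k)

/-- The action of `E` of `sl(2)` on the primitive vectors. -/
def primE : Module.End ℂ (primitive p M (k * p + (p - 1))) :=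
  primSign p k • ((Algebra.lsmul ℂ ℂ M (dE p p)).restrict fun _ => dE_p_smul_mem)

/-- The action of `F` of `sl(2)` on the primitive vectors. -/
def primF : Module.End ℂ (primitive p M (k * p + (p - 1))) :=
  (Algebra.lsmul ℂ ℂ M (dF p p)).restrict fun _ => dF_p_smul_mem

/-- The action of `H` of `sl(2)` on the primitive vectors. -/
def primH : Module.End ℂ (primitive p M (k * p + (p - 1))) :=
  primSign p k • ((Algebra.lsmul ℂ ℂ M (cartanBinom p 0 p)).restrict fun _ => cartanBinom_smul_mem)

variable {p M k}

theorem primE_apply (x : primitive p M (k * p + (p - 1))) :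
    (primE p M k x : M) = primSign p k • dE p p • (x : M) := rfl

theorem primF_apply (x : primitive p M (k * p + (p - 1))) :
    (primF p M k x : M) = dF p p • (x : M) := rfl

theorem primH_apply (x : primitive p M (k * p + (p - 1))) :
    (primH p M k x : M) = primSign p k • cartanBinom p 0 p • (x : M) := rfl

theorem sl2Rel_prim : Sl2Rel (primE p M k) (primF p M k) (primH p M k) where
  h_e := by
    refine LinearMap.ext fun x => Subtype.ext ?_
    rw [mul_add, mul_two, LinearMap.add_apply, LinearMap.add_apply, Module.End.mul_apply,
      Module.End.mul_apply, Submodule.coe_add, Submodule.coe_add, primH_apply, primE_apply,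
      primE_apply, primH_apply, smul_comm (cartanBinom p 0 p), smul_comm (dE p p),
      cartanBinom_smul_dE_p_smul x.2]
    have h := primSign_mul_self (p := p) (k := k)
    generalize dE p p • cartanBinom p 0 p • (x : M) = u
    generalize dE p p • (x : M) = w
    rw [smul_add, smul_smul, smul_add, smul_smul, smul_smul,
      show primSign p k * (primSign p k * (2 * primSign p k)) =
        2 * (primSign p k * primSign p k) * primSign p k by ring, h]
    module
  h_f := by
    refine LinearMap.ext fun x => Subtype.ext ?_
    rw [mul_sub, mul_two, LinearMap.sub_apply, LinearMap.add_apply, Module.End.mul_apply,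
      Module.End.mul_apply, Submodule.coe_sub, Submodule.coe_add, primH_apply, primF_apply,
      primF_apply, primH_apply, smul_comm (dF p p), cartanBinom_smul_dF_p_smul x.2]
    have h := primSign_mul_self (p := p) (k := k)
    generalize dF p p • cartanBinom p 0 p • (x : M) = u
    generalize dF p p • (x : M) = w
    rw [smul_sub, smul_smul, mul_left_comm, h]
    module
  e_f := by
    refine LinearMap.ext fun x => Subtype.ext ?_
    rw [LinearMap.add_apply, Module.End.mul_apply,
      Module.End.mul_apply, Submodule.coe_add, primH_apply, primF_apply, primE_apply,
      primF_apply, primE_apply, smul_comm (dF p p), dE_p_smul_dF_p_smul x.2, smul_add]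

theorem exists_dF_mul_p_eq (j : ℕ) : ∃ c : ℂ, dF p (j * p) = c • dF p p ^ j := by
  induction j with
  | zero => exact ⟨1, by rw [zero_mul, dF_zero, pow_zero, one_smul]⟩
  | succ j ih =>
    obtain ⟨c, hc⟩ := ih
    refine ⟨(qBinom (q p) (j * p + p) (j * p))⁻¹ * c, ?_⟩
    rw [add_one_mul, pow_succ, mul_smul, ← smul_mul_assoc c, ← hc, dF_mul_dF, smul_smul,
      inv_mul_cancel₀ (qBinom_mul_p_ne_zero j), one_smul]

theorem dF_smul_eq_zero (h : dF p p ^ k • m = 0) {b : ℕ} (hb : k * p ≤ b) : dF p b • m = 0 := by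
  have hp2 := hp.out
  induction b, hb using Nat.le_induction with
  | base =>
    obtain ⟨c, hc⟩ := exists_dF_mul_p_eq (p := p) k
    rw [hc, smul_assoc, h, smul_zero]
  | succ b hb ih =>
    by_cases hd : p ∣ b + 1
    · obtain ⟨j, hj⟩ := hd
      obtain ⟨c, hc⟩ := exists_dF_mul_p_eq (p := p) j
      have hkj : k ≤ j := by
        by_contra! hlt
        have := Nat.mul_le_mul_left p hlt.le
        rw [← hj, mul_comm p] at this
        omega
      rw [hj, mul_comm, hc, smul_assoc, ← Nat.sub_add_cancel hkj, pow_add, mul_smul, h, smul_zero,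
        smul_zero]
    · have h1 := congrArg (· • m) (dF_mul_dF p 1 b)
      simp only [mul_smul, ih, smul_zero, smul_assoc] at h1
      rw [add_comm 1 b, qBinom_one_right (q_ne_zero p) (q_sub_inv_ne_zero p hp2)] at h1
      refine (smul_eq_zero.1 h1.symm).resolve_left ?_
      rw [qInt_eq_zero_iff hp2]
      exact_mod_cast hd

theorem exists_primitive_preimage {N : Type*} [AddCommGroup N] [Module ℂ N] [Module (Lusztig p) N]
    [IsScalarTower ℂ (Lusztig p) N] {g : M →ₗ[Lusztig p] N} (hg : Function.Surjective g) {w : N}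
    (hw : w ∈ primitive p N (k * p + (p - 1))) :
    ∃ v ∈ primitive p M (k * p + (p - 1)), g v = w := by
  have hp2 := hp.out
  letI : Module (SmallQG p) M := Module.compHom M (ofSmall p).toRingHom
  letI : Module (SmallQG p) N := Module.compHom N (ofSmall p).toRingHom
  have hM (s : SmallQG p) (x : M) : s • x = ofSmall p s • x := rfl
  have hN (s : SmallQG p) (x : N) : s • x = ofSmall p s • x := rfl
  haveI : IsScalarTower ℂ (SmallQG p) M := ⟨fun c s x => by
    rw [hM, hM, map_smul, smul_assoc]⟩
  haveI : IsScalarTower ℂ (SmallQG p) N := ⟨fun c s x => by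
    rw [hN, hN, map_smul, smul_assoc]⟩
  let g' : M →ₗ[SmallQG p] N := { g with map_smul' := fun s x => g.map_smul (ofSmall p s) x }
  have hq : ((((-1) ^ k : ℤˣ) : ℤ) : ℂ) * q p ^ ((p : ℤ) - 1) =
      q p ^ ((k * p + (p - 1) : ℕ) : ℤ) := by
    rw [show ((k * p + (p - 1) : ℕ) : ℤ) = p * k + (p - 1) by
      push_cast [Nat.cast_sub (by omega : 1 ≤ p)]; ring, zpow_add₀ (q_ne_zero p), zpow_mul,
      zpow_natCast (q p) p, q_pow_p p (by omega), zpow_natCast]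
    push_cast
    rfl
  obtain ⟨f, hf⟩ := WMod.exists_hom (p := p) (ε := (-1) ^ k) (m := w)
    (by rw [hq, hN, ofSmall_gen]; exact hw.1) (by rw [hN, ofSmall_gen]; exact hw.2)
  obtain ⟨h, hh⟩ := WMod.exists_lift _ g' hg f
  refine ⟨h (WMod.w p p 1 _ 0), ⟨?_, ?_⟩, ?_⟩
  · have h1 := WMod.K_smul_w (p := p) p 1 ((-1) ^ k) 0
    rw [show (p : ℤ) - 1 - 2 * (0 : ℕ) = p - 1 by simp, hq] at h1
    have h2 := congrArg h h1
    rw [map_smul, LinearMap.map_smul_of_tower, hM, ofSmall_gen] at h2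
    exact h2
  · have h2 := congrArg h (WMod.E_smul_w_zero (p := p) p 1 ((-1) ^ k))
    rw [map_smul, map_zero, hM, ofSmall_gen] at h2
    exact h2
  · rw [← hf, ← hh]
    rfl

end Lusztig

end QSl2

end

noncomputable section

namespace QSl2

variable {p : ℕ} [hp : Fact (2 ≤ p)]

namespace QPlane

instance (i : ℤ) : FiniteDimensional ℂ (homog p {i}) := by
  have h : (homog p {i}).restrictScalars ℂ ≤
      Submodule.span ℂ (Set.range fun b : Fin (i.toNat + 1) => xyZ p (i - b) b) :=
    homog_le fun m n hmn => by
      obtain rfl : (m : ℤ) + n = i := hmn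
      exact Submodule.subset_span ⟨⟨n, by omega⟩, by simp⟩
  have : FiniteDimensional ℂ (Submodule.span ℂ
      (Set.range fun b : Fin (i.toNat + 1) => xyZ p (i - b) b)) :=
    FiniteDimensional.span_of_finite ℂ (Set.finite_range _)
  exact Submodule.finiteDimensional_of_le h

theorem homog_hom_ext {i : ℕ} {N : Type*} [AddCommGroup N] [Module ℂ N] [Module (Lusztig p) N]
    [IsScalarTower ℂ (Lusztig p) N] {f g : homog p {(i : ℤ)} →ₗ[Lusztig p] N}
    (h : ∀ x : homog p {(i : ℤ)}, x.1 = xyZ p i 0 → f x = g x) : f = g := by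
  obtain ⟨z, hz⟩ : ∃ z : homog p {(i : ℤ)}, z.1 = xyZ p i 0 :=
    ⟨⟨_, xyZ_mem_homog (add_zero _)⟩, rfl⟩
  have hspan : homog p {(i : ℤ)} ≤ Submodule.span (Lusztig p) {z.1} := by
    refine homog_le (S := (Submodule.span (Lusztig p) {z.1}).restrictScalars ℂ) fun m n hmn => ?_
    have hmn : (m : ℤ) + n = i := hmn
    refine Submodule.mem_span_singleton.2 ⟨dF p n, ?_⟩
    rw [hz, dF_smul, opFd_xyZ, zero_add, Int.toNat_natCast, qBinom_self, one_smul]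
    congr 1
    omega
  refine LinearMap.ext fun x => ?_
  obtain ⟨a, ha⟩ := Submodule.mem_span_singleton.1 (hspan x.2)
  obtain rfl : x = a • z := Subtype.ext ha.symm
  rw [map_smul, map_smul, h z hz]

/-- The graded component of degree `(k + 1) p - 1` is projective. -/
theorem exists_lift_homog (k : ℕ) {M N : Type*} [AddCommGroup M] [Module ℂ M] [Module (Lusztig p) M]
    [IsScalarTower ℂ (Lusztig p) M] [FiniteDimensional ℂ M] [AddCommGroup N] [Module ℂ N]
    [Module (Lusztig p) N] [IsScalarTower ℂ (Lusztig p) N] {g : M →ₗ[Lusztig p] N}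
    (hg : Function.Surjective g)
    (f : homog p {((k * p + (p - 1) : ℕ) : ℤ)} →ₗ[Lusztig p] N) :
    ∃ h : homog p {((k * p + (p - 1) : ℕ) : ℤ)} →ₗ[Lusztig p] M, g ∘ₗ h = f := by
  have hp2 := hp.out
  obtain ⟨z, hz⟩ : ∃ z : homog p {((k * p + (p - 1) : ℕ) : ℤ)},
      z.1 = xyZ p ((k * p + (p - 1) : ℕ) : ℤ) 0 := ⟨⟨_, xyZ_mem_homog (add_zero _)⟩, rfl⟩
  have hσ : primSign p k ≠ 0 := left_ne_zero_of_mul_eq_one primSign_mul_self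
  have hEz {n : ℕ} (hn : 0 < n) : dE p n • z = 0 := Subtype.ext (by
    change dE p n • z.1 = 0
    rw [hz, dE_smul, opEd_xyZ, xyZ_of_neg p (Or.inr (by omega)), smul_zero])
  have hz1 : z ∈ primitive p (homog p {((k * p + (p - 1) : ℕ) : ℤ)}) (k * p + (p - 1)) := by
    refine ⟨Subtype.ext ?_, hEz one_pos⟩
    change K p • z.1 = _ • z.1
    rw [hz, K_smul, opK_xyZ, sub_zero]
  have hHz : cartanBinom p 0 p • z = (k * primSign p k) • z := by
    have h := dE_p_smul_dF_p_smul hz1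
    rw [hEz (by omega), smul_zero, zero_add] at h
    rw [← h]
    refine Subtype.ext ?_
    change dE p p • dF p p • z.1 = _ • z.1
    rw [hz, dF_smul, opFd_xyZ, dE_smul, map_smul, opEd_xyZ, zero_add, Int.toNat_natCast, qBinom_self,
      one_smul, sub_add_cancel, sub_self, Int.toNat_natCast, qBinom_primitive]
  have hfz : f z ∈ primitive p N (k * p + (p - 1)) :=
    ⟨by rw [← map_smul, hz1.1, LinearMap.map_smul_of_tower], by rw [← map_smul, hz1.2, map_zero]⟩
  have hgp : ∀ x ∈ primitive p M (k * p + (p - 1)),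
      (g.restrictScalars ℂ) x ∈ primitive p N (k * p + (p - 1)) := fun x hx =>
    ⟨by
      change K p • g x = _ • g x
      rw [← map_smul, hx.1, LinearMap.map_smul_of_tower],
    by
      change dE p 1 • g x = 0
      rw [← map_smul, hx.2, map_zero]⟩
  obtain ⟨v, hgv, hev, hhv, hfv⟩ := (sl2Rel_prim (p := p) (M := M) (k := k)).exists_primitive_lift
    (g := (g.restrictScalars ℂ).restrict hgp) (e' := primE p N k) (f' := primF p N k)
    (h' := primH p N k) (μ := k) (w := ⟨f z, hfz⟩)
    (fun w => by
      obtain ⟨v, hv, hvw⟩ := exists_primitive_preimage hg w.2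
      exact ⟨⟨v, hv⟩, Subtype.ext hvw⟩)
    (fun v => Subtype.ext (by
      change g (primSign p k • dE p p • v.1) = primSign p k • dE p p • g v.1
      rw [LinearMap.map_smul_of_tower, map_smul]))
    (fun v => Subtype.ext (map_smul g _ _))
    (fun v => Subtype.ext (by
      change g (primSign p k • cartanBinom p 0 p • v.1) = primSign p k • cartanBinom p 0 p • g v.1
      rw [LinearMap.map_smul_of_tower, map_smul]))
    (Subtype.ext (by
      change primSign p k • dE p p • f z = 0
      rw [← map_smul, hEz (by omega), map_zero, smul_zero]))
    (Subtype.ext (by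
      change primSign p k • cartanBinom p 0 p • f z = (k : ℂ) • f z
      rw [← map_smul, hHz, LinearMap.map_smul_of_tower, smul_smul, mul_left_comm,
        primSign_mul_self, mul_one]))
  have hEv : dE p p • v.1 = 0 := by
    have h : primSign p k • dE p p • v.1 = 0 := congrArg Subtype.val hev
    exact (smul_eq_zero.1 h).resolve_left hσ
  have hHv : cartanBinom p 0 p • v.1 = qBinom (q p) (k * p + (p - 1)) p • v.1 := by
    have h : primSign p k • cartanBinom p 0 p • v.1 = (k : ℂ) • v.1 := congrArg Subtype.val hhv
    rw [qBinom_primitive, mul_comm (k : ℂ), mul_smul, ← h, smul_smul, primSign_mul_self, one_smul]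
  have hFv : dF p p ^ (k + 1) • v.1 = 0 := by
    have h (j : ℕ) : ((primF p M k ^ j) v : M) = dF p p ^ j • v.1 := by
      induction j with
      | zero => simp
      | succ j ih => rw [pow_succ', Module.End.mul_apply, primF_apply, ih, pow_succ', mul_smul]
    rw [← h, hfv]
    rfl
  obtain ⟨φ, hφ⟩ := exists_hom_homog v.2.1 v.2.2 hEv hHv fun b hb => dF_smul_eq_zero hFv (by
    rw [add_one_mul]; omega)
  refine ⟨φ, homog_hom_ext fun x hx => ?_⟩
  obtain rfl : x = z := Subtype.ext (hx.trans hz.symm)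
  rw [LinearMap.comp_apply, hφ x hx]
  exact congrArg Subtype.val hgv

end QPlane

namespace OneForm

instance (i : ℤ) : FiniteDimensional ℂ (homog p {i}) :=
  Module.Finite.equiv ((homogEquiv {i}).symm.restrictScalars ℂ)

theorem isProjectiveFD_homog (k : ℕ) :
    IsProjectiveFD (Lusztig p) (homog p {((k * p + (p - 1) : ℕ) : ℤ)}) := by
  refine ⟨inferInstance, ?_⟩
  intro M N _ _ _ _ _ _ _ _ _ _ g f hg
  obtain ⟨h, hh⟩ := Tw.exists_lift (q_ne_zero p)
    (QPlane.homog p {((k * p + (p - 1) : ℕ) : ℤ)}) N M g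
    (fun f => QPlane.exists_lift_homog k (g := Tw.map g) (fun u => by
      obtain ⟨x, hx⟩ := hg u.1
      obtain ⟨y, hy⟩ := hg u.2
      exact ⟨Tw.mk _ x y, Tw.ext hx hy⟩) f)
    (f ∘ₗ (homogEquiv _).symm.toLinearMap)
  refine ⟨h ∘ₗ (homogEquiv _).toLinearMap, ?_⟩
  rw [← LinearMap.comp_assoc, hh, LinearMap.comp_assoc]
  refine LinearMap.ext fun x => ?_
  simp

end OneForm

end QSl2

end

noncomputable section

namespace QSl2

variable {p : ℕ} [hp : Fact (2 ≤ p)] {n r : ℕ}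

theorem weylDegree_eq (hn : 1 ≤ n) (hr : 1 ≤ r) :
    ((n : ℤ) - 1) * p + (r : ℕ) - 1 = (((n - 1) * p + r - 1 : ℕ) : ℤ) := by
  rw [Nat.cast_sub (by omega)]
  push_cast [Nat.cast_sub hn]
  ring

theorem steinbergDegree_eq (hn : 1 ≤ n) : (n : ℤ) * p - 1 = ((n * p - 1 : ℕ) : ℤ) := by
  have := hp.out
  rw [Nat.cast_sub (Nat.mul_pos hn (by omega))]
  push_cast
  rfl

theorem not_dvd_sub_one_mul_add {s : ℤ} (h0 : 0 < s) (h : s < p) :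
    ¬ (p : ℤ) ∣ ((n : ℤ) - 1) * p + s := by
  rw [Int.dvd_add_right (dvd_mul_left _ _)]
  intro hd
  have := Int.le_of_dvd h0 hd
  omega

namespace QPlane

theorem isIndecomposable_weyl (hn : 1 ≤ n) (hr : 1 ≤ r) (hrp : r < p) :
    IsIndecomposable (Lusztig p) (homog p {((n : ℤ) - 1) * p + (r : ℕ) - 1}) := by
  have h := not_dvd_sub_one_mul_add (n := n) (s := r) (by omega) (Int.ofNat_lt.2 hrp)
  rw [weylDegree_eq hn hr]
  refine isIndecomposable_homog fun hd => h ?_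
  rw [← sub_add_cancel (((n : ℤ) - 1) * p + r) 1, weylDegree_eq hn hr]
  exact_mod_cast hd

theorem isSimpleModule_weyl (hn : n = 1) (hr : 1 ≤ r) (hrp : r < p) :
    IsSimpleModule (Lusztig p) (homog p {((n : ℤ) - 1) * p + (r : ℕ) - 1}) := by
  subst hn
  rw [weylDegree_eq le_rfl hr]
  exact isSimpleModule_homog (.inr (by simp; omega))

theorem isSimpleModule_steinberg (hn : 1 ≤ n) :
    IsSimpleModule (Lusztig p) (homog p {(n : ℤ) * p - 1}) := by
  have := hp.out
  have hpos : 0 < n * p := Nat.mul_pos hn (by omega)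
  rw [steinbergDegree_eq hn]
  refine isSimpleModule_homog (.inl ?_)
  rw [Nat.sub_add_cancel hpos]
  exact dvd_mul_left _ _

end QPlane

namespace OneForm

theorem nonempty_homog_equiv_dPart {g i : ℤ} (hi : g + 1 = i) (hg : ¬ (p : ℤ) ∣ i) :
    Nonempty (QPlane.homog p {i} ≃ₗ[Lusztig p] dPart p g) := by
  subst hi
  exact ⟨dPartEquiv hg⟩

theorem nonempty_homog_equiv_kappaPart {g i : ℤ} (hi : g - 1 = i) (hg : ¬ (p : ℤ) ∣ g + 1) :
    Nonempty (QPlane.homog p {i} ≃ₗ[Lusztig p] kappaPart p g) := by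
  subst hi
  exact ⟨kappaPartEquiv hg⟩

theorem dPart_restrictScalars {g : ℤ} {i : ℕ} (hi : g + 1 = i) :
    (dPart p g).restrictScalars ℂ = (grade₀ p i).map (d p) := by
  rw [← QPlane.homog_eq_grade, ← hi]
  rfl

theorem kappaPart_restrictScalars_le {g : ℤ} {i : ℕ} (hi : g = i) :
    (kappaPart p g).restrictScalars ℂ ≤ grade₁ p i := by
  rw [← OneForm.homog_eq_grade, ← hi]
  exact kappaPart_le g

end OneForm

end QSl2

end


open QSl2 QSl2.QPlane QSl2.OneForm QSl2.Lusztig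

theorem mainTheorem3 (p : ℕ) [Fact (2 ≤ p)] :
    -- the actions of `U_q sl(2)` ...
    ∃ (_ : Module (Lusztig p) (QPlane p)) (_ : IsScalarTower ℂ (Lusztig p) (QPlane p))
      (_ : Module (Lusztig p) (OneForm p)) (_ : IsScalarTower ℂ (Lusztig p) (OneForm p))
      -- ... that extend those of `Ū_q sl(2)` ...
      (_ : IsScalarTower (SmallQG p) (Lusztig p) (QPlane p))
      (_ : IsScalarTower (SmallQG p) (Lusztig p) (OneForm p)),
    -- ... with the explicit formulas for `𝓔` and `𝓕`
    (∀ M N m n : ℕ, m < p → n < p →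
      𝓔 p • frob p M N m n =
        (N * (-1) ^ ((N - 1) * p + n + m) : ℂ) • frob p (M + 1) (N - 1) m n ∧
      𝓕 p • frob p M N m n =
        (M * (-1) ^ ((M - 1) * p) : ℂ) • frob p (M - 1) (N + 1) m n ∧
      (𝓔 p * 𝓕 p - 𝓕 p * 𝓔 p) • frob p M N m n =
        ((-1) ^ (((M : ℤ) + N - 1) * p + m + n) * ((M : ℂ) - N)) • frob p M N m n ∧
      𝓔 p • frob p M N m n • ξ p =
        (-(N * (-1) ^ ((N - 1) * p + n + m)) : ℂ) • frob p (M + 1) (N - 1) m n • ξ p ∧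
      𝓔 p • frob p M N m n • η p =
        (-(N * (-1) ^ ((N - 1) * p + n + m)) : ℂ) • frob p (M + 1) (N - 1) m n • η p +
          (if m = 0 then
            if n = p - 1 then frob p M N (p - 1) 0 • ξ p
            else (N * (-1) ^ n : ℂ) • frob p M (N - 1) (p - 1) (n + 1) • ξ p
          else 0) ∧
      𝓕 p • frob p M N m n • ξ p =
        (M * (-1) ^ ((M - 1) * p) : ℂ) • frob p (M - 1) (N + 1) m n • ξ p +
          (if n = 0 then
            if m = p - 1 then ((-1) ^ ((M + N) * p) : ℂ) • frob p M N 0 (p - 1) • η p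
            else (M * (-1) ^ ((M - 1) * p + m) * q p ^ (-(m : ℤ) - 1)) •
              frob p (M - 1) N (m + 1) (p - 1) • η p
          else 0) ∧
      𝓕 p • frob p M N m n • η p =
        (M * (-1) ^ ((M - 1) * p) : ℂ) • frob p (M - 1) (N + 1) m n • η p) ∧
    -- decomposition of the quantum plane
    (∀ n : ℕ, 1 ≤ n →
      ∃ (C C' Z : Submodule (Lusztig p) (QPlane p)) (V : ℕ → Submodule (Lusztig p) (QPlane p)),
      C.restrictScalars ℂ = fil₀ p (n * p) ∧
      C'.restrictScalars ℂ = fil₀ p ((n - 1) * p) ∧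
      IsDirectSum C (Sum.elim ![C', Z] (fun r : Finset.Icc 1 (p - 1) => V r)) ∧
      (∀ r ∈ Finset.Icc 1 (p - 1),
        (V r).restrictScalars ℂ = grade₀ p ((n - 1) * p + r - 1) ∧
        Nonempty (V r ≃ₗ[SmallQG p] WMod p r n (sgn n)) ∧
        IsIndecomposable (Lusztig p) (V r) ∧
        (n = 1 → IsSimpleModule (Lusztig p) (V r))) ∧
      Z.restrictScalars ℂ = grade₀ p (n * p - 1) ∧
      Nonempty (Z ≃ₗ[SmallQG p] (Fin n → XMod p p (sgn n))) ∧
      IsSimpleModule (Lusztig p) Z) ∧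
    -- decomposition of the one-forms
    (∀ n : ℕ, 1 ≤ n →
      ∃ (O O' dZ T Q : Submodule (Lusztig p) (OneForm p))
        (dV V : ℕ → Submodule (Lusztig p) (OneForm p)),
      O.restrictScalars ℂ = fil₁ p (n * p) ∧
      O'.restrictScalars ℂ = fil₁ p ((n - 1) * p) ∧
      IsDirectSum O (Sum.elim ![O', dZ, T, Q]
        (Sum.elim (fun r : Finset.Icc 2 (p - 1) => dV r)
          (fun r : Finset.Icc 1 (p - 2) => V r))) ∧
      (∀ r ∈ Finset.Icc 2 (p - 1),
        (dV r).restrictScalars ℂ = (grade₀ p ((n - 1) * p + r - 1)).map (d p) ∧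
        Nonempty (dV r ≃ₗ[SmallQG p] WMod p r n (sgn n)) ∧
        IsIndecomposable (Lusztig p) (dV r) ∧
        (n = 1 → IsSimpleModule (Lusztig p) (dV r))) ∧
      dZ.restrictScalars ℂ = (grade₀ p (n * p - 1)).map (d p) ∧
      Nonempty (dZ ≃ₗ[SmallQG p] (Fin n → XMod p p (sgn n))) ∧
      IsSimpleModule (Lusztig p) dZ ∧
      T.restrictScalars ℂ ≤ grade₁ p ((n - 1) * p) ∧
      Nonempty (T ≃ₗ[SmallQG p] (Fin (n - 1) → XMod p p (-sgn n))) ∧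
      (2 ≤ n → IsSimpleModule (Lusztig p) T) ∧
      (∀ r ∈ Finset.Icc 1 (p - 2),
        (V r).restrictScalars ℂ ≤ grade₁ p ((n - 1) * p + r) ∧
        Nonempty (V r ≃ₗ[SmallQG p] WMod p r n (sgn n)) ∧
        IsIndecomposable (Lusztig p) (V r) ∧
        (n = 1 → IsSimpleModule (Lusztig p) (V r))) ∧
      Q.restrictScalars ℂ = grade₁ p (n * p - 1) ∧
      (∃ (P : Type) (_ : AddCommGroup P) (_ : Module (SmallQG p) P),
        IsProjectiveCover (SmallQG p) P (XMod p (p - 1) (sgn n)) ∧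
        Nonempty (Q ≃ₗ[SmallQG p] (Fin n → P))) ∧
      IsProjectiveFD (Lusztig p) Q) := by
  have hp2 : 2 ≤ p := Fact.out
  refine ⟨inferInstance, inferInstance, inferInstance, inferInstance, inferInstance, inferInstance,
    fun M N m n hm hn => ⟨𝓔_smul_frob p M N m n hm hn, 𝓕_smul_frob p M N m n hm hn,
      commutator_smul_frob p M N m n hm hn, 𝓔_smul_frob_ξ p M N m n hm hn,
      𝓔_smul_frob_η p M N m n hm hn, 𝓕_smul_frob_ξ p M N m n hm hn,
      𝓕_smul_frob_η p M N m n hm hn⟩, fun n hn => ?_, fun n hn => ?_⟩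
  · refine ⟨QPlane.homog p (Set.Iio ((n : ℤ) * p)), QPlane.homog p (Set.Iio (((n : ℤ) - 1) * p)),
      QPlane.homog p {(n : ℤ) * p - 1}, fun r => QPlane.homog p {((n : ℤ) - 1) * p + (r : ℕ) - 1},
      ?_, ?_, plane_isDirectSum n, fun r hr => ?_, ?_,
      QPlane.nonempty_homog_equiv_pi n _ rfl, QPlane.isSimpleModule_steinberg hn⟩
    · rw [← QPlane.homog_eq_fil]; push_cast; rfl
    · rw [← QPlane.homog_eq_fil]; push_cast [Nat.cast_sub hn]; rfl
    · obtain ⟨hr1, hr2⟩ := Finset.mem_Icc.1 hr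
      exact ⟨by beta_reduce; rw [weylDegree_eq hn hr1, QPlane.homog_eq_grade],
        QPlane.nonempty_homog_equiv_wmod hr1 (by omega) hn,
        QPlane.isIndecomposable_weyl hn hr1 (by omega),
        fun h => QPlane.isSimpleModule_weyl h hr1 (by omega)⟩
    · rw [steinbergDegree_eq hn, QPlane.homog_eq_grade]
  · have hsgn : -sgn n = (-1) ^ (n - 1 + 1) := by
      obtain ⟨k, rfl⟩ : ∃ k, n = k + 1 := ⟨n - 1, by omega⟩
      rw [sgn, pow_succ]; simp
    have hZ : ¬ (p : ℤ) ∣ (n : ℤ) * p - 1 := by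
      have := not_dvd_sub_one_mul_add (p := p) (n := n) (s := p - 1) (by omega) (by omega)
      rwa [show ((n : ℤ) - 1) * p + (p - 1) = n * p - 1 by ring] at this
    have hT : ¬ (p : ℤ) ∣ ((n : ℤ) - 1) * p + 1 :=
      not_dvd_sub_one_mul_add (by omega) (by omega)
    obtain ⟨eZ⟩ := nonempty_homog_equiv_dPart (p := p) (g := n * p - 2) (by ring) hZ
    obtain ⟨eT⟩ := nonempty_homog_equiv_kappaPart (p := p) (g := ((n : ℤ) - 1) * p)
      (i := ((n - 1 : ℕ) : ℤ) * p - 1) (by rw [Nat.cast_sub hn]; simp) hT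
    refine ⟨OneForm.homog p (Set.Iio ((n : ℤ) * p)), OneForm.homog p (Set.Iio (((n : ℤ) - 1) * p)),
      dPart p ((n : ℤ) * p - 2), kappaPart p (((n : ℤ) - 1) * p), OneForm.homog p {(n : ℤ) * p - 1},
      fun r => dPart p (((n : ℤ) - 1) * p + (r : ℕ) - 2),
      fun r => kappaPart p (((n : ℤ) - 1) * p + (r : ℕ)),
      ?_, ?_, form_isDirectSum n, fun r hr => ?_, ?_, ?_, ?_, ?_, ?_, fun h => ?_, fun r hr => ?_, ?_,
      ⟨Tw (SmallQG.coprod p) (XMod p p (sgn n)), inferInstance, inferInstance,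
        WMod.isProjectiveCover p _, OneForm.nonempty_homog_equiv_pi n _ rfl⟩, ?_⟩
    · rw [← OneForm.homog_eq_fil]; push_cast; rfl
    · rw [← OneForm.homog_eq_fil]; push_cast [Nat.cast_sub hn]; rfl
    · obtain ⟨hr1, hr2⟩ := Finset.mem_Icc.1 hr
      obtain ⟨e⟩ := nonempty_homog_equiv_dPart (p := p) (g := ((n : ℤ) - 1) * p + (r : ℕ) - 2)
        (i := ((n : ℤ) - 1) * p + (r : ℕ) - 1) (by ring) (by
          rw [add_sub_assoc]
          exact not_dvd_sub_one_mul_add (by omega) (by omega))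
      obtain ⟨w⟩ := QPlane.nonempty_homog_equiv_wmod (p := p) (by omega : 1 ≤ r) (by omega) hn
      refine ⟨dPart_restrictScalars ?_, ⟨(e.symm.restrictScalars (SmallQG p)).trans w⟩,
        (QPlane.isIndecomposable_weyl hn (by omega) (by omega)).congr e, fun h => ?_⟩
      · rw [← weylDegree_eq hn (by omega)]; ring
      · have := QPlane.isSimpleModule_weyl (p := p) h (by omega : 1 ≤ r) (by omega)
        exact IsSimpleModule.congr e.symm
    · exact dPart_restrictScalars (by rw [← steinbergDegree_eq hn]; ring)
    · obtain ⟨w⟩ := QPlane.nonempty_homog_equiv_pi (p := p) n (sgn n) rfl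
      exact ⟨(eZ.symm.restrictScalars (SmallQG p)).trans w⟩
    · have := QPlane.isSimpleModule_steinberg (p := p) hn
      exact IsSimpleModule.congr eZ.symm
    · exact kappaPart_restrictScalars_le (by push_cast [Nat.cast_sub hn]; rfl)
    · obtain ⟨w⟩ := QPlane.nonempty_homog_equiv_pi (p := p) (n - 1) (-sgn n) hsgn
      exact ⟨(eT.symm.restrictScalars (SmallQG p)).trans w⟩
    · have := QPlane.isSimpleModule_steinberg (p := p) (by omega : 1 ≤ n - 1)
      exact IsSimpleModule.congr eT.symm
    · obtain ⟨hr1, hr2⟩ := Finset.mem_Icc.1 hr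
      obtain ⟨e⟩ := nonempty_homog_equiv_kappaPart (p := p) (g := ((n : ℤ) - 1) * p + (r : ℕ))
        (i := ((n : ℤ) - 1) * p + (r : ℕ) - 1) rfl (by
          rw [add_assoc]
          exact not_dvd_sub_one_mul_add (by omega) (by omega))
      obtain ⟨w⟩ := QPlane.nonempty_homog_equiv_wmod (p := p) hr1 (by omega) hn
      refine ⟨kappaPart_restrictScalars_le (by push_cast [Nat.cast_sub hn]; rfl),
        ⟨(e.symm.restrictScalars (SmallQG p)).trans w⟩,
        (QPlane.isIndecomposable_weyl hn hr1 (by omega)).congr e, fun h => ?_⟩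
      have := QPlane.isSimpleModule_weyl (p := p) h hr1 (by omega)
      exact IsSimpleModule.congr e.symm
    · rw [steinbergDegree_eq hn, OneForm.homog_eq_grade]
    · have h := isProjectiveFD_homog (p := p) (n - 1)
      rwa [show (((n - 1) * p + (p - 1) : ℕ) : ℤ) = (n : ℤ) * p - 1 by
        push_cast [Nat.cast_sub hn, Nat.cast_sub (by omega : 1 ≤ p)]; ring] at h
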